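/- Let $n\ge 2$ and $0<\alpha<1$. Let $S^n\subset\mathbb R^{n+1}$ be the unit sphere with surface measure $dy$, and let $\sigma_{n-1}=2\pi^{n/2}/\Gamma(n/2)$. For functions on $S^n$ the one-sided fractional integrals are $$(S^\alpha_{\pm}\varphi)(x)=\frac{2}{\Gamma(\alpha)\,\sigma_{n-1}}\int_{\pm(x_{n+1}-y_{n+1})>0}\frac{|x_{n+1}-y_{n+1}|^{\alpha}}{|x-y|^{n}}\,\varphi(y)\,dy .$$ Write a point $x\in S^n$ other than the poles $\pm e_{n+1}$ as $x=(\sin\theta\,\xi',-\cos\theta)$ with $0<\theta<\pi$, $\xi'\in S^{n-1}$, write $f(x)=f(\theta,\xi')$, and put $t=\tan^2(\theta/2)=\frac{1+x_{n+1}}{1-x_{n+1}}$. Let $(\Pi\psi)(s,\xi')=\frac1{\sigma_{n-1}}\int_{S^{n-1}}\frac{1-s^2}{|s\xi'-\eta'|^n}\psi(\eta')\,d\eta'$ be the Poisson integral, and define $$(A^+_xf)(u)=\Big(1+\frac ut\Big)^{n/2-1}(1+t+u)^{\alpha-n/2}\,\Pi\big[f(2\arctan\sqrt{t+u},\cdot)\big]\big((1+u/t)^{1/2},\xi'\big)\quad(-t<u<0),$$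 $(A^+_xf)(u)=0$ for $u\le -t$, $$(A^-_xf)(u)=(1+t-u)^{\alpha-n/2}\,\Pi\big[f(2\arctan\sqrt{t-u},\cdot)\big]\big((1-u/t)^{-1/2},\xi'\big)\quad(u<0),$$ and $(A^\pm_xf)(0)=(1+t)^{\alpha-n/2}f(x)$. For an integer $\ell>\alpha$ and $\varepsilon>0$ let $$(T^{\alpha}_{\pm,\varepsilon}f)(x)=\frac{2^{-\alpha}}{\varkappa(\alpha,\ell)}(1+t)^{\alpha+n/2}\int_\varepsilon^\infty\Big[\sum_{j=0}^{\ell}\binom{\ell}{j}(-1)^j(A^\pm_xf)(-j\tau)\Big]\frac{d\tau}{\tau^{1+\alpha}},\qquad \varkappa(\alpha,\ell)=\int_0^\infty\frac{(1-e^{-\tau})^\ell}{\tau^{1+\alpha}}\,d\tau ,$$ and say that $(T^\alpha_\pm f)(x)$ exists and equals $c$ if, for every integer $\ell>\alpha$, these integrals converge absolutely for all $\varepsilon>0$ and $(T^{\alpha}_{\pm,\varepsilon}f)(x)\to c$ as $\varepsilon\to0^+$. (1) Let $f:S^n\to\mathbb C$ and $x\in S^n\setminus\{\pm e_{n+1}\}$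 be such that the integral below converges absolutely. Then $(T^\alpha_\pm f)(x)$ exists, and $$(T^{\alpha}_{\pm} f)(x)=\frac{\Gamma(n/2)}{\Gamma(n/2-\alpha)\,(1\pm x_{n+1})^\alpha}\,f(x)+\frac{2\alpha}{\sigma_{n-1}\Gamma(1-\alpha)}\int_{\pm(x_{n+1}-y_{n+1})>0}\frac{f(x)-f(y)}{|x_{n+1}-y_{n+1}|^\alpha\,|x-y|^n}\,dy .$$ (2) These operators invert $S^\alpha_\pm$. Let $1<p\le\infty$, $1/p'=1-1/p$, $\mu,\nu\in\mathbb R$, and let $(1+x_{n+1})^\mu(1-x_{n+1})^\nu\varphi\in L^p(S^n)$, where $\mu<n/(2p')$ for the sign $+$ and $\nu<n/(2p')$ for the sign $-$. Then for almost every $x\in S^n$ the integral $f(x)=(S^\alpha_\pm\varphi)(x)$ converges absolutely, $(T^\alpha_\pm f)(x)$ exists and equals $\varphi(x)$, and the closed form in (1) also has the value $\varphi(x)$ if its integral is understood as the limit, as $\varepsilon\to0^+$, of the (absolutely convergent) integrals over $\{y\in S^n:\pm(x_{n+1}-y_{n+1})>\varepsilon\}$. (3) For every $x\in S^n$ with $x_{n+1}<1$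 the following integral converges absolutely, and $$\frac{2\alpha}{\sigma_{n-1}\Gamma(1-\alpha)}\int_{y_{n+1}>x_{n+1}}\Big[\Big(\frac{1-y_{n+1}}{1-x_{n+1}}\Big)^{\alpha-n/2}-1\Big]\frac{dy}{(y_{n+1}-x_{n+1})^\alpha|x-y|^n}=\frac{\Gamma(n/2)}{\Gamma(n/2-\alpha)\,(1-x_{n+1})^\alpha}.$$ -/

import Mathlib

open MeasureTheory Set Filter Topology
open scoped ENNReal

noncomputable section

namespace SphFrac

/-- The Euclidean space of dimension `m`. -/
abbrev Euc (m : ℕ) : Type := EuclideanSpace ℝ (Fin m)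

/-- The unit sphere of the `m`-dimensional Euclidean space: `Sph (n + 1)` is the sphere `S^n`. -/
abbrev Sph (m : ℕ) : Type := Metric.sphere (0 : Euc m) 1

/-- The surface area measure of the unit sphere. -/
abbrev surf (m : ℕ) : Measure (Sph m) := (volume : Measure (Euc m)).toSphere

/-- The surface area `2 π^{m/2} / Γ(m/2)` of the unit sphere in dimension `m`. -/
def sphArea (m : ℕ) : ℝ := 2 * Real.pi ^ ((m : ℝ) / 2) / Real.Gamma ((m : ℝ) / 2)

/-- The last coordinate `x_{n+1}` of a point of `S^n`. -/
def height {n : ℕ} (x : Sph (n + 1)) : ℝ := (x : Euc (n + 1)) (Fin.last n)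

/-- The spherical segment of the points with `a < y_{n+1} < b`. -/
def segment (n : ℕ) (a b : ℝ) : Set (Sph (n + 1)) := {y | a < height y ∧ height y < b}

/-! ### One-sided spherical fractional integrals -/

/-- The integrand of the left-sided fractional integral, without the constant. -/
def leftFracIntegrand (n : ℕ) (α : ℝ) (φ : Sph (n + 1) → ℂ) (x y : Sph (n + 1)) : ℂ :=
  ((height x - height y) ^ α / ‖(x : Euc (n + 1)) - y‖ ^ n : ℝ) • φ y

/-- The integrand of the right-sided fractional integral, without the constant. -/
def rightFracIntegrand (n : ℕ) (α : ℝ) (φ : Sph (n + 1) → ℂ) (x y : Sph (n + 1)) : ℂ :=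
  ((height y - height x) ^ α / ‖(x : Euc (n + 1)) - y‖ ^ n : ℝ) • φ y

/-- The left-sided integral of order `α` on the part of the sphere above the level `a`. -/
def leftFracFrom (n : ℕ) (α a : ℝ) (φ : Sph (n + 1) → ℂ) (x : Sph (n + 1)) : ℂ :=
  (2 / (Real.Gamma α * sphArea n) : ℝ) •
    ∫ y in segment n a (height x), leftFracIntegrand n α φ x y ∂(surf (n + 1))

/-- The right-sided integral of order `α` on the part of the sphere below the level `b`. -/
def rightFracFrom (n : ℕ) (α b : ℝ) (φ : Sph (n + 1) → ℂ) (x : Sph (n + 1)) : ℂ :=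
  (2 / (Real.Gamma α * sphArea n) : ℝ) •
    ∫ y in segment n (height x) b, rightFracIntegrand n α φ x y ∂(surf (n + 1))

/-- `S_+^α`. -/
def leftFrac (n : ℕ) (α : ℝ) (φ : Sph (n + 1) → ℂ) : Sph (n + 1) → ℂ :=
  leftFracFrom n α (-1) φ

/-- `S_-^α`. -/
def rightFrac (n : ℕ) (α : ℝ) (φ : Sph (n + 1) → ℂ) : Sph (n + 1) → ℂ :=
  rightFracFrom n α 1 φ

/-- The weight `(1 + x_{n+1})^μ (1 - x_{n+1})^ν`. -/
def weight {n : ℕ} (μ ν : ℝ) (x : Sph (n + 1)) : ℝ :=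
  (1 + height x) ^ μ * (1 - height x) ^ ν

/-! ### Polar coordinates through the stereographic projection

A point of `S^n` other than the poles is `x = (sin θ ξ', -cos θ)` with `0 < θ < π` and
`ξ' ∈ S^{n-1}`, and `r = tan (θ/2)` is the norm of its stereographic image. -/

/-- `tan² (θ/2) = (1 + x_{n+1}) / (1 - x_{n+1})`. -/
def tanSq {n : ℕ} (x : Sph (n + 1)) : ℝ := (1 + height x) / (1 - height x)

/-- The direction `ξ'` of `x`: its first `n` coordinates, divided by `sin θ`. -/
def direction {n : ℕ} (x : Sph (n + 1)) : Euc n :=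
  (Real.sqrt (1 - height x ^ 2))⁻¹ •
    WithLp.toLp 2 (fun i : Fin n => (x : Euc (n + 1)) i.castSucc)

/-- The vector `(2 r ω, r² - 1) / (1 + r²)`. -/
def polarVec {n : ℕ} (r : ℝ) (ω : Sph n) : Euc (n + 1) :=
  WithLp.toLp 2 (Fin.snoc (α := fun _ => ℝ)
    (fun i : Fin n => 2 * r / (1 + r ^ 2) * (ω : Euc n) i) ((r ^ 2 - 1) / (1 + r ^ 2)))

theorem polarVec_mem {n : ℕ} (r : ℝ) (ω : Sph n) :
    polarVec r ω ∈ Metric.sphere (0 : Euc (n + 1)) 1 := by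
  have hω : ∑ i, ((ω : Euc n) i) ^ 2 = 1 := by
    have h := EuclideanSpace.norm_sq_eq (ω : Euc n)
    rw [norm_eq_of_mem_sphere ω] at h
    simpa using h.symm
  rw [mem_sphere_zero_iff_norm]
  have h0 : ‖polarVec r ω‖ ^ 2 = 1 := by
    rw [EuclideanSpace.norm_sq_eq, Fin.sum_univ_castSucc]
    simp only [polarVec, Fin.snoc_castSucc, Fin.snoc_last, Real.norm_eq_abs, sq_abs, mul_pow]
    rw [← Finset.mul_sum, hω]
    have : (1 + r ^ 2) ≠ 0 := by positivity
    field_simp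
    ring
  exact (sq_eq_sq₀ (norm_nonneg _) zero_le_one).1 (by rw [h0, one_pow])

/-- The point of `S^n` with polar coordinates `θ = 2 arctan r` and `ω ∈ S^{n-1}`, that is, the
point whose stereographic image is `r ω`. -/
def polarPt {n : ℕ} (r : ℝ) (ω : Sph n) : Sph (n + 1) := ⟨polarVec r ω, polarVec_mem r ω⟩

/-! ### Hypersingular integrals of the Marchaud type -/

/-- The Poisson integral on `S^{n-1}` at the point `s ξ`, where `|ξ| = 1` and `0 ≤ s < 1`. -/
def poissonInt {n : ℕ} (ψ : Sph n → ℂ) (s : ℝ) (ξ : Euc n) : ℂ :=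
  (1 / sphArea n : ℝ) •
    ∫ η : Sph n, ((1 - s ^ 2) / ‖s • ξ - (η : Euc n)‖ ^ n : ℝ) • ψ η ∂(surf n)

/-- The finite difference `∑_j (-1)^j (ℓ choose j) A (u - j τ)`. -/
def finDiff (ℓ : ℕ) (τ : ℝ) (A : ℝ → ℂ) (u : ℝ) : ℂ :=
  ∑ j ∈ Finset.range (ℓ + 1), ((-1) ^ j * (ℓ.choose j : ℝ) : ℝ) • A (u - j * τ)

/-- `ϰ(α, ℓ)`. -/
def kappa (α : ℝ) (ℓ : ℕ) : ℝ :=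
  ∫ τ in Ioi (0 : ℝ), (1 - Real.exp (-τ)) ^ ℓ / τ ^ (1 + α)

/-- The function `A_x^+ f` of a variable `u ≤ 0`. -/
def leftAux (n : ℕ) (α : ℝ) (f : Sph (n + 1) → ℂ) (x : Sph (n + 1)) (u : ℝ) : ℂ :=
  if u = 0 then ((1 + tanSq x) ^ (α - (n : ℝ) / 2) : ℝ) • f x
  else if u ≤ -tanSq x then 0
  else ((1 + u / tanSq x) ^ ((n : ℝ) / 2 - 1) * (1 + tanSq x + u) ^ (α - (n : ℝ) / 2) : ℝ) •
    poissonInt (fun ω => f (polarPt (Real.sqrt (tanSq x + u)) ω))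
      (Real.sqrt (1 + u / tanSq x)) (direction x)

/-- The function `A_x^- f` of a variable `u ≤ 0`. -/
def rightAux (n : ℕ) (α : ℝ) (f : Sph (n + 1) → ℂ) (x : Sph (n + 1)) (u : ℝ) : ℂ :=
  if u = 0 then ((1 + tanSq x) ^ (α - (n : ℝ) / 2) : ℝ) • f x
  else ((1 + tanSq x - u) ^ (α - (n : ℝ) / 2) : ℝ) •
    poissonInt (fun ω => f (polarPt (Real.sqrt (tanSq x - u)) ω))
      (Real.sqrt (1 - u / tanSq x))⁻¹ (direction x)

/-- The integrand of the hypersingular integral built from a function `A` (below, `A_x^± f`). -/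
def marchaudIntegrand (α : ℝ) (ℓ : ℕ) (A : ℝ → ℂ) (τ : ℝ) : ℂ :=
  ((τ ^ (1 + α))⁻¹ : ℝ) • finDiff ℓ τ A 0

/-- The truncated integral `T_{+,ε}^α f`. -/
def leftT (n : ℕ) (α : ℝ) (ℓ : ℕ) (ε : ℝ) (f : Sph (n + 1) → ℂ) (x : Sph (n + 1)) : ℂ :=
  (2 ^ (-α) / kappa α ℓ * (1 + tanSq x) ^ (α + (n : ℝ) / 2) : ℝ) •
    ∫ τ in Ioi ε, marchaudIntegrand α ℓ (leftAux n α f x) τ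

/-- The truncated integral `T_{-,ε}^α f`. -/
def rightT (n : ℕ) (α : ℝ) (ℓ : ℕ) (ε : ℝ) (f : Sph (n + 1) → ℂ) (x : Sph (n + 1)) : ℂ :=
  (2 ^ (-α) / kappa α ℓ * (1 + tanSq x) ^ (α + (n : ℝ) / 2) : ℝ) •
    ∫ τ in Ioi ε, marchaudIntegrand α ℓ (rightAux n α f x) τ

/-- `T_+^α f` exists at `x` and equals `c`: for every order `ℓ > α` of the finite differences
the truncated integrals are absolutely convergent and tend to `c` as `ε → 0+`. -/
def HasLeftT (n : ℕ) (α : ℝ) (f : Sph (n + 1) → ℂ) (x : Sph (n + 1)) (c : ℂ) : Prop :=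
  ∀ ℓ : ℕ, α < ℓ →
    (∀ ε : ℝ, 0 < ε → IntegrableOn (marchaudIntegrand α ℓ (leftAux n α f x)) (Ioi ε)) ∧
    Tendsto (fun ε => leftT n α ℓ ε f x) (𝓝[>] 0) (𝓝 c)

/-- `T_-^α f` exists at `x` and equals `c`. -/
def HasRightT (n : ℕ) (α : ℝ) (f : Sph (n + 1) → ℂ) (x : Sph (n + 1)) (c : ℂ) : Prop :=
  ∀ ℓ : ℕ, α < ℓ →
    (∀ ε : ℝ, 0 < ε → IntegrableOn (marchaudIntegrand α ℓ (rightAux n α f x)) (Ioi ε)) ∧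
    Tendsto (fun ε => rightT n α ℓ ε f x) (𝓝[>] 0) (𝓝 c)

/-! ### The integrands of the closed form -/

/-- `(f(x) - f(y)) / ((x_{n+1} - y_{n+1})^α |x - y|^n)`, used where `y_{n+1} < x_{n+1}`. -/
def leftQuot (n : ℕ) (α : ℝ) (f : Sph (n + 1) → ℂ) (x y : Sph (n + 1)) : ℂ :=
  (((height x - height y) ^ α * ‖(x : Euc (n + 1)) - y‖ ^ n)⁻¹ : ℝ) • (f x - f y)

/-- `(f(x) - f(y)) / ((y_{n+1} - x_{n+1})^α |x - y|^n)`, used where `x_{n+1} < y_{n+1}`. -/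
def rightQuot (n : ℕ) (α : ℝ) (f : Sph (n + 1) → ℂ) (x y : Sph (n + 1)) : ℂ :=
  (((height y - height x) ^ α * ‖(x : Euc (n + 1)) - y‖ ^ n)⁻¹ : ℝ) • (f x - f y)

/-- The integrand of the integral `Λ`. -/
def lambdaIntegrand (n : ℕ) (α : ℝ) (x y : Sph (n + 1)) : ℝ :=
  (((1 - height y) / (1 - height x)) ^ (α - (n : ℝ) / 2) - 1) /
    ((height y - height x) ^ α * ‖(x : Euc (n + 1)) - y‖ ^ n)

end SphFrac

end

noncomputable section

namespace SphFrac

/-! ### Polar coordinates -/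

/-! Use the coordinates `s = tan² (θ/2)` and `η ∈ S^{n-1}`. The heights of two points at levels `t`
and `s` differ by `2 (t - s) / ((1 + t) (1 + s))`, and for `s < t` the kernel `|x - y|^{-n}` is, up
to a constant and powers of `t`, `1 + s`, `1 + t`, the Poisson kernel at `√(s/t) ξ` divided by `t -
s`. So `S_+^α` is a Riemann-Liouville integral in `s` whose coefficients are Poisson operators.

These operators form a semigroup: the Poisson mean at `√(s/t)` of the Poisson mean at `√(p/s)` is
the Poisson mean at `√(p/t)` (`integral_poissonKer_mul_poissonKer`). Hence the Poisson mean in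
`A_x^+` turns `f = S_+^α φ` into an ordinary fractional integral, in the variable `u`, of a single
function `G` of `w = t - s` (`leftAux_leftFrac`), and `T_+^α` is the Marchaud derivative of that
integral at `0`. The truncated Marchaud integral is `G` integrated against an approximate identity
(`integrableOn_firstDiff_and_eq`), so it recovers the value of `G` at `0` as soon as the averages of
`G` over the shells `(h/2, h)` converge (`tendsto_firstDiff`).

They converge almost everywhere. On a shell the Poisson kernel is at most a constant times `h max
(h, |ξ - η|)^{-n}` (`poissonKer_le_slabKer`), and Lebesgue's theorem holds for this kernel
(`ae_tendsto_slabInt`): it is a sum over dyadic slabs of eccentricity `2^j`, for which a Vitali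
covering gives a weak type bound with a constant independent of `j`.

For the closed form, the Poisson kernel has total mass `sphArea n`, so a first difference of `A_x^±`
splits into the contribution of the constant `f x` and a Poisson mean of `f x - f`. The first part
integrates to the quotient of Gamma values; the second is the surface integral read in polar
coordinates (`integral_leftQuot`, `integral_rightQuot`). Differences of order `ℓ` are combinations
of first differences with steps `j τ`, and `kappa α ℓ` is the normalization that makes the limit
independent of `ℓ` (`tendsto_marchaud`). The identity for the constant is the integral of the first
part for the sign minus.

The reflection in the equator exchanges `S_+^α` with `S_-^α` and the two closed forms with each
other, but not `A_x^+` with `A_x^-`. The inversion of `S_-^α` is therefore reflected in its closed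
form and carried from there to `T_-^α` (`hasRightT_of_tendsto_closedForm`).

The mass and the semigroup property of the Poisson kernel come from a maximum principle for
functions whose second differences vanish to first order beyond `h^2`; such differences pass under
the integral sign without differentiation. -/

theorem lintegral_polar {m : ℕ} (hm : m ≠ 0) (G : Euc m → ℝ≥0∞) (hG : Measurable G) :
    ∫⁻ x, G x = ∫⁻ r in Ioi (0 : ℝ), ∫⁻ ω : Sph m, ENNReal.ofReal (r ^ (m - 1)) * G (r • (ω : Euc m))
      ∂(surf m) := by
  have : Nonempty (Fin m) := ⟨⟨0, Nat.pos_of_ne_zero hm⟩⟩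
  have h1 := (volume : Measure (Euc m)).measurePreserving_homeomorphUnitSphereProd
  have h2 : ∫⁻ x, G x = ∫⁻ x : ({0}ᶜ : Set (Euc m)), G x ∂(Measure.comap Subtype.val volume) := by
    rw [lintegral_subtype_comap (measurableSet_singleton _).compl G, restrict_compl_singleton]
  have hmeas : Measurable fun p : Sph m × Ioi (0 : ℝ) => G ((p.2 : ℝ) • (p.1 : Euc m)) := by
    apply hG.comp; fun_prop
  have h3 : ∫⁻ x : ({0}ᶜ : Set (Euc m)), G x ∂(Measure.comap Subtype.val volume) =
      ∫⁻ p : Sph m × Ioi (0 : ℝ), G ((p.2 : ℝ) • (p.1 : Euc m))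
        ∂((surf m).prod (Measure.volumeIoiPow (Module.finrank ℝ (Euc m) - 1))) := by
    rw [← h1.lintegral_comp hmeas]
    refine lintegral_congr fun x => ?_
    congr 1
    have := congrArg Subtype.val ((homeomorphUnitSphereProd (Euc m)).symm_apply_apply x)
    simp only [homeomorphUnitSphereProd_symm_apply_coe] at this
    exact this.symm
  rw [h2, h3, lintegral_prod_symm _ hmeas.aemeasurable, finrank_euclideanSpace_fin,
    Measure.volumeIoiPow, lintegral_withDensity_eq_lintegral_mul₀ (by fun_prop)]
  · have := lintegral_subtype_comap (μ := (volume : Measure ℝ)) (measurableSet_Ioi (a := (0 : ℝ)))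
      (fun r : ℝ => ENNReal.ofReal (r ^ (m - 1)) * ∫⁻ ω : Sph m, G (r • (ω : Euc m)) ∂(surf m))
    refine (Eq.trans ?_ this).trans ?_
    · rfl
    · refine lintegral_congr fun r => ?_
      rw [lintegral_const_mul]
      apply hG.comp; fun_prop
  · exact (Measurable.lintegral_prod_left' hmeas).aemeasurable

/-- The vector with the first `n` coordinates `X` and last coordinate `z`. -/
def snocVec {n : ℕ} (X : Euc n) (z : ℝ) : Euc (n + 1) :=
  WithLp.toLp 2 (Fin.snoc (α := fun _ => ℝ) (fun i => X i) z)

@[simp] theorem snocVec_castSucc {n : ℕ} (X : Euc n) (z : ℝ) (i : Fin n) :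
    snocVec X z i.castSucc = X i := by simp [snocVec]

@[simp] theorem snocVec_last {n : ℕ} (X : Euc n) (z : ℝ) :
    snocVec X z (Fin.last n) = z := by simp [snocVec]

theorem snocVec_smul {n : ℕ} (X : Euc n) (z a : ℝ) :
    snocVec (a • X) (a * z) = a • snocVec X z := by
  ext i
  refine Fin.lastCases ?_ (fun i => ?_) i <;> simp

theorem continuous_snocVec {n : ℕ} : Continuous fun p : Euc n × ℝ => snocVec p.1 p.2 := by
  refine (PiLp.continuous_toLp 2 _).comp (continuous_pi fun i => ?_)
  refine Fin.lastCases ?_ (fun i => ?_) i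
  · simpa using continuous_snd
  · simp only [Fin.snoc_castSucc]; fun_prop

theorem polarVec_eq {n : ℕ} (r : ℝ) (ω : Sph n) :
    polarVec r ω = snocVec ((2 * r / (1 + r ^ 2)) • (ω : Euc n)) ((r ^ 2 - 1) / (1 + r ^ 2)) := by
  ext i
  refine Fin.lastCases ?_ (fun i => ?_) i <;> simp [polarVec, snocVec]

theorem continuous_polarVec {n : ℕ} : Continuous fun p : ℝ × Sph n => polarVec p.1 p.2 := by
  simp_rw [polarVec_eq]
  have h : ∀ r : ℝ, 1 + r ^ 2 ≠ 0 := fun r => by positivity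
  refine (continuous_snocVec (n := n)).comp (Continuous.prodMk (Continuous.smul (M := ℝ) (X := Euc n) ?_ ?_) ?_)
  · exact Continuous.div (by fun_prop) (by fun_prop) fun p => h _
  · fun_prop
  · exact Continuous.div (by fun_prop) (by fun_prop) fun p => h _

theorem continuous_polarPt {n : ℕ} : Continuous fun p : ℝ × Sph n => polarPt p.1 p.2 :=
  continuous_polarVec.subtype_mk _

theorem lintegral_snocVec {n : ℕ} (G : Euc (n + 1) → ℝ≥0∞) (hG : Measurable G) :
    ∫⁻ Y, G Y = ∫⁻ X : Euc n, ∫⁻ z : ℝ, G (snocVec X z) := by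
  have e1 := (PiLp.volume_preserving_toLp (Fin (n + 1))).lintegral_comp hG
  have e2 := (volume_preserving_piFinSuccAbove (fun _ : Fin (n + 1) => ℝ) (Fin.last n)).symm
  have e3 := e2.lintegral_comp (f := fun v => G (WithLp.toLp 2 v)) (by fun_prop)
  have hm : Measurable fun p : Euc n × ℝ => G (snocVec p.1 p.2) :=
    hG.comp continuous_snocVec.measurable
  have e4 := (PiLp.volume_preserving_toLp (Fin n)).lintegral_comp
    (f := fun X => ∫⁻ z : ℝ, G (snocVec X z)) hm.lintegral_prod_right'
  have hm2 : Measurable fun p : ℝ × (Fin n → ℝ) => G (snocVec (WithLp.toLp 2 p.2) p.1) :=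
    hm.comp (f := fun p : ℝ × (Fin n → ℝ) => (WithLp.toLp 2 p.2, p.1)) (by fun_prop)
  rw [← e1, ← e3, ← e4, Measure.volume_eq_prod, ← lintegral_prod_symm _ hm2.aemeasurable]
  refine lintegral_congr fun p => ?_
  congr 2
  ext i
  refine Fin.lastCases ?_ (fun i => ?_) i <;>
    simp [MeasurableEquiv.piFinSuccAbove, Fin.insertNthEquiv]

theorem lintegral_Ioo_pow (n : ℕ) {k : ℝ} (hk : 0 ≤ k) :
    ∫⁻ r in Ioo 0 k, ENNReal.ofReal (r ^ n) = ENNReal.ofReal (k ^ (n + 1) / (n + 1)) := by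
  rw [Measure.restrict_congr_set Ioo_ae_eq_Ioc,
    ← ofReal_integral_eq_lintegral_ofReal (intervalIntegral.intervalIntegrable_pow _).1,
    ← intervalIntegral.integral_of_le hk]
  · simp
  · filter_upwards [ae_restrict_mem measurableSet_Ioc] with y hy
    exact pow_nonneg hy.1.le _

/-- The density of the surface measure in the coordinates `s = tan² (θ/2)` and `ξ'`. -/
def polarDens (n : ℕ) (s : ℝ) : ℝ :=
  2 ^ (n - 1 : ℝ) * s ^ ((n : ℝ) / 2 - 1) * ((1 + s) ^ n)⁻¹

theorem polarDens_nonneg (n : ℕ) {s : ℝ} (hs : 0 ≤ s) : 0 ≤ polarDens n s := by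
  unfold polarDens; positivity

theorem polarDens_pos (n : ℕ) {s : ℝ} (hs : 0 < s) : 0 < polarDens n s := by
  unfold polarDens; positivity

theorem measurable_polarDens (n : ℕ) : Measurable (polarDens n) := by
  unfold polarDens; fun_prop

/-- On the vertical line over a point at distance `ρ` from the axis, the ray from the origin in the
direction of level `s` is met at height `ρ (s - 1) / (2 √s)`. The level `s` thus parametrizes the
line. -/
theorem lintegral_vertical_subst {ρ : ℝ} (hρ : 0 < ρ) (g : ℝ → ℝ≥0∞) :
    ∫⁻ z, g z = ∫⁻ s in Ioi (0 : ℝ), ENNReal.ofReal (ρ * ((1 + s) / (4 * (s * √s)))) *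
      g (ρ * ((s - 1) / (2 * √s))) := by
  have himg : (fun s : ℝ => ρ * ((s - 1) / (2 * √s))) '' Ioi 0 = univ := by
    refine eq_univ_of_forall fun z => ?_
    set v := z / ρ
    -- The positive root of `r^2 - 1 = 2 r v`; then `s = r^2` solves `(s - 1) / (2 √s) = v`.
    set r := v + √(v ^ 2 + 1)
    have hs1 : √(v ^ 2 + 1) ^ 2 = v ^ 2 + 1 := Real.sq_sqrt (by positivity)
    have hr : 0 < r := by
      have : |v| < √(v ^ 2 + 1) := by
        rw [← Real.sqrt_sq_eq_abs]; exact Real.sqrt_lt_sqrt (by positivity) (by linarith)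
      have := neg_abs_le v
      simp only [r]; linarith
    refine ⟨r ^ 2, by simpa using by positivity, ?_⟩
    have h2 : r ^ 2 - 1 = 2 * r * v := by simp only [r]; nlinarith
    simp only [Real.sqrt_sq hr.le, h2]
    simp only [v]; field_simp
  have hderiv : ∀ s ∈ Ioi (0 : ℝ), HasDerivWithinAt (fun s : ℝ => ρ * ((s - 1) / (2 * √s)))
      (ρ * ((1 + s) / (4 * (s * √s)))) (Ioi 0) s := by
    intro s hs
    have hs' : (0 : ℝ) < s := hs
    have hq : √s ≠ 0 := (Real.sqrt_pos.2 hs').ne'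
    have h := (((hasDerivAt_id s).sub_const 1).div
      ((Real.hasDerivAt_sqrt hs'.ne').const_mul 2) (by positivity)).const_mul ρ
    refine HasDerivAt.hasDerivWithinAt (h.congr_deriv ?_)
    congr 1
    simp only [id]
    have : √s ^ 2 = s := Real.sq_sqrt hs'.le
    rw [div_eq_div_iff (by positivity) (by positivity)]
    field_simp
    rw [this]; ring
  have hinj : InjOn (fun s : ℝ => ρ * ((s - 1) / (2 * √s))) (Ioi 0) := by
    refine StrictMonoOn.injOn (strictMonoOn_of_deriv_pos (convex_Ioi 0) ?_ ?_)
    · exact fun s hs => (hderiv s hs).continuousWithinAt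
    · intro s hs
      rw [interior_Ioi] at hs
      have hs' : (0 : ℝ) < s := hs
      rw [((hderiv s hs).hasDerivAt (Ioi_mem_nhds hs)).deriv]
      positivity
  have h := lintegral_image_eq_lintegral_abs_deriv_mul measurableSet_Ioi hderiv hinj g
  rw [himg, Measure.restrict_univ] at h
  rw [h]
  refine setLIntegral_congr_fun measurableSet_Ioi fun s hs => ?_
  have hs' : (0 : ℝ) < s := hs
  rw [abs_of_pos (by positivity)]

theorem snocVec_vertical {n : ℕ} {ρ s : ℝ} (hs : 0 < s) (ω : Sph n) :
    snocVec (ρ • (ω : Euc n)) (ρ * ((s - 1) / (2 * √s))) =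
      (ρ * (1 + s) / (2 * √s)) • polarVec (√s) ω := by
  have hq : √s ≠ 0 := (Real.sqrt_pos.2 hs).ne'
  have h2 : √s ^ 2 = s := Real.sq_sqrt hs.le
  have e1 : ρ = ρ * (1 + s) / (2 * √s) * (2 * √s / (1 + s)) := by field_simp
  have e2 : ρ * ((s - 1) / (2 * √s)) = ρ * (1 + s) / (2 * √s) * ((s - 1) / (1 + s)) := by
    field_simp
  rw [polarVec_eq, ← snocVec_smul, smul_smul, h2, ← e1, ← e2]

-- The volume integral of `F (Y / |Y|)` over the punctured unit ball is computed twice. Spherical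
-- coordinates give the surface integral times `1 / (n + 1)`. Cylindrical coordinates, with the
-- vertical variable replaced by the level `s`, give the right side with the same factor once the
-- distance `ρ` to the axis is integrated out.
set_option maxHeartbeats 800000 in
theorem lintegral_sphere_polar_vec {n : ℕ} (hn : n ≠ 0) (F : Euc (n + 1) → ℝ≥0∞)
    (hF : Measurable F) :
    ∫⁻ y : Sph (n + 1), F y ∂(surf (n + 1)) =
      ∫⁻ s in Ioi (0 : ℝ), ∫⁻ ω : Sph n, ENNReal.ofReal (polarDens n s) * F (polarVec (√s) ω)
        ∂(surf n) := by
  set ι : ℝ → ℝ≥0∞ := (Ioo (0 : ℝ) 1).indicator 1 with hι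
  have hιm : Measurable ι := measurable_const.indicator measurableSet_Ioo
  set G : Euc (n + 1) → ℝ≥0∞ := fun Y => ι ‖Y‖ * F (‖Y‖⁻¹ • Y) with hG
  have hGm : Measurable G := by
    refine (hιm.comp measurable_norm).mul (hF.comp ?_); fun_prop
  have hGs : ∀ R : ℝ, 0 < R → ∀ v : Euc (n + 1), ‖v‖ = 1 → G (R • v) = ι R * F v := by
    intro R hR v hv
    have : ‖R • v‖ = R := by rw [norm_smul, hv, mul_one, Real.norm_of_nonneg hR.le]
    simp only [hG, this, smul_smul, inv_mul_cancel₀ hR.ne', one_smul]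
  have hpow : ∀ k : ℝ, 0 < k → ∫⁻ r in Ioi (0 : ℝ), ENNReal.ofReal (r ^ n) * ι (r / k) =
      ENNReal.ofReal (k ^ (n + 1) / (n + 1)) := by
    intro k hk
    rw [← lintegral_Ioo_pow n hk.le, ← lintegral_indicator measurableSet_Ioi,
      ← lintegral_indicator measurableSet_Ioo]
    refine lintegral_congr fun r => ?_
    have hdiv : r / k < 1 ↔ r < k := div_lt_one hk
    by_cases h1 : 0 < r
    · have h3 : 0 < r / k := by positivity
      by_cases h2 : r < k
      · have : ι (r / k) = 1 := by simp [hι, h3, hdiv, h2]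
        rw [indicator_of_mem (show r ∈ Ioi (0:ℝ) from h1), indicator_of_mem (show r ∈ Ioo 0 k from ⟨h1, h2⟩), this, mul_one]
      · have : ι (r / k) = 0 := by simp [hι, hdiv, h2]
        rw [indicator_of_mem (show r ∈ Ioi (0:ℝ) from h1), this,
          indicator_of_notMem (by simp [h2]), mul_zero]
    · rw [indicator_of_notMem (by simpa using h1), indicator_of_notMem (by simp [h1])]
  clear_value G ι
  have hA : ∫⁻ Y, G Y = ENNReal.ofReal (1 / (n + 1)) * ∫⁻ y : Sph (n + 1), F y ∂(surf (n + 1)) := by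
    rw [lintegral_polar (Nat.succ_ne_zero n) G hGm]
    have h1 := hpow 1 one_pos
    simp only [div_one, one_pow] at h1
    rw [← h1, ← lintegral_mul_const _ (by fun_prop)]
    refine setLIntegral_congr_fun measurableSet_Ioi fun r hr => ?_
    rw [← lintegral_const_mul (f := fun y : Sph (n + 1) => F y) _ (hF.comp measurable_subtype_coe)]
    refine lintegral_congr fun ω => ?_
    rw [hGs r hr _ (norm_eq_of_mem_sphere ω), ← mul_assoc]
    simp
  have hB : ∫⁻ Y, G Y = ENNReal.ofReal (1 / (n + 1)) *
      ∫⁻ s in Ioi (0 : ℝ), ∫⁻ ω : Sph n, ENNReal.ofReal (polarDens n s) * F (polarVec (√s) ω)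
        ∂(surf n) := by
    have hFm : Measurable fun p : ℝ × Sph n => F (polarVec (√p.1) p.2) := by
      have hq : Measurable fun p : ℝ × Sph n => (√p.1, p.2) := by fun_prop
      exact (hF.comp (continuous_polarVec (n := n)).measurable).comp hq
    have hm1 : Measurable fun X : Euc n => ∫⁻ z : ℝ, G (snocVec X z) :=
      (hGm.comp continuous_snocVec.measurable).lintegral_prod_right'
    rw [lintegral_snocVec G hGm, lintegral_polar hn _ hm1]
    have hιr : ∀ k : ℝ, Measurable fun r : ℝ => ENNReal.ofReal (r ^ n) * ι (r / k) := fun k =>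
      Measurable.mul (by fun_prop) (hιm.comp (by fun_prop))
    have hkm' : Measurable fun q : ℝ × ℝ × Sph n =>
        ENNReal.ofReal ((1 + q.2.1) / (4 * (q.2.1 * √q.2.1))) *
          F (polarVec (√q.2.1) q.2.2) *
          (ENNReal.ofReal (q.1 ^ n) * ι (q.1 / (2 * √q.2.1 / (1 + q.2.1)))) := by
      have m1 : Measurable fun q : ℝ × ℝ × Sph n =>
          ENNReal.ofReal ((1 + q.2.1) / (4 * (q.2.1 * √q.2.1))) := by fun_prop
      have m2 : Measurable fun q : ℝ × ℝ × Sph n => q.1 / (2 * √q.2.1 / (1 + q.2.1)) := by fun_prop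
      have m3 : Measurable fun q : ℝ × ℝ × Sph n => ENNReal.ofReal (q.1 ^ n) := by fun_prop
      exact (m1.mul (hFm.comp measurable_snd)).mul (m3.mul (hιm.comp m2))
    have hkm : ∀ ρ : ℝ, Measurable fun p : ℝ × Sph n =>
        ENNReal.ofReal ((1 + p.1) / (4 * (p.1 * √p.1))) *
          F (polarVec (√p.1) p.2) * (ENNReal.ofReal (ρ ^ n) * ι (ρ / (2 * √p.1 / (1 + p.1)))) :=
      fun ρ => by
        have m1 : Measurable fun q : ℝ × Sph n =>
            ENNReal.ofReal ((1 + q.1) / (4 * (q.1 * √q.1))) := by fun_prop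
        have m2 : Measurable fun q : ℝ × Sph n => ρ / (2 * √q.1 / (1 + q.1)) := by fun_prop
        exact (m1.mul hFm).mul (measurable_const.mul (hιm.comp m2))
    have hstep : ∀ ρ ∈ Ioi (0 : ℝ), ∫⁻ ω : Sph n, ENNReal.ofReal (ρ ^ (n - 1)) *
        (∫⁻ z, G (snocVec (ρ • (ω : Euc n)) z)) ∂(surf n) =
        ∫⁻ p : ℝ × Sph n, ENNReal.ofReal ((1 + p.1) / (4 * (p.1 * √p.1))) *
          F (polarVec (√p.1) p.2) * (ENNReal.ofReal (ρ ^ n) * ι (ρ / (2 * √p.1 / (1 + p.1))))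
          ∂((volume.restrict (Ioi 0)).prod (surf n)) := by
      intro ρ hρ
      have hρ' : (0 : ℝ) < ρ := hρ
      rw [lintegral_prod_symm _ (hkm ρ).aemeasurable]
      refine lintegral_congr fun ω => ?_
      have hvm : Measurable fun s : ℝ => ENNReal.ofReal (ρ * ((1 + s) / (4 * (s * √s)))) *
          G (snocVec (ρ • (ω : Euc n)) (ρ * ((s - 1) / (2 * √s)))) := by
        have m1 : Measurable fun s : ℝ => (ρ • (ω : Euc n), ρ * ((s - 1) / (2 * √s))) := by
          fun_prop
        have m2 : Measurable fun s : ℝ => ENNReal.ofReal (ρ * ((1 + s) / (4 * (s * √s)))) := by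
          fun_prop
        exact m2.mul ((hGm.comp (continuous_snocVec (n := n)).measurable).comp m1)
      rw [lintegral_vertical_subst hρ', ← lintegral_const_mul _ hvm]
      · refine setLIntegral_congr_fun measurableSet_Ioi fun s hs => ?_
        have hs' : (0 : ℝ) < s := hs
        have hq : 0 < √s := Real.sqrt_pos.2 hs'
        rw [snocVec_vertical hs', hGs _ (by positivity) _
          (mem_sphere_zero_iff_norm.1 (polarVec_mem _ _)), ENNReal.ofReal_mul hρ'.le]
        have e1 : ρ / (2 * √s / (1 + s)) = ρ * (1 + s) / (2 * √s) := by field_simp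
        have e2 : ENNReal.ofReal (ρ ^ n) = ENNReal.ofReal (ρ ^ (n - 1)) * ENNReal.ofReal ρ := by
          rw [← ENNReal.ofReal_mul (by positivity), ← pow_succ, Nat.sub_add_cancel
            (Nat.pos_of_ne_zero hn)]
        rw [e1, e2]; ring
    rw [setLIntegral_congr_fun measurableSet_Ioi hstep, lintegral_lintegral_swap
      hkm'.aemeasurable, ← lintegral_const_mul', lintegral_prod]
    · refine setLIntegral_congr_fun measurableSet_Ioi fun s hs => ?_
      have hs' : (0 : ℝ) < s := hs
      have hq : 0 < √s := Real.sqrt_pos.2 hs'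
      rw [← lintegral_const_mul' _ _ (by simp)]
      refine lintegral_congr fun ω => ?_
      dsimp only
      -- The ball restricts `ρ` to `ρ < k` with `k = 2 √s / (1 + s)`, and `k^{n+1}` times the
      -- Jacobian `(1 + s) / (4 s √s)` is `polarDens n s`.
      rw [lintegral_const_mul _ (hιr _), hpow _ (by positivity)]
      rw [mul_right_comm, ← ENNReal.ofReal_mul (by positivity),
        ← mul_assoc (ENNReal.ofReal (1 / _)), ← ENNReal.ofReal_mul (by positivity)]
      congr 2
      have h2 : √s ^ 2 = s := Real.sq_sqrt hs'.le
      have e3 : s ^ ((n : ℝ) / 2 - 1) = √s ^ n / s := by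
        rw [Real.rpow_sub hs', Real.rpow_one, Real.sqrt_eq_rpow, ← Real.rpow_natCast,
          ← Real.rpow_mul hs'.le]
        ring_nf
      have e4 : (2 : ℝ) ^ (n - 1 : ℝ) = 2 ^ n / 2 := by
        rw [Real.rpow_sub two_pos, Real.rpow_one, Real.rpow_natCast]
      have e5 : √s ^ (n + 1) = √s ^ n * √s := pow_succ _ _
      rw [polarDens, e3, e4, div_pow, mul_pow, e5]
      field_simp
      ring
    · exact hkm'.lintegral_prod_left'.aemeasurable
    · exact ENNReal.ofReal_ne_top
  have hc : ENNReal.ofReal (1 / ((n : ℝ) + 1)) ≠ 0 := by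
    simp only [ne_eq, ENNReal.ofReal_eq_zero, not_le]; positivity
  exact (ENNReal.mul_right_inj hc ENNReal.ofReal_ne_top).1 (hA.symm.trans hB)

/-! ### Total area of the sphere and invariance of the surface measure under isometries. -/

theorem sphArea_pos {m : ℕ} (hm : m ≠ 0) : 0 < sphArea m := by
  have : (0 : ℝ) < m := by positivity
  have := Real.Gamma_pos_of_pos (s := (m : ℝ) / 2) (by positivity)
  have := Real.pi_pos
  unfold sphArea; positivity

theorem surf_univ {m : ℕ} (hm : m ≠ 0) : surf m univ = ENNReal.ofReal (sphArea m) := by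
  have : Nonempty (Fin m) := ⟨⟨0, Nat.pos_of_ne_zero hm⟩⟩
  have hm' : (0 : ℝ) < m := by positivity
  rw [Measure.toSphere_apply_univ, EuclideanSpace.volume_ball, finrank_euclideanSpace_fin,
    Fintype.card_fin, ← ENNReal.ofReal_natCast, ENNReal.ofReal_one, one_pow, one_mul,
    ← ENNReal.ofReal_mul hm'.le, Real.Gamma_add_one (by positivity), sphArea]
  have hG := Real.Gamma_pos_of_pos (s := (m : ℝ) / 2) (by positivity)
  congr 1
  have : √Real.pi ^ m = Real.pi ^ ((m : ℝ) / 2) := by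
    rw [Real.sqrt_eq_rpow, ← Real.rpow_natCast, ← Real.rpow_mul Real.pi_pos.le]
    ring_nf
  rw [this]; field_simp

theorem surf_real_univ {m : ℕ} (hm : m ≠ 0) : (surf m).real univ = sphArea m := by
  rw [measureReal_def, surf_univ hm, ENNReal.toReal_ofReal (sphArea_pos hm).le]

/-- The restriction of a linear isometry to the unit sphere. -/
def sphMap {m : ℕ} (L : Euc m ≃ₗᵢ[ℝ] Euc m) (η : Sph m) : Sph m :=
  ⟨L η, by rw [mem_sphere_zero_iff_norm, L.norm_map, norm_eq_of_mem_sphere]⟩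

theorem continuous_sphMap {m : ℕ} (L : Euc m ≃ₗᵢ[ℝ] Euc m) : Continuous (sphMap L) :=
  (L.continuous.comp continuous_subtype_val).subtype_mk _

-- `toSphere` measures `E` through the volume of the cone over `E`, and a linear isometry maps cones
-- to cones and preserves volume.
open scoped Pointwise in
theorem measurePreserving_sphMap {m : ℕ} (L : Euc m ≃ₗᵢ[ℝ] Euc m) :
    MeasurePreserving (sphMap L) (surf m) (surf m) := by
  refine ⟨(continuous_sphMap L).measurable, ?_⟩
  ext E hE
  rw [Measure.map_apply (continuous_sphMap L).measurable hE, Measure.toSphere_apply' _ hE,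
    Measure.toSphere_apply' _ ((continuous_sphMap L).measurable hE)]
  congr 1
  have h : (Ioo (0 : ℝ) 1 • (Subtype.val '' (sphMap L ⁻¹' E)) : Set (Euc m)) =
      L ⁻¹' (Ioo (0 : ℝ) 1 • (Subtype.val '' E)) := by
    ext x
    simp only [Set.mem_smul, mem_image, mem_preimage]
    constructor
    · rintro ⟨r, hr, _, ⟨η, hη, rfl⟩, rfl⟩
      exact ⟨r, hr, L η, ⟨_, hη, rfl⟩, by simp⟩
    · rintro ⟨r, hr, _, ⟨η, hη, rfl⟩, hx⟩
      have he : sphMap L (sphMap L.symm η) = η := Subtype.ext (by simp [sphMap])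
      refine ⟨r, hr, _, ⟨sphMap L.symm η, by rwa [he], rfl⟩, L.injective ?_⟩
      rw [← hx]; simp [sphMap]
  rw [h]
  exact (LinearIsometryEquiv.measurePreserving L).measure_preimage_equiv
    (f := L.toHomeomorph.toMeasurableEquiv) _

/-- The reflection in the hyperplane orthogonal to `ξ - η` exchanges unit vectors `ξ` and `η`. -/
theorem exists_isometry_apply_eq {m : ℕ} (ξ η : Euc m) (h : ‖ξ‖ = ‖η‖) :
    ∃ L : Euc m ≃ₗᵢ[ℝ] Euc m, L ξ = η :=
  ⟨(ℝ ∙ (ξ - η))ᗮ.reflection, Submodule.reflection_sub h⟩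

/-! ### The polar coordinates as a map -/

/-- The point of `S^n` with `tan² (θ/2) = p.1` and direction `p.2`. -/
def polarMap {n : ℕ} (p : ℝ × Sph n) : Sph (n + 1) := polarPt (√p.1) p.2

theorem continuous_polarMap {n : ℕ} : Continuous (polarMap (n := n)) :=
  continuous_polarPt.comp (f := fun p : ℝ × Sph n => (√p.1, p.2)) (by fun_prop)

theorem height_polarMap {n : ℕ} {s : ℝ} (hs : 0 ≤ s) (ω : Sph n) :
    height (polarMap (s, ω)) = (s - 1) / (1 + s) := by
  simp [height, polarMap, polarPt, polarVec, Real.sq_sqrt hs]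

theorem tanSq_polarMap {n : ℕ} {s : ℝ} (hs : 0 ≤ s) (ω : Sph n) : tanSq (polarMap (s, ω)) = s := by
  rw [tanSq, height_polarMap hs]
  have : 1 + s ≠ 0 := by positivity
  field_simp; ring

theorem direction_polarMap {n : ℕ} {s : ℝ} (hs : 0 < s) (ω : Sph n) :
    direction (polarMap (s, ω)) = ω := by
  rw [direction, height_polarMap hs.le]
  have h1 : 1 + s ≠ 0 := by positivity
  have h0 : 0 < √s := Real.sqrt_pos.2 hs
  have h2 : 1 - ((s - 1) / (1 + s)) ^ 2 = (2 * √s / (1 + s)) ^ 2 := by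
    rw [div_pow, div_pow, mul_pow, Real.sq_sqrt hs.le]; field_simp; ring
  rw [h2, Real.sqrt_sq (by positivity)]
  ext i
  simp only [polarMap, polarPt, polarVec, Fin.snoc_castSucc, PiLp.smul_apply, smul_eq_mul,
    Real.sq_sqrt hs.le]
  field_simp

theorem abs_height_le {n : ℕ} (x : Sph (n + 1)) : |height x| ≤ 1 := by
  have := PiLp.norm_apply_le (x : Euc (n + 1)) (Fin.last n)
  rwa [norm_eq_of_mem_sphere x, Real.norm_eq_abs] at this

theorem continuous_height {n : ℕ} : Continuous (height (n := n)) := by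
  unfold height; fun_prop

theorem exists_polarMap_eq {n : ℕ} (x : Sph (n + 1)) (h1 : -1 < height x) (h2 : height x < 1) :
    ∃ ω : Sph n, 0 < tanSq x ∧ x = polarMap (tanSq x, ω) := by
  set c := height x
  have hc : 0 < 1 - c ^ 2 := by nlinarith
  have ht : 0 < tanSq x := div_pos (by linarith) (by linarith)
  have hnorm : ∑ i : Fin n, ((x : Euc (n + 1)) i.castSucc) ^ 2 = 1 - c ^ 2 := by
    have h := EuclideanSpace.norm_sq_eq (x : Euc (n + 1))
    rw [norm_eq_of_mem_sphere x, Fin.sum_univ_castSucc] at h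
    simp only [Real.norm_eq_abs, sq_abs, one_pow] at h
    simp only [c, height]; linarith
  have hdir : ‖direction x‖ = 1 := by
    have h3 : ‖direction x‖ ^ 2 = 1 := by
      rw [direction, norm_smul, mul_pow, EuclideanSpace.norm_sq_eq]
      simp only [Real.norm_eq_abs, sq_abs, inv_pow]
      rw [hnorm, Real.sq_sqrt hc.le]
      exact inv_mul_cancel₀ hc.ne'
    exact (sq_eq_sq₀ (norm_nonneg _) zero_le_one).1 (by rw [h3, one_pow])
  refine ⟨⟨direction x, by simpa using hdir⟩, ht, Subtype.ext ?_⟩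
  have e2 : 2 * √(tanSq x) / (1 + tanSq x) = √(1 - c ^ 2) := by
    have e3 : 1 + tanSq x = 2 / (1 - c) := by
      simp only [tanSq, c]; field_simp [(by linarith : 1 - height x ≠ 0)]; ring
    have e4 : √(tanSq x) = √(1 - c ^ 2) / (1 - c) := by
      rw [show tanSq x = (1 - c ^ 2) / (1 - c) ^ 2 by
        simp only [tanSq]; change (1 + c) / (1 - c) = _
        rw [div_eq_div_iff (by linarith) (by nlinarith)]; ring,
        Real.sqrt_div hc.le, Real.sqrt_sq (by linarith)]
    rw [e3, e4]; field_simp [(by linarith : 1 - c ≠ 0)]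
  ext i
  refine Fin.lastCases ?_ (fun i => ?_) i
  · simp only [polarMap, polarPt, polarVec, Fin.snoc_last, Real.sq_sqrt ht.le]
    simp only [tanSq]; change c = ((1 + c) / (1 - c) - 1) / (1 + (1 + c) / (1 - c))
    have : 1 - c ≠ 0 := by linarith
    field_simp
    ring
  · simp only [polarMap, polarPt, polarVec, Fin.snoc_castSucc, Real.sq_sqrt ht.le, e2, direction,
      PiLp.smul_apply, smul_eq_mul]
    rw [← mul_assoc]
    change _ = √(1 - c ^ 2) * (√(1 - c ^ 2))⁻¹ * _
    rw [mul_inv_cancel₀ (Real.sqrt_pos.2 hc).ne', one_mul]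

theorem injOn_polarMap {n : ℕ} : InjOn (polarMap (n := n)) (Ioi 0 ×ˢ univ) := by
  rintro ⟨s, ω⟩ ⟨hs, -⟩ ⟨s', ω'⟩ ⟨hs', -⟩ h
  have hs0 : 0 < s := hs
  have hs0' : 0 < s' := hs'
  have h1 := congrArg tanSq h
  rw [tanSq_polarMap hs0.le, tanSq_polarMap hs0'.le] at h1
  have h2 := congrArg direction h
  rw [direction_polarMap hs0, direction_polarMap hs0'] at h2
  exact Prod.ext h1 (Subtype.ext h2)

/-- The product of the Lebesgue measure on `(0, ∞)` and the surface measure. -/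
abbrev polarProd (n : ℕ) : Measure (ℝ × Sph n) := (volume.restrict (Ioi 0)).prod (surf n)

theorem map_polarMap {n : ℕ} (hn : n ≠ 0) :
    ((polarProd n).withDensity fun p => ENNReal.ofReal (polarDens n p.1)).map polarMap =
      surf (n + 1) := by
  have hd : Measurable fun p : ℝ × Sph n => ENNReal.ofReal (polarDens n p.1) :=
    ((measurable_polarDens n).comp measurable_fst).ennreal_ofReal
  ext E hE
  -- A measurable subset of the sphere is the trace of a measurable subset of the ambient space, to
  -- which the formula for functions of a vector applies.
  obtain ⟨E', hE', rfl⟩ := hE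
  have hm := continuous_polarMap.measurable (hE'.preimage (measurable_subtype_coe))
  have h := lintegral_sphere_polar_vec hn (E'.indicator 1) (measurable_const.indicator hE')
  rw [Measure.map_apply continuous_polarMap.measurable (hE'.preimage measurable_subtype_coe),
    withDensity_apply _ hm, ← lintegral_indicator_one (hE'.preimage measurable_subtype_coe)]
  refine Eq.trans ?_ h.symm
  rw [← lintegral_indicator hm, lintegral_prod _ (hd.indicator hm).aemeasurable]
  refine lintegral_congr fun s => lintegral_congr fun ω => ?_
  simp only [indicator, mem_preimage]
  by_cases hE : polarVec (√s) ω ∈ E'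
  · rw [if_pos hE, if_pos (by simpa [polarMap, polarPt] using hE)]; simp
  · rw [if_neg hE, if_neg (by simpa [polarMap, polarPt] using hE)]; simp

theorem ae_pos_polarProd {n : ℕ} : ∀ᵐ p ∂(polarProd n), 0 < p.1 := by
  have := Measure.quasiMeasurePreserving_fst (μ := volume.restrict (Ioi (0 : ℝ))) (ν := surf n)
  exact this.ae (ae_restrict_mem measurableSet_Ioi)

/-- The exceptional set need not be measurable, so it is enclosed in a measurable null set `N`. The
image of the complement of `N` under the continuous injective map `polarMap` is Borel by the
Lusin-Souslin theorem, and it carries the whole surface measure. -/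
theorem ae_surf_of_ae_polarProd {n : ℕ} (hn : n ≠ 0) {q : Sph (n + 1) → Prop}
    (h : ∀ᵐ p ∂(polarProd n), q (polarMap p)) : ∀ᵐ y ∂(surf (n + 1)), q y := by
  set N := toMeasurable (polarProd n) {p | ¬ q (polarMap p)}
  have hN0 : polarProd n N = 0 := by rw [measure_toMeasurable]; exact h
  have hNm : MeasurableSet N := measurableSet_toMeasurable _ _
  set D : Set (ℝ × Sph n) := (Ioi 0 ×ˢ univ) \ N
  have hDm : MeasurableSet D := (measurableSet_Ioi.prod MeasurableSet.univ).diff hNm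
  have hM : MeasurableSet (polarMap '' D) := hDm.image_of_continuousOn_injOn
    continuous_polarMap.continuousOn (injOn_polarMap.mono sdiff_subset)
  have hz : surf (n + 1) (polarMap '' D)ᶜ = 0 := by
    rw [← map_polarMap hn, Measure.map_apply continuous_polarMap.measurable hM.compl]
    refine withDensity_absolutelyContinuous _ _ ?_
    have h0 : polarProd n (N ∪ {p | ¬ 0 < p.1}) = 0 := measure_union_null hN0 ae_pos_polarProd
    refine measure_mono_null (fun p hp => ?_) h0
    by_contra hcon
    simp only [mem_union, mem_ofPred_eq, not_or, not_not] at hcon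
    exact hp ⟨p, ⟨⟨hcon.2, mem_univ _⟩, hcon.1⟩, rfl⟩
  refine measure_mono_null (subset_compl_iff_disjoint_right.2 ?_) hz
  refine Set.disjoint_left.2 fun y hy hyD => ?_
  obtain ⟨p, hp, rfl⟩ := hyD
  exact hp.2 (subset_toMeasurable _ _ hy)

theorem aestronglyMeasurable_polarMap {E : Type*} [NormedAddCommGroup E] {n : ℕ} (hn : n ≠ 0) {F : Sph (n + 1) → E}
    (hF : AEStronglyMeasurable F (surf (n + 1))) :
    AEStronglyMeasurable (fun p => F (polarMap p)) (polarProd n) := by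
  rw [← map_polarMap hn] at hF
  have h := hF.comp_measurable continuous_polarMap.measurable
  refine h.mono_ac ?_
  refine withDensity_absolutelyContinuous' ?_ ?_
  · exact ((measurable_polarDens n).comp measurable_fst).ennreal_ofReal.aemeasurable
  · filter_upwards [ae_pos_polarProd] with p hp
    simpa using polarDens_pos n hp

theorem integrable_polarMap_iff {E : Type*} [NormedAddCommGroup E] [NormedSpace ℝ E]
    {n : ℕ} (hn : n ≠ 0) {F : Sph (n + 1) → E}
    (hF : AEStronglyMeasurable F (surf (n + 1))) :
    Integrable F (surf (n + 1)) ↔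
      Integrable (fun p => polarDens n p.1 • F (polarMap p)) (polarProd n) := by
  have hd : Measurable fun p : ℝ × Sph n => ENNReal.ofReal (polarDens n p.1) :=
    ((measurable_polarDens n).comp measurable_fst).ennreal_ofReal
  rw [← map_polarMap hn] at hF ⊢
  rw [integrable_map_measure hF continuous_polarMap.measurable.aemeasurable,
    integrable_withDensity_iff_integrable_smul' hd (by simp)]
  refine integrable_congr ?_
  filter_upwards [ae_pos_polarProd] with p hp
  simp [ENNReal.toReal_ofReal (polarDens_nonneg n hp.le)]

theorem integral_polarMap {E : Type*} [NormedAddCommGroup E] [NormedSpace ℝ E]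
    {n : ℕ} (hn : n ≠ 0) {F : Sph (n + 1) → E}
    (hF : AEStronglyMeasurable F (surf (n + 1))) :
    ∫ y, F y ∂(surf (n + 1)) = ∫ p, polarDens n p.1 • F (polarMap p) ∂(polarProd n) := by
  have hd : Measurable fun p : ℝ × Sph n => ENNReal.ofReal (polarDens n p.1) :=
    ((measurable_polarDens n).comp measurable_fst).ennreal_ofReal
  rw [← map_polarMap hn] at hF ⊢
  rw [integral_map continuous_polarMap.measurable.aemeasurable hF,
    integral_withDensity_eq_integral_toReal_smul hd (by simp)]
  refine integral_congr_ae ?_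
  filter_upwards [ae_pos_polarProd] with p hp
  simp [ENNReal.toReal_ofReal (polarDens_nonneg n hp.le)]

/-! ### A maximum principle -/

/-- The mean value inequality is applied twice, to `g' s - g' (-s) - 2 c s` and then to `g s + g
(-s) - c s^2`. Only the oscillation of `g''` enters the bound, so it can be used uniformly in
parameters. -/
theorem abs_second_difference_le {g g' g'' : ℝ → ℝ} {c M δ : ℝ}
    (h1 : ∀ s, |s| ≤ δ → HasDerivAt g (g' s) s) (h2 : ∀ s, |s| ≤ δ → HasDerivAt g' (g'' s) s)
    (hM : ∀ s, |s| ≤ δ → |g'' s - c| ≤ M) {h : ℝ} (h0 : 0 ≤ h) (hδ : h ≤ δ) :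
    |g h + g (-h) - 2 * g 0 - c * h ^ 2| ≤ 2 * M * h ^ 2 := by
  have habs : ∀ s ∈ Icc 0 h, |s| ≤ δ ∧ |(-s)| ≤ δ := fun s hs => by
    rw [abs_neg, abs_of_nonneg hs.1]; exact ⟨hs.2.trans hδ, hs.2.trans hδ⟩
  have d2 : ∀ s ∈ Icc 0 h, HasDerivWithinAt (fun s => g' s - g' (-s) - 2 * c * s)
      (g'' s + g'' (-s) - 2 * c) (Icc 0 h) s := fun s hs => by
    have e1 := h2 s (habs s hs).1
    have e2 := (h2 (-s) (habs s hs).2).comp s (hasDerivAt_neg s)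
    exact (((e1.sub e2).sub ((hasDerivAt_id s).const_mul (2 * c))).congr_deriv
      (by ring)).hasDerivWithinAt
  have b2 : ∀ s ∈ Icc 0 h, ‖g'' s + g'' (-s) - 2 * c‖ ≤ 2 * M := fun s hs => by
    have e1 := abs_le.1 (hM s (habs s hs).1)
    have e2 := abs_le.1 (hM (-s) (habs s hs).2)
    rw [Real.norm_eq_abs, abs_le]; constructor <;> linarith
  have h00 : (0 : ℝ) ∈ Icc 0 h := ⟨le_rfl, h0⟩
  have hM0 : 0 ≤ M := (abs_nonneg _).trans (hM 0 (habs 0 h00).1)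
  have b1 : ∀ s ∈ Icc 0 h, ‖g' s - g' (-s) - 2 * c * s‖ ≤ 2 * M * h := fun s hs => by
    have := (convex_Icc 0 h).norm_image_sub_le_of_norm_hasDerivWithin_le d2 b2 h00 hs
    simp only [neg_zero, sub_self, mul_zero, sub_zero] at this
    refine this.trans (mul_le_mul_of_nonneg_left ?_ (by positivity))
    rw [Real.norm_eq_abs, abs_of_nonneg hs.1]; exact hs.2
  have d1 : ∀ s ∈ Icc 0 h, HasDerivWithinAt (fun s => g s + g (-s) - c * s ^ 2)
      (g' s - g' (-s) - 2 * c * s) (Icc 0 h) s := fun s hs => by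
    have e1 := h1 s (habs s hs).1
    have e2 := (h1 (-s) (habs s hs).2).comp s (hasDerivAt_neg s)
    exact (((e1.add e2).sub ((hasDerivAt_pow 2 s).const_mul c)).congr_deriv
      (by norm_num; ring)).hasDerivWithinAt
  have := (convex_Icc 0 h).norm_image_sub_le_of_norm_hasDerivWithin_le d1 b1 h00 ⟨h0, le_rfl⟩
  simp only [neg_zero, sub_zero, Real.norm_eq_abs, abs_of_nonneg h0] at this
  calc _ = |g h + g (-h) - c * h ^ 2 - (g 0 + g 0 - c * 0 ^ 2)| := by congr 1; ring
    _ ≤ _ := this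
    _ = _ := by ring

/-- The `i`-th unit vector. -/
abbrev unitVec {n : ℕ} (i : Fin n) : Euc n := EuclideanSpace.single i 1

/-- The second difference of `u` at `X` with step `h`, summed over the coordinate directions. -/
def discLap {n : ℕ} (u : Euc n → ℝ) (X : Euc n) (h : ℝ) : ℝ :=
  ∑ i, (u (X + h • unitVec i) + u (X - h • unitVec i) - 2 * u X)

/-- `c` is the limit of the second difference quotients of `u` at `X`. -/
def HasDiscLap {n : ℕ} (u : Euc n → ℝ) (X : Euc n) (c : ℝ) : Prop :=
  Tendsto (fun h => discLap u X h / h ^ 2) (𝓝[>] 0) (𝓝 c)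

theorem HasDiscLap.add {n : ℕ} {u v : Euc n → ℝ} {X : Euc n} {c d : ℝ} (hu : HasDiscLap u X c)
    (hv : HasDiscLap v X d) : HasDiscLap (fun Y => u Y + v Y) X (c + d) := by
  refine (Tendsto.add hu hv).congr fun h => ?_
  rw [← add_div]; congr 1
  simp only [discLap, ← Finset.sum_add_distrib]
  exact Finset.sum_congr rfl fun i _ => by ring

theorem HasDiscLap.const_mul {n : ℕ} {u : Euc n → ℝ} {X : Euc n} {c : ℝ} (hu : HasDiscLap u X c)
    (a : ℝ) : HasDiscLap (fun Y => a * u Y) X (a * c) := by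
  refine (Tendsto.const_mul a hu).congr fun h => ?_
  rw [← mul_div_assoc]; congr 1
  simp only [discLap, Finset.mul_sum]
  exact Finset.sum_congr rfl fun i _ => by ring

theorem norm_add_unitVec_sq {n : ℕ} (X : Euc n) (h : ℝ) (i : Fin n) :
    ‖X + h • unitVec i‖ ^ 2 = ‖X‖ ^ 2 + 2 * X i * h + h ^ 2 := by
  rw [norm_add_sq_real, norm_smul, inner_smul_right, EuclideanSpace.inner_single_right]
  simp; ring

theorem hasDiscLap_norm_sq {n : ℕ} (X : Euc n) : HasDiscLap (fun Y => ‖Y‖ ^ 2) X (2 * n) := by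
  refine (tendsto_const_nhds (x := (2 * n : ℝ))).congr' ?_
  filter_upwards [self_mem_nhdsWithin] with h hh
  have hh' : (0 : ℝ) < h := hh
  rw [eq_div_iff (by positivity), discLap]
  have : ∀ i : Fin n, ‖X + h • unitVec i‖ ^ 2 + ‖X - h • unitVec i‖ ^ 2 - 2 * ‖X‖ ^ 2 =
      2 * h ^ 2 := fun i => by
    rw [sub_eq_add_neg X, ← neg_smul, norm_add_unitVec_sq, norm_add_unitVec_sq]; ring
  simp only [this]; simp; ring

theorem HasDiscLap.comp_smul {n : ℕ} {u : Euc n → ℝ} {X : Euc n} {b : ℝ} (hb : 0 ≤ b)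
    (hu : HasDiscLap u (b • X) 0) : HasDiscLap (fun Y => u (b • Y)) X 0 := by
  rcases hb.eq_or_lt with rfl | hb
  · refine (tendsto_const_nhds (x := (0 : ℝ))).congr fun h => ?_
    simp [discLap]; ring
  · have ht : Tendsto (fun h : ℝ => b * h) (𝓝[>] 0) (𝓝[>] 0) := by
      refine tendsto_nhdsWithin_iff.2 ⟨?_, ?_⟩
      · have : Tendsto (fun h : ℝ => b * h) (𝓝 0) (𝓝 (b * 0)) := by
          exact (continuous_const.mul continuous_id).tendsto 0
        rw [mul_zero] at this
        exact this.mono_left nhdsWithin_le_nhds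
      · filter_upwards [self_mem_nhdsWithin] with h hh
        exact mul_pos hb hh
    have := ((Tendsto.comp hu ht).const_mul (b ^ 2))
    rw [mul_zero] at this
    refine this.congr' ?_
    filter_upwards [self_mem_nhdsWithin] with h hh
    have hh' : (0 : ℝ) < h := hh
    simp only [Function.comp, discLap, smul_add, smul_sub, smul_smul, mul_pow]
    field_simp

/-- The weak maximum principle. Adding `ε |Y|^2` raises the Laplacian to `2 n ε > 0`, whereas at an
interior maximum all second differences are nonpositive; so the maximum is attained on the boundary.
-/
theorem le_of_hasDiscLap_zero {n : ℕ} (hn : n ≠ 0) {u : Euc n → ℝ} {r M : ℝ}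
    (hu : ContinuousOn u (Metric.closedBall 0 r))
    (hh : ∀ X : Euc n, ‖X‖ < r → HasDiscLap u X 0) (hM : ∀ X : Euc n, ‖X‖ = r → u X ≤ M)
    {X : Euc n} (hX : ‖X‖ ≤ r) : u X ≤ M := by
  by_contra! hcon
  have hr : 0 ≤ r := (norm_nonneg X).trans hX
  -- So small that the perturbation, at most `ε r^2` on the boundary, does not lift the boundary
  -- values up to `u X`.
  obtain ⟨ε, hε, hεr⟩ : ∃ ε > 0, ε * r ^ 2 < u X - M := by
    refine ⟨(u X - M) / (r ^ 2 + 1), by apply div_pos <;> nlinarith, ?_⟩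
    rw [div_mul_eq_mul_div, div_lt_iff₀ (by positivity)]
    nlinarith
  have hv : ContinuousOn (fun Y => u Y + ε * ‖Y‖ ^ 2) (Metric.closedBall 0 r) := by fun_prop
  obtain ⟨Y, hY, hmax⟩ := (isCompact_closedBall (0 : Euc n) r).exists_isMaxOn
    ⟨X, by simpa using hX⟩ hv
  have hY' : ‖Y‖ ≤ r := by simpa using hY
  have hYX := hmax (show X ∈ Metric.closedBall 0 r by simpa using hX)
  simp only [mem_ofPred_eq] at hYX
  have hYr : ‖Y‖ < r := by
    refine lt_of_le_of_ne hY' fun he => ?_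
    have := hM Y he
    rw [he] at hYX
    nlinarith [sq_nonneg ‖X‖]
  have hlap := (hh Y hYr).add ((hasDiscLap_norm_sq Y).const_mul ε)
  have hle : 0 + ε * (2 * n) ≤ 0 := by
    refine le_of_tendsto hlap ?_
    have : ∀ᶠ h : ℝ in 𝓝[>] 0, h < r - ‖Y‖ :=
      nhdsWithin_le_nhds (Iio_mem_nhds (by linarith))
    filter_upwards [self_mem_nhdsWithin, this] with h hh hlt
    have hh' : (0 : ℝ) < h := hh
    refine div_nonpos_of_nonpos_of_nonneg (Finset.sum_nonpos fun i _ => ?_) (by positivity)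
    have hn1 : ‖h • unitVec i‖ = h := by rw [norm_smul]; simp [abs_of_pos hh']
    have e1 := hmax (show Y + h • unitVec i ∈ Metric.closedBall 0 r by
      have := norm_add_le Y (h • unitVec i); simp only [mem_closedBall_zero_iff]; linarith)
    have e2 := hmax (show Y - h • unitVec i ∈ Metric.closedBall 0 r by
      have := norm_sub_le Y (h • unitVec i); simp only [mem_closedBall_zero_iff]; linarith)
    simp only [mem_ofPred_eq] at e1 e2
    linarith
  have : (0 : ℝ) < n := by positivity
  nlinarith [mul_pos hε this]

/-! ### The Poisson kernel -/

/-- The Poisson kernel of the unit ball, without the normalizing constant. -/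
def poissonKer {n : ℕ} (X η : Euc n) : ℝ := (1 - ‖X‖ ^ 2) / ‖X - η‖ ^ n

theorem one_sub_norm_le {n : ℕ} (X : Euc n) {η : Euc n} (hη : ‖η‖ = 1) :
    1 - ‖X‖ ≤ ‖X - η‖ := by
  have := norm_sub_norm_le η X
  rw [hη, norm_sub_rev] at this; exact this

theorem poissonKer_nonneg {n : ℕ} {X : Euc n} (hX : ‖X‖ ≤ 1) (η : Euc n) : 0 ≤ poissonKer X η :=
  div_nonneg (by nlinarith [norm_nonneg X]) (by positivity)

/-- Along a line the Poisson kernel is `(p₀ + p₁ s - s²) (q₀ + q₁ s + s²)^{-m}`: this is the second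
derivative of the latter. -/
def lineSecond (m p0 p1 q0 q1 s : ℝ) : ℝ :=
  -2 * (q0 + q1 * s + s ^ 2) ^ (-m) -
    2 * m * (p1 - 2 * s) * (q1 + 2 * s) * (q0 + q1 * s + s ^ 2) ^ (-m - 1) +
    m * (m + 1) * (p0 + p1 * s - s ^ 2) * (q1 + 2 * s) ^ 2 * (q0 + q1 * s + s ^ 2) ^ (-m - 2) -
    2 * m * (p0 + p1 * s - s ^ 2) * (q0 + q1 * s + s ^ 2) ^ (-m - 1)

theorem hasDerivAt_line (m p0 p1 q0 q1 s : ℝ) (hq : 0 < q0 + q1 * s + s ^ 2) :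
    HasDerivAt (fun s => (p0 + p1 * s - s ^ 2) * (q0 + q1 * s + s ^ 2) ^ (-m))
      ((p1 - 2 * s) * (q0 + q1 * s + s ^ 2) ^ (-m) -
        m * (p0 + p1 * s - s ^ 2) * (q1 + 2 * s) * (q0 + q1 * s + s ^ 2) ^ (-m - 1)) s := by
  have hp : HasDerivAt (fun s => p0 + p1 * s - s ^ 2) (p1 - 2 * s) s :=
    ((((hasDerivAt_id s).const_mul p1).const_add p0).sub (hasDerivAt_pow 2 s)).congr_deriv
      (by norm_num)
  have hq' : HasDerivAt (fun s => q0 + q1 * s + s ^ 2) (q1 + 2 * s) s :=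
    ((((hasDerivAt_id s).const_mul q1).const_add q0).add (hasDerivAt_pow 2 s)).congr_deriv
      (by norm_num)
  exact (hp.mul (hq'.rpow_const (Or.inl hq.ne'))).congr_deriv (by ring)

theorem hasDerivAt_line' (m p0 p1 q0 q1 s : ℝ) (hq : 0 < q0 + q1 * s + s ^ 2) :
    HasDerivAt (fun s => (p1 - 2 * s) * (q0 + q1 * s + s ^ 2) ^ (-m) -
        m * (p0 + p1 * s - s ^ 2) * (q1 + 2 * s) * (q0 + q1 * s + s ^ 2) ^ (-m - 1))
      (lineSecond m p0 p1 q0 q1 s) s := by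
  have hp : HasDerivAt (fun s => p0 + p1 * s - s ^ 2) (p1 - 2 * s) s :=
    ((((hasDerivAt_id s).const_mul p1).const_add p0).sub (hasDerivAt_pow 2 s)).congr_deriv
      (by norm_num)
  have hq' : HasDerivAt (fun s => q0 + q1 * s + s ^ 2) (q1 + 2 * s) s :=
    ((((hasDerivAt_id s).const_mul q1).const_add q0).add (hasDerivAt_pow 2 s)).congr_deriv
      (by norm_num)
  have hp1 : HasDerivAt (fun s => p1 - 2 * s) (-2) s :=
    (((hasDerivAt_id s).const_mul 2).const_sub p1).congr_deriv (by norm_num)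
  have hq1 : HasDerivAt (fun s => q1 + 2 * s) 2 s :=
    (((hasDerivAt_id s).const_mul 2).const_add q1).congr_deriv (by norm_num)
  have e1 := hp1.mul (hq'.rpow_const (p := -m) (Or.inl hq.ne'))
  have e2 := ((hp.const_mul m).mul hq1).mul (hq'.rpow_const (p := -m - 1) (Or.inl hq.ne'))
  refine (e1.sub e2).congr_deriv ?_
  rw [lineSecond, show -m - 1 - 1 = -m - 2 by ring]
  simp only [Pi.mul_apply]
  ring

theorem poissonKer_line {n : ℕ} (X η : Euc n) (i : Fin n) (s : ℝ) :
    poissonKer (X + s • unitVec i) η =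
      ((1 - ‖X‖ ^ 2) + (-2 * X i) * s - s ^ 2) *
        (‖X - η‖ ^ 2 + (2 * (X - η) i) * s + s ^ 2) ^ (-((n : ℝ) / 2)) := by
  have e : ‖X + s • unitVec i - η‖ ^ 2 = ‖X - η‖ ^ 2 + (2 * (X - η) i) * s + s ^ 2 := by
    rw [add_sub_right_comm, norm_add_unitVec_sq]
  have e2 : ‖X + s • unitVec i - η‖ ^ n = (‖X + s • unitVec i - η‖ ^ 2) ^ ((n : ℝ) / 2) := by
    rw [← Real.rpow_natCast _ 2, ← Real.rpow_mul (norm_nonneg _), ← Real.rpow_natCast]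
    congr 1; push_cast; ring
  rw [poissonKer, e2, e, norm_add_unitVec_sq, Real.rpow_neg, div_eq_mul_inv]
  · ring
  · rw [← e]; positivity

/-- Harmonicity of the Poisson kernel. After summation over `i` only `|X|^2`, `q = |X - η|^2` and
the inner product of `X` and `X - η` remain, and `|η| = 1` makes the latter equal to `(|X|^2 + q -
1) / 2`; the rest is algebra with `n = 2 m`. -/
theorem sum_lineSecond_zero {n : ℕ} (X η : Euc n) (hη : ‖η‖ = 1) (hX : ‖X‖ < 1) :
    ∑ i, lineSecond ((n : ℝ) / 2) (1 - ‖X‖ ^ 2) (-2 * X i) (‖X - η‖ ^ 2) (2 * (X - η) i) 0 = 0 := by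
  have hq : 0 < ‖X - η‖ := lt_of_lt_of_le (by linarith) (one_sub_norm_le X hη)
  set q := ‖X - η‖ ^ 2
  have hq0 : 0 < q := by positivity
  have hs1 : ∑ i, (X - η) i ^ 2 = q := by
    simp only [q, EuclideanSpace.norm_sq_eq, Real.norm_eq_abs, sq_abs]
  have hs2 : ∑ i, X i * (X - η) i = (‖X‖ ^ 2 + q - 1) / 2 := by
    have h1 : inner ℝ X (X - η) = ∑ i, X i * (X - η) i := by
      simp [PiLp.inner_apply, mul_comm]
    have h2 := norm_sub_sq_real X (X - η)
    rw [sub_sub_cancel, hη] at h2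
    rw [← h1]; simp only [q]; linarith
  set m := (n : ℝ) / 2
  have r1 : q ^ (-m) = q ^ (-m - 1) * q := by
    rw [← Real.rpow_add_one hq0.ne']; congr 1; ring
  have r2 : q ^ (-m - 1) = q ^ (-m - 2) * q := by
    rw [← Real.rpow_add_one hq0.ne']; congr 1; ring
  set Q := q ^ (-m - 2)
  have hterm : ∀ i, lineSecond m (1 - ‖X‖ ^ 2) (-2 * X i) q (2 * (X - η) i) 0 =
      Q * (-2 * q ^ 2 - 2 * m * (1 - ‖X‖ ^ 2) * q) + Q * (8 * m * q) * (X i * (X - η) i) +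
        Q * (4 * m * (m + 1) * (1 - ‖X‖ ^ 2)) * (X - η) i ^ 2 := fun i => by
    simp only [lineSecond, mul_zero, add_zero, sub_zero, ne_eq, OfNat.ofNat_ne_zero,
      not_false_eq_true, zero_pow]
    rw [r1, r2]; ring
  simp only [hterm, Finset.sum_add_distrib, ← Finset.mul_sum, hs1, hs2, Finset.sum_const,
    Finset.card_univ, Fintype.card_fin, nsmul_eq_mul]
  have : (n : ℝ) = 2 * m := by simp only [m]; ring
  rw [this]; ring

/-- The point is the uniformity in `η`, needed in order to integrate over `η`. The second
derivatives along the coordinate lines are jointly continuous in the line parameter and `η`, and the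
sphere is compact. -/
theorem eventually_abs_discLap_poissonKer_le {n : ℕ} {X : Euc n} (hX : ‖X‖ < 1) {ε : ℝ}
    (hε : 0 < ε) : ∀ᶠ h in 𝓝[>] (0 : ℝ), ∀ η : Euc n, ‖η‖ = 1 →
      |discLap (fun Y => poissonKer Y η) X h| ≤ ε * h ^ 2 := by
  set Φ : Fin n → ℝ → Euc n → ℝ := fun i s η =>
    lineSecond ((n : ℝ) / 2) (1 - ‖X‖ ^ 2) (-2 * X i) (‖X - η‖ ^ 2) (2 * (X - η) i) s
  -- Each of the `n` directions contributes an error of at most `2 M h^2`, and `2 n M ≤ ε`.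
  set M := ε / (2 * n + 1)
  have hM : 0 < M := by positivity
  have hqpos : ∀ η : Euc n, ‖η‖ = 1 → ∀ i s, |s| < 1 - ‖X‖ →
      0 < ‖X - η‖ ^ 2 + (2 * (X - η) i) * s + s ^ 2 := fun η hη i s hs => by
    rw [← norm_add_unitVec_sq]
    have h1 : ‖s • unitVec i‖ = |s| := by rw [norm_smul]; simp
    have h2 := norm_sub_norm_le (X - η) (-(s • unitVec i))
    rw [norm_neg, h1, sub_neg_eq_add] at h2
    have h3 := one_sub_norm_le X hη
    have : 0 < ‖X - η + s • unitVec i‖ := by linarith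
    positivity
  have hcont : ∀ i, ∀ η ∈ Metric.sphere (0 : Euc n) 1,
      ∀ᶠ z : ℝ × Euc n in 𝓝 0 ×ˢ 𝓝 η, |Φ i z.1 z.2 - Φ i 0 z.2| < M := fun i η hη => by
    have hη' : ‖η‖ = 1 := by simpa using hη
    have hq0 := hqpos η hη' i 0 (by simpa using hX)
    have c0 : ContinuousAt (fun z : ℝ × Euc n =>
        ‖X - z.2‖ ^ 2 + (2 * (X - z.2) i) * z.1 + z.1 ^ 2) (0, η) := by fun_prop
    have c0' : ContinuousAt (fun z : ℝ × Euc n =>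
        ‖X - z.2‖ ^ 2 + (2 * (X - z.2) i) * 0 + 0 ^ 2) (0, η) := by fun_prop
    have c1 : ∀ a : ℝ, ContinuousAt (fun z : ℝ × Euc n =>
        (‖X - z.2‖ ^ 2 + (2 * (X - z.2) i) * z.1 + z.1 ^ 2) ^ a) (0, η) := fun a =>
      c0.rpow_const (Or.inl hq0.ne')
    have c1' : ∀ a : ℝ, ContinuousAt (fun z : ℝ × Euc n =>
        (‖X - z.2‖ ^ 2 + (2 * (X - z.2) i) * 0 + 0 ^ 2) ^ a) (0, η) := fun a =>
      c0'.rpow_const (Or.inl hq0.ne')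
    have hc : ContinuousAt (fun z : ℝ × Euc n => Φ i z.1 z.2 - Φ i 0 z.2) (0, η) := by
      simp only [Φ, lineSecond]
      have k1 := c1 (-((n : ℝ) / 2))
      have k2 := c1 (-((n : ℝ) / 2) - 1)
      have k3 := c1 (-((n : ℝ) / 2) - 2)
      have l1 := c1' (-((n : ℝ) / 2))
      have l2 := c1' (-((n : ℝ) / 2) - 1)
      have l3 := c1' (-((n : ℝ) / 2) - 2)
      fun_prop
    have := (hc.abs).eventually_lt_const (u := M) (by simpa using hM)
    rwa [nhds_prod_eq] at this
  have hev : ∀ᶠ s in 𝓝 (0 : ℝ), ∀ i, ∀ η ∈ Metric.sphere (0 : Euc n) 1,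
      |Φ i s η - Φ i 0 η| < M := by
    refine eventually_all.2 fun i => ?_
    exact (isCompact_sphere (0 : Euc n) 1).eventually_forall_of_forall_eventually fun η hη => by
      simpa only [nhds_prod_eq] using hcont i η hη
  obtain ⟨δ, hδ, hδM⟩ := Metric.eventually_nhds_iff.1 hev
  set d := min (δ / 2) ((1 - ‖X‖) / 2)
  have hd : 0 < d := lt_min (by linarith) (by linarith)
  have hev2 : ∀ᶠ h : ℝ in 𝓝[>] 0, h ≤ d := nhdsWithin_le_nhds (Iic_mem_nhds hd)
  filter_upwards [hev2, self_mem_nhdsWithin] with h hhd hh0 η hη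
  have hh0' : (0 : ℝ) < h := hh0
  have hd1 : ∀ s, |s| ≤ d → |s| < 1 - ‖X‖ := fun s hs => by
    have := hs.trans (min_le_right _ _); linarith
  have hd2 : ∀ s, |s| ≤ d → |s| < δ := fun s hs => by
    have := hs.trans (min_le_left _ _); linarith
  have key : ∀ i, |poissonKer (X + h • unitVec i) η + poissonKer (X - h • unitVec i) η -
      2 * poissonKer X η - Φ i 0 η * h ^ 2| ≤ 2 * M * h ^ 2 := fun i => by
    have := abs_second_difference_le (δ := d)
      (fun s hs => hasDerivAt_line ((n : ℝ) / 2) (1 - ‖X‖ ^ 2) (-2 * X i) _ _ s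
        (hqpos η hη i s (hd1 s hs)))
      (fun s hs => hasDerivAt_line' ((n : ℝ) / 2) (1 - ‖X‖ ^ 2) (-2 * X i) _ _ s
        (hqpos η hη i s (hd1 s hs)))
      (c := Φ i 0 η) (M := M)
      (fun s hs => (hδM (by simpa using hd2 s hs) i η (by simpa using hη)).le) hh0'.le hhd
    rw [← poissonKer_line, ← poissonKer_line, ← poissonKer_line, neg_smul, ← sub_eq_add_neg,
      zero_smul, add_zero] at this
    exact this
  have hz := sum_lineSecond_zero X η hη hX
  calc |discLap (fun Y => poissonKer Y η) X h|
      = |∑ i, (poissonKer (X + h • unitVec i) η + poissonKer (X - h • unitVec i) η -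
      2 * poissonKer X η - Φ i 0 η * h ^ 2)| := by
        rw [Finset.sum_sub_distrib, ← Finset.sum_mul, hz, zero_mul, sub_zero, discLap]
    _ ≤ ∑ i : Fin n, 2 * M * h ^ 2 := (Finset.abs_sum_le_sum_abs _ _).trans
        (Finset.sum_le_sum fun i _ => key i)
    _ = (2 * n * M) * h ^ 2 := by simp; ring
    _ ≤ ε * h ^ 2 := by
        gcongr
        simp only [M]; rw [mul_div_assoc', div_le_iff₀ (by positivity)]; nlinarith

theorem norm_sub_pos {n : ℕ} {X η : Euc n} (hX : ‖X‖ < 1) (hη : ‖η‖ = 1) : 0 < ‖X - η‖ :=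
  lt_of_lt_of_le (by linarith) (one_sub_norm_le X hη)

theorem continuous_poissonKer_right {n : ℕ} {X : Euc n} (hX : ‖X‖ < 1) :
    Continuous fun η : Sph n => poissonKer X η := by
  unfold poissonKer
  refine Continuous.div (by fun_prop) (by fun_prop) fun η => ?_
  exact (pow_pos (norm_sub_pos hX (norm_eq_of_mem_sphere η)) n).ne'

theorem continuousAt_poissonKer_left {n : ℕ} {X η : Euc n} (hX : ‖X‖ < 1) (hη : ‖η‖ = 1) :
    ContinuousAt (fun Y => poissonKer Y η) X := by
  unfold poissonKer
  refine ContinuousAt.div (by fun_prop) (by fun_prop) ?_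
  exact (pow_pos (norm_sub_pos hX hη) n).ne'

theorem integrable_of_continuous {E : Type*} [NormedAddCommGroup E] {n : ℕ} {ψ : Sph n → E}
    (hψ : Continuous ψ) : Integrable ψ (surf n) :=
  hψ.integrable_of_hasCompactSupport (HasCompactSupport.of_compactSpace _)

theorem poissonKer_le {n : ℕ} {X η : Euc n} {r : ℝ} (hr : r < 1) (hX : ‖X‖ ≤ r) (hη : ‖η‖ = 1) :
    poissonKer X η ≤ ((1 - r) ^ n)⁻¹ := by
  have h1 := one_sub_norm_le X hη
  rw [poissonKer, ← one_div]
  refine div_le_div₀ zero_le_one ?_ (pow_pos (by linarith) n) ?_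
  · nlinarith [sq_nonneg ‖X‖]
  · exact pow_le_pow_left₀ (by linarith) (by linarith) n

/-- A second difference is a finite sum, so it commutes with the integral, and the bound on the
kernel is uniform in `η`. This is the reason to define harmonicity by second differences. -/
theorem hasDiscLap_integral_poissonKer {n : ℕ} {ψ : Sph n → ℝ} (hψ : Continuous ψ) {X : Euc n}
    (hX : ‖X‖ < 1) :
    HasDiscLap (fun Y => ∫ η : Sph n, poissonKer Y η * ψ η ∂(surf n)) X 0 := by
  obtain ⟨B, hB0, hB⟩ : ∃ B, 0 < B ∧ ∀ η, |ψ η| ≤ B := by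
    obtain ⟨B, hB⟩ := (isCompact_univ.image hψ).isBounded.exists_norm_le
    exact ⟨max B 1, by positivity, fun η => (hB _ ⟨η, mem_univ _, rfl⟩).trans (le_max_left _ _)⟩
  set V := (surf n).real univ
  have hV : 0 ≤ V := measureReal_nonneg
  rw [HasDiscLap, Metric.tendsto_nhds]
  intro ε hε
  have hδ : 0 < ε / (2 * (B * V + 1)) := by positivity
  have hev : ∀ᶠ h : ℝ in 𝓝[>] 0, h < 1 - ‖X‖ :=
    nhdsWithin_le_nhds (Iio_mem_nhds (by linarith))
  filter_upwards [eventually_abs_discLap_poissonKer_le hX hδ, hev, self_mem_nhdsWithin]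
    with h hK hh1 hh0
  have hh0' : (0 : ℝ) < h := hh0
  have hint : ∀ Y : Euc n, ‖Y‖ < 1 → Integrable (fun η : Sph n => poissonKer Y η * ψ η) (surf n) :=
    fun Y hY => integrable_of_continuous ((continuous_poissonKer_right hY).mul hψ)
  have hn1 : ∀ i : Fin n, ‖h • unitVec i‖ = h := fun i => by rw [norm_smul]; simp [abs_of_pos hh0']
  have ha : ∀ i : Fin n, ‖X + h • unitVec i‖ < 1 := fun i => by
    have := norm_add_le X (h • unitVec i); have := hn1 i; linarith
  have hs : ∀ i : Fin n, ‖X - h • unitVec i‖ < 1 := fun i => by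
    have := norm_sub_le X (h • unitVec i); have := hn1 i; linarith
  have heq : discLap (fun Y => ∫ η : Sph n, poissonKer Y η * ψ η ∂(surf n)) X h =
      ∫ η : Sph n, discLap (fun Y => poissonKer Y η) X h * ψ η ∂(surf n) := by
    simp only [discLap, Finset.sum_mul]
    rw [integral_finsetSum]
    · refine Finset.sum_congr rfl fun i _ => ?_
      have e1 := integral_sub ((hint _ (ha i)).add (hint _ (hs i))) ((hint _ hX).const_mul 2)
      have e2 := integral_add (hint _ (ha i)) (hint _ (hs i))
      simp only [Pi.add_apply] at e1
      rw [← e2, ← integral_const_mul, ← e1]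
      refine integral_congr_ae (Eventually.of_forall fun η => ?_)
      simp only; ring
    · intro i _
      have := ((hint _ (ha i)).add (hint _ (hs i))).sub ((hint _ hX).const_mul 2)
      refine this.congr (Eventually.of_forall fun η => ?_)
      simp only [Pi.add_apply, Pi.sub_apply]; ring
  rw [dist_zero_right, heq, norm_div, Real.norm_of_nonneg (by positivity : (0:ℝ) ≤ h ^ 2),
    div_lt_iff₀ (by positivity)]
  calc _ ≤ ε / (2 * (B * V + 1)) * h ^ 2 * B * V := by
        refine norm_integral_le_of_norm_le_const (Eventually.of_forall fun η => ?_)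
        rw [norm_mul]
        exact mul_le_mul (hK η (norm_eq_of_mem_sphere η)) (hB η) (norm_nonneg _) (by positivity)
    _ = (ε * (B * V) / (2 * (B * V + 1))) * h ^ 2 := by ring
    _ < ε * h ^ 2 := by
        refine mul_lt_mul_of_pos_right ?_ (by positivity)
        rw [div_lt_iff₀ (by positivity)]
        nlinarith [mul_nonneg hB0.le hV]

theorem continuousAt_integral_poissonKer {n : ℕ} {ψ : Sph n → ℝ} (hψ : Continuous ψ) {X : Euc n}
    (hX : ‖X‖ < 1) :
    ContinuousAt (fun Y => ∫ η : Sph n, poissonKer Y η * ψ η ∂(surf n)) X := by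
  set r := (1 + ‖X‖) / 2
  have hr1 : r < 1 := by simp only [r]; linarith
  have hXr : ‖X‖ < r := by simp only [r]; linarith
  have hev : ∀ᶠ Y in 𝓝 X, ‖Y‖ < r := continuous_norm.continuousAt.eventually_lt_const hXr
  refine continuousAt_of_dominated (bound := fun η => ((1 - r) ^ n)⁻¹ * |ψ η|) ?_ ?_ ?_ ?_
  · filter_upwards [hev] with Y hY
    exact ((continuous_poissonKer_right (hY.trans hr1)).mul hψ).aestronglyMeasurable
  · filter_upwards [hev] with Y hY
    refine Eventually.of_forall fun η => ?_
    rw [norm_mul, Real.norm_of_nonneg (poissonKer_nonneg (hY.trans hr1).le _)]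
    exact mul_le_mul_of_nonneg_right (poissonKer_le hr1 hY.le (norm_eq_of_mem_sphere η))
      (abs_nonneg _)
  · exact (integrable_of_continuous hψ.abs).const_mul _
  · exact Eventually.of_forall fun η =>
      (continuousAt_poissonKer_left hX (norm_eq_of_mem_sphere η)).mul continuousAt_const

theorem poissonKer_map {n : ℕ} (L : Euc n ≃ₗᵢ[ℝ] Euc n) (X η : Euc n) :
    poissonKer (L X) (L η) = poissonKer X η := by
  rw [poissonKer, poissonKer, ← map_sub, L.norm_map, L.norm_map]

/-- The mass `u` is harmonic and invariant under rotations, hence constant on the sphere of radius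
`|X|`. The maximum principle for `u` and `-u` in that ball gives `u X = u 0`, and the kernel at the
centre is `1`. -/
theorem integral_poissonKer {n : ℕ} (hn : n ≠ 0) {X : Euc n} (hX : ‖X‖ < 1) :
    ∫ η : Sph n, poissonKer X η ∂(surf n) = sphArea n := by
  set u : Euc n → ℝ := fun Y => ∫ η : Sph n, poissonKer Y η * 1 ∂(surf n)
  have hu0 : u 0 = sphArea n := by
    simp only [u, mul_one]
    have : ∀ η : Sph n, poissonKer 0 (η : Euc n) = 1 := fun η => by simp [poissonKer]
    simp only [this]
    rw [integral_const, surf_real_univ hn, smul_eq_mul, mul_one]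
  have hsymm : ∀ Y Z : Euc n, ‖Y‖ = ‖Z‖ → u Y = u Z := fun Y Z hYZ => by
    obtain ⟨L, hL⟩ := exists_isometry_apply_eq Y Z hYZ
    have := (measurePreserving_sphMap L).integral_comp'
      (f := (⟨⟨sphMap L, sphMap L.symm, fun η => Subtype.ext (by simp [sphMap]),
        fun η => Subtype.ext (by simp [sphMap])⟩, (continuous_sphMap L).measurable,
        (continuous_sphMap L.symm).measurable⟩ : Sph n ≃ᵐ Sph n))
      (fun η : Sph n => poissonKer Z η)
    simp only [u, mul_one]
    rw [← this]
    refine integral_congr_ae (Eventually.of_forall fun η => ?_)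
    change _ = poissonKer Z (L η)
    rw [← hL, poissonKer_map]
  have hc : ContinuousOn u (Metric.closedBall 0 ‖X‖) := fun Y hY =>
    (continuousAt_integral_poissonKer continuous_const
      (lt_of_le_of_lt (by simpa using hY) hX)).continuousWithinAt
  have hh : ∀ Y : Euc n, ‖Y‖ < ‖X‖ → HasDiscLap u Y 0 := fun Y hY =>
    hasDiscLap_integral_poissonKer continuous_const (hY.trans hX)
  have h1 := le_of_hasDiscLap_zero hn hc hh (M := u X) (fun Y hY => (hsymm Y X hY).le)
    (X := 0) (by simp)
  have h2 := le_of_hasDiscLap_zero hn (u := fun Y => (-1) * u Y) (continuousOn_const.mul hc)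
    (fun Y hY => by simpa using (hh Y hY).const_mul (-1)) (M := (-1) * u X)
    (fun Y hY => by rw [hsymm Y X hY]) (X := 0) (by simp)
  have : u X = u 0 := by linarith
  rw [hu0] at this
  simpa [u] using this

/-! ### Boundary values of Poisson integrals and the semigroup property. -/

theorem norm_sub_le_two_mul {n : ℕ} {ξ η : Euc n} (hξ : ‖ξ‖ = 1) (hη : ‖η‖ = 1) {r : ℝ}
    (hr0 : 0 ≤ r) (hr1 : r ≤ 1) : ‖ξ - η‖ ≤ 2 * ‖r • ξ - η‖ := by
  have hrn : ‖r • ξ‖ = r := by rw [norm_smul, hξ, mul_one, Real.norm_of_nonneg hr0]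
  have h1 : ‖ξ - r • ξ‖ = 1 - r := by
    rw [show ξ - r • ξ = (1 - r) • ξ by rw [sub_smul, one_smul], norm_smul, hξ, mul_one,
      Real.norm_of_nonneg (by linarith)]
  have h2 := one_sub_norm_le (r • ξ) hη
  have h3 := norm_sub_le_norm_sub_add_norm_sub ξ (r • ξ) η
  linarith

theorem poissonKer_comm {n : ℕ} {ξ η : Euc n} (hξ : ‖ξ‖ = 1) (hη : ‖η‖ = 1) (r : ℝ) :
    poissonKer (r • ξ) η = poissonKer (r • η) ξ := by
  have h : ‖r • ξ - η‖ = ‖r • η - ξ‖ := by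
    rw [← sq_eq_sq₀ (norm_nonneg _) (norm_nonneg _), norm_sub_sq_real, norm_sub_sq_real, norm_smul,
      norm_smul, hξ, hη, real_inner_smul_left, real_inner_smul_left, real_inner_comm]
  rw [poissonKer, poissonKer, h, norm_smul, norm_smul, hξ, hη]

-- The Poisson kernel is an approximate identity, with an error uniform over the sphere of radius
-- `r`. For `η` near the radial projection `ξ` of `Y` the uniform continuity of `k` is used; for the
-- other `η` the kernel is of order `1 - r`.
set_option maxHeartbeats 400000 in
theorem exists_abs_integral_poissonKer_sub_le {n : ℕ} (hn : n ≠ 0) {k : Euc n → ℝ}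
    (hkc : ContinuousOn k (Metric.closedBall 0 1)) {B : ℝ} (hB : 0 < B)
    (hk0 : ∀ Y : Euc n, ‖Y‖ ≤ 1 → 0 ≤ k Y) (hkB : ∀ Y : Euc n, ‖Y‖ ≤ 1 → k Y ≤ B) {ε : ℝ}
    (hε : 0 < ε) : ∃ ρ < 1, ∀ r, ρ < r → r < 1 → ∀ Y : Euc n, ‖Y‖ = r →
      |(∫ η : Sph n, poissonKer Y η * k η ∂(surf n)) + -sphArea n * k Y| ≤ 2 * sphArea n * ε := by
  set σ := sphArea n
  have hkS : Continuous fun η : Sph n => k η :=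
    hkc.comp_continuous continuous_subtype_val fun η => by
      simp [norm_eq_of_mem_sphere η]
  have huc := (isCompact_closedBall (0 : Euc n) 1).uniformContinuousOn_of_continuous hkc
  obtain ⟨δ, hδ, hδk⟩ := Metric.uniformContinuousOn_iff.1 huc (ε / 2) (half_pos hε)
  -- With `1 - r < D` the far part of the kernel, at most `2 (1 - r) / (δ / 2)^n`, is at most `ε /
  -- 2` after multiplication by `B`.
  set D := ε * (δ / 2) ^ n / (4 * B)
  have hD : 0 < D := by positivity
  refine ⟨max (max (1 - δ) (1 - D)) 0, by simp; constructor <;> linarith, fun r hr hr1 Y hY => ?_⟩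
  have hr0 : 0 < r := (le_max_right _ _).trans_lt hr
  have hrδ : 1 - δ < r := ((le_max_left _ _).trans (le_max_left _ _)).trans_lt hr
  have hrD : 1 - D < r := ((le_max_right _ _).trans (le_max_left _ _)).trans_lt hr
  set ξ := r⁻¹ • Y
  have hξ : ‖ξ‖ = 1 := by
    simp only [ξ]; rw [norm_smul, hY, norm_inv, Real.norm_of_nonneg hr0.le, inv_mul_cancel₀ hr0.ne']
  have hYξ : Y = r • ξ := by simp only [ξ]; rw [smul_smul, mul_inv_cancel₀ hr0.ne', one_smul]
  have hY1 : ‖Y‖ < 1 := by rw [hY]; exact hr1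
  have hKi := integral_poissonKer hn hY1
  have hKint : Integrable (fun η : Sph n => poissonKer Y η) (surf n) :=
    integrable_of_continuous (continuous_poissonKer_right hY1)
  have hdiff : ∀ η : Sph n, |poissonKer Y η * (k η - k Y)| ≤ poissonKer Y η * ε + ε := by
    intro η
    have hη := norm_eq_of_mem_sphere η
    have hP := poissonKer_nonneg hY1.le (η : Euc n)
    rw [abs_mul, abs_of_nonneg hP]
    have hYξd : dist ξ Y < δ := by
      rw [dist_eq_norm, hYξ, show ξ - r • ξ = (1 - r) • ξ by rw [sub_smul, one_smul], norm_smul,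
        hξ, mul_one, Real.norm_of_nonneg (by linarith)]
      linarith
    have hkξ : |k ξ - k Y| < ε / 2 := by
      rw [← Real.dist_eq]
      exact hδk ξ (by simp [hξ]) Y (by simpa using hY1.le) hYξd
    by_cases hc : dist (η : Euc n) ξ < δ
    · have h1 : |k η - k ξ| < ε / 2 := by
        rw [← Real.dist_eq]
        exact hδk η (by simp) ξ (by simp [hξ]) hc
      have h2 := abs_sub_le (k η) (k ξ) (k Y)
      have : |k η - k Y| ≤ ε := by linarith
      nlinarith
    · have h1 : |k η - k Y| ≤ B := by
        have a1 := hk0 η hη.le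
        have a2 := hkB η hη.le
        have a3 := hk0 Y hY1.le
        have a4 := hkB Y hY1.le
        rw [abs_le]; constructor <;> linarith
      have h2 : δ / 2 ≤ ‖Y - η‖ := by
        have := norm_sub_le_two_mul hξ hη hr0.le hr1.le
        rw [← hYξ, norm_sub_rev, ← dist_eq_norm] at this
        linarith
      have h3 : poissonKer Y η ≤ 2 * (1 - r) / (δ / 2) ^ n := by
        rw [poissonKer, hY]
        refine div_le_div₀ (by linarith) (by nlinarith) (by positivity) ?_
        exact pow_le_pow_left₀ (by positivity) h2 n
      have h4 : poissonKer Y η * B ≤ ε := by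
        calc _ ≤ 2 * (1 - r) / (δ / 2) ^ n * B := by gcongr
          _ ≤ 2 * D / (δ / 2) ^ n * B := by gcongr; linarith
          _ = ε / 2 := by simp only [D]; field_simp; ring
          _ ≤ ε := by linarith
      nlinarith
  have hKkint : Integrable (fun η : Sph n => poissonKer Y η * k η) (surf n) :=
    integrable_of_continuous ((continuous_poissonKer_right hY1).mul hkS)
  have hw : (∫ η : Sph n, poissonKer Y η * k η ∂(surf n)) + -σ * k Y =
      ∫ η : Sph n, poissonKer Y η * (k η - k Y) ∂(surf n) := by
    simp only [mul_sub]
    rw [integral_sub hKkint (hKint.mul_const _), integral_mul_const, hKi]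
    ring
  rw [hw]
  calc _ ≤ ∫ η : Sph n, (poissonKer Y η * ε + ε) ∂(surf n) := by
        refine norm_integral_le_of_norm_le (g := fun η : Sph n => poissonKer Y η * ε + ε)
          (f := fun η : Sph n => poissonKer Y η * (k η - k Y))
          ((hKint.mul_const ε).add (integrable_const ε)) (Eventually.of_forall fun η => hdiff η)
    _ = 2 * σ * ε := by
        rw [integral_add (hKint.mul_const ε) (integrable_const ε), integral_mul_const, hKi,
          integral_const, surf_real_univ hn, smul_eq_mul]
        ring

set_option maxHeartbeats 400000 in
/-- The semigroup property of the Poisson kernel. -/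
theorem integral_poissonKer_mul_poissonKer {n : ℕ} (hn : n ≠ 0) {ζ : Euc n} (hζ : ‖ζ‖ = 1) {b : ℝ}
    (hb0 : 0 ≤ b) (hb1 : b < 1) {X : Euc n} (hX : ‖X‖ < 1) :
    ∫ η : Sph n, poissonKer X η * poissonKer (b • (η : Euc n)) ζ ∂(surf n) =
      sphArea n * poissonKer (b • X) ζ := by
  set σ := sphArea n
  have hσ : 0 < σ := sphArea_pos hn
  have hbn : ∀ Y : Euc n, ‖Y‖ ≤ 1 → ‖b • Y‖ ≤ b := fun Y hY => by
    rw [norm_smul, Real.norm_of_nonneg hb0]; nlinarith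
  set k : Euc n → ℝ := fun Y => poissonKer (b • Y) ζ
  have hkc : ContinuousOn k (Metric.closedBall 0 1) := fun Y hY => by
    have h1 : ‖b • Y‖ < 1 := (hbn Y (by simpa using hY)).trans_lt hb1
    exact ((continuousAt_poissonKer_left h1 hζ).comp (f := fun Y : Euc n => b • Y)
      (by fun_prop)).continuousWithinAt
  have hkS : Continuous fun η : Sph n => k η :=
    hkc.comp_continuous continuous_subtype_val fun η => by
      simp [norm_eq_of_mem_sphere η]
  set B := ((1 - b) ^ n)⁻¹
  have hB : 0 < B := inv_pos.2 (pow_pos (by linarith) n)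
  have hk0 : ∀ Y : Euc n, ‖Y‖ ≤ 1 → 0 ≤ k Y := fun Y hY =>
    poissonKer_nonneg ((hbn Y hY).trans hb1.le) _
  have hkB : ∀ Y : Euc n, ‖Y‖ ≤ 1 → k Y ≤ B := fun Y hY => poissonKer_le hb1 (hbn Y hY) hζ
  set v : Euc n → ℝ := fun Y => ∫ η : Sph n, poissonKer Y η * k η ∂(surf n)
  -- `w` is harmonic in the open ball. Since `b < 1`, `k` is continuous up to the boundary and `v`
  -- has the boundary values `σ k`, so `w` is uniformly small near the sphere; the maximum principle
  -- for `w` and `-w` makes it vanish.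
  set w : Euc n → ℝ := fun Y => v Y + (-σ) * k Y
  have hwlap : ∀ Y : Euc n, ‖Y‖ < 1 → HasDiscLap w Y 0 := fun Y hY => by
    have hkl : HasDiscLap k Y 0 := by
      refine HasDiscLap.comp_smul (u := fun Z => poissonKer Z ζ) hb0 ?_
      have hY' : ‖b • Y‖ < 1 := (hbn Y hY.le).trans_lt hb1
      rw [HasDiscLap, Metric.tendsto_nhds]
      intro ε hε
      filter_upwards [eventually_abs_discLap_poissonKer_le hY' (half_pos hε),
        self_mem_nhdsWithin] with h hK hh0
      have hh0' : (0 : ℝ) < h := hh0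
      rw [dist_zero_right, norm_div, Real.norm_of_nonneg (by positivity : (0:ℝ) ≤ h ^ 2),
        div_lt_iff₀ (by positivity)]
      have := hK ζ hζ
      rw [Real.norm_eq_abs]
      nlinarith [sq_pos_of_pos hh0']
    have h := HasDiscLap.add (u := v) (v := fun Y => (-σ) * k Y)
      (hasDiscLap_integral_poissonKer hkS hY) (hkl.const_mul (-σ))
    rw [mul_zero, add_zero] at h
    exact h
  have hwc : ∀ Y : Euc n, ‖Y‖ < 1 → ContinuousAt w Y := fun Y hY => by
    refine (continuousAt_integral_poissonKer hkS hY).add (continuousAt_const.mul ?_)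
    have h1 : ‖b • Y‖ < 1 := (hbn Y hY.le).trans_lt hb1
    exact (continuousAt_poissonKer_left h1 hζ).comp (f := fun Y : Euc n => b • Y) (by fun_prop)
  have hbd := fun ε hε => exists_abs_integral_poissonKer_sub_le hn hkc hB hk0 hkB (ε := ε) hε
  have hzero : ∀ ε > 0, |w X| ≤ 2 * σ * ε := by
    intro ε hε
    obtain ⟨ρ, hρ1, hρ⟩ := hbd ε hε
    obtain ⟨r, hr, hr1⟩ := exists_between (max_lt hρ1 hX)
    have hrρ : ρ < r := (le_max_left _ _).trans_lt hr
    have hrX : ‖X‖ < r := (le_max_right _ _).trans_lt hr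
    have hc : ContinuousOn w (Metric.closedBall 0 r) := fun Y hY =>
      (hwc Y (lt_of_le_of_lt (by simpa using hY) hr1)).continuousWithinAt
    have h1 := le_of_hasDiscLap_zero hn hc (fun Y hY => hwlap Y (hY.trans hr1))
      (fun Y hY => (abs_le.1 (hρ r hrρ hr1 Y hY)).2) hrX.le
    have h2 := le_of_hasDiscLap_zero hn (u := fun Y => (-1) * w Y) (continuousOn_const.mul hc)
      (fun Y hY => by simpa using (hwlap Y (hY.trans hr1)).const_mul (-1)) (M := 2 * σ * ε)
      (fun Y hY => by linarith [(abs_le.1 (hρ r hrρ hr1 Y hY)).1]) hrX.le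
    rw [abs_le]; constructor <;> linarith
  have hw0 : |w X| ≤ 0 := by
    refine le_of_forall_pos_le_add fun ε hε => ?_
    have := hzero (ε / (2 * σ)) (by positivity)
    rw [zero_add]
    calc _ ≤ _ := this
      _ = ε := by field_simp
  have := abs_nonpos_iff.1 hw0
  simp only [w, v] at this
  simp only [k] at this
  linarith

/-! ### Lebesgue points with respect to slabs -/

/-- For `R < 1` the Poisson kernel at `(1 - R) ξ` is at least `1 / (2^n R^{n-1})` on the cap of
radius `R`, and its integral is `sphArea n`. For `R ≥ 1` the whole sphere satisfies the bound. -/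
theorem surf_closedBall_le {n : ℕ} (hn : n ≠ 0) (ξ : Sph n) {R : ℝ} (hR : 0 < R) :
    surf n (Metric.closedBall ξ R) ≤ ENNReal.ofReal (sphArea n * 2 ^ n * R ^ (n - 1)) := by
  have hσ := sphArea_pos hn
  rcases lt_or_ge R 1 with h1 | h1
  · set X : Euc n := (1 - R) • (ξ : Euc n)
    have hXn : ‖X‖ = 1 - R := by
      simp only [X]
      rw [norm_smul, norm_eq_of_mem_sphere, mul_one, Real.norm_of_nonneg (by linarith)]
    have hX : ‖X‖ < 1 := by rw [hXn]; linarith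
    have hK : ∀ η ∈ Metric.closedBall ξ R, (2 ^ n * R ^ (n - 1))⁻¹ ≤ poissonKer X (η : Euc n) := by
      intro η hη
      have hd : ‖(ξ : Euc n) - η‖ ≤ R := by
        rw [← dist_eq_norm, dist_comm]; exact hη
      have h3 : ‖X - ξ‖ = R := by
        have : X - ξ = (-R) • (ξ : Euc n) := by simp only [X]; module
        rw [this, norm_smul, norm_eq_of_mem_sphere, mul_one, norm_neg, Real.norm_of_nonneg hR.le]
      have h4 : ‖X - η‖ ≤ 2 * R := by
        have := norm_sub_le_norm_sub_add_norm_sub X (ξ : Euc n) η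
        linarith
      have h5 := norm_sub_pos hX (norm_eq_of_mem_sphere η)
      have h6 : (2 ^ n * R ^ (n - 1))⁻¹ = R / (2 * R) ^ n := by
        obtain ⟨k, rfl⟩ := Nat.exists_eq_succ_of_ne_zero hn
        rw [mul_pow, Nat.succ_eq_add_one, Nat.add_sub_cancel, pow_succ R]
        field_simp
      rw [h6, poissonKer, hXn]
      exact div_le_div₀ (by nlinarith) (by nlinarith) (by positivity)
        (pow_le_pow_left₀ h5.le h4 n)
    have hint : Integrable (fun η : Sph n => poissonKer X η) (surf n) :=
      integrable_of_continuous (continuous_poissonKer_right hX)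
    have hI := integral_poissonKer hn hX
    have h7 : (surf n).real (Metric.closedBall ξ R) * (2 ^ n * R ^ (n - 1))⁻¹ ≤ sphArea n := by
      rw [← hI, ← smul_eq_mul, ← setIntegral_const]
      calc _ ≤ ∫ η in Metric.closedBall ξ R, poissonKer X (η : Euc n) ∂(surf n) :=
            setIntegral_mono_on (integrable_const _).integrableOn hint.integrableOn
              Metric.isClosed_closedBall.measurableSet hK
        _ ≤ _ := setIntegral_le_integral hint
            (Eventually.of_forall fun η => poissonKer_nonneg hX.le _)
    rw [← div_eq_mul_inv, div_le_iff₀ (by positivity)] at h7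
    rw [← ENNReal.ofReal_toReal (measure_ne_top (surf n) _)]
    exact ENNReal.ofReal_le_ofReal (by rw [mul_assoc]; exact h7)
  · refine (measure_mono (subset_univ _)).trans ?_
    rw [surf_univ hn]
    refine ENNReal.ofReal_le_ofReal ?_
    have h2 : (1 : ℝ) ≤ 2 ^ n := one_le_pow₀ (by norm_num)
    have h3 : (1 : ℝ) ≤ R ^ (n - 1) := one_le_pow₀ h1
    nlinarith [mul_le_mul h2 h3 zero_le_one (by positivity)]

/-- The product of the Lebesgue measure on the line and the surface measure. -/
abbrev cylMeas (n : ℕ) : Measure (ℝ × Sph n) := (volume : Measure ℝ).prod (surf n)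

/-- The slab around `x` of half height `h` and radius `a h`. -/
def slab {n : ℕ} (a : ℝ) (x : ℝ × Sph n) (h : ℝ) : Set (ℝ × Sph n) :=
  Metric.closedBall x.1 h ×ˢ Metric.closedBall x.2 (a * h)

theorem measurableSet_slab {n : ℕ} (a : ℝ) (x : ℝ × Sph n) (h : ℝ) : MeasurableSet (slab a x h) :=
  Metric.isClosed_closedBall.measurableSet.prod Metric.isClosed_closedBall.measurableSet

theorem cylMeas_slab_le {n : ℕ} (hn : n ≠ 0) {a : ℝ} (ha : 0 < a) (x : ℝ × Sph n) {h : ℝ}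
    (hh : 0 < h) :
    cylMeas n (slab a x h) ≤ ENNReal.ofReal (sphArea n * 2 ^ (n + 1) * (h * (a * h) ^ (n - 1))) := by
  have hσ := sphArea_pos hn
  rw [slab, Measure.prod_prod, Real.volume_closedBall]
  refine (mul_le_mul_right (surf_closedBall_le hn x.2 (by positivity)) _).trans ?_
  rw [← ENNReal.ofReal_mul (by positivity)]
  refine ENNReal.ofReal_le_ofReal (le_of_eq ?_)
  ring

/-- The weak type estimate for averages over slabs of a fixed eccentricity. -/
theorem weak_type_slab {n : ℕ} (hn : n ≠ 0) {a : ℝ} (ha : 0 < a) (u : ℝ × Sph n → ℝ≥0∞) {c : ℝ}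
    (hc : 0 < c) :
    cylMeas n {x | ∃ h, 0 < h ∧ h ≤ 1 ∧
      ENNReal.ofReal (c * (h * (a * h) ^ (n - 1))) < ∫⁻ p in slab a x h, u p ∂(cylMeas n)} ≤
      ENNReal.ofReal (sphArea n * 6 ^ (n + 1) / c) * ∫⁻ p, u p ∂(cylMeas n) := by
  have hσ := sphArea_pos hn
  set E := {x | ∃ h, 0 < h ∧ h ≤ 1 ∧
      ENNReal.ofReal (c * (h * (a * h) ^ (n - 1))) < ∫⁻ p in slab a x h, u p ∂(cylMeas n)}
  have hE : ∀ x : ℝ × Sph n, ∃ h, x ∈ E → 0 < h ∧ h ≤ 1 ∧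
      ENNReal.ofReal (c * (h * (a * h) ^ (n - 1))) < ∫⁻ p in slab a x h, u p ∂(cylMeas n) := by
    intro x
    by_cases hx : x ∈ E
    · obtain ⟨h, hh⟩ := hx
      exact ⟨h, fun _ => hh⟩
    · exact ⟨0, fun h => absurd h hx⟩
  choose r hr using hE
  -- All slabs have the same eccentricity `a`. If two of them meet and `r x ≤ 2 r b`, then the
  -- centre `x` lies in the slab around `b` enlarged three times in both directions, whatever `a`
  -- is; so the constant does not depend on `a`.
  obtain ⟨v, hvE, hdisj, hcov⟩ := Vitali.exists_disjoint_subfamily_covering_enlargement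
    (fun x : ℝ × Sph n => slab a x (r x)) E r 2 one_lt_two (fun x hx => (hr x hx).1.le) 1
    (fun x hx => (hr x hx).2.1) (fun x hx => ⟨x, by
      have := (hr x hx).1
      exact ⟨Metric.mem_closedBall_self this.le, Metric.mem_closedBall_self (by positivity)⟩⟩)
  have hcount : v.Countable := by
    refine hdisj.countable_of_nonempty_interior fun x hx => ?_
    have h0 := (hr x (hvE hx)).1
    refine ⟨x, mem_interior.2 ⟨Metric.ball x.1 (r x) ×ˢ Metric.ball x.2 (a * r x),
      prod_mono Metric.ball_subset_closedBall Metric.ball_subset_closedBall,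
      Metric.isOpen_ball.prod Metric.isOpen_ball,
      Metric.mem_ball_self h0, Metric.mem_ball_self (by positivity)⟩⟩
  have hsub : E ⊆ ⋃ b ∈ v, slab a b (3 * r b) := by
    intro x hx
    obtain ⟨b, hb, ⟨y, hy1, hy2⟩, hle⟩ := hcov x hx
    refine mem_iUnion₂.2 ⟨b, hb, ?_⟩
    have e1 : dist y.1 x.1 ≤ r x := hy1.1
    have e2 : dist y.2 x.2 ≤ a * r x := hy1.2
    have e3 : dist y.1 b.1 ≤ r b := hy2.1
    have e4 : dist y.2 b.2 ≤ a * r b := hy2.2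
    refine ⟨?_, ?_⟩
    · have := dist_triangle_left x.1 b.1 y.1
      simp only [Metric.mem_closedBall]; linarith
    · have := dist_triangle_left x.2 b.2 y.2
      simp only [Metric.mem_closedBall]; nlinarith
  have hterm : ∀ b ∈ v, cylMeas n (slab a b (3 * r b)) ≤
      ENNReal.ofReal (sphArea n * 6 ^ (n + 1) / c) * ∫⁻ p in slab a b (r b), u p ∂(cylMeas n) := by
    intro b hb
    obtain ⟨h0, h1, h2⟩ := hr b (hvE hb)
    refine (cylMeas_slab_le hn ha b (by positivity)).trans ?_
    refine le_trans ?_ (mul_le_mul_right h2.le _)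
    rw [← ENNReal.ofReal_mul (by positivity)]
    refine ENNReal.ofReal_le_ofReal ?_
    obtain ⟨k, rfl⟩ := Nat.exists_eq_succ_of_ne_zero hn
    simp only [Nat.succ_eq_add_one, Nat.add_sub_cancel]
    have e1 : sphArea (k + 1) * 6 ^ (k + 1 + 1) / c * (c * (r b * (a * r b) ^ k)) =
      sphArea (k + 1) * 6 ^ (k + 1 + 1) * (r b * (a * r b) ^ k) := by field_simp
    have e2 : a * (3 * r b) = 3 * (a * r b) := by ring
    -- The power of `2` belongs to the measure of a slab and tripling costs `3^n`; one further
    -- factor `3` is given away.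
    have e3 : (6 : ℝ) ^ (k + 1 + 1) = 2 ^ (k + 1 + 1) * (3 * 3 ^ k * 3) := by
      rw [show (6 : ℝ) = 2 * 3 by norm_num, mul_pow, pow_succ (3 : ℝ) (k + 1), pow_succ (3 : ℝ) k]
      ring
    rw [e1, e2, e3, mul_pow 3]
    have : 0 ≤ sphArea (k + 1) * 2 ^ (k + 1 + 1) * (r b * (3 ^ k * (a * r b) ^ k)) := by positivity
    nlinarith
  calc cylMeas n E ≤ cylMeas n (⋃ b ∈ v, slab a b (3 * r b)) := measure_mono hsub
    _ ≤ ∑' b : v, cylMeas n (slab a b.1 (3 * r b.1)) := measure_biUnion_le _ hcount _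
    _ ≤ ∑' b : v, ENNReal.ofReal (sphArea n * 6 ^ (n + 1) / c) *
          ∫⁻ p in slab a b.1 (r b.1), u p ∂(cylMeas n) :=
        ENNReal.tsum_le_tsum fun b => hterm b.1 b.2
    _ = ENNReal.ofReal (sphArea n * 6 ^ (n + 1) / c) *
          ∫⁻ p in ⋃ b ∈ v, slab a b (r b), u p ∂(cylMeas n) := by
        rw [ENNReal.tsum_mul_left, lintegral_biUnion hcount (fun b _ => measurableSet_slab a b _)
          hdisj]
    _ ≤ _ := mul_le_mul_right (setLIntegral_le_lintegral _ _) _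

/-- The kernel `max (h, |ξ - η|)^{-n}`. -/
def slabKer {n : ℕ} (h : ℝ) (ξ η : Sph n) : ℝ≥0∞ :=
  ENNReal.ofReal ((max h ‖(ξ : Euc n) - η‖ ^ n)⁻¹)

theorem continuous_slabKer {n : ℕ} {h : ℝ} (hh : 0 < h) (ξ : Sph n) :
    Continuous fun η => slabKer h ξ η := by
  refine ENNReal.continuous_ofReal.comp (Continuous.inv₀ (by fun_prop) fun η => ?_)
  have : 0 < max h ‖(ξ : Euc n) - η‖ := lt_max_of_lt_left hh
  positivity

/-- The integral of `u` over `|s - t| ≤ h` against the kernel `max (h, |ξ - η|)^{-n}`. -/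
def slabInt {n : ℕ} (h : ℝ) (u : ℝ × Sph n → ℝ≥0∞) (x : ℝ × Sph n) : ℝ≥0∞ :=
  ∫⁻ p in Metric.closedBall x.1 h ×ˢ univ, slabKer h x.2 p.2 * u p ∂(cylMeas n)

/-- A single term suffices: for the least `j` with `|ξ - η| ≤ 2^j h`, minimality gives `max (h, |ξ -
η|) ≥ 2^j h / 2`. -/
theorem slabKer_le_tsum {n : ℕ} {h : ℝ} (hh : 0 < h) (ξ η : Sph n) :
    slabKer h ξ η ≤ ∑' j : ℕ, ENNReal.ofReal ((2 / (2 ^ j * h)) ^ n) *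
      (Metric.closedBall ξ (2 ^ j * h)).indicator 1 η := by
  set d := ‖(ξ : Euc n) - η‖
  have hd : dist η ξ = d := by rw [dist_comm]; exact dist_eq_norm (ξ : Euc n) η
  have hex : ∃ j : ℕ, d ≤ 2 ^ j * h := by
    obtain ⟨j, hj⟩ := pow_unbounded_of_one_lt (d / h) (one_lt_two)
    exact ⟨j, by rw [div_lt_iff₀ hh] at hj; exact hj.le⟩
  classical
  set j := Nat.find hex
  have hj : d ≤ 2 ^ j * h := Nat.find_spec hex
  refine le_trans ?_ (ENNReal.le_tsum j)
  rw [indicator_of_mem (by rw [Metric.mem_closedBall, hd]; exact hj), Pi.one_apply, mul_one]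
  refine ENNReal.ofReal_le_ofReal ?_
  rw [← inv_pow]
  have hm : 0 < max h d := lt_max_of_lt_left hh
  refine pow_le_pow_left₀ (by positivity) ?_ n
  rw [inv_le_comm₀ hm (by positivity), inv_div]
  rcases Nat.eq_zero_or_pos j with h0 | h0
  · rw [h0, pow_zero, one_mul]
    exact (by linarith : h / 2 ≤ h).trans (le_max_left _ _)
  · have := Nat.find_min hex (m := j - 1) (by omega)
    have e : (2 : ℝ) ^ j = 2 ^ (j - 1) * 2 := by rw [← pow_succ, Nat.sub_add_cancel h0]
    refine le_trans ?_ (le_max_right _ _)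
    rw [e]; push Not at this; linarith

theorem slabInt_le_tsum {n : ℕ} {h : ℝ} (hh : 0 < h) {u : ℝ × Sph n → ℝ≥0∞}
    (hu : AEMeasurable u (cylMeas n))
    (x : ℝ × Sph n) : slabInt h u x ≤ ∑' j : ℕ, ENNReal.ofReal ((2 / (2 ^ j * h)) ^ n) *
      ∫⁻ p in slab (2 ^ j) x h, u p ∂(cylMeas n) := by
  have hmeas : ∀ j : ℕ, Measurable fun p : ℝ × Sph n =>
      (Metric.closedBall x.2 (2 ^ j * h)).indicator (1 : Sph n → ℝ≥0∞) p.2 := fun j =>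
    (measurable_one.indicator Metric.isClosed_closedBall.measurableSet).comp measurable_snd
  calc slabInt h u x ≤ ∫⁻ p in Metric.closedBall x.1 h ×ˢ univ,
        ∑' j : ℕ, ENNReal.ofReal ((2 / (2 ^ j * h)) ^ n) *
          ((Metric.closedBall x.2 (2 ^ j * h)).indicator 1 p.2 * u p) ∂(cylMeas n) := by
        refine lintegral_mono fun p => ?_
        simp only [← mul_assoc]
        rw [ENNReal.tsum_mul_right]
        exact mul_le_mul_left (slabKer_le_tsum hh _ _) _
    _ = ∑' j : ℕ, ENNReal.ofReal ((2 / (2 ^ j * h)) ^ n) *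
        ∫⁻ p in Metric.closedBall x.1 h ×ˢ univ,
          (Metric.closedBall x.2 (2 ^ j * h)).indicator 1 p.2 * u p ∂(cylMeas n) := by
        have hm : ∀ j : ℕ, AEMeasurable (fun p : ℝ × Sph n =>
            (Metric.closedBall x.2 (2 ^ j * h)).indicator (1 : Sph n → ℝ≥0∞) p.2 * u p)
            ((cylMeas n).restrict (Metric.closedBall x.1 h ×ˢ univ)) := fun j =>
          ((hmeas j).aemeasurable.mul hu).restrict
        rw [lintegral_tsum fun j => (hm j).const_mul _]
        congr 1; ext j
        rw [lintegral_const_mul'' _ (hm j)]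
    _ = _ := by
        congr 1; ext j; congr 1
        rw [← lintegral_indicator (Metric.isClosed_closedBall.measurableSet.prod MeasurableSet.univ),
          ← lintegral_indicator (measurableSet_slab _ _ _)]
        refine lintegral_congr fun p => ?_
        by_cases h1 : p.1 ∈ Metric.closedBall x.1 h <;>
          by_cases h2 : p.2 ∈ Metric.closedBall x.2 (2 ^ j * h) <;>
          simp [indicator, slab, h1, h2, mem_prod, -Metric.mem_closedBall]

/-- The thresholds `c j` for the slabs of eccentricity `2^j` grow like `(3/2)^j`. This is slow
enough for the terms `2^n c j / 2^j = (l / 4) (3/4)^j` to add up to `l`, and fast enough for the sum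
of `1 / c j` to converge, to `12 * 2^n / l`. -/
theorem weak_type_slabInt {n : ℕ} (hn : n ≠ 0) {u : ℝ × Sph n → ℝ≥0∞}
    (hu : AEMeasurable u (cylMeas n)) {l : ℝ} (hl : 0 < l) :
    cylMeas n {x | ∃ h, 0 < h ∧ h ≤ 1 ∧ ENNReal.ofReal l < slabInt h u x} ≤
      ENNReal.ofReal (sphArea n * 6 ^ (n + 1) * 2 ^ n * 12 / l) * ∫⁻ p, u p ∂(cylMeas n) := by
  have hσ := sphArea_pos hn
  set c : ℕ → ℝ := fun j => l / 2 ^ n * (3 / 2) ^ j / 4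
  have hc : ∀ j, 0 < c j := fun j => by positivity
  have hsub : {x | ∃ h, 0 < h ∧ h ≤ 1 ∧ ENNReal.ofReal l < slabInt h u x} ⊆
      ⋃ j : ℕ, {x | ∃ h, 0 < h ∧ h ≤ 1 ∧ ENNReal.ofReal (c j * (h * (2 ^ j * h) ^ (n - 1))) <
        ∫⁻ p in slab (2 ^ j) x h, u p ∂(cylMeas n)} := by
    rintro x ⟨h, h0, h1, hlt⟩
    by_contra hcon
    simp only [mem_iUnion, mem_ofPred_eq, not_exists, not_and, not_lt] at hcon
    refine absurd hlt (not_lt.2 ((slabInt_le_tsum h0 hu x).trans ?_))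
    calc _ ≤ ∑' j : ℕ, ENNReal.ofReal (l / 4 * (3 / 4) ^ j) := by
          refine ENNReal.tsum_le_tsum fun j => ?_
          refine (mul_le_mul_right (hcon j h h0 h1) _).trans ?_
          rw [← ENNReal.ofReal_mul (by positivity)]
          refine ENNReal.ofReal_le_ofReal (le_of_eq ?_)
          obtain ⟨k, rfl⟩ := Nat.exists_eq_succ_of_ne_zero hn
          simp only [Nat.succ_eq_add_one, Nat.add_sub_cancel, c]
          rw [div_pow, pow_succ (2 ^ j * h) k, div_pow, div_pow, 
            show (4 : ℝ) ^ j = 2 ^ j * 2 ^ j by rw [← mul_pow]; norm_num]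
          field_simp
      _ = ENNReal.ofReal (∑' j : ℕ, l / 4 * (3 / 4) ^ j) := by
          rw [ENNReal.ofReal_tsum_of_nonneg (fun j => by positivity)]
          exact (summable_geometric_of_lt_one (by norm_num) (by norm_num)).mul_left _
      _ ≤ ENNReal.ofReal l := by
          rw [tsum_mul_left, tsum_geometric_of_lt_one (by norm_num) (by norm_num)]
          refine ENNReal.ofReal_le_ofReal (le_of_eq ?_)
          norm_num
  calc _ ≤ _ := measure_mono hsub
    _ ≤ ∑' j : ℕ, _ := measure_iUnion_le _
    _ ≤ ∑' j : ℕ, ENNReal.ofReal (sphArea n * 6 ^ (n + 1) / c j) * ∫⁻ p, u p ∂(cylMeas n) :=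
        ENNReal.tsum_le_tsum fun j => weak_type_slab hn (by positivity) u (hc j)
    _ = ENNReal.ofReal (∑' j : ℕ, sphArea n * 6 ^ (n + 1) / c j) * ∫⁻ p, u p ∂(cylMeas n) := by
        rw [ENNReal.tsum_mul_right, ENNReal.ofReal_tsum_of_nonneg (fun j => by have := hc j; positivity)]
        refine ((summable_geometric_of_lt_one (r := (2 / 3 : ℝ)) (by norm_num) (by norm_num)).mul_left
          (sphArea n * 6 ^ (n + 1) * 2 ^ n * 4 / l)).congr fun j => ?_
        simp only [c]; rw [div_pow, div_pow]; field_simp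
    _ = _ := by
        congr 2
        have : ∀ j : ℕ, sphArea n * 6 ^ (n + 1) / c j =
            sphArea n * 6 ^ (n + 1) * 2 ^ n * 4 / l * (2 / 3) ^ j := fun j => by
          simp only [c]; rw [div_pow, div_pow]; field_simp
        simp only [this]
        rw [tsum_mul_left, tsum_geometric_of_lt_one (by norm_num) (by norm_num)]
        ring

/-- The measure of the slab of eccentricity `2^j` leaves a factor `2^{-j}` in the dyadic sum, so the
kernel has mass bounded uniformly in `h` and `x`. -/
theorem slabInt_one_le {n : ℕ} (hn : n ≠ 0) {h : ℝ} (hh : 0 < h) (x : ℝ × Sph n) :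
    slabInt h 1 x ≤ ENNReal.ofReal (sphArea n * 4 ^ (n + 1)) := by
  have hσ := sphArea_pos hn
  refine (slabInt_le_tsum hh measurable_one.aemeasurable x).trans ?_
  calc _ ≤ ∑' j : ℕ, ENNReal.ofReal (sphArea n * 4 ^ n * 2 * (1 / 2) ^ j) := by
        refine ENNReal.tsum_le_tsum fun j => ?_
        simp only [Pi.one_apply, lintegral_one, Measure.restrict_apply_univ]
        refine (mul_le_mul_right (cylMeas_slab_le hn (by positivity) x hh) _).trans ?_
        rw [← ENNReal.ofReal_mul (by positivity)]
        refine ENNReal.ofReal_le_ofReal (le_of_eq ?_)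
        obtain ⟨k, rfl⟩ := Nat.exists_eq_succ_of_ne_zero hn
        simp only [Nat.succ_eq_add_one, Nat.add_sub_cancel]
        rw [div_pow, pow_succ (2 ^ j * h) k, show (4 : ℝ) ^ (k + 1) = 2 ^ (k + 1) * 2 ^ (k + 1) by
          rw [← mul_pow]; norm_num, div_pow, one_pow]
        field_simp
        ring
    _ = ENNReal.ofReal (∑' j : ℕ, sphArea n * 4 ^ n * 2 * (1 / 2) ^ j) := by
        rw [ENNReal.ofReal_tsum_of_nonneg (fun j => by positivity)]
        exact (summable_geometric_of_lt_one (by norm_num) (by norm_num)).mul_left _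
    _ = _ := by
        rw [tsum_mul_left, tsum_geometric_of_lt_one (by norm_num) (by norm_num)]
        congr 1; rw [pow_succ]; ring

theorem slabInt_mono {n : ℕ} {h : ℝ} {u v : ℝ × Sph n → ℝ≥0∞} {x : ℝ × Sph n}
    (huv : ∀ p, u p ≤ v p) : slabInt h u x ≤ slabInt h v x :=
  lintegral_mono fun p => mul_le_mul_right (huv p) _

theorem measurable_slabKer_snd {n : ℕ} {h : ℝ} (hh : 0 < h) (ξ : Sph n) :
    Measurable fun p : ℝ × Sph n => slabKer h ξ p.2 :=
  (continuous_slabKer hh ξ).measurable.comp measurable_snd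

theorem slabInt_add {n : ℕ} {h : ℝ} (hh : 0 < h) {u v : ℝ × Sph n → ℝ≥0∞}
    (hu : AEMeasurable u (cylMeas n)) (x : ℝ × Sph n) :
    slabInt h (fun p => u p + v p) x = slabInt h u x + slabInt h v x := by
  simp only [slabInt, mul_add]
  exact lintegral_add_left' ((measurable_slabKer_snd hh x.2).aemeasurable.mul hu).restrict _

theorem slabInt_const_le {n : ℕ} (hn : n ≠ 0) {h : ℝ} (hh : 0 < h) (c : ℝ≥0∞) (x : ℝ × Sph n) :
    slabInt h (fun _ => c) x ≤ c * ENNReal.ofReal (sphArea n * 4 ^ (n + 1)) := by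
  refine le_trans (le_of_eq ?_) (mul_le_mul_right (slabInt_one_le hn hh x) c)
  simp only [slabInt, Pi.one_apply, mul_one]
  rw [lintegral_mul_const _ (measurable_slabKer_snd hh x.2), mul_comm]

/-- At distance less than `δ` from `x` continuity is combined with the bounded mass of the kernel.
Away from `x` the kernel is at most `δ^{-n}`, and the measure of `|s - t| ≤ h` is of order `h`. -/
theorem eventually_slabInt_sub_le {n : ℕ} (hn : n ≠ 0) {φ : ℝ × Sph n → ℂ} (hφ : Continuous φ)
    (hφc : HasCompactSupport φ) (x : ℝ × Sph n) {ε : ℝ} (hε : 0 < ε) :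
    ∀ᶠ h in 𝓝[>] (0 : ℝ), slabInt h (fun p => ‖φ p - φ x‖ₑ) x ≤ ENNReal.ofReal ε := by
  have hσ := sphArea_pos hn
  obtain ⟨B, hB0, hB⟩ : ∃ B, 0 < B ∧ ∀ p, ‖φ p‖ ≤ B := by
    obtain ⟨B, hB⟩ := hφ.bounded_above_of_compact_support hφc
    exact ⟨max B 1, by positivity, fun p => (hB p).trans (le_max_left _ _)⟩
  set C := sphArea n * 4 ^ (n + 1)
  have hC : 0 < C := by positivity
  obtain ⟨δ, hδ, hδφ⟩ := Metric.continuousAt_iff.1 hφ.continuousAt (ε / (2 * C)) (by positivity)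
  set D := (δ ^ n)⁻¹ * (2 * B)
  have hD : 0 < D := by positivity
  have hev : ∀ᶠ h : ℝ in 𝓝[>] 0, h < min δ (ε / (4 * D * sphArea n)) :=
    nhdsWithin_le_nhds (Iio_mem_nhds (by positivity))
  filter_upwards [hev, self_mem_nhdsWithin] with h hlt hh0
  have hh : (0 : ℝ) < h := hh0
  have hhδ := hlt.trans_le (min_le_left _ _)
  have hhD := hlt.trans_le (min_le_right _ _)
  have hS : MeasurableSet (Metric.closedBall x.1 h ×ˢ (univ : Set (Sph n))) :=
    Metric.isClosed_closedBall.measurableSet.prod MeasurableSet.univ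
  have hpt : ∀ p ∈ Metric.closedBall x.1 h ×ˢ (univ : Set (Sph n)),
      slabKer h x.2 p.2 * ‖φ p - φ x‖ₑ ≤
        slabKer h x.2 p.2 * ENNReal.ofReal (ε / (2 * C)) + ENNReal.ofReal D := by
    rintro p ⟨hp1, -⟩
    by_cases hc : dist p.2 x.2 < δ
    · refine le_add_right (mul_le_mul_right ?_ _)
      have : dist p x < δ := max_lt (lt_of_le_of_lt hp1 hhδ) hc
      have h2 := (hδφ this).le
      rw [dist_eq_norm] at h2
      rw [← ofReal_norm]
      exact ENNReal.ofReal_le_ofReal h2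
    · refine le_add_left ?_
      rw [slabKer, ← ofReal_norm, ← ENNReal.ofReal_mul (by positivity)]
      refine ENNReal.ofReal_le_ofReal (mul_le_mul ?_ ?_ (norm_nonneg _) (by positivity))
      · refine inv_anti₀ (by positivity) (pow_le_pow_left₀ hδ.le ?_ n)
        refine le_trans ?_ (le_max_right _ _)
        rw [not_lt, dist_comm] at hc
        exact hc
      · calc _ ≤ ‖φ p‖ + ‖φ x‖ := norm_sub_le _ _
          _ ≤ 2 * B := by linarith [hB p, hB x]
  calc slabInt h (fun p => ‖φ p - φ x‖ₑ) x
      ≤ ∫⁻ p in Metric.closedBall x.1 h ×ˢ univ, (slabKer h x.2 p.2 * ENNReal.ofReal (ε / (2 * C)) +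
        ENNReal.ofReal D) ∂(cylMeas n) := setLIntegral_mono' hS hpt
    _ = slabInt h (fun _ => ENNReal.ofReal (ε / (2 * C))) x +
        ENNReal.ofReal D * cylMeas n (Metric.closedBall x.1 h ×ˢ univ) := by
        rw [lintegral_add_right _ measurable_const, setLIntegral_const]; rfl
    _ ≤ ENNReal.ofReal (ε / 2) + ENNReal.ofReal (ε / 2) := by
        refine add_le_add ((slabInt_const_le hn hh _ x).trans ?_) ?_
        · rw [← ENNReal.ofReal_mul (by positivity)]
          refine ENNReal.ofReal_le_ofReal (le_of_eq ?_)
          change ε / (2 * C) * C = _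
          field_simp
        · rw [Measure.prod_prod, Real.volume_closedBall, surf_univ hn,
            ← ENNReal.ofReal_mul (by positivity), ← ENNReal.ofReal_mul (by positivity)]
          refine ENNReal.ofReal_le_ofReal ?_
          rw [lt_div_iff₀ (by positivity)] at hhD
          linarith
    _ = ENNReal.ofReal ε := by
        rw [← ENNReal.ofReal_add (by positivity) (by positivity), add_halves]

/-- The Lebesgue differentiation theorem for the averages `slabInt`. -/
theorem ae_tendsto_slabInt {n : ℕ} (hn : n ≠ 0) {g : ℝ × Sph n → ℂ}
    (hg : Integrable g (cylMeas n)) :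
    ∀ᵐ x ∂(cylMeas n), Tendsto (fun h => slabInt h (fun p => ‖g p - g x‖ₑ) x) (𝓝[>] 0) (𝓝 0) := by
  have hσ := sphArea_pos hn
  set C := sphArea n * 4 ^ (n + 1)
  have hC : 0 < C := by positivity
  have main : ∀ k : ℕ, ∀ᵐ x ∂(cylMeas n), ∀ᶠ h in 𝓝[>] (0 : ℝ),
      slabInt h (fun p => ‖g p - g x‖ₑ) x ≤ ENNReal.ofReal (1 / (k + 1)) := by
    intro k
    set ε : ℝ := 1 / (k + 1)
    have hε : 0 < ε := by positivity
    set C1 := sphArea n * 6 ^ (n + 1) * 2 ^ n * 12 / (ε / 3)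
    have hC1 : 0 < C1 := by positivity
    rw [ae_iff]
    refine le_antisymm (ENNReal.le_of_forall_pos_le_add fun δ hδ _ => ?_) zero_le
    rw [zero_add]
    -- `φ` is a compactly supported continuous function at `L¹` distance at most `c` from `g`. The
    -- weak type bound for `g - φ` and Chebyshev's inequality bound the exceptional set by `C1 c + 3
    -- C c / ε`, which is `δ` for this `c`.
    set c : ℝ := δ / (C1 + 3 * C / ε)
    have hδ' : (0 : ℝ) < δ := hδ
    have hc : 0 < c := by positivity
    obtain ⟨φ, hφc, hφi, hφ, -⟩ := hg.exists_hasCompactSupport_lintegral_sub_le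
      (ε := ENNReal.ofReal c) (by simpa using hc)
    have hm1 : AEMeasurable (fun p => ‖g p - φ p‖ₑ) (cylMeas n) :=
      (hg.aestronglyMeasurable.sub hφ.aestronglyMeasurable).enorm
    have hsub : {x | ¬ ∀ᶠ h in 𝓝[>] (0 : ℝ),
        slabInt h (fun p => ‖g p - g x‖ₑ) x ≤ ENNReal.ofReal ε} ⊆
        {x | ∃ h, 0 < h ∧ h ≤ 1 ∧ ENNReal.ofReal (ε / 3) < slabInt h (fun p => ‖g p - φ p‖ₑ) x} ∪
          {x | ENNReal.ofReal (ε / 3 / C) ≤ ‖g x - φ x‖ₑ} := by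
      intro x hx
      by_contra hcon
      simp only [mem_union, mem_ofPred_eq, not_or, not_exists, not_and, not_lt, not_le] at hcon
      refine hx ?_
      have hev : ∀ᶠ h : ℝ in 𝓝[>] 0, h < 1 := nhdsWithin_le_nhds (Iio_mem_nhds one_pos)
      filter_upwards [eventually_slabInt_sub_le hn hφ hφc x (ε := ε / 3) (by positivity), hev,
        self_mem_nhdsWithin] with h h1 h2 hh0
      have hh : (0 : ℝ) < h := hh0
      calc slabInt h (fun p => ‖g p - g x‖ₑ) x
          ≤ slabInt h (fun p => ‖g p - φ p‖ₑ + (‖φ p - φ x‖ₑ + ‖g x - φ x‖ₑ)) x := by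
            refine slabInt_mono fun p => ?_
            have e : g p - g x = (g p - φ p) + ((φ p - φ x) - (g x - φ x)) := by ring
            rw [e]
            exact (enorm_add_le _ _).trans (by gcongr; exact enorm_sub_le)
        _ = slabInt h (fun p => ‖g p - φ p‖ₑ) x + (slabInt h (fun p => ‖φ p - φ x‖ₑ) x +
              slabInt h (fun _ => ‖g x - φ x‖ₑ) x) := by
            rw [slabInt_add hh hm1, slabInt_add hh]
            exact (by fun_prop : Continuous fun p => ‖φ p - φ x‖ₑ).measurable.aemeasurable
        _ ≤ ENNReal.ofReal (ε / 3) + (ENNReal.ofReal (ε / 3) + ENNReal.ofReal (ε / 3)) := by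
            refine add_le_add (hcon.1 h hh h2.le) (add_le_add h1 ?_)
            refine (slabInt_const_le hn hh _ x).trans ?_
            refine (mul_le_mul_left hcon.2.le _).trans ?_
            rw [← ENNReal.ofReal_mul (by positivity)]
            refine ENNReal.ofReal_le_ofReal (le_of_eq ?_)
            change ε / 3 / C * C = _
            field_simp
        _ = ENNReal.ofReal ε := by
            rw [← ENNReal.ofReal_add (by positivity) (by positivity),
              ← ENNReal.ofReal_add (by positivity) (by positivity)]
            congr 1; ring
    calc _ ≤ _ := measure_mono hsub
      _ ≤ _ := measure_union_le _ _
      _ ≤ ENNReal.ofReal C1 * ENNReal.ofReal c +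
          ENNReal.ofReal c / ENNReal.ofReal (ε / 3 / C) := by
          refine add_le_add ((weak_type_slabInt hn hm1 (by positivity)).trans
            (mul_le_mul_right hφi _)) ?_
          exact (meas_ge_le_lintegral_div hm1 (by simpa using by positivity)
            ENNReal.ofReal_ne_top).trans (ENNReal.div_le_div_right hφi _)
      _ = δ := by
          rw [← ENNReal.ofReal_mul hC1.le, ← ENNReal.ofReal_div_of_pos (by positivity),
            ← ENNReal.ofReal_add (by positivity) (by positivity), ← ENNReal.ofReal_coe_nnreal]
          congr 1
          have : C1 * c + c / (ε / 3 / C) = c * (C1 + 3 * C / ε) := by field_simp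
          rw [this]
          simp only [c]; field_simp
  filter_upwards [ae_all_iff.2 main] with x hx
  rw [ENNReal.tendsto_nhds_zero]
  intro ε hε
  obtain ⟨k, hk⟩ : ∃ k : ℕ, ENNReal.ofReal (1 / (k + 1)) ≤ ε := by
    rcases eq_or_ne ε ⊤ with rfl | htop
    · exact ⟨0, le_top⟩
    obtain ⟨k, hk⟩ := exists_nat_one_div_lt (ENNReal.toReal_pos hε.ne' htop)
    exact ⟨k, (ENNReal.ofReal_le_iff_le_toReal htop).2 hk.le⟩
  filter_upwards [hx k] with h hh
  exact hh.trans hk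

/-! ### The constants -/

theorem one_sub_exp_neg_nonneg {τ : ℝ} (h : 0 ≤ τ) : 0 ≤ 1 - Real.exp (-τ) := by
  have := Real.exp_le_one_iff.2 (neg_nonpos.2 h); linarith

theorem one_sub_exp_neg_le (τ : ℝ) : 1 - Real.exp (-τ) ≤ τ := by
  have := Real.add_one_le_exp (-τ); linarith

theorem rpow_inv_one_add {α τ : ℝ} (hτ : 0 < τ) : (τ ^ (1 + α))⁻¹ = τ ^ (-1 - α) := by
  rw [← Real.rpow_neg hτ.le]; congr 1; ring

theorem integrableOn_kappa {α : ℝ} (hα0 : 0 < α) (hα1 : α < 1) {ℓ : ℕ} (hℓ : 1 ≤ ℓ) :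
    IntegrableOn (fun τ : ℝ => (1 - Real.exp (-τ)) ^ ℓ / τ ^ (1 + α)) (Ioi 0) := by
  have hm : Measurable fun τ : ℝ => (1 - Real.exp (-τ)) ^ ℓ / τ ^ (1 + α) := by fun_prop
  rw [← Ioc_union_Ioi_eq_Ioi (zero_le_one (α := ℝ))]
  refine IntegrableOn.union ?_ ?_
  · have h : IntegrableOn (fun τ : ℝ => τ ^ (-α)) (Ioc 0 1) :=
      (intervalIntegral.intervalIntegrable_rpow' (by linarith)).1
    refine Integrable.mono' h hm.aestronglyMeasurable ?_
    filter_upwards [ae_restrict_mem measurableSet_Ioc] with τ hτ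
    have h0 := one_sub_exp_neg_nonneg hτ.1.le
    have h1 : (1 - Real.exp (-τ)) ^ ℓ ≤ τ := by
      refine (pow_le_of_le_one h0 ?_ (by omega)).trans (one_sub_exp_neg_le τ)
      linarith [Real.exp_pos (-τ)]
    have hp := Real.rpow_pos_of_pos hτ.1 (1 + α)
    rw [Real.norm_of_nonneg (by positivity), div_le_iff₀ hp, ← Real.rpow_add hτ.1]
    simpa using h1
  · have h : IntegrableOn (fun τ : ℝ => τ ^ (-(1 + α))) (Ioi 1) :=
      integrableOn_Ioi_rpow_of_lt (by linarith) one_pos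
    refine Integrable.mono' h hm.aestronglyMeasurable ?_
    filter_upwards [ae_restrict_mem measurableSet_Ioi] with τ hτ
    have hτ0 : (0 : ℝ) < τ := one_pos.trans hτ
    have h0 := one_sub_exp_neg_nonneg hτ0.le
    have h1 : (1 - Real.exp (-τ)) ^ ℓ ≤ 1 := pow_le_one₀ h0 (by linarith [Real.exp_pos (-τ)])
    have hp := Real.rpow_pos_of_pos hτ0 (1 + α)
    rw [Real.norm_of_nonneg (by positivity), Real.rpow_neg hτ0.le, div_eq_mul_inv]
    exact mul_le_of_le_one_left (by positivity) h1

theorem kappa_pos {α : ℝ} (hα0 : 0 < α) (hα1 : α < 1) {ℓ : ℕ} (hℓ : 1 ≤ ℓ) : 0 < kappa α ℓ := by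
  rw [kappa, setIntegral_pos_iff_support_of_nonneg_ae]
  · have : Function.support (fun τ : ℝ => (1 - Real.exp (-τ)) ^ ℓ / τ ^ (1 + α)) ∩ Ioi 0 = Ioi 0 := by
      refine inter_eq_right.2 fun τ hτ => ?_
      have hτ0 : (0 : ℝ) < τ := hτ
      have h1 : 0 < 1 - Real.exp (-τ) := by
        have := Real.exp_lt_one_iff.2 (neg_lt_zero.2 hτ0); linarith
      have hp := Real.rpow_pos_of_pos hτ0 (1 + α)
      exact (div_pos (pow_pos h1 ℓ) hp).ne'
    rw [this]; simp
  · filter_upwards [ae_restrict_mem measurableSet_Ioi] with τ hτ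
    have hτ0 : (0 : ℝ) < τ := hτ
    have h0 := one_sub_exp_neg_nonneg hτ0.le
    simp only [Pi.zero_apply]; positivity
  · exact integrableOn_kappa hα0 hα1 hℓ

/-- Integration by parts against `-τ^{-α} / α`. The boundary terms vanish because `1 - e^{-τ}` is at
most `τ` and at most `1`. -/
theorem kappa_one {α : ℝ} (hα0 : 0 < α) (hα1 : α < 1) :
    kappa α 1 = Real.Gamma (1 - α) / α := by
  have hG : IntegrableOn (fun τ : ℝ => Real.exp (-τ) * τ ^ (-α)) (Ioi 0) := by
    have := Real.GammaIntegral_convergent (s := 1 - α) (by linarith)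
    simpa using this
  have hbd : ∀ τ ∈ Ioi (0 : ℝ), ‖(1 - Real.exp (-τ)) * (-(τ ^ (-α)) / α)‖ ≤ τ ^ (1 - α) / α ∧
      ‖(1 - Real.exp (-τ)) * (-(τ ^ (-α)) / α)‖ ≤ τ ^ (-α) / α := fun τ hτ => by
    have hτ0 : (0 : ℝ) < τ := hτ
    have h0 := one_sub_exp_neg_nonneg hτ0.le
    have h1 := one_sub_exp_neg_le τ
    have h2 : 1 - Real.exp (-τ) ≤ 1 := by linarith [Real.exp_pos (-τ)]
    have h3 : 0 ≤ τ ^ (-α) / α := by positivity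
    rw [norm_mul, Real.norm_of_nonneg h0, neg_div, norm_neg, Real.norm_of_nonneg h3]
    refine ⟨?_, by nlinarith⟩
    have : τ ^ (1 - α) / α = τ * (τ ^ (-α) / α) := by
      rw [sub_eq_add_neg, Real.rpow_add hτ0, Real.rpow_one]; ring
    rw [this]; nlinarith
  have h := integral_Ioi_mul_deriv_eq_deriv_mul (a := 0) (a' := 0) (b' := 0)
    (u := fun τ : ℝ => 1 - Real.exp (-τ)) (v := fun τ : ℝ => -(τ ^ (-α)) / α)
    (u' := fun τ : ℝ => Real.exp (-τ)) (v' := fun τ : ℝ => τ ^ (-α - 1))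
    (fun τ _ => by
      have := ((Real.hasDerivAt_exp (-τ)).comp τ (hasDerivAt_neg τ)).const_sub 1
      exact this.congr_deriv (by ring))
    (fun τ hτ => by
      have hτ0 : (0 : ℝ) < τ := hτ
      have := ((Real.hasDerivAt_rpow_const (p := -α) (Or.inl hτ0.ne')).neg).div_const α
      exact this.congr_deriv (by field_simp))
    (by
      refine (integrableOn_kappa hα0 hα1 le_rfl).congr_fun (fun τ hτ => ?_) measurableSet_Ioi
      have hτ0 : (0 : ℝ) < τ := hτ
      simp only [Pi.mul_apply, pow_one]
      rw [div_eq_mul_inv, rpow_inv_one_add hτ0]; congr 2; ring)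
    (by
      have h : IntegrableOn (fun τ : ℝ => -1 / α * (Real.exp (-τ) * τ ^ (-α))) (Ioi 0) :=
        hG.const_mul (-1 / α)
      refine h.congr_fun (fun τ hτ => ?_) measurableSet_Ioi
      simp only [Pi.mul_apply]; ring)
    (by
      refine squeeze_zero_norm' (a := fun τ => τ ^ (1 - α) / α) ?_ ?_
      · filter_upwards [self_mem_nhdsWithin] with τ hτ using (hbd τ hτ).1
      · have : ContinuousAt (fun τ : ℝ => τ ^ (1 - α) / α) 0 :=
          (Real.continuousAt_rpow_const _ _ (Or.inr (by linarith))).div_const _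
        have h2 := this.tendsto
        simp only [Real.zero_rpow (by linarith : 1 - α ≠ 0), zero_div] at h2
        exact h2.mono_left nhdsWithin_le_nhds)
    (by
      refine squeeze_zero_norm' (a := fun τ => τ ^ (-α) / α) ?_ ?_
      · filter_upwards [eventually_gt_atTop 0] with τ hτ using (hbd τ hτ).2
      · simpa using (tendsto_rpow_neg_atTop hα0).div_const α)
  have e1 : kappa α 1 = ∫ τ in Ioi (0 : ℝ), (1 - Real.exp (-τ)) * τ ^ (-α - 1) := by
    refine setIntegral_congr_fun measurableSet_Ioi fun τ hτ => ?_
    have hτ0 : (0 : ℝ) < τ := hτ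
    simp only [pow_one]
    rw [div_eq_mul_inv, rpow_inv_one_add hτ0]; congr 2; ring
  have e2 : ∫ τ in Ioi (0 : ℝ), Real.exp (-τ) * (-(τ ^ (-α)) / α) = -(Real.Gamma (1 - α) / α) := by
    rw [Real.Gamma_eq_integral (by linarith), ← integral_div, ← integral_neg]
    refine setIntegral_congr_fun measurableSet_Ioi fun τ hτ => ?_
    rw [show 1 - α - 1 = -α by ring]; ring
  rw [e1, h, e2]; ring

theorem lintegral_one_sub_exp_mul {α : ℝ} (hα0 : 0 < α) (hα1 : α < 1) {y : ℝ} (hy : 0 < y) :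
    ∫⁻ u in Ioi (0 : ℝ), ENNReal.ofReal ((1 - Real.exp (-(y * u))) * (u ^ (1 + α))⁻¹) =
      ENNReal.ofReal (y ^ α * kappa α 1) := by
  have hI := integrableOn_kappa hα0 hα1 (ℓ := 1) le_rfl
  have h2 : IntegrableOn (fun u : ℝ => (1 - Real.exp (-(y * u))) ^ 1 / (y * u) ^ (1 + α)) (Ioi 0) := by
    rw [integrableOn_Ioi_comp_mul_left_iff (fun τ => (1 - Real.exp (-τ)) ^ 1 / τ ^ (1 + α)) 0 hy,
      mul_zero]
    exact hI
  have h3 := integral_comp_mul_left_Ioi (fun τ => (1 - Real.exp (-τ)) ^ 1 / τ ^ (1 + α)) 0 hy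
  rw [mul_zero] at h3
  have hpt : ∀ u ∈ Ioi (0 : ℝ), (1 - Real.exp (-(y * u))) * (u ^ (1 + α))⁻¹ =
      y ^ (1 + α) * ((1 - Real.exp (-(y * u))) ^ 1 / (y * u) ^ (1 + α)) := fun u hu => by
    have hu0 : (0 : ℝ) < u := hu
    rw [Real.mul_rpow hy.le hu0.le]
    have := Real.rpow_pos_of_pos hy (1 + α)
    have := Real.rpow_pos_of_pos hu0 (1 + α)
    field_simp
  rw [setLIntegral_congr_fun measurableSet_Ioi (fun u hu => by rw [hpt u hu]),
    ← ofReal_integral_eq_lintegral_ofReal (h2.const_mul _), integral_const_mul, h3]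
  · congr 1
    rw [kappa, smul_eq_mul, Real.rpow_add hy, Real.rpow_one]
    field_simp
  · filter_upwards [ae_restrict_mem measurableSet_Ioi] with u hu
    have hu0 : (0 : ℝ) < u := hu
    have := one_sub_exp_neg_nonneg (mul_pos hy hu0).le
    simp only [Pi.zero_apply]; positivity

theorem integrableOn_gammaDensity {β q : ℝ} (hβ : 0 < β) (hq : 0 < q) :
    IntegrableOn (fun y : ℝ => y ^ (β - 1) * Real.exp (-(q * y))) (Ioi 0) := by
  have := integrableOn_rpow_mul_exp_neg_mul_rpow (s := β - 1) (p := 1) (b := q) (by linarith)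
    one_pos hq
  simpa using this

/-- `(1 + u)^{-β}` is the Laplace transform of the Gamma density of parameter `β`. By Tonelli's
theorem the `u`-integral comes first and produces `y^α κ(α, 1)`; what is left is the Gamma integral
at `β + α`. -/
theorem lintegral_one_sub_rpow {α β : ℝ} (hα0 : 0 < α) (hα1 : α < 1) (hβ : 0 < β) :
    ∫⁻ u in Ioi (0 : ℝ), ENNReal.ofReal ((1 - (1 + u) ^ (-β)) * (u ^ (1 + α))⁻¹) =
      ENNReal.ofReal (kappa α 1 * Real.Gamma (β + α) / Real.Gamma β) := by
  have hG := Real.Gamma_pos_of_pos hβ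
  have hk := kappa_pos hα0 hα1 (ℓ := 1) le_rfl
  have hin : ∀ u ∈ Ioi (0 : ℝ), ENNReal.ofReal ((1 - (1 + u) ^ (-β)) * (u ^ (1 + α))⁻¹) =
      ∫⁻ y in Ioi (0 : ℝ), ENNReal.ofReal ((Real.Gamma β)⁻¹ * (y ^ (β - 1) * Real.exp (-y)) *
        ((1 - Real.exp (-(y * u))) * (u ^ (1 + α))⁻¹)) := by
    intro u hu
    have hu0 : (0 : ℝ) < u := hu
    have i1 := integrableOn_gammaDensity hβ one_pos
    have i2 := integrableOn_gammaDensity hβ (by linarith : 0 < 1 + u)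
    have i3 := ((i1.sub i2).const_mul ((Real.Gamma β)⁻¹ * (u ^ (1 + α))⁻¹))
    have e : ∀ y : ℝ, (Real.Gamma β)⁻¹ * (y ^ (β - 1) * Real.exp (-y)) *
        ((1 - Real.exp (-(y * u))) * (u ^ (1 + α))⁻¹) = (Real.Gamma β)⁻¹ * (u ^ (1 + α))⁻¹ *
        (y ^ (β - 1) * Real.exp (-(1 * y)) - y ^ (β - 1) * Real.exp (-((1 + u) * y))) := fun y => by
      rw [show -((1 + u) * y) = -y + -(y * u) by ring, Real.exp_add, one_mul]; ring
    simp only [e]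
    simp only [Pi.sub_apply] at i3
    rw [← ofReal_integral_eq_lintegral_ofReal i3]
    · congr 1
      rw [integral_const_mul, integral_sub i1 i2, Real.integral_rpow_mul_exp_neg_mul_Ioi hβ one_pos,
        Real.integral_rpow_mul_exp_neg_mul_Ioi hβ (by linarith), one_div_one, Real.one_rpow,
        Real.rpow_neg (by linarith), one_div, Real.inv_rpow (by linarith)]
      field_simp
    · filter_upwards [ae_restrict_mem measurableSet_Ioi] with y hy
      have hy0 : (0 : ℝ) < y := hy
      rw [← e]
      have := one_sub_exp_neg_nonneg (mul_pos hy0 hu0).le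
      simp only [Pi.zero_apply]; positivity
  rw [setLIntegral_congr_fun measurableSet_Ioi hin, lintegral_lintegral_swap]
  · have hin2 : ∀ y ∈ Ioi (0 : ℝ), ∫⁻ u in Ioi (0 : ℝ), ENNReal.ofReal ((Real.Gamma β)⁻¹ *
        (y ^ (β - 1) * Real.exp (-y)) * ((1 - Real.exp (-(y * u))) * (u ^ (1 + α))⁻¹)) =
        ENNReal.ofReal ((Real.Gamma β)⁻¹ * kappa α 1 * (y ^ (β + α - 1) * Real.exp (-(1 * y)))) := by
      intro y hy
      have hy0 : (0 : ℝ) < y := hy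
      simp only [ENNReal.ofReal_mul (by positivity : 0 ≤ (Real.Gamma β)⁻¹ *
        (y ^ (β - 1) * Real.exp (-y)))]
      rw [lintegral_const_mul _ (by fun_prop), lintegral_one_sub_exp_mul hα0 hα1 hy0,
        ← ENNReal.ofReal_mul (by positivity)]
      congr 1
      rw [show β + α - 1 = (β - 1) + α by ring, Real.rpow_add hy0, one_mul]; ring
    rw [setLIntegral_congr_fun measurableSet_Ioi hin2, ← ofReal_integral_eq_lintegral_ofReal
      ((integrableOn_gammaDensity (by linarith) one_pos).const_mul _), integral_const_mul,
      Real.integral_rpow_mul_exp_neg_mul_Ioi (by linarith) one_pos, one_div_one, Real.one_rpow]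
    · congr 1; field_simp
    · filter_upwards [ae_restrict_mem measurableSet_Ioi] with y hy
      have hy0 : (0 : ℝ) < y := hy
      simp only [Pi.zero_apply]; positivity
  · fun_prop

/-- The value of `∫ (1 - (1 + u)^{-β}) u^{-1-α} du`. -/
def marchaudConst (α β : ℝ) : ℝ := kappa α 1 * Real.Gamma (β + α) / Real.Gamma β

theorem one_sub_rpow_neg_nonneg {β u : ℝ} (hβ : 0 < β) (hu : 0 ≤ u) : 0 ≤ 1 - (1 + u) ^ (-β) :=
  sub_nonneg.2 (Real.rpow_le_one_of_one_le_of_nonpos (by linarith) (by linarith))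

theorem integrableOn_one_sub_rpow {α β : ℝ} (hα0 : 0 < α) (hα1 : α < 1) (hβ : 0 < β) :
    IntegrableOn (fun u : ℝ => (1 - (1 + u) ^ (-β)) * (u ^ (1 + α))⁻¹) (Ioi 0) := by
  refine ⟨Measurable.aestronglyMeasurable (by fun_prop), ?_⟩
  rw [hasFiniteIntegral_iff_ofReal, lintegral_one_sub_rpow hα0 hα1 hβ]
  · exact ENNReal.ofReal_lt_top
  · filter_upwards [ae_restrict_mem measurableSet_Ioi] with u hu
    have hu0 : (0 : ℝ) < u := hu
    have := one_sub_rpow_neg_nonneg hβ hu0.le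
    simp only [Pi.zero_apply]; positivity

theorem integral_one_sub_rpow {α β : ℝ} (hα0 : 0 < α) (hα1 : α < 1) (hβ : 0 < β) :
    ∫ u in Ioi (0 : ℝ), (1 - (1 + u) ^ (-β)) * (u ^ (1 + α))⁻¹ = marchaudConst α β := by
  have hG := Real.Gamma_pos_of_pos hβ
  have hG2 := Real.Gamma_pos_of_pos (by linarith : 0 < β + α)
  have hk := kappa_pos hα0 hα1 (ℓ := 1) le_rfl
  rw [integral_eq_lintegral_of_nonneg_ae, lintegral_one_sub_rpow hα0 hα1 hβ, ENNReal.toReal_ofReal]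
  · rfl
  · positivity
  · filter_upwards [ae_restrict_mem measurableSet_Ioi] with u hu
    have hu0 : (0 : ℝ) < u := hu
    have := one_sub_rpow_neg_nonneg hβ hu0.le
    simp only [Pi.zero_apply]; positivity
  · exact (integrableOn_one_sub_rpow hα0 hα1 hβ).aestronglyMeasurable

theorem scaled_rpow_eq {α β q u : ℝ} (hq : 0 < q) (hu : 0 < u) :
    (1 - (1 + q * u) ^ (-β)) * (u ^ (1 + α))⁻¹ =
      q ^ (1 + α) * ((1 - (1 + q * u) ^ (-β)) * ((q * u) ^ (1 + α))⁻¹) := by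
  rw [Real.mul_rpow hq.le hu.le]
  have := Real.rpow_pos_of_pos hq (1 + α)
  have := Real.rpow_pos_of_pos hu (1 + α)
  field_simp

theorem integrableOn_one_sub_rpow_mul {α β q : ℝ} (hα0 : 0 < α) (hα1 : α < 1) (hβ : 0 < β)
    (hq : 0 < q) :
    IntegrableOn (fun u : ℝ => (1 - (1 + q * u) ^ (-β)) * (u ^ (1 + α))⁻¹) (Ioi 0) := by
  have h : IntegrableOn (fun u : ℝ => (1 - (1 + q * u) ^ (-β)) * ((q * u) ^ (1 + α))⁻¹) (Ioi 0) := by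
    rw [integrableOn_Ioi_comp_mul_left_iff (fun u => (1 - (1 + u) ^ (-β)) * (u ^ (1 + α))⁻¹) 0 hq,
      mul_zero]
    exact integrableOn_one_sub_rpow hα0 hα1 hβ
  have h2 : IntegrableOn (fun u : ℝ => q ^ (1 + α) *
    ((1 - (1 + q * u) ^ (-β)) * ((q * u) ^ (1 + α))⁻¹)) (Ioi 0) := h.const_mul (q ^ (1 + α))
  exact h2.congr_fun (fun u hu => (scaled_rpow_eq hq hu).symm)
    measurableSet_Ioi

theorem integral_one_sub_rpow_mul {α β q : ℝ} (hα0 : 0 < α) (hα1 : α < 1) (hβ : 0 < β)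
    (hq : 0 < q) :
    ∫ u in Ioi (0 : ℝ), (1 - (1 + q * u) ^ (-β)) * (u ^ (1 + α))⁻¹ = q ^ α * marchaudConst α β := by
  have h := integral_comp_mul_left_Ioi (fun u => (1 - (1 + u) ^ (-β)) * (u ^ (1 + α))⁻¹) 0 hq
  rw [mul_zero, integral_one_sub_rpow hα0 hα1 hβ] at h
  rw [setIntegral_congr_fun measurableSet_Ioi (fun u hu => scaled_rpow_eq hq hu),
    integral_const_mul, h, smul_eq_mul, Real.rpow_add hq, Real.rpow_one]
  field_simp

/-! ### Reduction of the finite differences to the first order -/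

/-- The integrand of the Marchaud integral with a first order difference. -/
def firstDiff (α : ℝ) (A : ℝ → ℂ) (τ : ℝ) : ℂ := ((τ ^ (1 + α))⁻¹ : ℝ) • (A 0 - A (-τ))

/-- The coefficients that express a difference of order `ℓ` through first differences. -/
def diffCoeff (α : ℝ) (ℓ j : ℕ) : ℝ := -((-1) ^ j * (ℓ.choose j : ℝ)) * (j : ℝ) ^ α

theorem sum_alternating_choose {ℓ : ℕ} (hℓ : 1 ≤ ℓ) :
    ∑ j ∈ Finset.range (ℓ + 1), ((-1) ^ j * (ℓ.choose j : ℝ)) = 0 := by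
  have h := Int.alternating_sum_range_choose_of_ne (n := ℓ) (by omega)
  exact_mod_cast h

/-- The alternating sum of the binomial coefficients vanishes for `ℓ ≥ 1`, so `A 0` can be
subtracted in every term. The additional factor `j` anticipates the Jacobian of `τ ↦ j τ`, after
which `diffCoeff α ℓ j` alone remains. -/
theorem marchaudIntegrand_eq_sum {α : ℝ} {ℓ : ℕ} (hℓ : 1 ≤ ℓ) (A : ℝ → ℂ) {τ : ℝ}
    (hτ : 0 < τ) :
    marchaudIntegrand α ℓ A τ =
      ∑ j ∈ Finset.range (ℓ + 1), (diffCoeff α ℓ j * j) • firstDiff α A (j * τ) := by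
  have h1 : ∑ j ∈ Finset.range (ℓ + 1), (diffCoeff α ℓ j * j) • firstDiff α A (j * τ) =
      ∑ j ∈ Finset.range (ℓ + 1), ((τ ^ (1 + α))⁻¹ : ℝ) •
        (((-1) ^ j * (ℓ.choose j : ℝ)) • A (0 - j * τ) - ((-1) ^ j * (ℓ.choose j : ℝ)) • A 0) := by
    refine Finset.sum_congr rfl fun j _ => ?_
    rcases Nat.eq_zero_or_pos j with rfl | hj
    · simp
    · have hj0 : (0 : ℝ) < j := by exact_mod_cast hj
      rw [firstDiff, Real.mul_rpow hj0.le hτ.le, ← smul_sub, smul_smul, smul_smul, diffCoeff,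
        ← neg_sub, smul_neg, ← neg_smul, zero_sub]
      congr 1
      have e : (j : ℝ) ^ (1 + α) = j * (j : ℝ) ^ α := by rw [Real.rpow_add hj0, Real.rpow_one]
      have := Real.rpow_pos_of_pos hj0 α
      have := Real.rpow_pos_of_pos hτ (1 + α)
      rw [e]; field_simp
  rw [h1, ← Finset.smul_sum, Finset.sum_sub_distrib, ← Finset.sum_smul, sum_alternating_choose hℓ,
    zero_smul, sub_zero]
  rfl

theorem integrableOn_firstDiff_mul {α : ℝ} {A : ℝ → ℂ}
    (h : ∀ ε : ℝ, 0 < ε → IntegrableOn (firstDiff α A) (Ioi ε)) {ε : ℝ} (hε : 0 < ε) (ℓ j : ℕ) :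
    IntegrableOn (fun τ => (diffCoeff α ℓ j * j) • firstDiff α A (j * τ)) (Ioi ε) := by
  rcases Nat.eq_zero_or_pos j with rfl | hj
  · simp
  · have hj0 : (0 : ℝ) < j := by exact_mod_cast hj
    refine Integrable.smul (c := diffCoeff α ℓ j * j) (f := fun τ => firstDiff α A (j * τ)) ?_
    exact (integrableOn_Ioi_comp_mul_left_iff (firstDiff α A) ε hj0).2 (h _ (by positivity))

theorem integrableOn_marchaudIntegrand {α : ℝ} {A : ℝ → ℂ}
    (h : ∀ ε : ℝ, 0 < ε → IntegrableOn (firstDiff α A) (Ioi ε)) {ℓ : ℕ} (hℓ : 1 ≤ ℓ) {ε : ℝ}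
    (hε : 0 < ε) : IntegrableOn (marchaudIntegrand α ℓ A) (Ioi ε) := by
  have h1 : IntegrableOn (fun τ => ∑ j ∈ Finset.range (ℓ + 1),
      (diffCoeff α ℓ j * j) • firstDiff α A (j * τ)) (Ioi ε) :=
    integrable_finsetSum _ fun j _ => integrableOn_firstDiff_mul h hε ℓ j
  exact h1.congr_fun (fun τ hτ => (marchaudIntegrand_eq_sum hℓ A (hε.trans hτ)).symm)
    measurableSet_Ioi

theorem integral_marchaudIntegrand {α : ℝ} (hα0 : 0 < α) {A : ℝ → ℂ}
    (h : ∀ ε : ℝ, 0 < ε → IntegrableOn (firstDiff α A) (Ioi ε)) {ℓ : ℕ} (hℓ : 1 ≤ ℓ) {ε : ℝ}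
    (hε : 0 < ε) :
    ∫ τ in Ioi ε, marchaudIntegrand α ℓ A τ =
      ∑ j ∈ Finset.range (ℓ + 1), diffCoeff α ℓ j • ∫ τ in Ioi (j * ε), firstDiff α A τ := by
  rw [setIntegral_congr_fun measurableSet_Ioi
    (fun τ hτ => marchaudIntegrand_eq_sum hℓ A (hε.trans hτ)),
    integral_finsetSum _ fun j _ => integrableOn_firstDiff_mul h hε ℓ j]
  refine Finset.sum_congr rfl fun j _ => ?_
  rw [integral_smul]
  rcases Nat.eq_zero_or_pos j with rfl | hj
  · simp [diffCoeff, Real.zero_rpow hα0.ne']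
  · have hj0 : (0 : ℝ) < j := by exact_mod_cast hj
    rw [integral_comp_mul_left_Ioi (firstDiff α A) ε hj0, smul_smul]
    congr 1
    field_simp

theorem tendsto_setIntegral_Ioi_zero {E : Type*} [NormedAddCommGroup E] [NormedSpace ℝ E]
    {g : ℝ → E} (hg : IntegrableOn g (Ioi 0)) :
    Tendsto (fun ε => ∫ τ in Ioi ε, g τ) (𝓝[>] 0) (𝓝 (∫ τ in Ioi 0, g τ)) := by
  have h : ∀ ε : ℝ, 0 < ε → ∫ τ in Ioi ε, g τ = ∫ τ in Ioi 0, (Ioi ε).indicator g τ := fun ε hε => by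
    rw [setIntegral_indicator measurableSet_Ioi, inter_eq_right.2 (Ioi_subset_Ioi hε.le)]
  refine Tendsto.congr' (f₁ := fun ε => ∫ τ in Ioi (0 : ℝ), (Ioi ε).indicator g τ) ?_ ?_
  · filter_upwards [self_mem_nhdsWithin] with ε hε using (h ε hε).symm
  refine tendsto_integral_filter_of_dominated_convergence (fun τ => ‖g τ‖) ?_ ?_ hg.norm ?_
  · exact Eventually.of_forall fun ε => hg.aestronglyMeasurable.indicator measurableSet_Ioi
  · exact Eventually.of_forall fun ε => Eventually.of_forall fun τ => norm_indicator_le_norm_self _ _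
  · filter_upwards [ae_restrict_mem measurableSet_Ioi] with τ hτ
    refine tendsto_const_nhds.congr' ?_
    filter_upwards [nhdsWithin_le_nhds (Iio_mem_nhds hτ)] with ε hε
    rw [indicator_of_mem (show τ ∈ Ioi ε from hε)]

theorem tendsto_sum_diffCoeff {α : ℝ} (hα0 : 0 < α) {D : ℝ → ℂ} {d : ℂ}
    (hd : Tendsto D (𝓝[>] 0) (𝓝 d)) (ℓ : ℕ) :
    Tendsto (fun ε => ∑ j ∈ Finset.range (ℓ + 1), diffCoeff α ℓ j • D (j * ε)) (𝓝[>] 0)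
      (𝓝 ((∑ j ∈ Finset.range (ℓ + 1), diffCoeff α ℓ j) • d)) := by
  rw [Finset.sum_smul]
  refine tendsto_finsetSum _ fun j _ => ?_
  rcases Nat.eq_zero_or_pos j with rfl | hj
  · simp [diffCoeff, Real.zero_rpow hα0.ne']
  · have hj0 : (0 : ℝ) < j := by exact_mod_cast hj
    refine (hd.comp ?_).const_smul _
    refine tendsto_nhdsWithin_iff.2 ⟨?_, ?_⟩
    · have : Tendsto (fun ε : ℝ => (j : ℝ) * ε) (𝓝 0) (𝓝 (j * 0)) :=
        (continuous_const.mul continuous_id).tendsto _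
      rw [mul_zero] at this
      exact this.mono_left nhdsWithin_le_nhds
    · filter_upwards [self_mem_nhdsWithin] with ε hε using mul_pos hj0 hε

theorem marchaudIntegrand_exp (α : ℝ) (ℓ : ℕ) (τ : ℝ) :
    marchaudIntegrand α ℓ (fun u => ((Real.exp u : ℝ) : ℂ)) τ =
      (((1 - Real.exp (-τ)) ^ ℓ / τ ^ (1 + α) : ℝ) : ℂ) := by
  have h : (1 - Real.exp (-τ)) ^ ℓ =
      ∑ j ∈ Finset.range (ℓ + 1), (-1) ^ j * (ℓ.choose j : ℝ) * Real.exp (0 - j * τ) := by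
    rw [show 1 - Real.exp (-τ) = -Real.exp (-τ) + 1 by ring, add_pow]
    refine Finset.sum_congr rfl fun j _ => ?_
    rw [neg_pow, ← Real.exp_nat_mul, one_pow, show 0 - j * τ = j * -τ by ring]; ring
  rw [marchaudIntegrand, finDiff, h]
  simp only [Complex.real_smul]
  push_cast
  rw [div_eq_mul_inv, mul_comm]

/-- Reduction to first differences is applied to `A u = e^u`, for which the integral of order `ℓ` is
the one that defines `kappa α ℓ`. Comparison of the limits as `ε → 0` determines the sum of the
coefficients. -/
theorem kappa_eq {α : ℝ} (hα0 : 0 < α) (hα1 : α < 1) {ℓ : ℕ} (hℓ : 1 ≤ ℓ) :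
    kappa α ℓ = (∑ j ∈ Finset.range (ℓ + 1), diffCoeff α ℓ j) * kappa α 1 := by
  have hfirst : ∀ τ, firstDiff α (fun u => ((Real.exp u : ℝ) : ℂ)) τ =
      (((1 - Real.exp (-τ)) ^ 1 / τ ^ (1 + α) : ℝ) : ℂ) := fun τ => by
    rw [firstDiff, Complex.real_smul]
    push_cast
    simp [div_eq_mul_inv, mul_comm]
  have hint : ∀ k : ℕ, 1 ≤ k → IntegrableOn
      (fun τ : ℝ => (((1 - Real.exp (-τ)) ^ k / τ ^ (1 + α) : ℝ) : ℂ)) (Ioi 0) := fun k hk =>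
    (integrableOn_kappa hα0 hα1 hk).ofReal
  have hlim : ∀ k : ℕ, 1 ≤ k → Tendsto (fun ε => ∫ τ in Ioi ε,
      (((1 - Real.exp (-τ)) ^ k / τ ^ (1 + α) : ℝ) : ℂ)) (𝓝[>] 0) (𝓝 (kappa α k : ℂ)) := fun k hk => by
    have := tendsto_setIntegral_Ioi_zero (hint k hk)
    rwa [integral_complex_ofReal] at this
  have h1 : ∀ ε : ℝ, 0 < ε → IntegrableOn (firstDiff α (fun u => ((Real.exp u : ℝ) : ℂ))) (Ioi ε) :=
    fun ε hε => by
      simp only [funext hfirst]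
      exact (hint 1 le_rfl).mono_set (Ioi_subset_Ioi hε.le)
  have hA := tendsto_sum_diffCoeff hα0 (D := fun ε => ∫ τ in Ioi ε,
    firstDiff α (fun u => ((Real.exp u : ℝ) : ℂ)) τ) (d := (kappa α 1 : ℂ))
    (by simpa only [hfirst] using hlim 1 le_rfl) ℓ
  have hB := (hlim ℓ hℓ).congr' (f₂ := fun ε : ℝ => ∑ j ∈ Finset.range (ℓ + 1), diffCoeff α ℓ j •
    ∫ τ in Ioi (j * ε), firstDiff α (fun u => ((Real.exp u : ℝ) : ℂ)) τ) (by
      filter_upwards [self_mem_nhdsWithin] with ε hε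
      rw [← integral_marchaudIntegrand hα0 h1 hℓ hε]
      simp only [marchaudIntegrand_exp])
  have := tendsto_nhds_unique hB hA
  rw [Complex.real_smul] at this
  exact_mod_cast this

/-- The integral of order `ℓ` is a combination of first order integrals truncated at `j ε`, all with
the limit `d`. The sum of the coefficients is `κ(α, ℓ) / κ(α, 1)`, so the normalized limit does not
depend on `ℓ`. -/
theorem tendsto_marchaud {α : ℝ} (hα0 : 0 < α) (hα1 : α < 1) {A : ℝ → ℂ} {d : ℂ}
    (h : ∀ ε : ℝ, 0 < ε → IntegrableOn (firstDiff α A) (Ioi ε))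
    (hd : Tendsto (fun ε => ∫ τ in Ioi ε, firstDiff α A τ) (𝓝[>] 0) (𝓝 d)) {ℓ : ℕ} (hℓ : 1 ≤ ℓ) :
    Tendsto (fun ε => (kappa α ℓ)⁻¹ • ∫ τ in Ioi ε, marchaudIntegrand α ℓ A τ) (𝓝[>] 0)
      (𝓝 ((kappa α 1)⁻¹ • d)) := by
  have hA := (tendsto_sum_diffCoeff hα0 hd ℓ).const_smul (kappa α ℓ)⁻¹
  have hk := kappa_pos hα0 hα1 hℓ
  have h1 := kappa_pos hα0 hα1 (ℓ := 1) le_rfl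
  have e : (kappa α ℓ)⁻¹ * (∑ j ∈ Finset.range (ℓ + 1), diffCoeff α ℓ j) = (kappa α 1)⁻¹ := by
    have := kappa_eq hα0 hα1 hℓ
    field_simp
    linarith
  rw [smul_smul, e] at hA
  refine hA.congr' ?_
  filter_upwards [self_mem_nhdsWithin] with ε hε
  rw [integral_marchaudIntegrand hα0 h hℓ hε]

theorem hasLeftT_of_tendsto {n : ℕ} {α : ℝ} (hα0 : 0 < α) (hα1 : α < 1) {f : Sph (n + 1) → ℂ}
    {x : Sph (n + 1)} {d : ℂ}
    (h : ∀ ε : ℝ, 0 < ε → IntegrableOn (firstDiff α (leftAux n α f x)) (Ioi ε))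
    (hd : Tendsto (fun ε => ∫ τ in Ioi ε, firstDiff α (leftAux n α f x) τ) (𝓝[>] 0) (𝓝 d)) :
    HasLeftT n α f x
      ((2 ^ (-α) * (1 + tanSq x) ^ (α + (n : ℝ) / 2) * (kappa α 1)⁻¹ : ℝ) • d) := by
  intro ℓ hℓ
  have hℓ1 : 1 ≤ ℓ := by
    rcases Nat.eq_zero_or_pos ℓ with rfl | h
    · simp at hℓ; linarith
    · exact h
  refine ⟨fun ε hε => integrableOn_marchaudIntegrand h hℓ1 hε, ?_⟩
  have := (tendsto_marchaud hα0 hα1 h hd hℓ1).const_smul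
    (2 ^ (-α) * (1 + tanSq x) ^ (α + (n : ℝ) / 2))
  rw [smul_smul] at this
  refine this.congr fun ε => ?_
  rw [leftT, smul_smul]
  congr 1; ring

theorem hasRightT_of_tendsto {n : ℕ} {α : ℝ} (hα0 : 0 < α) (hα1 : α < 1) {f : Sph (n + 1) → ℂ}
    {x : Sph (n + 1)} {d : ℂ}
    (h : ∀ ε : ℝ, 0 < ε → IntegrableOn (firstDiff α (rightAux n α f x)) (Ioi ε))
    (hd : Tendsto (fun ε => ∫ τ in Ioi ε, firstDiff α (rightAux n α f x) τ) (𝓝[>] 0) (𝓝 d)) :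
    HasRightT n α f x
      ((2 ^ (-α) * (1 + tanSq x) ^ (α + (n : ℝ) / 2) * (kappa α 1)⁻¹ : ℝ) • d) := by
  intro ℓ hℓ
  have hℓ1 : 1 ≤ ℓ := by
    rcases Nat.eq_zero_or_pos ℓ with rfl | h
    · simp at hℓ; linarith
    · exact h
  refine ⟨fun ε hε => integrableOn_marchaudIntegrand h hℓ1 hε, ?_⟩
  have := (tendsto_marchaud hα0 hα1 h hd hℓ1).const_smul
    (2 ^ (-α) * (1 + tanSq x) ^ (α + (n : ℝ) / 2))
  rw [smul_smul] at this
  refine this.congr fun ε => ?_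
  rw [rightT, smul_smul]
  congr 1; ring

/-! ### The integrals that produce the coefficient of the closed form -/

theorem integrableOn_right_const {α m q : ℝ} (hα0 : 0 < α) (hα1 : α < 1) (hm : 1 ≤ m) (hq : 0 < q) :
    IntegrableOn (fun τ : ℝ => (q ^ (α - m) - (q + τ) ^ (α - m)) * (τ ^ (1 + α))⁻¹) (Ioi 0) ∧
    ∫ τ in Ioi (0 : ℝ), (q ^ (α - m) - (q + τ) ^ (α - m)) * (τ ^ (1 + α))⁻¹ =
      q ^ (-m) * marchaudConst α (m - α) := by
  have hq' : 0 < q⁻¹ := inv_pos.2 hq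
  have e : ∀ τ ∈ Ioi (0 : ℝ), q ^ (α - m) * ((1 - (1 + q⁻¹ * τ) ^ (-(m - α))) * (τ ^ (1 + α))⁻¹) =
      (q ^ (α - m) - (q + τ) ^ (α - m)) * (τ ^ (1 + α))⁻¹ := fun τ hτ => by
    have hτ0 : (0 : ℝ) < τ := hτ
    rw [show q + τ = q * (1 + q⁻¹ * τ) by field_simp, Real.mul_rpow hq.le (by positivity), neg_sub]
    ring
  have hI : IntegrableOn (fun τ : ℝ =>
      q ^ (α - m) * ((1 - (1 + q⁻¹ * τ) ^ (-(m - α))) * (τ ^ (1 + α))⁻¹)) (Ioi 0) :=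
    (integrableOn_one_sub_rpow_mul hα0 hα1 (by linarith : 0 < m - α) hq').const_mul _
  refine ⟨hI.congr_fun e measurableSet_Ioi, ?_⟩
  rw [← setIntegral_congr_fun measurableSet_Ioi e, integral_const_mul,
    integral_one_sub_rpow_mul hα0 hα1 (by linarith) hq', Real.inv_rpow hq.le, ← Real.rpow_neg hq.le,
    ← mul_assoc, ← Real.rpow_add hq]
  congr 2; ring

theorem marchaudConst_one_sub {α : ℝ} (hα0 : 0 < α) (hα1 : α < 1) :
    marchaudConst α (1 - α) = 1 / α := by
  have := Real.Gamma_pos_of_pos (sub_pos.2 hα1)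
  rw [marchaudConst, kappa_one hα0 hα1, sub_add_cancel, Real.Gamma_one]
  field_simp

theorem image_div_one_add {t q : ℝ} (ht : 0 < t) (hq : 0 < q) :
    (fun u : ℝ => t * (u * q) / (1 + u * q)) '' Ioi 0 = Ioo 0 t := by
  ext τ
  constructor
  · rintro ⟨u, hu, rfl⟩
    have hu0 : (0 : ℝ) < u := hu
    refine ⟨by positivity, ?_⟩
    rw [div_lt_iff₀ (by positivity)]; nlinarith [mul_pos hu0 hq]
  · rintro ⟨h0, h1⟩
    have h2 : 0 < t - τ := by linarith
    refine ⟨τ / (t - τ) / q, by simp only [mem_Ioi]; positivity, ?_⟩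
    simp only
    field_simp
    ring

theorem injOn_div_one_add {t q : ℝ} (ht : 0 < t) (hq : 0 < q) :
    InjOn (fun u : ℝ => t * (u * q) / (1 + u * q)) (Ioi 0) := by
  intro u hu v hv h
  have hu0 : (0 : ℝ) < u := hu
  have hv0 : (0 : ℝ) < v := hv
  simp only at h
  rw [div_eq_div_iff (by positivity) (by positivity)] at h
  have : t * q * (u - v) = 0 := by linarith
  have h3 : u - v = 0 := by
    rcases mul_eq_zero.1 this with h | h
    · exact absurd h (by positivity)
    · exact h
  linarith

/-- The weight of the left-sided function, a function of `τ = -u`. -/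
def leftWeight (α m t τ : ℝ) : ℝ :=
  if τ < t then (1 - τ / t) ^ (m - 1) * (1 + t - τ) ^ (α - m) else 0

/-- With `q = 1 + t`, the substitution `τ = t u q / (1 + u q)` turns `1 - τ / t` into `1 / (1 + u
q)` and `q - τ` into `q (1 + u) / (1 + u q)`. The integrand becomes a difference of two integrands
of the type `(1 - (1 + p u)^{-β}) u^{-1-α}`, with `β = m - α` and `β = 1 - α`. -/
theorem left_const_subst {α m t u : ℝ} (ht : 0 < t) (hu : 0 < u) :
    |t * (1 + t) / (1 + u * (1 + t)) ^ 2| *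
      (((1 + t) ^ (α - m) - leftWeight α m t (t * (u * (1 + t)) / (1 + u * (1 + t)))) *
        ((t * (u * (1 + t)) / (1 + u * (1 + t))) ^ (1 + α))⁻¹) =
    (1 + t) ^ (-m) * t ^ (-α) * ((1 - (1 + 1 * u) ^ (-(m - α))) * (u ^ (1 + α))⁻¹ -
      (1 - (1 + (1 + t) * u) ^ (-(1 - α))) * (u ^ (1 + α))⁻¹) := by
  set q := 1 + t with hq
  have hq0 : 0 < q := by linarith
  have hr : 0 < 1 + u * q := by positivity
  have hlt : t * (u * q) / (1 + u * q) < t := by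
    rw [div_lt_iff₀ hr]; nlinarith [mul_pos hu hq0]
  rw [leftWeight, if_pos hlt, ← hq, show 1 - t * (u * q) / (1 + u * q) / t = (1 + u * q)⁻¹ by
    field_simp; ring, show q - t * (u * q) / (1 + u * q) = q * (1 + u) * (1 + u * q)⁻¹ by
    field_simp; rw [hq]; ring, abs_of_pos (by positivity), div_eq_mul_inv (t * (u * q)),
    Real.mul_rpow (x := t * (u * q)) (by positivity) (by positivity), Real.mul_rpow ht.le (by positivity),
    Real.mul_rpow hu.le hq0.le, Real.mul_rpow (x := q * (1 + u)) (by positivity) (by positivity),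
    Real.mul_rpow hq0.le (by positivity), one_mul, mul_comm q u]
  set r := 1 + u * q
  have h1 : (r⁻¹) ^ (m - 1) * (q ^ (α - m) * (1 + u) ^ (α - m) * (r⁻¹) ^ (α - m)) =
      q ^ (α - m) * (1 + u) ^ (α - m) * r ^ (1 - α) := by
    have : (r⁻¹) ^ (m - 1) * (r⁻¹) ^ (α - m) = r ^ (1 - α) := by
      rw [← Real.rpow_add (by positivity), Real.inv_rpow hr.le, ← Real.rpow_neg hr.le]
      congr 1; ring
    rw [← this]; ring
  have h2 : (r⁻¹) ^ (1 + α) = (r ^ 2)⁻¹ * r ^ (1 - α) := by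
    rw [Real.inv_rpow hr.le, ← Real.rpow_natCast, ← Real.rpow_neg hr.le, ← Real.rpow_neg hr.le,
      ← Real.rpow_add hr]
    congr 1; push_cast; ring
  have h3 : r ^ (-(1 - α)) = (r ^ (1 - α))⁻¹ := Real.rpow_neg hr.le _
  have h4 : q ^ (α - m) = q ^ α * q ^ (-m) := by rw [← Real.rpow_add hq0]; congr 1
  have h5 : q ^ (1 + α) = q * q ^ α := by rw [Real.rpow_add hq0, Real.rpow_one]
  have h6 : t ^ (1 + α) = t * t ^ α := by rw [Real.rpow_add ht, Real.rpow_one]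
  have h7 : t ^ (-α) = (t ^ α)⁻¹ := Real.rpow_neg ht.le _
  rw [h1, h2, h3, h4, h5, h6, h7, neg_sub m α]
  have := Real.rpow_pos_of_pos hr (1 - α)
  have := Real.rpow_pos_of_pos hq0 α
  have := Real.rpow_pos_of_pos ht α
  have := Real.rpow_pos_of_pos hu (1 + α)
  have hr0 := hr.ne'
  clear_value r
  field_simp
  ring

/-- On `(0, t)` the part with exponent `1 - α` contributes `-(1 + t)^{α-m} t^{-α} / α`. It cancels
against the tail `τ ≥ t`, where the weight is zero, and the part with exponent `m - α` survives. -/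
theorem integrableOn_left_const {α m t : ℝ} (hα0 : 0 < α) (hα1 : α < 1) (hm : 1 ≤ m) (ht : 0 < t) :
    IntegrableOn (fun τ : ℝ => ((1 + t) ^ (α - m) - leftWeight α m t τ) * (τ ^ (1 + α))⁻¹) (Ioi 0) ∧
    ∫ τ in Ioi (0 : ℝ), ((1 + t) ^ (α - m) - leftWeight α m t τ) * (τ ^ (1 + α))⁻¹ =
      t ^ (-α) * (1 + t) ^ (-m) * marchaudConst α (m - α) := by
  have hq : 0 < 1 + t := by linarith
  set F := fun τ : ℝ => ((1 + t) ^ (α - m) - leftWeight α m t τ) * (τ ^ (1 + α))⁻¹ with hF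
  have hder : ∀ u ∈ Ioi (0 : ℝ), HasDerivWithinAt (fun u : ℝ => t * (u * (1 + t)) / (1 + u * (1 + t)))
      (t * (1 + t) / (1 + u * (1 + t)) ^ 2) (Ioi 0) u := fun u hu => by
    have hu0 : (0 : ℝ) < u := hu
    have h1 : HasDerivAt (fun u : ℝ => t * (u * (1 + t))) (t * (1 * (1 + t))) u :=
      ((hasDerivAt_id u).mul_const (1 + t)).const_mul t
    have h2 : HasDerivAt (fun u : ℝ => 1 + u * (1 + t)) (1 * (1 + t)) u :=
      ((hasDerivAt_id u).mul_const (1 + t)).const_add 1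
    refine ((h1.div h2 (by positivity)).congr_deriv ?_).hasDerivWithinAt
    congr 1; ring
  have i1 := integrableOn_one_sub_rpow_mul hα0 hα1 (by linarith : 0 < m - α) one_pos
  have i2 := integrableOn_one_sub_rpow_mul hα0 hα1 (by linarith : 0 < 1 - α) hq
  have i3 : IntegrableOn (fun u : ℝ => (1 + t) ^ (-m) * t ^ (-α) *
      ((1 - (1 + 1 * u) ^ (-(m - α))) * (u ^ (1 + α))⁻¹ -
      (1 - (1 + (1 + t) * u) ^ (-(1 - α))) * (u ^ (1 + α))⁻¹)) (Ioi 0) := (i1.sub i2).const_mul _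
  have hA : IntegrableOn F (Ioo 0 t) := by
    rw [← image_div_one_add ht hq, integrableOn_image_iff_integrableOn_abs_deriv_smul
      measurableSet_Ioi hder (injOn_div_one_add ht hq)]
    exact i3.congr_fun (fun u hu => (left_const_subst ht hu).symm) measurableSet_Ioi
  have hAv : ∫ τ in Ioo 0 t, F τ = (1 + t) ^ (-m) * t ^ (-α) *
      (marchaudConst α (m - α) - (1 + t) ^ α / α) := by
    rw [← image_div_one_add ht hq, integral_image_eq_integral_abs_deriv_smul
      measurableSet_Ioi hder (injOn_div_one_add ht hq)]
    refine (setIntegral_congr_fun measurableSet_Ioi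
      (fun u hu => left_const_subst (α := α) (m := m) ht hu)).trans ?_
    rw [integral_const_mul, integral_sub i1 i2, integral_one_sub_rpow_mul hα0 hα1 (by linarith) one_pos,
      integral_one_sub_rpow_mul hα0 hα1 (by linarith) hq, marchaudConst_one_sub hα0 hα1, Real.one_rpow,
      one_mul, mul_one_div]
  have hpt : ∀ τ ∈ Ici t, (1 + t) ^ (α - m) * τ ^ (-1 - α) = F τ := fun τ hτ => by
    have hτ0 : 0 < τ := ht.trans_le hτ
    simp only [hF]
    rw [leftWeight, if_neg (not_lt.2 hτ), sub_zero, rpow_inv_one_add hτ0]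
  have hB : IntegrableOn F (Ici t) := by
    have : IntegrableOn (fun τ : ℝ => (1 + t) ^ (α - m) * τ ^ (-1 - α)) (Ici t) :=
      ((integrableOn_Ici_iff_integrableOn_Ioi).2
        (integrableOn_Ioi_rpow_of_lt (by linarith) ht)).const_mul _
    exact this.congr_fun hpt measurableSet_Ici
  have hBv : ∫ τ in Ici t, F τ = (1 + t) ^ (α - m) * (t ^ (-α) / α) := by
    rw [← setIntegral_congr_fun measurableSet_Ici hpt, integral_Ici_eq_integral_Ioi,
      integral_const_mul, integral_Ioi_rpow_of_lt (by linarith) ht, show -1 - α + 1 = -α by ring]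
    congr 1; rw [neg_div_neg_eq]
  rw [← Ioo_union_Ici_eq_Ioi ht]
  refine ⟨hA.union hB, ?_⟩
  have hdis : Disjoint (Ioo 0 t) (Ici t) := Set.disjoint_left.2 fun τ h1 h2 => not_lt.2 h2 h1.2
  rw [setIntegral_union hdis measurableSet_Ici hA hB, hAv, hBv,
    show α - m = α + -m by ring, Real.rpow_add hq]
  field_simp
  ring

/-! ### Inversion of the one-sided fractional integral on the half-line -/

/-- The kernel that turns up when the Marchaud integral, truncated at `ε`, is applied to a
fractional integral. -/
def truncKer (α ε w : ℝ) : ℝ := ε ^ (-α) * (w ^ (α - 1) - (max (w - ε) 0) ^ α / w)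

/-- A nonincreasing integrable majorant of `truncKer`. -/
def truncMaj (α ε w : ℝ) : ℝ := min (ε ^ (-α) * w ^ (α - 1)) (ε ^ (1 - α) * w ^ (α - 2))

theorem measurable_truncKer (α ε : ℝ) : Measurable (truncKer α ε) := by
  unfold truncKer; fun_prop

theorem measurable_truncMaj (α ε : ℝ) : Measurable (truncMaj α ε) := by
  unfold truncMaj; fun_prop

theorem truncMaj_nonneg {α ε w : ℝ} (hε : 0 < ε) (hw : 0 < w) : 0 ≤ truncMaj α ε w := by
  refine le_min ?_ ?_ <;> positivity

theorem truncKer_nonneg {α ε w : ℝ} (hα0 : 0 < α) (hε : 0 < ε) (hw : 0 < w) :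
    0 ≤ truncKer α ε w := by
  refine mul_nonneg (by positivity) (sub_nonneg.2 ?_)
  rw [Real.rpow_sub_one hw.ne']
  have : (max (w - ε) 0) ^ α ≤ w ^ α :=
    Real.rpow_le_rpow (le_max_right _ _) (max_le (by linarith) hw.le) hα0.le
  gcongr

theorem truncKer_le {α ε w : ℝ} (hα1 : α < 1) (hε : 0 < ε) (hw : 0 < w) :
    truncKer α ε w ≤ truncMaj α ε w := by
  have h0 : 0 ≤ (max (w - ε) 0) ^ α / w :=
    div_nonneg (Real.rpow_nonneg (le_max_right _ _) _) hw.le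
  have h1 : truncKer α ε w ≤ ε ^ (-α) * w ^ (α - 1) := by
    rw [truncKer]
    gcongr
    linarith
  refine le_min h1 ?_
  have e1 : ε ^ (1 - α) = ε ^ (-α) * ε := by
    rw [show 1 - α = -α + 1 by ring, Real.rpow_add hε, Real.rpow_one]
  have e2 : w ^ (α - 1) = w ^ (α - 2) * w := by
    rw [show α - 1 = α - 2 + 1 by ring, Real.rpow_add hw, Real.rpow_one]
  rcases le_total w ε with h | h
  · refine h1.trans ?_
    rw [e1, e2, mul_assoc, mul_comm (w ^ (α - 2))]
    gcongr
  · rw [truncKer, max_eq_left (by linarith), e1, mul_assoc]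
    gcongr
    have hb0 : 0 ≤ 1 - ε / w := sub_nonneg.2 ((div_le_one hw).2 h)
    -- A number in `[0, 1]` is at most its power of exponent `α < 1`; hence the difference of powers
    -- in the kernel gains a factor `ε / w`.
    have hb : 1 - ε / w ≤ (1 - ε / w) ^ α :=
      Real.self_le_rpow_of_le_one hb0 (by linarith [div_pos hε hw]) hα1.le
    have e3 : (w - ε) ^ α = w ^ (α - 1) * w * (1 - ε / w) ^ α := by
      rw [show w - ε = w * (1 - ε / w) by field_simp, Real.mul_rpow hw.le hb0,
        Real.rpow_sub_one hw.ne']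
      field_simp
    have hp : 0 ≤ w ^ (α - 1) := by positivity
    calc w ^ (α - 1) - (w - ε) ^ α / w = w ^ (α - 1) * (1 - (1 - ε / w) ^ α) := by
          rw [e3]; field_simp
      _ ≤ w ^ (α - 1) * (ε / w) := by gcongr; linarith
      _ = ε * w ^ (α - 2) := by rw [e2]; field_simp

theorem integrableOn_truncMaj {α ε : ℝ} (hα0 : 0 < α) (hα1 : α < 1) (hε : 0 < ε) :
    IntegrableOn (truncMaj α ε) (Ioi 0) := by
  have hm := (measurable_truncMaj α ε).aestronglyMeasurable (μ := volume.restrict (Ioc 0 ε))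
  have hm2 := (measurable_truncMaj α ε).aestronglyMeasurable (μ := volume.restrict (Ioi ε))
  rw [← Ioc_union_Ioi_eq_Ioi hε.le]
  refine IntegrableOn.union ?_ ?_
  · have h : IntegrableOn (fun w : ℝ => ε ^ (-α) * w ^ (α - 1)) (Ioc 0 ε) :=
      ((intervalIntegral.intervalIntegrable_rpow' (by linarith)).1).const_mul _
    refine Integrable.mono' h hm ?_
    filter_upwards [ae_restrict_mem measurableSet_Ioc] with w hw
    rw [Real.norm_of_nonneg (truncMaj_nonneg hε hw.1)]
    exact min_le_left _ _
  · have h : IntegrableOn (fun w : ℝ => ε ^ (1 - α) * w ^ (α - 2)) (Ioi ε) :=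
      (integrableOn_Ioi_rpow_of_lt (by linarith) hε).const_mul _
    refine Integrable.mono' h hm2 ?_
    filter_upwards [ae_restrict_mem measurableSet_Ioi] with w hw
    rw [Real.norm_of_nonneg (truncMaj_nonneg hε (hε.trans hw))]
    exact min_le_right _ _

theorem lintegral_truncMaj_le {α ε : ℝ} (hα0 : 0 < α) (hα1 : α < 1) (hε : 0 < ε) :
    ∫⁻ w in Ioi (0 : ℝ), ENNReal.ofReal (truncMaj α ε w) ≤
      ENNReal.ofReal (1 / α + 1 / (1 - α)) := by
  rw [← ofReal_integral_eq_lintegral_ofReal (integrableOn_truncMaj hα0 hα1 hε) (by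
    filter_upwards [ae_restrict_mem measurableSet_Ioi] with w hw using truncMaj_nonneg hε hw)]
  refine ENNReal.ofReal_le_ofReal ?_
  have hI := integrableOn_truncMaj hα0 hα1 hε
  have h : IntegrableOn (fun w : ℝ => ε ^ (-α) * w ^ (α - 1)) (Ioc 0 ε) :=
    ((intervalIntegral.intervalIntegrable_rpow' (by linarith)).1).const_mul _
  have h' : IntegrableOn (fun w : ℝ => ε ^ (1 - α) * w ^ (α - 2)) (Ioi ε) :=
    (integrableOn_Ioi_rpow_of_lt (by linarith) hε).const_mul _
  have hd : Disjoint (Ioc 0 ε) (Ioi ε) := Ioc_disjoint_Ioi le_rfl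
  rw [← Ioc_union_Ioi_eq_Ioi hε.le] at hI ⊢
  rw [setIntegral_union hd measurableSet_Ioi hI.left_of_union hI.right_of_union]
  refine add_le_add ?_ ?_
  · refine (setIntegral_mono hI.left_of_union h fun w => min_le_left _ _).trans ?_
    rw [integral_const_mul, ← intervalIntegral.integral_of_le hε.le,
      integral_rpow (Or.inl (by linarith)), sub_add_cancel, Real.zero_rpow hα0.ne', sub_zero,
      Real.rpow_neg hε.le]
    have := Real.rpow_pos_of_pos hε α
    field_simp
    exact le_rfl
  · refine (setIntegral_mono hI.right_of_union h' fun w => min_le_right _ _).trans ?_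
    rw [integral_const_mul, integral_Ioi_rpow_of_lt (by linarith) hε,
      show α - 2 + 1 = -(1 - α) by ring, Real.rpow_neg hε.le]
    have := Real.rpow_pos_of_pos hε (1 - α)
    have : 1 - α ≠ 0 := by linarith
    field_simp
    exact le_rfl

/-- Between `w` and `2 w` the majorant falls by a factor of at most `4`, because its exponents lie
in `[-2, 0]`; so it is dominated by its logarithmic average over `(w, 2 w)`. This makes the kernel a
superposition of shells. -/
theorem truncMaj_le_lintegral {α ε w : ℝ} (hα0 : 0 < α) (hα1 : α < 1) (hε : 0 < ε) (hw : 0 < w) :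
    ENNReal.ofReal (truncMaj α ε w) ≤
      8 * ∫⁻ r in Ioo w (2 * w), ENNReal.ofReal (truncMaj α ε r) * ENNReal.ofReal r⁻¹ := by
  have hlow : ∀ r ∈ Ioo w (2 * w), ENNReal.ofReal (truncMaj α ε w / 4 * (2 * w)⁻¹) ≤
      ENNReal.ofReal (truncMaj α ε r) * ENNReal.ofReal r⁻¹ := fun r hr => by
    have hr0 : 0 < r := hw.trans hr.1
    rw [← ENNReal.ofReal_mul (truncMaj_nonneg hε hr0)]
    refine ENNReal.ofReal_le_ofReal ?_
    have hpow : ∀ s : ℝ, -2 ≤ s → s ≤ 0 → w ^ s / 4 ≤ r ^ s := fun s hs hs0 => by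
      have h1 : (2 * w) ^ s ≤ r ^ s := Real.rpow_le_rpow_of_nonpos hr0 hr.2.le hs0
      have h2 : (1 : ℝ) / 4 ≤ 2 ^ s := by
        have := Real.rpow_le_rpow_of_exponent_le (one_le_two (α := ℝ)) hs
        refine le_trans (le_of_eq ?_) this
        rw [show (-2 : ℝ) = ((-2 : ℤ) : ℝ) by norm_num, Real.rpow_intCast]; norm_num
      rw [Real.mul_rpow (by norm_num) hw.le] at h1
      have := Real.rpow_pos_of_pos hw s
      nlinarith
    have h1 : truncMaj α ε w / 4 ≤ truncMaj α ε r := by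
      refine le_min ?_ ?_
      · refine (div_le_div_of_nonneg_right (min_le_left _ _) (by norm_num)).trans ?_
        rw [mul_div_assoc]
        gcongr
        exact hpow _ (by linarith) (by linarith)
      · refine (div_le_div_of_nonneg_right (min_le_right _ _) (by norm_num)).trans ?_
        rw [mul_div_assoc]
        gcongr
        exact hpow _ (by linarith) (by linarith)
    have h2 := truncMaj_nonneg (α := α) hε hr0
    have h3 : (2 * w)⁻¹ ≤ r⁻¹ := by gcongr; exact hr.2.le
    have : 0 ≤ (2 * w)⁻¹ := by positivity
    exact mul_le_mul h1 h3 this h2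
  have h := setLIntegral_mono' (μ := volume) measurableSet_Ioo hlow
  rw [setLIntegral_const, Real.volume_Ioo] at h
  refine le_trans (le_of_eq ?_) (mul_le_mul_right h 8)
  have := truncMaj_nonneg (α := α) hε hw
  rw [← ENNReal.ofReal_mul (by positivity), show (8 : ℝ≥0∞) = ENNReal.ofReal 8 by norm_num,
    ← ENNReal.ofReal_mul (by norm_num)]
  congr 1; field_simp; ring

/-- After the majorant is replaced by its averages over `(w, 2 w)` and the order of integration is
reversed, the inner integral is the average of `g` over the shell `(r/2, r)`, which is at most `η`.
Only `r < 2 δ` occurs, and the mass of the majorant is bounded uniformly in `ε`. -/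
theorem lintegral_truncMaj_mul_le {α ε δ : ℝ} (hα0 : 0 < α) (hα1 : α < 1) (hε : 0 < ε)
    {g : ℝ → ℝ≥0∞} (hg : AEMeasurable g (volume.restrict (Ioi 0))) {η : ℝ≥0∞}
    (hη : ∀ r ∈ Ioo 0 (2 * δ), ENNReal.ofReal r⁻¹ * ∫⁻ w in Ioo (r / 2) r, g w ≤ η) :
    ∫⁻ w in Ioo 0 δ, ENNReal.ofReal (truncMaj α ε w) * g w ≤
      8 * ENNReal.ofReal (1 / α + 1 / (1 - α)) * η := by
  set S : Set (ℝ × ℝ) := {p | p.1 < δ ∧ p.1 < p.2 ∧ p.2 < 2 * p.1} with hS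
  have hSm : MeasurableSet S := by
    refine (measurableSet_lt measurable_fst measurable_const).inter
      ((measurableSet_lt measurable_fst measurable_snd).inter
        (measurableSet_lt measurable_snd (measurable_fst.const_mul 2)))
  set Φ : ℝ × ℝ → ℝ≥0∞ := S.indicator
    fun p => ENNReal.ofReal (truncMaj α ε p.2) * ENNReal.ofReal p.2⁻¹ * g p.1 with hΦ
  have hM := measurable_truncMaj α ε
  have hΦm : AEMeasurable Φ ((volume.restrict (Ioi 0)).prod (volume.restrict (Ioi 0))) := by
    refine AEMeasurable.indicator (AEMeasurable.mul (Measurable.aemeasurable (by fun_prop)) ?_) hSm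
    exact hg.comp_quasiMeasurePreserving Measure.quasiMeasurePreserving_fst
  have h1 : ∫⁻ w in Ioo 0 δ, ENNReal.ofReal (truncMaj α ε w) * g w ≤
      8 * ∫⁻ w in Ioi (0 : ℝ), ∫⁻ r in Ioi (0 : ℝ), Φ (w, r) := by
    rw [← lintegral_const_mul' _ _ (by norm_num)]
    refine (setLIntegral_mono' measurableSet_Ioo fun w hw => ?_).trans
      (lintegral_mono_set (fun w hw => hw.1))
    rw [← lintegral_const_mul' _ _ (by norm_num)]
    calc ENNReal.ofReal (truncMaj α ε w) * g w ≤
        (8 * ∫⁻ r in Ioo w (2 * w), ENNReal.ofReal (truncMaj α ε r) * ENNReal.ofReal r⁻¹) * g w := by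
          gcongr; exact truncMaj_le_lintegral hα0 hα1 hε hw.1
      _ = ∫⁻ r in Ioo w (2 * w), 8 * Φ (w, r) := by
          rw [← lintegral_const_mul _ (by fun_prop), ← lintegral_mul_const _ (by fun_prop)]
          refine setLIntegral_congr_fun measurableSet_Ioo fun r hr => ?_
          rw [hΦ, indicator_of_mem (show (w, r) ∈ S from ⟨hw.2, hr.1, hr.2⟩), mul_assoc]
      _ ≤ _ := lintegral_mono_set (fun r hr => hw.1.trans hr.1)
  refine h1.trans ?_
  rw [lintegral_lintegral_swap (f := fun w r => Φ (w, r)) hΦm, mul_assoc, mul_comm (ENNReal.ofReal _)]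
  gcongr
  refine le_trans ?_ (mul_le_mul_right (lintegral_truncMaj_le hα0 hα1 hε) η)
  rw [← lintegral_const_mul _ (by fun_prop)]
  refine setLIntegral_mono' measurableSet_Ioi fun r hr => ?_
  have hr0 : (0 : ℝ) < r := hr
  have h2 : ∀ w, Φ (w, r) ≤ (if r < 2 * δ then ENNReal.ofReal (truncMaj α ε r) *
      ENNReal.ofReal r⁻¹ else 0) * (Ioo (r / 2) r).indicator g w := fun w => by
    rw [hΦ]
    by_cases hw : (w, r) ∈ S
    · have hw' := hw
      simp only [hS, mem_ofPred_eq] at hw'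
      rw [indicator_of_mem hw, if_pos (by linarith),
        indicator_of_mem (show w ∈ Ioo (r / 2) r from ⟨by linarith, by linarith⟩)]
    · rw [indicator_of_notMem hw]; exact zero_le
  refine (lintegral_mono h2).trans ?_
  split_ifs with hrδ
  · rw [lintegral_const_mul' _ _ (by finiteness)]
    have hsub : Ioo (r / 2) r ⊆ Ioi 0 := fun w hw => (by positivity : (0 : ℝ) < r / 2).trans hw.1
    rw [setLIntegral_indicator measurableSet_Ioo, inter_eq_left.2 hsub]
    rw [mul_assoc, mul_comm η]
    gcongr
    exact hη r ⟨hr0, hrδ⟩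
  · simp

theorem integral_truncated_beta {α ε w : ℝ} (hα0 : 0 < α) (hε : 0 < ε) (hw : ε < w) :
    IntegrableOn (fun τ : ℝ => (τ ^ (1 + α))⁻¹ * (w - τ) ^ (α - 1)) (Ioo ε w) ∧
    ∫ τ in Ioo ε w, (τ ^ (1 + α))⁻¹ * (w - τ) ^ (α - 1) = (w - ε) ^ α / w * ε ^ (-α) / α := by
  have hw0 : 0 < w := hε.trans hw
  -- An elementary primitive exists because the exponents `-1 - α` and `α - 1` add up to `-2`; it
  -- vanishes at `τ = w`.
  set F : ℝ → ℝ := fun τ => -((w - τ) ^ α * τ ^ (-α) / (α * w)) with hF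
  have hc : ContinuousOn F (Icc ε w) := by
    have h1 : ContinuousOn (fun τ : ℝ => (w - τ) ^ α) (Icc ε w) :=
      (continuous_const.sub continuous_id).continuousOn.rpow_const fun τ _ => Or.inr hα0.le
    have h2 : ContinuousOn (fun τ : ℝ => τ ^ (-α)) (Icc ε w) :=
      continuousOn_id.rpow_const fun τ hτ => Or.inl (hε.trans_le hτ.1).ne'
    exact ((h1.mul h2).div_const _).neg
  have hd : ∀ τ ∈ Ioo ε w, HasDerivAt F ((τ ^ (1 + α))⁻¹ * (w - τ) ^ (α - 1)) τ := fun τ hτ => by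
    have hτ0 : 0 < τ := hε.trans hτ.1
    have hwτ : 0 < w - τ := sub_pos.2 hτ.2
    have h1 : HasDerivAt (fun τ : ℝ => (w - τ) ^ α) (-1 * α * (w - τ) ^ (α - 1)) τ :=
      ((hasDerivAt_id τ).const_sub w).rpow_const (Or.inl hwτ.ne')
    have h2 : HasDerivAt (fun τ : ℝ => τ ^ (-α)) (-α * τ ^ (-α - 1)) τ :=
      Real.hasDerivAt_rpow_const (Or.inl hτ0.ne')
    refine (((h1.mul h2).div_const (α * w)).neg).congr_deriv ?_
    have e1 : (w - τ) ^ α = (w - τ) ^ (α - 1) * (w - τ) := by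
      rw [Real.rpow_sub_one hwτ.ne']; field_simp
    have e2 : τ ^ (-α) = τ ^ (-1 - α) * τ := by
      rw [← Real.rpow_add_one hτ0.ne']; congr 1; ring
    rw [rpow_inv_one_add hτ0, show -α - 1 = -1 - α by ring, e1, e2]
    field_simp
    ring
  have hn : ∀ τ ∈ Ioo ε w, 0 ≤ (τ ^ (1 + α))⁻¹ * (w - τ) ^ (α - 1) := fun τ hτ => by
    have hτ0 : 0 < τ := hε.trans hτ.1
    have hwτ : 0 < w - τ := sub_pos.2 hτ.2
    positivity
  have hI := intervalIntegral.integrableOn_deriv_of_nonneg hc hd hn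
  refine ⟨hI.mono_set Ioo_subset_Ioc_self, ?_⟩
  rw [← integral_Ioc_eq_integral_Ioo, ← intervalIntegral.integral_of_le hw.le,
    intervalIntegral.integral_eq_sub_of_hasDerivAt_of_le hw.le hc hd
    ((intervalIntegrable_iff_integrableOn_Ioc_of_le hw.le).2 hI), hF]
  simp only [sub_self, Real.zero_rpow hα0.ne']
  field_simp
  ring

/-- The kernel of the iterated integral behind `integral_firstDiff_eq`. -/
def truncPairKer (α τ w : ℝ) : ℝ := if τ < w then (τ ^ (1 + α))⁻¹ * (w - τ) ^ (α - 1) else 0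

theorem integral_truncPairKer {α ε : ℝ} (hα0 : 0 < α) (hε : 0 < ε) {w : ℝ} (hw : 0 < w) :
    IntegrableOn (fun τ => truncPairKer α τ w) (Ioi ε) ∧
    ∫ τ in Ioi ε, truncPairKer α τ w = α⁻¹ * (ε ^ (-α) * w ^ (α - 1) - truncKer α ε w) := by
  have e : (fun τ => truncPairKer α τ w) =
      (Iio w).indicator fun τ => (τ ^ (1 + α))⁻¹ * (w - τ) ^ (α - 1) := by
    ext τ; simp [truncPairKer, indicator_apply]
  rw [e, integrableOn_indicator_iff measurableSet_Iio, setIntegral_indicator measurableSet_Iio,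
    inter_comm, inter_comm (Ioi ε), Iio_inter_Ioi]
  rcases lt_or_ge ε w with h | h
  · obtain ⟨h1, h2⟩ := integral_truncated_beta hα0 hε h
    refine ⟨h1, ?_⟩
    rw [h2, truncKer, max_eq_left (by linarith)]
    field_simp
    ring
  · rw [Ioo_eq_empty (not_lt.2 h)]
    simp [truncKer, max_eq_right (sub_nonpos.2 h), Real.zero_rpow hα0.ne']

theorem measurable_truncPairKer (α : ℝ) :
    Measurable (fun p : ℝ × ℝ => truncPairKer α p.1 p.2) := by
  unfold truncPairKer
  exact Measurable.ite (measurableSet_lt measurable_fst measurable_snd) (by fun_prop)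
    measurable_const

theorem truncPairKer_nonneg {α τ w : ℝ} (hτ : 0 < τ) : 0 ≤ truncPairKer α τ w := by
  unfold truncPairKer
  split_ifs with h
  · have : 0 < w - τ := sub_pos.2 h
    positivity
  · exact le_rfl

theorem aestronglyMeasurable_of_rpow_smul {α : ℝ} {G : ℝ → ℂ}
    (hG : IntegrableOn (fun w => (w ^ (α - 1) : ℝ) • G w) (Ioi 0)) :
    AEStronglyMeasurable G (volume.restrict (Ioi 0)) := by
  have h : AEStronglyMeasurable (fun w : ℝ => (w ^ (1 - α) : ℝ) • (w ^ (α - 1) : ℝ) • G w)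
      (volume.restrict (Ioi 0)) :=
    (show Measurable fun w : ℝ => w ^ (1 - α) by fun_prop).aestronglyMeasurable.smul hG.aestronglyMeasurable
  refine h.congr ?_
  filter_upwards [ae_restrict_mem measurableSet_Ioi] with w hw
  rw [smul_smul, ← Real.rpow_add hw]; simp

theorem integrable_truncPairKer {α ε : ℝ} (hα0 : 0 < α) (hε : 0 < ε) {G : ℝ → ℂ}
    (hG : IntegrableOn (fun w => (w ^ (α - 1) : ℝ) • G w) (Ioi 0)) :
    Integrable (fun p : ℝ × ℝ => truncPairKer α p.1 p.2 • G p.2)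
      ((volume.restrict (Ioi ε)).prod (volume.restrict (Ioi 0))) := by
  have hGm := aestronglyMeasurable_of_rpow_smul hG
  have hm : AEStronglyMeasurable (fun p : ℝ × ℝ => truncPairKer α p.1 p.2 • G p.2)
      ((volume.restrict (Ioi ε)).prod (volume.restrict (Ioi 0))) :=
    (measurable_truncPairKer α).aestronglyMeasurable.smul hGm.comp_snd
  have hnorm : ∀ w ∈ Ioi (0 : ℝ), ∫ τ in Ioi ε, ‖truncPairKer α τ w • G w‖ =
      α⁻¹ * (ε ^ (-α) * w ^ (α - 1) - truncKer α ε w) * ‖G w‖ := fun w hw => by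
    rw [← (integral_truncPairKer hα0 hε hw).2, ← integral_mul_const]
    refine setIntegral_congr_fun measurableSet_Ioi fun τ hτ => ?_
    rw [norm_smul, Real.norm_of_nonneg (truncPairKer_nonneg (hε.trans hτ))]
  rw [integrable_prod_iff' hm]
  constructor
  · filter_upwards [ae_restrict_mem measurableSet_Ioi] with w hw
    exact (integral_truncPairKer hα0 hε hw).1.smul_const _
  · refine Integrable.mono' (hG.norm.const_mul (α⁻¹ * ε ^ (-α))) ?_ ?_
    · exact hm.norm.prod_swap.integral_prod_right'
    · filter_upwards [ae_restrict_mem measurableSet_Ioi] with w hw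
      have hw0 : (0 : ℝ) < w := hw
      have h1 := truncKer_nonneg hα0 hε hw0
      rw [hnorm w hw, norm_smul, Real.norm_of_nonneg (Real.rpow_nonneg hw0.le _), norm_mul, norm_norm,
        Real.norm_of_nonneg]
      · calc _ ≤ α⁻¹ * (ε ^ (-α) * w ^ (α - 1)) * ‖G w‖ := by gcongr; linarith
          _ = _ := by ring
      · rw [← (integral_truncPairKer hα0 hε hw0).2]
        exact setIntegral_nonneg measurableSet_Ioi fun τ hτ => truncPairKer_nonneg (hε.trans hτ)

/-- Fubini's theorem for `truncPairKer`: its `τ`-integral is explicit, and the term `ε^{-α} w^{α-1}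
/ α` in it cancels against the contribution of `A 0`, leaving `truncKer`. As `τ` is integrated, the
formula for `A (-τ)` is only required almost everywhere. -/
theorem integrableOn_firstDiff_and_eq {α ε : ℝ} (hα0 : 0 < α) (hε : 0 < ε) {G A : ℝ → ℂ}
    (hG : IntegrableOn (fun w => (w ^ (α - 1) : ℝ) • G w) (Ioi 0))
    (hA0 : A 0 = ∫ w in Ioi 0, (w ^ (α - 1) : ℝ) • G w)
    (hA : ∀ᵐ τ ∂volume.restrict (Ioi (0 : ℝ)),
      A (-τ) = ∫ w in Ioi τ, ((w - τ) ^ (α - 1) : ℝ) • G w) :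
    IntegrableOn (firstDiff α A) (Ioi ε) ∧
    IntegrableOn (fun w => truncKer α ε w • G w) (Ioi 0) ∧
    ∫ τ in Ioi ε, firstDiff α A τ = α⁻¹ • ∫ w in Ioi 0, truncKer α ε w • G w := by
  have hP := integrable_truncPairKer hα0 hε hG
  have hA' : ∀ᵐ τ ∂volume.restrict (Ioi ε), (∫ w in Ioi 0, truncPairKer α τ w • G w) =
      ((τ ^ (1 + α))⁻¹ : ℝ) • A (-τ) := by
    filter_upwards [ae_restrict_of_ae_restrict_of_subset (Ioi_subset_Ioi hε.le) hA,
      ae_restrict_mem measurableSet_Ioi] with τ hτ hτε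
    rw [hτ, ← integral_smul]
    have hs : Ioi τ ⊆ Ioi 0 := Ioi_subset_Ioi (hε.trans hτε).le
    rw [← inter_eq_right.2 hs, ← setIntegral_indicator measurableSet_Ioi]
    refine setIntegral_congr_fun measurableSet_Ioi fun w _ => ?_
    by_cases hw : τ < w
    · rw [indicator_of_mem (show w ∈ Ioi τ from hw), truncPairKer, if_pos hw, smul_smul]
    · rw [indicator_of_notMem (show w ∉ Ioi τ from hw), truncPairKer, if_neg hw, zero_smul]
  have hI1 : IntegrableOn (fun τ : ℝ => ((τ ^ (1 + α))⁻¹ : ℝ) • A (-τ)) (Ioi ε) :=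
    hP.integral_prod_left.congr hA'
  have hpow : IntegrableOn (fun τ : ℝ => (τ ^ (1 + α))⁻¹) (Ioi ε) :=
    (integrableOn_Ioi_rpow_of_lt (by linarith : -1 - α < -1) hε).congr_fun
      (fun τ hτ => (rpow_inv_one_add (hε.trans hτ)).symm) measurableSet_Ioi
  have hpowv : ∫ τ in Ioi ε, (τ ^ (1 + α))⁻¹ = α⁻¹ * ε ^ (-α) := by
    rw [setIntegral_congr_fun measurableSet_Ioi (fun τ hτ => rpow_inv_one_add (hε.trans hτ)),
      integral_Ioi_rpow_of_lt (by linarith) hε, show -1 - α + 1 = -α by ring, neg_div_neg_eq]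
    ring
  have hI2 : IntegrableOn (fun τ : ℝ => ((τ ^ (1 + α))⁻¹ : ℝ) • A 0) (Ioi ε) := hpow.smul_const _
  have hF : firstDiff α A = fun τ => ((τ ^ (1 + α))⁻¹ : ℝ) • A 0 - ((τ ^ (1 + α))⁻¹ : ℝ) • A (-τ) := by
    ext τ; rw [firstDiff, smul_sub]
  have hin : ∀ w ∈ Ioi (0 : ℝ), ∫ τ in Ioi ε, truncPairKer α τ w • G w =
      (α⁻¹ * ε ^ (-α)) • (w ^ (α - 1) : ℝ) • G w - α⁻¹ • truncKer α ε w • G w := fun w hw => by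
    rw [integral_smul_const, (integral_truncPairKer hα0 hε hw).2, smul_smul, smul_smul, ← sub_smul]
    congr 1; ring
  have hB := hP.integral_prod_right.congr (by
    filter_upwards [ae_restrict_mem measurableSet_Ioi] with w hw using hin w hw)
  have hG' : IntegrableOn (fun w => (α⁻¹ * ε ^ (-α)) • (w ^ (α - 1) : ℝ) • G w) (Ioi 0) :=
    hG.smul (α⁻¹ * ε ^ (-α))
  have hT : IntegrableOn (fun w => truncKer α ε w • G w) (Ioi 0) := by
    have h := (hG'.sub hB).smul α
    refine h.congr (Eventually.of_forall fun w => ?_)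
    simp only [Pi.smul_apply, Pi.sub_apply, sub_sub_cancel]
    rw [smul_smul, mul_inv_cancel₀ hα0.ne', one_smul]
  have hT' : IntegrableOn (fun w => α⁻¹ • truncKer α ε w • G w) (Ioi 0) := hT.smul α⁻¹
  refine ⟨by rw [hF]; exact hI2.sub hI1, hT, ?_⟩
  rw [hF, integral_sub hI2 hI1, ← integral_congr_ae hA', integral_integral_swap hP,
    setIntegral_congr_fun measurableSet_Ioi hin, integral_sub hG' hT', integral_smul,
    integral_smul, ← hA0, integral_smul_const, hpowv, sub_sub_cancel]

theorem integrableOn_truncKer {α ε : ℝ} (hα0 : 0 < α) (hα1 : α < 1) (hε : 0 < ε) :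
    IntegrableOn (truncKer α ε) (Ioi 0) := by
  refine Integrable.mono' (integrableOn_truncMaj hα0 hα1 hε)
    (measurable_truncKer α ε).aestronglyMeasurable ?_
  filter_upwards [ae_restrict_mem measurableSet_Ioi] with w hw
  rw [Real.norm_of_nonneg (truncKer_nonneg hα0 hε hw)]
  exact truncKer_le hα1 hε hw

/-- `truncKer α ε` is the `L¹`-normalized dilation of `truncKer α 1`, as befits an approximate
identity. -/
theorem integral_truncKer_eq {α ε : ℝ} (hε : 0 < ε) :
    ∫ w in Ioi 0, truncKer α ε w = ∫ w in Ioi 0, truncKer α 1 w := by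
  have hε' : 0 < ε⁻¹ := inv_pos.2 hε
  have h := integral_comp_mul_left_Ioi (truncKer α 1) 0 hε'
  rw [mul_zero, inv_inv, smul_eq_mul] at h
  have e : ∀ w ∈ Ioi (0 : ℝ), truncKer α ε w = ε⁻¹ * truncKer α 1 (ε⁻¹ * w) := fun w hw => by
    have hw0 : (0 : ℝ) < w := hw
    have e1 : max (ε⁻¹ * w - 1) 0 = ε⁻¹ * max (w - ε) 0 := by
      rw [mul_max_of_nonneg _ _ hε'.le, mul_zero, mul_sub, inv_mul_cancel₀ hε.ne']
    rw [truncKer, truncKer, e1, Real.mul_rpow hε'.le hw0.le, Real.mul_rpow hε'.le (le_max_right _ _),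
      Real.one_rpow, one_mul, Real.rpow_sub_one hε'.ne', Real.inv_rpow hε.le, Real.rpow_neg hε.le]
    field_simp
  rw [setIntegral_congr_fun measurableSet_Ioi e, integral_const_mul, h, ← mul_assoc,
    inv_mul_cancel₀ hε.ne', one_mul]

theorem lintegral_rpow_mul_lt_top {α δ : ℝ} (hα1 : α < 1) (hδ : 0 < δ) {G : ℝ → ℂ}
    (hG : IntegrableOn (fun w => (w ^ (α - 1) : ℝ) • G w) (Ioi 0)) (c : ℂ) :
    ∫⁻ w in Ici δ, ENNReal.ofReal (w ^ (α - 2)) * ‖G w - c‖ₑ < ∞ := by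
  have h1 : IntegrableOn (fun w : ℝ => (w ^ (α - 2) : ℝ) • G w) (Ici δ) := by
    have hs : Ici δ ⊆ Ioi 0 := fun w hw => hδ.trans_le hw
    have hGm := (aestronglyMeasurable_of_rpow_smul hG).mono_set hs
    refine Integrable.mono' ((hG.mono_set hs).norm.const_mul δ⁻¹)
      ((show Measurable fun w : ℝ => w ^ (α - 2) by fun_prop).aestronglyMeasurable.smul hGm) ?_
    filter_upwards [ae_restrict_mem measurableSet_Ici] with w hw
    have hw0 : 0 < w := hδ.trans_le hw
    rw [norm_smul, norm_smul, Real.norm_of_nonneg (by positivity), Real.norm_of_nonneg (by positivity),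
      ← mul_assoc]
    gcongr
    rw [show α - 2 = α - 1 - 1 by ring, Real.rpow_sub_one hw0.ne', div_eq_inv_mul]
    have : w⁻¹ ≤ δ⁻¹ := by gcongr; exact hw
    gcongr
  have h2 : IntegrableOn (fun w : ℝ => (w ^ (α - 2) : ℝ) • c) (Ici δ) :=
    ((integrableOn_Ici_iff_integrableOn_Ioi).2
      (integrableOn_Ioi_rpow_of_lt (by linarith) hδ)).smul_const c
  have h3 := (h1.sub h2).hasFiniteIntegral
  rw [HasFiniteIntegral] at h3
  refine lt_of_eq_of_lt (setLIntegral_congr_fun measurableSet_Ici fun w hw => ?_) h3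
  have hw0 : 0 < w := hδ.trans_le hw
  simp only [Pi.sub_apply]
  rw [← smul_sub, enorm_smul, Real.enorm_of_nonneg (by positivity)]

/-- On `(0, δ)` the shell averages of `|G - c|` are small and the bound through shells applies for
every `ε`. Beyond `δ` the second expression in the majorant gives `ε^{1-α}` times a finite integral.
-/
theorem tendsto_lintegral_truncMaj {α : ℝ} (hα0 : 0 < α) (hα1 : α < 1) {G : ℝ → ℂ} {c : ℂ}
    (hG : IntegrableOn (fun w => (w ^ (α - 1) : ℝ) • G w) (Ioi 0))
    (hc : Tendsto (fun h : ℝ => ENNReal.ofReal h⁻¹ * ∫⁻ w in Ioo (h / 2) h, ‖G w - c‖ₑ)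
      (𝓝[>] 0) (𝓝 0)) :
    Tendsto (fun ε => ∫⁻ w in Ioi 0, ENNReal.ofReal (truncMaj α ε w) * ‖G w - c‖ₑ)
      (𝓝[>] 0) (𝓝 0) := by
  rw [ENNReal.tendsto_nhds_zero] at hc ⊢
  intro e he
  set C : ℝ≥0∞ := 8 * ENNReal.ofReal (1 / α + 1 / (1 - α)) with hC
  have hC0 : C ≠ 0 := by
    have : 0 < 1 / α + 1 / (1 - α) := by
      have := sub_pos.2 hα1
      positivity
    simpa [hC] using this
  have hCt : C ≠ ∞ := by rw [hC]; finiteness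
  have hη : 0 < e / 2 / C := ENNReal.div_pos (ENNReal.half_pos he.ne').ne' hCt
  obtain ⟨δ', hδ', hδ⟩ := mem_nhdsGT_iff_exists_Ioo_subset.1 (hc _ hη)
  have hδ'0 : 0 < δ' := hδ'
  set δ := δ' / 2
  have hδ0 : 0 < δ := by positivity
  have hGm := aestronglyMeasurable_of_rpow_smul hG
  have hgm : AEMeasurable (fun w => ‖G w - c‖ₑ) (volume.restrict (Ioi 0)) :=
    (hGm.sub aestronglyMeasurable_const).enorm
  have h1 : ∀ ε : ℝ, 0 < ε →
      ∫⁻ w in Ioo 0 δ, ENNReal.ofReal (truncMaj α ε w) * ‖G w - c‖ₑ ≤ e / 2 := fun ε hε => by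
    refine (lintegral_truncMaj_mul_le hα0 hα1 hε hgm (η := e / 2 / C) fun r hr => ?_).trans ?_
    · exact hδ ⟨hr.1, by have := hr.2; simp only [δ] at this; linarith⟩
    · rw [← hC, ENNReal.mul_div_cancel hC0 hCt]
  set B := ∫⁻ w in Ici δ, ENNReal.ofReal (w ^ (α - 2)) * ‖G w - c‖ₑ with hB
  have hBt : B ≠ ∞ := (lintegral_rpow_mul_lt_top hα1 hδ0 hG c).ne
  have h2 : ∀ ε : ℝ, 0 < ε →
      ∫⁻ w in Ici δ, ENNReal.ofReal (truncMaj α ε w) * ‖G w - c‖ₑ ≤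
        ENNReal.ofReal (ε ^ (1 - α)) * B := fun ε hε => by
    rw [hB, ← lintegral_const_mul' _ _ (by finiteness)]
    refine lintegral_mono fun w => ?_
    rw [← mul_assoc, ← ENNReal.ofReal_mul (by positivity)]
    gcongr
    exact min_le_right _ _
  have h3 : Tendsto (fun ε : ℝ => ENNReal.ofReal (ε ^ (1 - α)) * B) (𝓝[>] 0) (𝓝 0) := by
    have h4 : Tendsto (fun ε : ℝ => ENNReal.ofReal (ε ^ (1 - α))) (𝓝[>] 0) (𝓝 0) := by
      have h5 : ContinuousAt (fun ε : ℝ => ε ^ (1 - α)) 0 :=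
        Real.continuousAt_rpow_const _ _ (Or.inr (by linarith))
      have h6 := ENNReal.tendsto_ofReal h5.tendsto
      rw [Real.zero_rpow (by linarith), ENNReal.ofReal_zero] at h6
      exact h6.mono_left nhdsWithin_le_nhds
    simpa using ENNReal.Tendsto.mul_const h4 (Or.inr hBt)
  filter_upwards [self_mem_nhdsWithin,
    ENNReal.tendsto_nhds_zero.1 h3 (e / 2) (ENNReal.half_pos he.ne')] with ε hε hε2
  rw [← Ioo_union_Ici_eq_Ioi hδ0]
  refine (lintegral_union_le _ _ _).trans ?_
  calc _ ≤ e / 2 + e / 2 := add_le_add (h1 ε hε) ((h2 ε hε).trans hε2)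
    _ = e := ENNReal.add_halves e

theorem tendsto_integral_truncKer {α : ℝ} (hα0 : 0 < α) (hα1 : α < 1) {G : ℝ → ℂ} {c : ℂ}
    (hG : IntegrableOn (fun w => (w ^ (α - 1) : ℝ) • G w) (Ioi 0))
    (hT : ∀ ε : ℝ, 0 < ε → IntegrableOn (fun w => truncKer α ε w • G w) (Ioi 0))
    (hc : Tendsto (fun h : ℝ => ENNReal.ofReal h⁻¹ * ∫⁻ w in Ioo (h / 2) h, ‖G w - c‖ₑ)
      (𝓝[>] 0) (𝓝 0)) :
    Tendsto (fun ε => ∫ w in Ioi 0, truncKer α ε w • G w) (𝓝[>] 0)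
      (𝓝 ((∫ w in Ioi 0, truncKer α 1 w) • c)) := by
  rw [tendsto_iff_edist_tendsto_0]
  refine tendsto_of_tendsto_of_tendsto_of_le_of_le' tendsto_const_nhds
    (tendsto_lintegral_truncMaj hα0 hα1 hG hc) (Eventually.of_forall fun _ => zero_le) ?_
  filter_upwards [self_mem_nhdsWithin] with ε hε
  have h2 : IntegrableOn (fun w => truncKer α ε w • c) (Ioi 0) :=
    (integrableOn_truncKer hα0 hα1 hε).smul_const c
  rw [edist_eq_enorm_sub, ← integral_truncKer_eq hε, ← integral_smul_const,
    ← integral_sub (hT ε hε) h2]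
  refine (enorm_integral_le_lintegral_enorm _).trans
    (setLIntegral_mono' measurableSet_Ioi fun w hw => ?_)
  rw [← smul_sub, enorm_smul, Real.enorm_of_nonneg (truncKer_nonneg hα0 hε hw)]
  gcongr
  exact truncKer_le hα1 hε hw

theorem tendsto_shell_of_continuousAt {G : ℝ → ℂ} (hG : ContinuousAt G 0) :
    Tendsto (fun h : ℝ => ENNReal.ofReal h⁻¹ * ∫⁻ w in Ioo (h / 2) h, ‖G w - G 0‖ₑ)
      (𝓝[>] 0) (𝓝 0) := by
  rw [ENNReal.tendsto_nhds_zero]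
  intro e he
  have h1 : Tendsto (fun w => ‖G w - G 0‖ₑ) (𝓝 0) (𝓝 0) := by
    have := (hG.tendsto.sub_const (G 0)).enorm
    simpa using this
  obtain ⟨δ, hδ, h2⟩ := Metric.eventually_nhds_iff.1 (ENNReal.tendsto_nhds_zero.1 h1 e he)
  filter_upwards [self_mem_nhdsWithin, nhdsWithin_le_nhds (Iio_mem_nhds hδ)] with h hh0 hhδ
  have hh0' : (0 : ℝ) < h := hh0
  have hhδ' : h < δ := hhδ
  have h3 : ∫⁻ w in Ioo (h / 2) h, ‖G w - G 0‖ₑ ≤ ∫⁻ _ in Ioo (h / 2) h, e :=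
    setLIntegral_mono' measurableSet_Ioo fun w hw => h2 (by
      rw [Real.dist_0_eq_abs, abs_of_pos (by linarith [hw.1])]; linarith [hw.2])
  rw [setLIntegral_const, Real.volume_Ioo] at h3
  calc _ ≤ ENNReal.ofReal h⁻¹ * (e * ENNReal.ofReal h) := by
        gcongr; exact h3.trans (by gcongr; linarith)
    _ = e * (ENNReal.ofReal h⁻¹ * ENNReal.ofReal h) := by ring
    _ = e := by rw [← ENNReal.ofReal_mul (by positivity), inv_mul_cancel₀ hh0'.ne']; simp

/-- The mass is found from one example: for `G w = e^{-w}` the fractional integral is `Γ(α) e^u`,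
whose Marchaud integral is `Γ(α) κ(α, 1)`, and `G 0 = 1`. -/
theorem integral_truncKer_one {α : ℝ} (hα0 : 0 < α) (hα1 : α < 1) :
    ∫ w in Ioi 0, truncKer α 1 w = α * Real.Gamma α * kappa α 1 := by
  set G : ℝ → ℂ := fun w => ((Real.exp (-w) : ℝ) : ℂ) with hGdef
  set A : ℝ → ℂ := fun u => ((Real.Gamma α * Real.exp u : ℝ) : ℂ) with hAdef
  have hGi : IntegrableOn (fun w => (w ^ (α - 1) : ℝ) • G w) (Ioi 0) := by
    have := (Real.GammaIntegral_convergent hα0).ofReal (𝕜 := ℂ)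
    refine this.congr (Eventually.of_forall fun w => ?_)
    simp only [hGdef, Complex.real_smul]
    rw [mul_comm (Real.exp (-w))]
    exact RCLike.ofReal_mul _ _
  have hΓ : ∫ w in Ioi 0, (w ^ (α - 1) : ℝ) • G w = ((Real.Gamma α : ℝ) : ℂ) := by
    rw [Real.Gamma_eq_integral hα0, ← integral_complex_ofReal]
    refine integral_congr_ae (Eventually.of_forall fun w => ?_)
    simp only [hGdef, Complex.real_smul]
    push_cast; ring
  have hA0 : A 0 = ∫ w in Ioi 0, (w ^ (α - 1) : ℝ) • G w := by
    rw [hΓ, hAdef]; simp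
  have hA : ∀ τ : ℝ, A (-τ) = ∫ w in Ioi τ, ((w - τ) ^ (α - 1) : ℝ) • G w := fun τ => by
    have h := (measurePreserving_add_right (volume : Measure ℝ) τ).setIntegral_preimage_emb
      (measurableEmbedding_addRight τ) (fun w : ℝ => ((w - τ) ^ (α - 1) : ℝ) • G w) (Ioi τ)
    have e : ∀ w : ℝ, ((w + τ - τ) ^ (α - 1) : ℝ) • G (w + τ) =
        ((Real.exp (-τ) : ℝ) : ℂ) * ((w ^ (α - 1) : ℝ) • G w) := fun w => by
      simp only [hGdef, Complex.real_smul, add_sub_cancel_right]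
      rw [neg_add, Real.exp_add]; push_cast; ring
    rw [preimage_add_const_Ioi, sub_self] at h
    rw [← h]
    simp only [e]
    rw [integral_const_mul, hΓ, hAdef]; push_cast; ring
  have hall := fun ε (hε : (0 : ℝ) < ε) =>
    integrableOn_firstDiff_and_eq hα0 hε hGi hA0 (Eventually.of_forall hA)
  have hGc : Continuous G := by simp only [hGdef]; fun_prop
  have h1 := (tendsto_integral_truncKer hα0 hα1 hGi (fun ε hε => (hall ε hε).2.1)
    (tendsto_shell_of_continuousAt hGc.continuousAt)).const_smul α⁻¹
  have hk := integrableOn_kappa hα0 hα1 (ℓ := 1) le_rfl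
  have hfirst : firstDiff α A = fun τ =>
      ((Real.Gamma α * ((1 - Real.exp (-τ)) ^ 1 / τ ^ (1 + α)) : ℝ) : ℂ) := by
    ext τ
    rw [firstDiff, hAdef, Complex.real_smul]
    push_cast
    simp only [Complex.exp_zero]
    rw [div_eq_mul_inv]; ring
  have h2 := tendsto_setIntegral_Ioi_zero ((hk.const_mul (Real.Gamma α)).ofReal (𝕜 := ℂ))
  have h3 : Tendsto (fun ε => α⁻¹ • ∫ w in Ioi 0, truncKer α ε w • G w) (𝓝[>] 0)
      (𝓝 (((Real.Gamma α * kappa α 1 : ℝ)) : ℂ)) := by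
    have e : ((Real.Gamma α * kappa α 1 : ℝ) : ℂ) = ∫ τ in Ioi (0 : ℝ),
        ((Real.Gamma α * ((1 - Real.exp (-τ)) ^ 1 / τ ^ (1 + α)) : ℝ) : ℂ) := by
      rw [integral_complex_ofReal, integral_const_mul]; rfl
    rw [e]
    refine h2.congr' ?_
    filter_upwards [self_mem_nhdsWithin] with ε hε
    rw [← (hall ε hε).2.2, hfirst]
    rfl
  have h4 := tendsto_nhds_unique h1 h3
  simp only [hGdef, neg_zero, Real.exp_zero, Complex.real_smul] at h4
  have h5 : α⁻¹ * ((∫ w in Ioi 0, truncKer α 1 w) * 1) = Real.Gamma α * kappa α 1 := by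
    exact_mod_cast h4
  field_simp at h5
  linarith

/-- **Marchaud inversion.** The Marchaud integral recovers the density of a one-sided fractional
integral at a point where the averages of the density over the shells `(h/2, h)` converge. -/
theorem tendsto_firstDiff {α : ℝ} (hα0 : 0 < α) (hα1 : α < 1) {G A : ℝ → ℂ} {c : ℂ}
    (hG : IntegrableOn (fun w => (w ^ (α - 1) : ℝ) • G w) (Ioi 0))
    (hc : Tendsto (fun h : ℝ => ENNReal.ofReal h⁻¹ * ∫⁻ w in Ioo (h / 2) h, ‖G w - c‖ₑ)
      (𝓝[>] 0) (𝓝 0))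
    (hA0 : A 0 = ∫ w in Ioi 0, (w ^ (α - 1) : ℝ) • G w)
    (hA : ∀ᵐ τ ∂volume.restrict (Ioi (0 : ℝ)),
      A (-τ) = ∫ w in Ioi τ, ((w - τ) ^ (α - 1) : ℝ) • G w) :
    (∀ ε : ℝ, 0 < ε → IntegrableOn (firstDiff α A) (Ioi ε)) ∧
    Tendsto (fun ε => ∫ τ in Ioi ε, firstDiff α A τ) (𝓝[>] 0)
      (𝓝 ((Real.Gamma α * kappa α 1) • c)) := by
  have hall := fun ε (hε : (0 : ℝ) < ε) => integrableOn_firstDiff_and_eq hα0 hε hG hA0 hA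
  refine ⟨fun ε hε => (hall ε hε).1, ?_⟩
  have h1 := (tendsto_integral_truncKer hα0 hα1 hG (fun ε hε => (hall ε hε).2.1) hc).const_smul α⁻¹
  rw [integral_truncKer_one hα0 hα1, smul_smul,
    show α⁻¹ * (α * Real.Gamma α * kappa α 1) = Real.Gamma α * kappa α 1 by field_simp] at h1
  refine h1.congr' ?_
  filter_upwards [self_mem_nhdsWithin] with ε hε using (hall ε hε).2.2.symm

/-! ### The kernels in polar coordinates -/

theorem inner_snocVec {n : ℕ} (X Y : Euc n) (z w : ℝ) :
    inner ℝ (snocVec X z) (snocVec Y w) = inner ℝ X Y + z * w := by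
  simp only [PiLp.inner_apply, Fin.sum_univ_castSucc, snocVec_castSucc, snocVec_last]
  congr 1
  simp [mul_comm]

theorem height_sub_polarMap {n : ℕ} {s t : ℝ} (hs : 0 ≤ s) (ht : 0 ≤ t) (ξ η : Sph n) :
    height (polarMap (t, ξ)) - height (polarMap (s, η)) = 2 * (t - s) / ((1 + t) * (1 + s)) := by
  rw [height_polarMap hs, height_polarMap ht]
  have : 1 + t ≠ 0 := by positivity
  have : 1 + s ≠ 0 := by positivity
  field_simp
  ring

theorem norm_sub_polarMap_sq {n : ℕ} {s t : ℝ} (hs : 0 ≤ s) (ht : 0 < t) (ξ η : Sph n) :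
    ‖(polarMap (t, ξ) : Euc (n + 1)) - polarMap (s, η)‖ ^ 2 =
      4 * t * ‖√(s / t) • (ξ : Euc n) - η‖ ^ 2 / ((1 + t) * (1 + s)) := by
  have hin : inner ℝ (polarMap (t, ξ) : Euc (n + 1)) (polarMap (s, η) : Euc (n + 1)) =
      2 * √t / (1 + t) * (2 * √s / (1 + s)) * inner ℝ (ξ : Euc n) η +
        (t - 1) / (1 + t) * ((s - 1) / (1 + s)) := by
    change inner ℝ (polarVec (√t) ξ) (polarVec (√s) η) = _
    rw [polarVec_eq, polarVec_eq, inner_snocVec, real_inner_smul_left, real_inner_smul_right,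
      Real.sq_sqrt hs, Real.sq_sqrt ht.le]
    ring
  rw [norm_sub_sq_real, norm_sub_sq_real, norm_eq_of_mem_sphere, norm_eq_of_mem_sphere,
    norm_smul, norm_eq_of_mem_sphere, norm_eq_of_mem_sphere, hin, real_inner_smul_left,
    Real.norm_of_nonneg (Real.sqrt_nonneg _), mul_one, Real.sq_sqrt (by positivity),
    Real.sqrt_div hs]
  have h1 : √t ≠ 0 := (Real.sqrt_pos.2 ht).ne'
  have h2 : 1 + t ≠ 0 := by positivity
  have h3 : 1 + s ≠ 0 := by positivity
  have h4 : √t ^ 2 = t := Real.sq_sqrt ht.le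
  field_simp
  linear_combination (-8 * √s * inner ℝ (ξ : Euc n) η) * h4

theorem norm_smul_sqrt_lt_one {n : ℕ} {s t : ℝ} (hs : 0 ≤ s) (hst : s < t) (ξ : Sph n) :
    ‖√(s / t) • (ξ : Euc n)‖ < 1 := by
  have ht : 0 < t := hs.trans_lt hst
  rw [norm_smul, norm_eq_of_mem_sphere, mul_one, Real.norm_of_nonneg (Real.sqrt_nonneg _),
    Real.sqrt_lt' one_pos, one_pow, div_lt_one ht]
  exact hst

theorem sqrt_pow_eq_rpow {a : ℝ} (ha : 0 ≤ a) (n : ℕ) : √a ^ n = a ^ ((n : ℝ) / 2) := by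
  rw [Real.sqrt_eq_rpow, ← Real.rpow_natCast, ← Real.rpow_mul ha]; congr 1; ring

/-- The numerator of the Poisson kernel at `√(s/t) ξ` is `1 - s/t = (t - s) / t`, and its
denominator is a multiple of `|x - y|^n`. -/
theorem inv_norm_sub_polarMap_pow {n : ℕ} {s t : ℝ} (hs : 0 ≤ s) (hst : s < t) (ξ η : Sph n) :
    (‖(polarMap (t, ξ) : Euc (n + 1)) - polarMap (s, η)‖ ^ n)⁻¹ =
      (2 ^ n)⁻¹ * ((1 + t) * (1 + s)) ^ ((n : ℝ) / 2) * t ^ (1 - (n : ℝ) / 2) * (t - s)⁻¹ *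
        poissonKer (√(s / t) • (ξ : Euc n)) η := by
  have ht : 0 < t := hs.trans_lt hst
  have hN := norm_sub_pos (norm_smul_sqrt_lt_one hs hst ξ) (norm_eq_of_mem_sphere η)
  have h1 : ‖(polarMap (t, ξ) : Euc (n + 1)) - polarMap (s, η)‖ =
      2 * √t * ‖√(s / t) • (ξ : Euc n) - η‖ * (√((1 + t) * (1 + s)))⁻¹ := by
    rw [← sq_eq_sq₀ (norm_nonneg _) (by positivity), norm_sub_polarMap_sq hs ht, mul_pow, mul_pow,
      mul_pow, inv_pow, Real.sq_sqrt ht.le, Real.sq_sqrt (by positivity)]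
    ring
  have hr : ‖√(s / t) • (ξ : Euc n)‖ ^ 2 = s / t := by
    rw [norm_smul, norm_eq_of_mem_sphere, mul_one, Real.norm_of_nonneg (Real.sqrt_nonneg _),
      Real.sq_sqrt (by positivity)]
  have hts : t - s ≠ 0 := (sub_pos.2 hst).ne'
  have htp : t ^ (1 - (n : ℝ) / 2) = t * (t ^ ((n : ℝ) / 2))⁻¹ := by
    rw [sub_eq_add_neg, Real.rpow_add ht, Real.rpow_one, Real.rpow_neg ht.le]
  rw [h1, mul_pow, mul_pow, mul_pow, inv_pow, sqrt_pow_eq_rpow ht.le, sqrt_pow_eq_rpow (by positivity),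
    poissonKer, hr, htp]
  have := Real.rpow_pos_of_pos ht ((n : ℝ) / 2)
  have := Real.rpow_pos_of_pos (by positivity : 0 < (1 + t) * (1 + s)) ((n : ℝ) / 2)
  field_simp

/-- The left-sided kernel, with the density of the surface measure. -/
theorem inv_norm_pow_mul_polarDens_of_lt {n : ℕ} {s t : ℝ} (hs : 0 < s) (hst : s < t) (ξ η : Sph n) :
    (‖(polarMap (t, ξ) : Euc (n + 1)) - polarMap (s, η)‖ ^ n)⁻¹ * polarDens n s =
      1 / 2 * (1 + t) ^ ((n : ℝ) / 2) * (1 + s) ^ (-((n : ℝ) / 2)) * s ^ ((n : ℝ) / 2 - 1) *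
        t ^ (1 - (n : ℝ) / 2) * (t - s)⁻¹ * poissonKer (√(s / t) • (ξ : Euc n)) η := by
  have ht : 0 < t := hs.trans hst
  have h1 : ((1 + s) ^ n)⁻¹ = (1 + s) ^ (-((n : ℝ) / 2)) * (1 + s) ^ (-((n : ℝ) / 2)) := by
    rw [← Real.rpow_add (by positivity), ← Real.rpow_natCast, ← Real.rpow_neg (by positivity)]
    congr 1; ring
  have h2 : (1 + s) ^ ((n : ℝ) / 2) * (1 + s) ^ (-((n : ℝ) / 2)) = 1 := by
    rw [← Real.rpow_add (by positivity), add_neg_cancel, Real.rpow_zero]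
  have h3 : (2 ^ n)⁻¹ * (2 : ℝ) ^ (n - 1 : ℝ) = 1 / 2 := by
    rw [Real.rpow_sub_one (by norm_num), Real.rpow_natCast]; field_simp
  rw [inv_norm_sub_polarMap_pow hs.le hst, polarDens, h1,
    Real.mul_rpow (by positivity) (by positivity)]
  calc _ = ((2 ^ n)⁻¹ * (2 : ℝ) ^ (n - 1 : ℝ)) *
        ((1 + s) ^ ((n : ℝ) / 2) * (1 + s) ^ (-((n : ℝ) / 2))) *
        ((1 + t) ^ ((n : ℝ) / 2) * (1 + s) ^ (-((n : ℝ) / 2)) * s ^ ((n : ℝ) / 2 - 1) *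
        t ^ (1 - (n : ℝ) / 2) * (t - s)⁻¹ * poissonKer (√(s / t) • (ξ : Euc n)) η) := by ring
    _ = _ := by rw [h2, h3]; ring

/-- The right-sided kernel, with the density of the surface measure. -/
theorem inv_norm_pow_mul_polarDens_of_gt {n : ℕ} {s t : ℝ} (ht : 0 ≤ t) (hst : t < s) (ξ η : Sph n) :
    (‖(polarMap (t, ξ) : Euc (n + 1)) - polarMap (s, η)‖ ^ n)⁻¹ * polarDens n s =
      1 / 2 * (1 + t) ^ ((n : ℝ) / 2) * (1 + s) ^ (-((n : ℝ) / 2)) * (s - t)⁻¹ *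
        poissonKer (√(t / s) • (ξ : Euc n)) η := by
  have hs : 0 < s := ht.trans_lt hst
  have h1 : ((1 + s) ^ n)⁻¹ = (1 + s) ^ (-((n : ℝ) / 2)) * (1 + s) ^ (-((n : ℝ) / 2)) := by
    rw [← Real.rpow_add (by positivity), ← Real.rpow_natCast, ← Real.rpow_neg (by positivity)]
    congr 1; ring
  have h2 : (1 + s) ^ ((n : ℝ) / 2) * (1 + s) ^ (-((n : ℝ) / 2)) = 1 := by
    rw [← Real.rpow_add (by positivity), add_neg_cancel, Real.rpow_zero]
  have h3 : (2 ^ n)⁻¹ * (2 : ℝ) ^ (n - 1 : ℝ) = 1 / 2 := by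
    rw [Real.rpow_sub_one (by norm_num), Real.rpow_natCast]; field_simp
  have h4 : s ^ (1 - (n : ℝ) / 2) * s ^ ((n : ℝ) / 2 - 1) = 1 := by
    rw [← Real.rpow_add hs]; simp
  rw [norm_sub_rev, inv_norm_sub_polarMap_pow ht hst, polarDens, h1,
    Real.mul_rpow (by positivity) (by positivity),
    poissonKer_comm (norm_eq_of_mem_sphere η) (norm_eq_of_mem_sphere ξ)]
  calc _ = ((2 ^ n)⁻¹ * (2 : ℝ) ^ (n - 1 : ℝ)) *
        ((1 + s) ^ ((n : ℝ) / 2) * (1 + s) ^ (-((n : ℝ) / 2))) *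
        (s ^ (1 - (n : ℝ) / 2) * s ^ ((n : ℝ) / 2 - 1)) *
        ((1 + t) ^ ((n : ℝ) / 2) * (1 + s) ^ (-((n : ℝ) / 2)) * (s - t)⁻¹ *
          poissonKer (√(t / s) • (ξ : Euc n)) η) := by ring
    _ = _ := by rw [h2, h3, h4]; ring

theorem height_diff_rpow {s t τ a : ℝ} (hs : 0 ≤ s) (ht : 0 ≤ t) (hτ : 0 < τ) :
    (2 * τ / ((1 + t) * (1 + s))) ^ a = 2 ^ a * τ ^ a * (1 + t) ^ (-a) * (1 + s) ^ (-a) := by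
  rw [Real.div_rpow (by positivity) (by positivity), Real.mul_rpow (by norm_num) hτ.le,
    Real.mul_rpow (by positivity) (by positivity), Real.rpow_neg (by positivity),
    Real.rpow_neg (by positivity)]
  field_simp

/-- The power `-α` of `t - s` from the heights and the power `-1` from the Poisson form of the
kernel combine to the Marchaud kernel. The remaining powers of `s`, `t` and `1 + s` are the weight
of `A_x^+`. -/
theorem leftQuot_coeff {n : ℕ} {α s t : ℝ} (hs : 0 < s) (hst : s < t) (ξ η : Sph n) :
    polarDens n s * ((height (polarMap (t, ξ)) - height (polarMap (s, η))) ^ α *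
      ‖(polarMap (t, ξ) : Euc (n + 1)) - polarMap (s, η)‖ ^ n)⁻¹ =
      2 ^ (-α - 1) * (1 + t) ^ (α + (n : ℝ) / 2) * ((t - s) ^ (1 + α))⁻¹ *
        leftWeight α (n / 2) t (t - s) * poissonKer (√(s / t) • (ξ : Euc n)) η := by
  have ht : 0 < t := hs.trans hst
  have hts : 0 < t - s := sub_pos.2 hst
  have hw : leftWeight α (n / 2) t (t - s) =
      s ^ ((n : ℝ) / 2 - 1) * t ^ (1 - (n : ℝ) / 2) * ((1 + s) ^ α * (1 + s) ^ (-((n : ℝ) / 2))) := by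
    rw [leftWeight, if_pos (by linarith), show 1 - (t - s) / t = s / t by field_simp; ring,
      show 1 + t - (t - s) = 1 + s by ring, Real.div_rpow hs.le ht.le, ← Real.rpow_add (by positivity),
      show 1 - (n : ℝ) / 2 = -((n : ℝ) / 2 - 1) by ring, Real.rpow_neg ht.le, div_eq_mul_inv, sub_eq_add_neg α]
  rw [height_sub_polarMap hs.le ht.le, mul_inv, ← Real.rpow_neg (by positivity),
    height_diff_rpow hs.le ht.le hts, neg_neg, mul_comm (polarDens n s), mul_assoc,
    inv_norm_pow_mul_polarDens_of_lt hs hst, hw, Real.rpow_add (by positivity), Real.rpow_add hts,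
    Real.rpow_sub_one (x := 2) (by norm_num), Real.rpow_one, Real.rpow_neg hts.le, mul_inv]
  ring

theorem rightQuot_coeff {n : ℕ} {α s t : ℝ} (ht : 0 ≤ t) (hst : t < s) (ξ η : Sph n) :
    polarDens n s * ((height (polarMap (s, η)) - height (polarMap (t, ξ))) ^ α *
      ‖(polarMap (t, ξ) : Euc (n + 1)) - polarMap (s, η)‖ ^ n)⁻¹ =
      2 ^ (-α - 1) * (1 + t) ^ (α + (n : ℝ) / 2) * ((s - t) ^ (1 + α))⁻¹ *
        (1 + s) ^ (α - (n : ℝ) / 2) * poissonKer (√(t / s) • (ξ : Euc n)) η := by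
  have hs : 0 < s := ht.trans_lt hst
  have hts : 0 < s - t := sub_pos.2 hst
  rw [height_sub_polarMap ht hs.le, mul_inv, ← Real.rpow_neg (by positivity),
    height_diff_rpow ht hs.le hts, neg_neg, mul_comm (polarDens n s), mul_assoc,
    inv_norm_pow_mul_polarDens_of_gt ht hst, Real.rpow_add (by positivity), Real.rpow_add hts,
    Real.rpow_sub_one (by norm_num), Real.rpow_one, Real.rpow_neg hts.le, mul_inv, sub_eq_add_neg α,
    Real.rpow_add (by positivity)]
  ring

theorem leftFrac_coeff {n : ℕ} {α s t : ℝ} (hs : 0 < s) (hst : s < t) (ξ η : Sph n) :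
    polarDens n s * ((height (polarMap (t, ξ)) - height (polarMap (s, η))) ^ α /
      ‖(polarMap (t, ξ) : Euc (n + 1)) - polarMap (s, η)‖ ^ n) =
      2 ^ (α - 1) * (1 + t) ^ ((n : ℝ) / 2 - α) * t ^ (1 - (n : ℝ) / 2) * (t - s) ^ (α - 1) *
        poissonKer (√(s / t) • (ξ : Euc n)) η *
        (s ^ ((n : ℝ) / 2 - 1) * (1 + s) ^ (-((n : ℝ) / 2) - α)) := by
  have ht : 0 < t := hs.trans hst
  have hts : 0 < t - s := sub_pos.2 hst
  rw [height_sub_polarMap hs.le ht.le, div_eq_mul_inv,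
    height_diff_rpow hs.le ht.le hts, mul_comm (polarDens n s), mul_assoc,
    inv_norm_pow_mul_polarDens_of_lt hs hst, sub_eq_add_neg _ α, Real.rpow_add (by positivity),
    sub_eq_add_neg _ α, Real.rpow_add (by positivity),
    Real.rpow_sub_one (x := 2) (by norm_num), Real.rpow_sub_one hts.ne']
  ring

/-! ### The closed form in polar coordinates -/

theorem poissonInt_eq {n : ℕ} (ψ : Sph n → ℂ) (r : ℝ) (ξ : Sph n) :
    poissonInt ψ r ξ =
      (sphArea n)⁻¹ • ∫ η : Sph n, poissonKer (r • (ξ : Euc n)) η • ψ η ∂(surf n) := by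
  rw [poissonInt, one_div]
  have : ‖r • (ξ : Euc n)‖ ^ 2 = r ^ 2 := by
    rw [norm_smul, norm_eq_of_mem_sphere, mul_one, Real.norm_eq_abs, sq_abs]
  simp only [poissonKer, this]

/-- The kernel times the constant `c` is always integrable, so integrability of the difference gives
that of the kernel times `ψ`, and the two terms may be integrated separately. -/
theorem integral_poissonKer_smul_sub {n : ℕ} (hn : n ≠ 0) {X : Euc n} (hX : ‖X‖ < 1) {a : ℝ}
    {c : ℂ} {ψ : Sph n → ℂ}
    (h : Integrable (fun η : Sph n => (a * poissonKer X η) • (c - ψ η)) (surf n)) :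
    ∫ η : Sph n, (a * poissonKer X η) • (c - ψ η) ∂(surf n) =
      (a * sphArea n) • (c - (sphArea n)⁻¹ • ∫ η : Sph n, poissonKer X η • ψ η ∂(surf n)) := by
  have hK : Integrable (fun η : Sph n => (a * poissonKer X η) • c) (surf n) :=
    ((integrable_of_continuous (continuous_poissonKer_right hX)).const_mul a).smul_const c
  have hψ : Integrable (fun η : Sph n => (a * poissonKer X η) • ψ η) (surf n) := by
    refine (hK.sub h).congr (Eventually.of_forall fun η => ?_)
    simp only [Pi.sub_apply, smul_sub, sub_sub_cancel]
  have e : ∫ η : Sph n, (a * poissonKer X η) • ψ η ∂(surf n) =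
      a • ∫ η : Sph n, poissonKer X η • ψ η ∂(surf n) := by
    rw [← integral_smul]
    simp only [mul_smul]
  simp only [smul_sub]
  rw [integral_sub hK hψ, integral_smul_const, integral_const_mul, integral_poissonKer hn hX, e,
    smul_smul, mul_assoc, mul_inv_cancel₀ (sphArea_pos hn).ne', mul_one]

theorem leftAux_zero {n : ℕ} {α t : ℝ} (ht : 0 < t) (f : Sph (n + 1) → ℂ) (ξ : Sph n) :
    leftAux n α f (polarMap (t, ξ)) 0 = (1 + t) ^ (α - (n : ℝ) / 2) • f (polarMap (t, ξ)) := by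
  rw [leftAux, if_pos rfl, tanSq_polarMap ht.le]

theorem leftAux_neg {n : ℕ} {α t τ : ℝ} (ht : 0 < t) (hτ : 0 < τ) (f : Sph (n + 1) → ℂ)
    (ξ : Sph n) :
    leftAux n α f (polarMap (t, ξ)) (-τ) = leftWeight α (n / 2) t τ • ((sphArea n)⁻¹ •
      ∫ η : Sph n, poissonKer (√((t - τ) / t) • (ξ : Euc n)) η • f (polarMap (t - τ, η))
        ∂(surf n)) := by
  rw [leftAux, if_neg (by linarith), tanSq_polarMap ht.le, direction_polarMap ht, leftWeight]
  by_cases h : τ < t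
  · rw [if_neg (by linarith), if_pos h, poissonInt_eq, show 1 + -τ / t = 1 - τ / t by ring,
      show 1 + t + -τ = 1 + t - τ by ring, show 1 - τ / t = (t - τ) / t by field_simp]
    rfl
  · rw [if_pos (by linarith), if_neg h, zero_smul]

theorem rightAux_zero {n : ℕ} {α t : ℝ} (ht : 0 < t) (f : Sph (n + 1) → ℂ) (ξ : Sph n) :
    rightAux n α f (polarMap (t, ξ)) 0 = (1 + t) ^ (α - (n : ℝ) / 2) • f (polarMap (t, ξ)) := by
  rw [rightAux, if_pos rfl, tanSq_polarMap ht.le]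

theorem rightAux_neg {n : ℕ} {α t τ : ℝ} (ht : 0 < t) (hτ : 0 < τ) (f : Sph (n + 1) → ℂ)
    (ξ : Sph n) :
    rightAux n α f (polarMap (t, ξ)) (-τ) = (1 + t + τ) ^ (α - (n : ℝ) / 2) • ((sphArea n)⁻¹ •
      ∫ η : Sph n, poissonKer (√(t / (t + τ)) • (ξ : Euc n)) η • f (polarMap (t + τ, η))
        ∂(surf n)) := by
  rw [rightAux, if_neg (by linarith), tanSq_polarMap ht.le, direction_polarMap ht, poissonInt_eq,
    ← Real.sqrt_inv, show 1 - -τ / t = (t + τ) / t by field_simp; ring, inv_div, sub_neg_eq_add, sub_neg_eq_add]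
  rfl

/-- The distance `τ = t - s` that corresponds to a difference `ε` of heights. -/
def leftGap (t ε : ℝ) : ℝ := ε * (1 + t) ^ 2 / (2 + ε * (1 + t))

/-- The difference of heights that corresponds to a distance `δ = s - t`. -/
def rightGap (t δ : ℝ) : ℝ := 2 * δ / ((1 + t) * (1 + t + δ))

/-- For the sign plus a truncation in heights is translated into one in `τ`; the counterpart for the
sign minus goes from `τ` to heights. The limits are transported in these directions: from the
Marchaud integral to the closed form on the left, from the closed form to the Marchaud integral on
the right. -/
theorem height_lt_iff_left {n : ℕ} {s t ε : ℝ} (hs : 0 ≤ s) (ht : 0 ≤ t) (hε : 0 ≤ ε) (ξ η : Sph n) :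
    height (polarMap (s, η)) < height (polarMap (t, ξ)) - ε ↔ s < t - leftGap t ε := by
  rw [lt_sub_comm, height_sub_polarMap hs ht, lt_div_iff₀ (by positivity), lt_sub_comm, leftGap,
    div_lt_iff₀ (by positivity)]
  constructor <;> intro h <;> linarith

theorem height_lt_iff_right {n : ℕ} {s t δ : ℝ} (hs : 0 ≤ s) (ht : 0 ≤ t) (hδ : 0 ≤ δ) (ξ η : Sph n) :
    height (polarMap (t, ξ)) + rightGap t δ < height (polarMap (s, η)) ↔ t + δ < s := by
  rw [add_comm, ← lt_sub_iff_add_lt, height_sub_polarMap ht hs, rightGap,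
    div_lt_div_iff₀ (by positivity) (by positivity)]
  have h0 : 0 < 1 + t := by positivity
  have e : 2 * (s - t) * ((1 + t) * (1 + t + δ)) - 2 * δ * ((1 + s) * (1 + t)) =
      2 * (1 + t) ^ 2 * (s - (t + δ)) := by ring
  have h1 : 0 < 2 * (1 + t) ^ 2 := by positivity
  constructor
  · intro h
    have : 0 < 2 * (1 + t) ^ 2 * (s - (t + δ)) := by linarith
    linarith [pos_of_mul_pos_right this h1.le]
  · intro h
    have := mul_pos h1 (sub_pos.2 h)
    linarith

theorem measurableSet_height_lt {n : ℕ} (a : ℝ) : MeasurableSet {y : Sph (n + 1) | height y < a} :=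
  measurableSet_lt continuous_height.measurable measurable_const

theorem measurableSet_lt_height {n : ℕ} (a : ℝ) : MeasurableSet {y : Sph (n + 1) | a < height y} :=
  measurableSet_lt measurable_const continuous_height.measurable

/-- The part of the Marchaud integrand that corresponds to the closed form (left-sided). -/
def leftRest (n : ℕ) (α t : ℝ) (f : Sph (n + 1) → ℂ) (ξ : Sph n) (τ : ℝ) : ℂ :=
  ((τ ^ (1 + α))⁻¹ : ℝ) • (leftWeight α (n / 2) t τ • f (polarMap (t, ξ)) -
    leftAux n α f (polarMap (t, ξ)) (-τ))

/-- The part of the Marchaud integrand that corresponds to the closed form (right-sided). -/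
def rightRest (n : ℕ) (α t : ℝ) (f : Sph (n + 1) → ℂ) (ξ : Sph n) (τ : ℝ) : ℂ :=
  ((τ ^ (1 + α))⁻¹ : ℝ) • ((1 + t + τ) ^ (α - (n : ℝ) / 2) • f (polarMap (t, ξ)) -
    rightAux n α f (polarMap (t, ξ)) (-τ))

theorem leftRest_of_ge {n : ℕ} {α t : ℝ} (ht : 0 < t) (f : Sph (n + 1) → ℂ) (ξ : Sph n) {τ : ℝ}
    (hτ : t ≤ τ) : leftRest n α t f ξ τ = 0 := by
  rw [leftRest, leftAux_neg ht (ht.trans_le hτ), leftWeight, if_neg (not_lt.2 hτ), zero_smul,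
    zero_smul, sub_zero, smul_zero]

/-- In polar coordinates the integral over the sphere `S^{n-1}` at level `s = t - τ` is a Poisson
mean of `f x - f`, that is, a multiple of `leftRest` at `τ`. The value `ε = 0` yields the closed
form under absolute convergence, `ε > 0` the truncated one. -/
theorem integral_leftQuot {n : ℕ} (hn : n ≠ 0) {α t ε : ℝ} (ht : 0 < t) (hε : 0 ≤ ε)
    {f : Sph (n + 1) → ℂ} {ξ : Sph n}
    (h : IntegrableOn (leftQuot n α f (polarMap (t, ξ)))
      {y | height y < height (polarMap (t, ξ)) - ε} (surf (n + 1))) :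
    IntegrableOn (leftRest n α t f ξ) (Ioi (leftGap t ε)) ∧
    ∫ y in {y | height y < height (polarMap (t, ξ)) - ε}, leftQuot n α f (polarMap (t, ξ)) y
        ∂(surf (n + 1)) =
      (2 ^ (-α - 1) * (1 + t) ^ (α + (n : ℝ) / 2) * sphArea n) •
        ∫ τ in Ioi (leftGap t ε), leftRest n α t f ξ τ := by
  set x := polarMap (t, ξ) with hx
  set δ := leftGap t ε with hδ
  have hδ0 : 0 ≤ δ := by rw [hδ, leftGap]; positivity
  set C := 2 ^ (-α - 1) * (1 + t) ^ (α + (n : ℝ) / 2) with hC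
  have hC0 : 0 < C := by rw [hC]; positivity
  have hσ := sphArea_pos hn
  have hRm := measurableSet_height_lt (n := n) (height x - ε)
  set a : ℝ → ℝ := fun s => C * ((t - s) ^ (1 + α))⁻¹ * leftWeight α (n / 2) t (t - s) with ha
  set H : ℝ × Sph n → ℂ := fun p => if p.1 < t - δ then
    (a p.1 * poissonKer (√(p.1 / t) • (ξ : Euc n)) p.2) • (f x - f (polarMap p)) else 0 with hH
  have hF := (integrable_indicator_iff hRm).2 h
  have hcongr : (fun p => polarDens n p.1 • ({y | height y < height x - ε}.indicator
      (leftQuot n α f x) (polarMap p))) =ᵐ[polarProd n] H := by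
    filter_upwards [ae_pos_polarProd] with p hp
    obtain ⟨s, η⟩ := p
    by_cases hs : s < t - δ
    · rw [indicator_of_mem (show polarMap (s, η) ∈ {y | height y < height x - ε} from
        (height_lt_iff_left (le_of_lt hp) ht.le hε ξ η).2 hs)]
      simp only [hH, if_pos hs, ha]
      rw [leftQuot, smul_smul, leftQuot_coeff hp (by linarith) ξ η]
    · rw [indicator_of_notMem (show polarMap (s, η) ∉ {y | height y < height x - ε} from
        fun h => hs ((height_lt_iff_left (le_of_lt hp) ht.le hε ξ η).1 h)), smul_zero]
      simp only [hH, if_neg hs]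
  have hHi : Integrable H (polarProd n) :=
    ((integrable_polarMap_iff hn hF.aestronglyMeasurable).1 hF).congr hcongr
  have hslice : ∀ᵐ s ∂volume.restrict (Ioi (0 : ℝ)), ∫ η, H (s, η) ∂(surf n) =
      (Ioo 0 (t - δ)).indicator (fun s => (C * sphArea n) • leftRest n α t f ξ (t - s)) s := by
    filter_upwards [hHi.prod_right_ae, ae_restrict_mem measurableSet_Ioi] with s hs hs0
    have hs0' : (0 : ℝ) < s := hs0
    by_cases hsδ : s < t - δ
    · rw [indicator_of_mem (show s ∈ Ioo 0 (t - δ) from ⟨hs0, hsδ⟩)]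
      simp only [hH, if_pos hsδ] at hs ⊢
      have hst : s < t := by linarith
      have hτ : 0 < t - s := by linarith
      rw [integral_poissonKer_smul_sub hn (norm_smul_sqrt_lt_one hs0'.le hst ξ) hs, leftRest,
        leftAux_neg ht hτ, sub_sub_cancel, ← smul_sub, smul_smul, smul_smul]
      congr 1
      simp only [ha]; ring
    · rw [indicator_of_notMem (fun h => hsδ h.2)]
      simp [hH, if_neg hsδ]
  have hI1 := hHi.integral_prod_left.congr hslice
  have hv : ∫ y in {y | height y < height x - ε}, leftQuot n α f x y ∂(surf (n + 1)) =
      ∫ s in Ioi 0, (Ioo 0 (t - δ)).indicator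
        (fun s => (C * sphArea n) • leftRest n α t f ξ (t - s)) s := by
    rw [← integral_indicator hRm, integral_polarMap hn hF.aestronglyMeasurable,
      integral_congr_ae hcongr, integral_prod _ hHi, integral_congr_ae hslice]
  have hsub : Ioo 0 (t - δ) ⊆ Ioi 0 := fun s hs => hs.1
  have hind : ∀ τ, (Ioo 0 (t - δ)).indicator
      (fun s => (C * sphArea n) • leftRest n α t f ξ (t - s)) (t - τ) =
      (C * sphArea n) • (Ioi δ).indicator (leftRest n α t f ξ) τ := fun τ => by
    by_cases h1 : δ < τ
    · rw [indicator_of_mem (show τ ∈ Ioi δ from h1)]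
      by_cases h2 : τ < t
      · rw [indicator_of_mem (show t - τ ∈ Ioo 0 (t - δ) from ⟨by linarith, by linarith⟩),
          sub_sub_cancel]
      · rw [indicator_of_notMem (fun h => h2 (by linarith [h.1])), leftRest_of_ge ht f ξ (not_lt.1 h2),
          smul_zero]
    · rw [indicator_of_notMem (show τ ∉ Ioi δ from h1),
        indicator_of_notMem (fun h => h1 (by linarith [h.2])), smul_zero]
  have hI2 : Integrable ((Ioo 0 (t - δ)).indicator
      (fun s => (C * sphArea n) • leftRest n α t f ξ (t - s))) := by
    rw [integrable_indicator_iff measurableSet_Ioo]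
    have := (integrable_indicator_iff measurableSet_Ioo).1 hI1
    rwa [IntegrableOn, Measure.restrict_restrict measurableSet_Ioo, inter_eq_left.2 hsub] at this
  have hI3 := hI2.comp_sub_left t
  simp only [hind] at hI3
  have hCσ : C * sphArea n ≠ 0 := by positivity
  refine ⟨(integrable_indicator_iff measurableSet_Ioi).1
    ((integrable_smul_iff hCσ _).1 hI3), ?_⟩
  rw [hv, setIntegral_indicator measurableSet_Ioo, inter_eq_right.2 hsub,
    ← integral_indicator measurableSet_Ioo, ← integral_sub_left_eq_self _ volume t]
  simp only [hind]
  rw [integral_smul, integral_indicator measurableSet_Ioi]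

theorem integral_rightQuot {n : ℕ} (hn : n ≠ 0) {α t δ : ℝ} (ht : 0 < t) (hδ : 0 ≤ δ)
    {f : Sph (n + 1) → ℂ} {ξ : Sph n}
    (h : IntegrableOn (rightQuot n α f (polarMap (t, ξ)))
      {y | height (polarMap (t, ξ)) + rightGap t δ < height y} (surf (n + 1))) :
    IntegrableOn (rightRest n α t f ξ) (Ioi δ) ∧
    ∫ y in {y | height (polarMap (t, ξ)) + rightGap t δ < height y},
        rightQuot n α f (polarMap (t, ξ)) y ∂(surf (n + 1)) =
      (2 ^ (-α - 1) * (1 + t) ^ (α + (n : ℝ) / 2) * sphArea n) •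
        ∫ τ in Ioi δ, rightRest n α t f ξ τ := by
  set x := polarMap (t, ξ) with hx
  set R := {y : Sph (n + 1) | height x + rightGap t δ < height y} with hR
  set C := 2 ^ (-α - 1) * (1 + t) ^ (α + (n : ℝ) / 2) with hC
  have hC0 : 0 < C := by rw [hC]; positivity
  have hσ := sphArea_pos hn
  have hRm : MeasurableSet R := measurableSet_lt_height (n := n) (height x + rightGap t δ)
  set a : ℝ → ℝ := fun s => C * ((s - t) ^ (1 + α))⁻¹ * (1 + s) ^ (α - (n : ℝ) / 2) with ha
  set H : ℝ × Sph n → ℂ := fun p => if t + δ < p.1 then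
    (a p.1 * poissonKer (√(t / p.1) • (ξ : Euc n)) p.2) • (f x - f (polarMap p)) else 0 with hH
  have hF := (integrable_indicator_iff hRm).2 h
  have hcongr : (fun p => polarDens n p.1 • (R.indicator
      (rightQuot n α f x) (polarMap p))) =ᵐ[polarProd n] H := by
    filter_upwards [ae_pos_polarProd] with p hp
    obtain ⟨s, η⟩ := p
    by_cases hs : t + δ < s
    · rw [indicator_of_mem (show polarMap (s, η) ∈ R from
        (height_lt_iff_right (le_of_lt hp) ht.le hδ ξ η).2 hs)]
      simp only [hH, if_pos hs, ha]
      rw [rightQuot, smul_smul, rightQuot_coeff ht.le (by linarith) ξ η]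
    · rw [indicator_of_notMem (show polarMap (s, η) ∉ R from
        fun h => hs ((height_lt_iff_right (le_of_lt hp) ht.le hδ ξ η).1 h)), smul_zero]
      simp only [hH, if_neg hs]
  have hHi : Integrable H (polarProd n) :=
    ((integrable_polarMap_iff hn hF.aestronglyMeasurable).1 hF).congr hcongr
  have hslice : ∀ᵐ s ∂volume.restrict (Ioi (0 : ℝ)), ∫ η, H (s, η) ∂(surf n) =
      (Ioi (t + δ)).indicator (fun s => (C * sphArea n) • rightRest n α t f ξ (s - t)) s := by
    filter_upwards [hHi.prod_right_ae, ae_restrict_mem measurableSet_Ioi] with s hs hs0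
    have hs0' : (0 : ℝ) < s := hs0
    by_cases hsδ : t + δ < s
    · rw [indicator_of_mem (show s ∈ Ioi (t + δ) from hsδ)]
      simp only [hH, if_pos hsδ] at hs ⊢
      have hst : t < s := by linarith
      have hτ : 0 < s - t := by linarith
      rw [integral_poissonKer_smul_sub hn (norm_smul_sqrt_lt_one ht.le hst ξ) hs, rightRest,
        rightAux_neg ht hτ, add_sub_cancel, ← smul_sub, smul_smul, smul_smul,
        show 1 + t + (s - t) = 1 + s by ring]
      congr 1
      simp only [ha]; ring
    · rw [indicator_of_notMem (show s ∉ Ioi (t + δ) from hsδ)]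
      simp [hH, if_neg hsδ]
  have hI1 := hHi.integral_prod_left.congr hslice
  have hv : ∫ y in R, rightQuot n α f x y ∂(surf (n + 1)) =
      ∫ s in Ioi 0, (Ioi (t + δ)).indicator
        (fun s => (C * sphArea n) • rightRest n α t f ξ (s - t)) s := by
    rw [← integral_indicator hRm, integral_polarMap hn hF.aestronglyMeasurable,
      integral_congr_ae hcongr, integral_prod _ hHi, integral_congr_ae hslice]
  have hsub : Ioi (t + δ) ⊆ Ioi 0 := Ioi_subset_Ioi (by positivity)
  have hind : ∀ τ, (Ioi (t + δ)).indicator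
      (fun s => (C * sphArea n) • rightRest n α t f ξ (s - t)) (τ + t) =
      (C * sphArea n) • (Ioi δ).indicator (rightRest n α t f ξ) τ := fun τ => by
    by_cases h1 : δ < τ
    · rw [indicator_of_mem (show τ ∈ Ioi δ from h1),
        indicator_of_mem (show τ + t ∈ Ioi (t + δ) by simp only [mem_Ioi]; linarith),
        add_sub_cancel_right]
    · rw [indicator_of_notMem (show τ ∉ Ioi δ from h1),
        indicator_of_notMem (fun h => h1 (by simp only [mem_Ioi] at h; linarith)), smul_zero]
  have hI2 : Integrable ((Ioi (t + δ)).indicator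
      (fun s => (C * sphArea n) • rightRest n α t f ξ (s - t))) := by
    rw [integrable_indicator_iff measurableSet_Ioi]
    have := (integrable_indicator_iff measurableSet_Ioi).1 hI1
    rwa [IntegrableOn, Measure.restrict_restrict measurableSet_Ioi, inter_eq_left.2 hsub] at this
  have hI3 := hI2.comp_add_right t
  simp only [hind] at hI3
  have hCσ : C * sphArea n ≠ 0 := by positivity
  refine ⟨(integrable_indicator_iff measurableSet_Ioi).1
    ((integrable_smul_iff hCσ _).1 hI3), ?_⟩
  rw [hv, setIntegral_indicator measurableSet_Ioi, inter_eq_right.2 hsub,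
    ← integral_indicator measurableSet_Ioi, ← integral_add_right_eq_self _ t]
  simp only [hind]
  rw [integral_smul, integral_indicator measurableSet_Ioi]

/-- The factor between the Marchaud integral of first order and `T_±^α`. -/
def marchaudFactor (n : ℕ) (α t : ℝ) : ℝ := 2 ^ (-α) * (1 + t) ^ (α + (n : ℝ) / 2) * (kappa α 1)⁻¹

/-- `marchaudConst` contains `κ(α, 1)`, which cancels the normalization, and `1 - height = 2 / (1 +
t)` absorbs the powers of `2` and `1 + t`. -/
theorem marchaudFactor_mul_right {n : ℕ} {α t : ℝ} (hα0 : 0 < α) (hα1 : α < 1)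
    (ht : 0 ≤ t) (ξ : Sph n) :
    marchaudFactor n α t * ((1 + t) ^ (-((n : ℝ) / 2)) * marchaudConst α (n / 2 - α)) =
      Real.Gamma (n / 2) / (Real.Gamma (n / 2 - α) * (1 - height (polarMap (t, ξ))) ^ α) := by
  have hk := kappa_pos hα0 hα1 (ℓ := 1) le_rfl
  have h1 : 1 - height (polarMap (t, ξ)) = 2 / (1 + t) := by
    rw [height_polarMap ht]; field_simp; ring
  have e : (1 + t) ^ (α + (n : ℝ) / 2) * (1 + t) ^ (-((n : ℝ) / 2)) = (1 + t) ^ α := by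
    rw [← Real.rpow_add (by positivity)]; congr 1; ring
  rw [h1, Real.div_rpow (by norm_num) (by positivity), marchaudFactor, marchaudConst, sub_add_cancel,
    Real.rpow_neg (by norm_num)]
  calc _ = ((1 + t) ^ (α + (n : ℝ) / 2) * (1 + t) ^ (-((n : ℝ) / 2))) * (2 ^ α)⁻¹ *
        ((kappa α 1)⁻¹ * kappa α 1) * (Real.Gamma (n / 2) / Real.Gamma (n / 2 - α)) := by ring
    _ = _ := by rw [e, inv_mul_cancel₀ hk.ne', div_mul_eq_div_div, div_div_eq_mul_div]; ring

theorem marchaudFactor_mul_left {n : ℕ} {α t : ℝ} (hα0 : 0 < α) (hα1 : α < 1)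
    (ht : 0 < t) (ξ : Sph n) :
    marchaudFactor n α t * (t ^ (-α) * (1 + t) ^ (-((n : ℝ) / 2)) * marchaudConst α (n / 2 - α)) =
      Real.Gamma (n / 2) / (Real.Gamma (n / 2 - α) * (1 + height (polarMap (t, ξ))) ^ α) := by
  have h := marchaudFactor_mul_right (n := n) hα0 hα1 ht.le ξ
  have h1 : 1 + height (polarMap (t, ξ)) = t * (1 - height (polarMap (t, ξ))) := by
    rw [height_polarMap ht.le]; field_simp; ring
  have h2 : 0 ≤ 1 - height (polarMap (t, ξ)) := by
    have := abs_le.1 (abs_height_le (polarMap (t, ξ))); linarith [this.2]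
  rw [h1, Real.mul_rpow ht.le h2, Real.rpow_neg ht.le]
  rw [show ∀ a b c d : ℝ, a * (b * c * d) = (a * (c * d)) * b by intros; ring, h]
  rw [← div_eq_mul_inv, div_div]
  congr 1; ring

theorem marchaudFactor_eq {n : ℕ} (hn : n ≠ 0) {α t : ℝ} (hα0 : 0 < α) (hα1 : α < 1) (ht : 0 ≤ t) :
    marchaudFactor n α t = 2 * α / (sphArea n * Real.Gamma (1 - α)) *
      (2 ^ (-α - 1) * (1 + t) ^ (α + (n : ℝ) / 2) * sphArea n) := by
  have hσ := sphArea_pos hn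
  have hΓ := Real.Gamma_pos_of_pos (sub_pos.2 hα1)
  rw [marchaudFactor, kappa_one hα0 hα1, Real.rpow_sub_one (by norm_num)]
  field_simp

/-- The contribution of the constant function to the Marchaud integral (left-sided). -/
def leftConst (n : ℕ) (α t τ : ℝ) : ℝ :=
  ((1 + t) ^ (α - (n : ℝ) / 2) - leftWeight α (n / 2) t τ) * (τ ^ (1 + α))⁻¹

/-- The contribution of the constant function to the Marchaud integral (right-sided). -/
def rightConst (n : ℕ) (α t τ : ℝ) : ℝ :=
  ((1 + t) ^ (α - (n : ℝ) / 2) - (1 + t + τ) ^ (α - (n : ℝ) / 2)) * (τ ^ (1 + α))⁻¹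

/-- The term added and subtracted is the value of `A_x^+` at `-τ` for the constant function `f x`,
since the Poisson integral of a constant is that constant. -/
theorem firstDiff_leftAux {n : ℕ} {α t τ : ℝ} (ht : 0 < t) (f : Sph (n + 1) → ℂ) (ξ : Sph n) :
    firstDiff α (leftAux n α f (polarMap (t, ξ))) τ =
      leftConst n α t τ • f (polarMap (t, ξ)) + leftRest n α t f ξ τ := by
  rw [firstDiff, leftRest, leftConst, leftAux_zero ht]
  module

theorem firstDiff_rightAux {n : ℕ} {α t τ : ℝ} (ht : 0 < t) (f : Sph (n + 1) → ℂ) (ξ : Sph n) :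
    firstDiff α (rightAux n α f (polarMap (t, ξ))) τ =
      rightConst n α t τ • f (polarMap (t, ξ)) + rightRest n α t f ξ τ := by
  rw [firstDiff, rightRest, rightConst, rightAux_zero ht]
  module

theorem one_le_half {n : ℕ} (hn : 2 ≤ n) : (1 : ℝ) ≤ n / 2 := by
  have : (2 : ℝ) ≤ n := by exact_mod_cast hn
  linarith

theorem integrableOn_leftConst {n : ℕ} (hn : 2 ≤ n) {α t : ℝ} (hα0 : 0 < α) (hα1 : α < 1)
    (ht : 0 < t) : IntegrableOn (leftConst n α t) (Ioi 0) ∧ ∫ τ in Ioi 0, leftConst n α t τ =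
      t ^ (-α) * (1 + t) ^ (-((n : ℝ) / 2)) * marchaudConst α (n / 2 - α) :=
  integrableOn_left_const hα0 hα1 (one_le_half hn) ht

theorem integrableOn_rightConst {n : ℕ} (hn : 2 ≤ n) {α t : ℝ} (hα0 : 0 < α) (hα1 : α < 1)
    (ht : 0 ≤ t) : IntegrableOn (rightConst n α t) (Ioi 0) ∧ ∫ τ in Ioi 0, rightConst n α t τ =
      (1 + t) ^ (-((n : ℝ) / 2)) * marchaudConst α (n / 2 - α) :=
  integrableOn_right_const hα0 hα1 (one_le_half hn) (by linarith : 0 < 1 + t)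

theorem integral_firstDiff_leftAux {n : ℕ} (hn : 2 ≤ n) {α t δ : ℝ} (hα0 : 0 < α) (hα1 : α < 1)
    (ht : 0 < t) (hδ : 0 ≤ δ) {f : Sph (n + 1) → ℂ} {ξ : Sph n}
    (hI : IntegrableOn (leftRest n α t f ξ) (Ioi δ)) :
    IntegrableOn (firstDiff α (leftAux n α f (polarMap (t, ξ)))) (Ioi δ) ∧
    ∫ τ in Ioi δ, firstDiff α (leftAux n α f (polarMap (t, ξ))) τ =
      (∫ τ in Ioi δ, leftConst n α t τ) • f (polarMap (t, ξ)) +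
        ∫ τ in Ioi δ, leftRest n α t f ξ τ := by
  have hc := (integrableOn_leftConst hn hα0 hα1 ht).1.mono_set (Ioi_subset_Ioi hδ)
  simp only [funext fun τ => firstDiff_leftAux (τ := τ) (α := α) ht f ξ]
  refine ⟨(hc.smul_const _).add hI, ?_⟩
  rw [integral_add (hc.smul_const _) hI, integral_smul_const]

theorem integral_firstDiff_rightAux {n : ℕ} (hn : 2 ≤ n) {α t δ : ℝ} (hα0 : 0 < α) (hα1 : α < 1)
    (ht : 0 < t) (hδ : 0 ≤ δ) {f : Sph (n + 1) → ℂ} {ξ : Sph n}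
    (hI : IntegrableOn (rightRest n α t f ξ) (Ioi δ)) :
    IntegrableOn (firstDiff α (rightAux n α f (polarMap (t, ξ)))) (Ioi δ) ∧
    ∫ τ in Ioi δ, firstDiff α (rightAux n α f (polarMap (t, ξ))) τ =
      (∫ τ in Ioi δ, rightConst n α t τ) • f (polarMap (t, ξ)) +
        ∫ τ in Ioi δ, rightRest n α t f ξ τ := by
  have hc := (integrableOn_rightConst hn hα0 hα1 ht.le).1.mono_set (Ioi_subset_Ioi hδ)
  simp only [funext fun τ => firstDiff_rightAux (τ := τ) (α := α) ht f ξ]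
  refine ⟨(hc.smul_const _).add hI, ?_⟩
  rw [integral_add (hc.smul_const _) hI, integral_smul_const]

theorem closedForm_left {n : ℕ} (hn : n ≠ 0) {α t : ℝ} (hα0 : 0 < α) (hα1 : α < 1) (ht : 0 < t)
    (ξ : Sph n) (a J : ℂ) :
    (Real.Gamma (n / 2) / (Real.Gamma (n / 2 - α) * (1 + height (polarMap (t, ξ))) ^ α) : ℝ) • a +
      (2 * α / (sphArea n * Real.Gamma (1 - α)) : ℝ) •
        (2 ^ (-α - 1) * (1 + t) ^ (α + (n : ℝ) / 2) * sphArea n) • J =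
      marchaudFactor n α t •
        ((t ^ (-α) * (1 + t) ^ (-((n : ℝ) / 2)) * marchaudConst α (n / 2 - α)) • a + J) := by
  rw [smul_add, smul_smul, smul_smul, marchaudFactor_mul_left hα0 hα1 ht,
    ← marchaudFactor_eq hn hα0 hα1 ht.le]

theorem closedForm_right {n : ℕ} (hn : n ≠ 0) {α t : ℝ} (hα0 : 0 < α) (hα1 : α < 1) (ht : 0 ≤ t)
    (ξ : Sph n) (a J : ℂ) :
    (Real.Gamma (n / 2) / (Real.Gamma (n / 2 - α) * (1 - height (polarMap (t, ξ))) ^ α) : ℝ) • a +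
      (2 * α / (sphArea n * Real.Gamma (1 - α)) : ℝ) •
        (2 ^ (-α - 1) * (1 + t) ^ (α + (n : ℝ) / 2) * sphArea n) • J =
      marchaudFactor n α t •
        (((1 + t) ^ (-((n : ℝ) / 2)) * marchaudConst α (n / 2 - α)) • a + J) := by
  rw [smul_add, smul_smul, smul_smul, marchaudFactor_mul_right hα0 hα1 ht,
    ← marchaudFactor_eq hn hα0 hα1 ht]

theorem leftGap_zero (t : ℝ) : leftGap t 0 = 0 := by simp [leftGap]

theorem rightGap_zero (t : ℝ) : rightGap t 0 = 0 := by simp [rightGap]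

/-- The closed form of `T_+^α f`. -/
theorem hasLeftT_closedForm {n : ℕ} (hn : 2 ≤ n) {α : ℝ} (hα0 : 0 < α) (hα1 : α < 1)
    {f : Sph (n + 1) → ℂ} {x : Sph (n + 1)} (hx : -1 < height x) (hx1 : height x < 1)
    (h : IntegrableOn (leftQuot n α f x) {y | height y < height x} (surf (n + 1))) :
    HasLeftT n α f x
      ((Real.Gamma (n / 2) / (Real.Gamma (n / 2 - α) * (1 + height x) ^ α) : ℝ) • f x +
        (2 * α / (sphArea n * Real.Gamma (1 - α)) : ℝ) •
          ∫ y in {y | height y < height x}, leftQuot n α f x y ∂(surf (n + 1))) := by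
  have hn0 : n ≠ 0 := by omega
  obtain ⟨ξ, ht, hxe⟩ := exists_polarMap_eq x hx hx1
  generalize tanSq x = t at ht hxe
  subst hxe
  have h0 := integral_leftQuot hn0 (f := f) (ξ := ξ) (α := α) ht le_rfl (by simpa using h)
  rw [leftGap_zero, sub_zero] at h0
  obtain ⟨hI, hv⟩ := h0
  obtain ⟨hD, hDv⟩ := integral_firstDiff_leftAux hn hα0 hα1 ht le_rfl hI
  rw [(integrableOn_leftConst hn hα0 hα1 ht).2] at hDv
  have hT := hasLeftT_of_tendsto hα0 hα1 (f := f) (x := polarMap (t, ξ))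
    (fun ε hε => hD.mono_set (Ioi_subset_Ioi hε.le)) (tendsto_setIntegral_Ioi_zero hD)
  rw [hv, closedForm_left hn0 hα0 hα1 ht, ← hDv]
  rwa [tanSq_polarMap ht.le] at hT

/-- The closed form of `T_-^α f`. -/
theorem hasRightT_closedForm {n : ℕ} (hn : 2 ≤ n) {α : ℝ} (hα0 : 0 < α) (hα1 : α < 1)
    {f : Sph (n + 1) → ℂ} {x : Sph (n + 1)} (hx : -1 < height x) (hx1 : height x < 1)
    (h : IntegrableOn (rightQuot n α f x) {y | height x < height y} (surf (n + 1))) :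
    HasRightT n α f x
      ((Real.Gamma (n / 2) / (Real.Gamma (n / 2 - α) * (1 - height x) ^ α) : ℝ) • f x +
        (2 * α / (sphArea n * Real.Gamma (1 - α)) : ℝ) •
          ∫ y in {y | height x < height y}, rightQuot n α f x y ∂(surf (n + 1))) := by
  have hn0 : n ≠ 0 := by omega
  obtain ⟨ξ, ht, hxe⟩ := exists_polarMap_eq x hx hx1
  generalize tanSq x = t at ht hxe
  subst hxe
  have h0 := integral_rightQuot hn0 (f := f) (ξ := ξ) (α := α) ht le_rfl
    (by simpa [rightGap_zero] using h)
  rw [rightGap_zero, add_zero] at h0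
  obtain ⟨hI, hv⟩ := h0
  obtain ⟨hD, hDv⟩ := integral_firstDiff_rightAux hn hα0 hα1 ht le_rfl hI
  rw [(integrableOn_rightConst hn hα0 hα1 ht.le).2] at hDv
  have hT := hasRightT_of_tendsto hα0 hα1 (f := f) (x := polarMap (t, ξ))
    (fun ε hε => hD.mono_set (Ioi_subset_Ioi hε.le)) (tendsto_setIntegral_Ioi_zero hD)
  rw [hv, closedForm_right hn0 hα0 hα1 ht.le, ← hDv]
  rwa [tanSq_polarMap ht.le] at hT

/-! ### The identity for the constant -/

theorem nonempty_sph {n : ℕ} (hn : n ≠ 0) : Nonempty (Sph n) := by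
  have : Nonempty (Fin n) := ⟨⟨0, Nat.pos_of_ne_zero hn⟩⟩
  exact (NormedSpace.sphere_nonempty (x := (0 : Euc n)) (r := 1)).2 zero_le_one |>.to_subtype

/-- The pole of height `-1` is the level `t = 0` with an arbitrary direction. It is admitted in the
identity for the constant, which is why the right-sided formulas are kept valid at `t = 0`. -/
theorem exists_polarMap_eq_of_lt {n : ℕ} (hn : n ≠ 0) (x : Sph (n + 1)) (hx : height x < 1) :
    ∃ t : ℝ, ∃ ξ : Sph n, 0 ≤ t ∧ x = polarMap (t, ξ) := by
  rcases lt_or_ge (-1) (height x) with h | h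
  · obtain ⟨ξ, ht, e⟩ := exists_polarMap_eq x h hx
    exact ⟨_, ξ, ht.le, e⟩
  · obtain ⟨ξ⟩ := nonempty_sph hn
    refine ⟨0, ξ, le_rfl, Subtype.ext ?_⟩
    have h1 : height x = -1 := le_antisymm h (abs_le.1 (abs_height_le x)).1
    have h2 := EuclideanSpace.norm_sq_eq (x : Euc (n + 1))
    rw [norm_eq_of_mem_sphere, Fin.sum_univ_castSucc] at h2
    have h3 : ‖(x : Euc (n + 1)) (Fin.last n)‖ ^ 2 = 1 := by
      change ‖height x‖ ^ 2 = 1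
      rw [h1]; norm_num
    rw [h3] at h2
    have h4 : ∑ i : Fin n, ‖(x : Euc (n + 1)) i.castSucc‖ ^ 2 = 0 := by linarith
    rw [Finset.sum_eq_zero_iff_of_nonneg (fun i _ => sq_nonneg _)] at h4
    change (x : Euc (n + 1)) = polarVec (√0) ξ
    rw [polarVec_eq]
    ext i
    refine Fin.lastCases ?_ (fun i => ?_) i
    · rw [snocVec_last]
      change height x = _
      rw [h1]; simp
    · have := h4 i (Finset.mem_univ i)
      rw [snocVec_castSucc]
      simpa using this

theorem lambdaIntegrand_polarMap {n : ℕ} {α s t : ℝ} (ht : 0 ≤ t) (hst : t < s) (ξ η : Sph n) :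
    polarDens n s * lambdaIntegrand n α (polarMap (t, ξ)) (polarMap (s, η)) =
      2 ^ (-α - 1) * (1 + t) ^ (α + (n : ℝ) / 2) * rightConst n α t (s - t) *
        poissonKer (√(t / s) • (ξ : Euc n)) η := by
  have hs : 0 < s := ht.trans_lt hst
  have h1 : (1 - height (polarMap (s, η))) / (1 - height (polarMap (t, ξ))) = (1 + t) / (1 + s) := by
    rw [height_polarMap hs.le, height_polarMap ht]
    have : 1 + t ≠ 0 := by positivity
    have e1 : 1 - (s - 1) / (1 + s) = 2 / (1 + s) := by field_simp; ring
    have e2 : 1 - (t - 1) / (1 + t) = 2 / (1 + t) := by field_simp; ring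
    rw [e1, e2]
    field_simp
  have hp := Real.rpow_pos_of_pos (by positivity : 0 < 1 + s) (α - (n : ℝ) / 2)
  rw [lambdaIntegrand, h1, div_eq_mul_inv, mul_left_comm, rightQuot_coeff ht hst ξ η, rightConst,
    Real.div_rpow (by positivity) (by positivity), show 1 + t + (s - t) = 1 + s by ring]
  field_simp

theorem measurable_lambdaIntegrand {n : ℕ} (α : ℝ) (x : Sph (n + 1)) :
    Measurable (lambdaIntegrand n α x) := by
  have h := (continuous_height (n := n)).measurable
  have h2 : Measurable fun y : Sph (n + 1) => ‖(x : Euc (n + 1)) - y‖ := by fun_prop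
  unfold lambdaIntegrand
  fun_prop

/-- The quotient of the values `1 - height` is `(1 + t) / (1 + s)`, so in polar coordinates the
integrand is `rightConst` at `s - t` times a Poisson kernel. Integration over `S^{n-1}` gives the
mass of the kernel and leaves the constant part of `T_-^α`. Everything is nonnegative, which yields
absolute convergence. -/
theorem integral_lambdaIntegrand {n : ℕ} (hn : 2 ≤ n) {α : ℝ} (hα0 : 0 < α) (hα1 : α < 1)
    {x : Sph (n + 1)} (hx : height x < 1) :
    IntegrableOn (lambdaIntegrand n α x) {y | height x < height y} (surf (n + 1)) ∧
      2 * α / (sphArea n * Real.Gamma (1 - α)) *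
          ∫ y in {y | height x < height y}, lambdaIntegrand n α x y ∂(surf (n + 1)) =
        Real.Gamma (n / 2) / (Real.Gamma (n / 2 - α) * (1 - height x) ^ α) := by
  have hn0 : n ≠ 0 := by omega
  have hσ := sphArea_pos hn0
  obtain ⟨t, ξ, ht, rfl⟩ := exists_polarMap_eq_of_lt hn0 x hx
  obtain ⟨hc, hcv⟩ := integrableOn_rightConst hn hα0 hα1 ht
  set C := 2 ^ (-α - 1) * (1 + t) ^ (α + (n : ℝ) / 2) with hC
  have hC0 : 0 < C := by rw [hC]; positivity
  set R := {y : Sph (n + 1) | height (polarMap (t, ξ)) < height y} with hR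
  have hRm : MeasurableSet R := measurableSet_lt_height _
  set F := R.indicator (lambdaIntegrand n α (polarMap (t, ξ))) with hF
  have hFm : AEStronglyMeasurable F (surf (n + 1)) :=
    ((measurable_lambdaIntegrand α _).indicator hRm).aestronglyMeasurable
  set H : ℝ × Sph n → ℝ := fun p => if t < p.1 then
    C * rightConst n α t (p.1 - t) * poissonKer (√(t / p.1) • (ξ : Euc n)) p.2 else 0 with hH
  have hcongr : (fun p => polarDens n p.1 • F (polarMap p)) =ᵐ[polarProd n] H := by
    filter_upwards [ae_pos_polarProd] with p hp
    obtain ⟨s, η⟩ := p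
    have hiff := height_lt_iff_right (le_of_lt hp) ht le_rfl ξ η
    rw [rightGap_zero, add_zero, add_zero] at hiff
    by_cases hs : t < s
    · rw [hF, indicator_of_mem (show polarMap (s, η) ∈ R from hiff.2 hs)]
      simp only [hH, if_pos hs]
      rw [smul_eq_mul, lambdaIntegrand_polarMap ht hs]
    · rw [hF, indicator_of_notMem (show polarMap (s, η) ∉ R from fun h => hs (hiff.1 h)), smul_zero]
      simp only [hH, if_neg hs]
  have hHm : AEStronglyMeasurable H (polarProd n) := by
    refine AEStronglyMeasurable.congr ?_ hcongr
    exact ((measurable_polarDens n).comp measurable_fst).aestronglyMeasurable.smul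
      (aestronglyMeasurable_polarMap hn0 hFm)
  have hslice : ∀ s ∈ Ioi (0 : ℝ), Integrable (fun η => H (s, η)) (surf n) ∧
      ∫ η, H (s, η) ∂(surf n) =
        (Ioi t).indicator (fun s => C * sphArea n * rightConst n α t (s - t)) s := fun s hs => by
    by_cases hst : t < s
    · have hlt := norm_smul_sqrt_lt_one ht hst ξ
      rw [indicator_of_mem (show s ∈ Ioi t from hst)]
      simp only [hH, if_pos hst]
      refine ⟨(integrable_of_continuous (continuous_poissonKer_right hlt)).const_mul _, ?_⟩
      rw [integral_const_mul, integral_poissonKer hn0 hlt]; ring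
    · rw [indicator_of_notMem (show s ∉ Ioi t from hst)]
      simp [hH, if_neg hst]
  have hrc : ∀ τ : ℝ, 0 < τ → 0 ≤ rightConst n α t τ := fun τ hτ => by
    refine mul_nonneg (sub_nonneg.2 ?_) (by positivity)
    exact Real.rpow_le_rpow_of_nonpos (by positivity) (by linarith) (by linarith [one_le_half hn])
  have hHn : ∀ p : ℝ × Sph n, 0 ≤ H p := fun p => by
    simp only [hH]
    split_ifs with h
    · have := poissonKer_nonneg (norm_smul_sqrt_lt_one ht h ξ).le p.2
      have := hrc _ (sub_pos.2 h)
      positivity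
    · exact le_rfl
  have hsub : Ioi t ⊆ Ioi 0 := Ioi_subset_Ioi ht
  have hshift : IntegrableOn (fun s => C * sphArea n * rightConst n α t (s - t)) (Ioi t) ∧
      ∫ s in Ioi t, C * sphArea n * rightConst n α t (s - t) =
        C * sphArea n * ((1 + t) ^ (-((n : ℝ) / 2)) * marchaudConst α (n / 2 - α)) := by
    have hp := measurePreserving_add_right (volume : Measure ℝ) t
    have he := measurableEmbedding_addRight t
    have h1 := hp.setIntegral_preimage_emb he (fun s => C * sphArea n * rightConst n α t (s - t)) (Ioi t)
    have h2 := hp.integrableOn_comp_preimage he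
      (f := fun s => C * sphArea n * rightConst n α t (s - t)) (s := Ioi t)
    rw [preimage_add_const_Ioi, sub_self] at h1 h2
    simp only [Function.comp_def, add_sub_cancel_right] at h1 h2
    refine ⟨h2.1 (hc.const_mul _), ?_⟩
    rw [← h1, integral_const_mul, hcv]
  have hHi : Integrable H (polarProd n) := by
    rw [integrable_prod_iff hHm]
    refine ⟨?_, ?_⟩
    · filter_upwards [ae_restrict_mem measurableSet_Ioi] with s hs using (hslice s hs).1
    · have h3 : Integrable ((Ioi t).indicator fun s => C * sphArea n * rightConst n α t (s - t))
          (volume.restrict (Ioi 0)) :=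
        ((integrable_indicator_iff measurableSet_Ioi).2 hshift.1).restrict
      refine h3.congr ?_
      filter_upwards [ae_restrict_mem measurableSet_Ioi] with s hs
      simp only [Real.norm_of_nonneg (hHn _)]
      exact (hslice s hs).2.symm
  have hFi : Integrable F (surf (n + 1)) :=
    (integrable_polarMap_iff hn0 hFm).2 (hHi.congr hcongr.symm)
  refine ⟨(integrable_indicator_iff hRm).1 hFi, ?_⟩
  have hv : ∫ y in R, lambdaIntegrand n α (polarMap (t, ξ)) y ∂(surf (n + 1)) =
      C * sphArea n * ((1 + t) ^ (-((n : ℝ) / 2)) * marchaudConst α (n / 2 - α)) := by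
    rw [← integral_indicator hRm, integral_polarMap hn0 hFm, integral_congr_ae hcongr,
      integral_prod _ hHi, setIntegral_congr_fun measurableSet_Ioi fun s hs => (hslice s hs).2,
      setIntegral_indicator measurableSet_Ioi, inter_eq_right.2 hsub, hshift.2]
  rw [hv, ← mul_assoc, ← marchaudFactor_eq hn0 hα0 hα1 ht, marchaudFactor_mul_right hα0 hα1 ht]

/-! ### The fractional integral in polar coordinates -/

/-- The density of `φ` with respect to which `S_+^α φ` is a fractional integral on the half-line. -/
def polarDensity (n : ℕ) (α : ℝ) (φ : Sph (n + 1) → ℂ) (p : ℝ × Sph n) : ℂ :=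
  (if 0 < p.1 then p.1 ^ ((n : ℝ) / 2 - 1) * (1 + p.1) ^ (-((n : ℝ) / 2) - α) else 0) •
    φ (polarMap p)

/-- The kernel of order `α` on `(0, s) × S^{n-1}`, with the Poisson kernel at `√(p.1 / t) ξ`. -/
def fracKer {n : ℕ} (α s t : ℝ) (ξ : Sph n) (p : ℝ × Sph n) : ℝ :=
  if p.1 < s then (s - p.1) ^ (α - 1) * poissonKer (√(p.1 / t) • (ξ : Euc n)) p.2 else 0

theorem polarDensity_of_le {n : ℕ} {α : ℝ} {φ : Sph (n + 1) → ℂ} {s : ℝ} (hs : s ≤ 0) (η : Sph n) :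
    polarDensity n α φ (s, η) = 0 := by
  rw [polarDensity, if_neg (not_lt.2 hs), zero_smul]

theorem stronglyMeasurable_polarDensity {n : ℕ} {α : ℝ} {φ : Sph (n + 1) → ℂ}
    (hφ : StronglyMeasurable φ) : StronglyMeasurable (polarDensity n α φ) := by
  refine StronglyMeasurable.smul (f := fun p : ℝ × Sph n => if 0 < p.1 then
    p.1 ^ ((n : ℝ) / 2 - 1) * (1 + p.1) ^ (-((n : ℝ) / 2) - α) else 0) ?_
    (hφ.comp_measurable continuous_polarMap.measurable)
  exact (Measurable.ite (measurableSet_lt measurable_const measurable_fst) (by fun_prop)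
    measurable_const).stronglyMeasurable

theorem measurable_fracKer {n : ℕ} {β : Type*} [MeasurableSpace β] (α : ℝ) {s t : β → ℝ}
    {ξ : β → Sph n} {p : β → ℝ × Sph n} (hs : Measurable s) (ht : Measurable t) (hξ : Measurable ξ)
    (hp : Measurable p) : Measurable fun b => fracKer α (s b) (t b) (ξ b) (p b) := by
  unfold fracKer poissonKer
  have h1 : Measurable fun b => ((p b).2 : Euc n) := measurable_subtype_coe.comp hp.snd
  have h2 : Measurable fun b => (ξ b : Euc n) := measurable_subtype_coe.comp hξ
  refine Measurable.ite (measurableSet_lt hp.fst hs) ?_ measurable_const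
  fun_prop

theorem fracKer_nonneg {n : ℕ} {α s t : ℝ} (hst : s ≤ t) (ξ : Sph n) {p : ℝ × Sph n} (hp : 0 < p.1) :
    0 ≤ fracKer α s t ξ p := by
  rw [fracKer]
  split_ifs with h
  · have := poissonKer_nonneg (norm_smul_sqrt_lt_one hp.le (h.trans_le hst) ξ).le p.2
    have := sub_pos.2 h
    positivity
  · exact le_rfl

theorem lintegral_poissonKer {n : ℕ} (hn : n ≠ 0) {X : Euc n} (hX : ‖X‖ < 1) :
    ∫⁻ η : Sph n, ENNReal.ofReal (poissonKer X η) ∂(surf n) = ENNReal.ofReal (sphArea n) := by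
  rw [← ofReal_integral_eq_lintegral_ofReal
    (integrable_of_continuous (continuous_poissonKer_right hX))
    (Eventually.of_forall fun η => poissonKer_nonneg hX.le _), integral_poissonKer hn hX]

/-- The integration is over `ξ`, not over the variable of the Poisson integral; the symmetry
`poissonKer_comm` exchanges the two. -/
theorem lintegral_fracKer_sphere {n : ℕ} (hn : n ≠ 0) {α s t : ℝ} (hst : s ≤ t) {p : ℝ × Sph n}
    (hp : 0 < p.1) :
    ∫⁻ ξ : Sph n, ENNReal.ofReal (fracKer α s t ξ p) ∂(surf n) =
      if p.1 < s then ENNReal.ofReal (sphArea n) * ENNReal.ofReal ((s - p.1) ^ (α - 1)) else 0 := by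
  split_ifs with h
  · have hlt := norm_smul_sqrt_lt_one hp.le (h.trans_le hst) p.2
    have h0 := sub_pos.2 h
    simp only [fracKer, if_pos h]
    simp only [ENNReal.ofReal_mul (Real.rpow_nonneg h0.le _)]
    simp only [poissonKer_comm (norm_eq_of_mem_sphere _) (norm_eq_of_mem_sphere p.2)]
    rw [lintegral_const_mul _ (continuous_poissonKer_right hlt).measurable.ennreal_ofReal,
      lintegral_poissonKer hn hlt, mul_comm]
  · simp [fracKer, if_neg h]

theorem integrable_poissonKer_mul_poissonKer {n : ℕ} {X : Euc n} (hX : ‖X‖ < 1) {b : ℝ}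
    (hb0 : 0 ≤ b) (hb1 : b < 1) (ζ : Sph n) :
    Integrable (fun η : Sph n => poissonKer X η * poissonKer (b • (η : Euc n)) ζ) (surf n) := by
  have hlt : ‖b • (ζ : Euc n)‖ < 1 := by
    rwa [norm_smul, norm_eq_of_mem_sphere, mul_one, Real.norm_of_nonneg hb0]
  simp only [poissonKer_comm (norm_eq_of_mem_sphere _) (norm_eq_of_mem_sphere ζ)]
  exact integrable_of_continuous ((continuous_poissonKer_right hX).mul (continuous_poissonKer_right hlt))

/-- The semigroup property of the Poisson kernel, for the kernels `fracKer`. -/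
theorem integral_poissonKer_mul_fracKer {n : ℕ} (hn : n ≠ 0) {α s t : ℝ} (hs : 0 < s) (hst : s < t)
    (ξ : Sph n) {p : ℝ × Sph n} (hp : 0 < p.1) :
    Integrable (fun ζ : Sph n => poissonKer (√(s / t) • (ξ : Euc n)) ζ * fracKer α s s ζ p) (surf n) ∧
    ∫ ζ : Sph n, poissonKer (√(s / t) • (ξ : Euc n)) ζ * fracKer α s s ζ p ∂(surf n) =
      sphArea n * fracKer α s t ξ p := by
  by_cases h : p.1 < s
  · have hX := norm_smul_sqrt_lt_one hs.le hst ξ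
    have hb1 : √(p.1 / s) < 1 := by
      rw [Real.sqrt_lt' one_pos, one_pow, div_lt_one hs]; exact h
    have hI := integrable_poissonKer_mul_poissonKer hX (Real.sqrt_nonneg (p.1 / s)) hb1 p.2
    have e : √(p.1 / s) * √(s / t) = √(p.1 / t) := by
      rw [← Real.sqrt_mul (by positivity)]; congr 1; field_simp
    simp only [fracKer, if_pos h, mul_left_comm _ ((s - p.1) ^ (α - 1))]
    refine ⟨hI.const_mul _, ?_⟩
    rw [integral_const_mul, integral_poissonKer_mul_poissonKer hn (norm_eq_of_mem_sphere p.2)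
      (Real.sqrt_nonneg _) hb1 hX, smul_smul, e]
  · simp [fracKer, if_neg h]

theorem lintegral_rpow_sub {α a b : ℝ} (hα0 : 0 < α) (hab : a ≤ b) :
    ∫⁻ s in Ioo a b, ENNReal.ofReal ((s - a) ^ (α - 1)) = ENNReal.ofReal ((b - a) ^ α / α) := by
  have hI : IntervalIntegrable (fun s : ℝ => (s - a) ^ (α - 1)) volume a b := by
    have := (intervalIntegral.intervalIntegrable_rpow' (a := 0) (b := b - a)
      (by linarith : -1 < α - 1)).comp_sub_right a
    simpa using this
  have hI' := (intervalIntegrable_iff_integrableOn_Ioc_of_le hab).1 hI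
  rw [restrict_Ioo_eq_restrict_Ioc, ← ofReal_integral_eq_lintegral_ofReal hI' (by
    filter_upwards [ae_restrict_mem measurableSet_Ioc] with s hs
    exact Real.rpow_nonneg (by linarith [hs.1]) _), ← intervalIntegral.integral_of_le hab,
    intervalIntegral.integral_comp_sub_right (fun s => s ^ (α - 1)), sub_self,
    integral_rpow (Or.inl (by linarith)), sub_add_cancel, Real.zero_rpow hα0.ne', sub_zero]

/-- In `fracKer α s t` the power has its singularity at level `s`, while the Poisson kernel refers
to level `t`. The integral of `(s - p.1)^{α-1}` over `p.1 < s < t` equals `(t - p.1) / α` times `(t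
- p.1)^{α-1}`, so convergence for `s = t` controls almost every `s < t`. -/
theorem lintegral_fracKer_order {n : ℕ} {α t : ℝ} (hα0 : 0 < α) (ht : 0 < t) (ξ : Sph n)
    {p : ℝ × Sph n} (hp : 0 < p.1) :
    ∫⁻ s in Ioo 0 t, ENNReal.ofReal (fracKer α s t ξ p) ≤
      ENNReal.ofReal (t / α) * ENNReal.ofReal (fracKer α t t ξ p) := by
  by_cases h : p.1 < t
  · have hP := poissonKer_nonneg (norm_smul_sqrt_lt_one hp.le h ξ).le p.2
    have h0 := sub_pos.2 h
    have e : ∀ s, ENNReal.ofReal (fracKer α s t ξ p) = (Ioi p.1).indicator (fun s =>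
        ENNReal.ofReal ((s - p.1) ^ (α - 1)) *
          ENNReal.ofReal (poissonKer (√(p.1 / t) • (ξ : Euc n)) p.2)) s := fun s => by
      by_cases hs : p.1 < s
      · rw [indicator_of_mem (show s ∈ Ioi p.1 from hs), fracKer, if_pos hs,
          ENNReal.ofReal_mul (Real.rpow_nonneg (sub_pos.2 hs).le _)]
      · rw [indicator_of_notMem (show s ∉ Ioi p.1 from hs), fracKer, if_neg hs, ENNReal.ofReal_zero]
    rw [setLIntegral_congr_fun measurableSet_Ioo (fun s _ => e s),
      setLIntegral_indicator measurableSet_Ioi, inter_comm, Ioo_inter_Ioi, max_eq_right hp.le,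
      lintegral_mul_const' _ _ (by finiteness), lintegral_rpow_sub hα0 h.le, fracKer, if_pos h,
      ← ENNReal.ofReal_mul (by positivity), ← ENNReal.ofReal_mul (by positivity)]
    refine ENNReal.ofReal_le_ofReal ?_
    rw [← mul_assoc]
    refine mul_le_mul_of_nonneg_right ?_ hP
    rw [Real.rpow_sub_one h0.ne', div_mul_div_comm, mul_comm t, div_le_div_iff₀ hα0 (by positivity)]
    have : 0 ≤ (t - p.1) ^ α := by positivity
    have h1 : t - p.1 ≤ t := by linarith
    calc (t - p.1) ^ α * (α * (t - p.1)) = (t - p.1) ^ α * α * (t - p.1) := by ring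
      _ ≤ (t - p.1) ^ α * α * t := by gcongr
      _ = _ := by ring
  · have e : ∀ s ∈ Ioo 0 t, ENNReal.ofReal (fracKer α s t ξ p) = 0 := fun s hs => by
      rw [fracKer, if_neg (by linarith [hs.2, not_lt.1 h]), ENNReal.ofReal_zero]
    rw [setLIntegral_congr_fun measurableSet_Ioo e]
    simp

theorem polarProd_eq_restrict (n : ℕ) : polarProd n = (cylMeas n).restrict (Ioi 0 ×ˢ univ) := by
  rw [cylMeas, ← Measure.prod_restrict, Measure.restrict_univ]

/-! ### Local integrability and absolute convergence almost everywhere. -/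

/-- Integrability below every level `a < 1`. -/
def LocInt {n : ℕ} (φ : Sph (n + 1) → ℂ) : Prop :=
  ∀ a : ℝ, a < 1 → IntegrableOn φ {y | height y < a} (surf (n + 1))

theorem height_polarMap_lt_iff {n : ℕ} {s T : ℝ} (hs : 0 ≤ s) (hT : 0 ≤ T) (η : Sph n) :
    height (polarMap (s, η)) < (T - 1) / (1 + T) ↔ s < T := by
  rw [height_polarMap hs, div_lt_div_iff₀ (by positivity) (by positivity)]
  constructor <;> intro h <;> nlinarith

/-- `polarDensity` differs from the density of the surface measure times `φ` by at most the factor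
`(1 + s)^{n/2-α}`, which is bounded for `s < T`. Extension by zero to `s ≤ 0` makes the
differentiation theorem on the full cylinder applicable. -/
theorem integrable_polarDensity {n : ℕ} (hn : 2 ≤ n) {α : ℝ} (hα0 : 0 < α) (hα1 : α < 1)
    {φ : Sph (n + 1) → ℂ} (hφm : StronglyMeasurable φ) (hφ : LocInt φ) {T : ℝ} (hT : 0 < T) :
    Integrable ((Iio T ×ˢ univ).indicator (polarDensity n α φ)) (cylMeas n) := by
  have hn0 : n ≠ 0 := by omega
  have hm := one_le_half hn
  set a := (T - 1) / (1 + T) with ha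
  have ha1 : a < 1 := by rw [ha, div_lt_one (by positivity)]; linarith
  have hR := measurableSet_height_lt (n := n) a
  have h1 := (integrable_indicator_iff hR).2 (hφ a ha1)
  have h2 := ((integrable_polarMap_iff hn0 h1.aestronglyMeasurable).1 h1).norm.const_mul
    ((1 + T) ^ ((n : ℝ) / 2 - α))
  have hS : MeasurableSet (Iio T ×ˢ (univ : Set (Sph n))) := measurableSet_Iio.prod MeasurableSet.univ
  have hm2 := ((stronglyMeasurable_polarDensity (α := α) hφm).indicator hS)
  have h3 : Integrable ((Iio T ×ˢ univ).indicator (polarDensity n α φ)) (polarProd n) := by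
    refine Integrable.mono' h2 hm2.aestronglyMeasurable ?_
    filter_upwards [ae_pos_polarProd] with p hp
    obtain ⟨s, η⟩ := p
    have hs : 0 < s := hp
    by_cases hsT : s < T
    · rw [indicator_of_mem (show (s, η) ∈ Iio T ×ˢ univ from ⟨hsT, mem_univ _⟩),
        indicator_of_mem (show polarMap (s, η) ∈ {y | height y < a} from
          (height_polarMap_lt_iff hs.le hT.le η).2 hsT), polarDensity, if_pos hp, norm_smul, norm_smul,
        Real.norm_of_nonneg (by positivity), Real.norm_of_nonneg (polarDens_nonneg n hs.le), ← mul_assoc]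
      refine mul_le_mul_of_nonneg_right ?_ (norm_nonneg _)
      have e : (1 + s) ^ (-((n : ℝ) / 2) - α) = (1 + s) ^ ((n : ℝ) / 2 - α) * ((1 + s) ^ n)⁻¹ := by
        rw [← Real.rpow_natCast, ← Real.rpow_neg (by positivity), ← Real.rpow_add (by positivity)]
        congr 1; ring
      have h4 : (1 + s) ^ ((n : ℝ) / 2 - α) ≤ (1 + T) ^ ((n : ℝ) / 2 - α) :=
        Real.rpow_le_rpow (by positivity) (by linarith) (by linarith)
      have h5 : (1 : ℝ) ≤ 2 ^ (n - 1 : ℝ) :=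
        Real.one_le_rpow (by norm_num) (by linarith)
      rw [e, polarDens]
      have hp1 : 0 ≤ s ^ ((n : ℝ) / 2 - 1) := by positivity
      have hp2 : 0 ≤ ((1 + s) ^ n)⁻¹ := by positivity
      calc s ^ ((n : ℝ) / 2 - 1) * ((1 + s) ^ ((n : ℝ) / 2 - α) * ((1 + s) ^ n)⁻¹)
          = 1 * (1 + s) ^ ((n : ℝ) / 2 - α) * (s ^ ((n : ℝ) / 2 - 1) * ((1 + s) ^ n)⁻¹) := by ring
        _ ≤ 2 ^ (n - 1 : ℝ) * (1 + T) ^ ((n : ℝ) / 2 - α) *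
            (s ^ ((n : ℝ) / 2 - 1) * ((1 + s) ^ n)⁻¹) := by gcongr
        _ = _ := by ring
    · rw [indicator_of_notMem (show (s, η) ∉ Iio T ×ˢ univ from fun h => hsT h.1), norm_zero]
      positivity
  rw [polarProd_eq_restrict] at h3
  rw [← IntegrableOn, ← integrable_indicator_iff (measurableSet_Ioi.prod MeasurableSet.univ)] at h3
  refine h3.congr (Eventually.of_forall fun p => ?_)
  obtain ⟨s, η⟩ := p
  by_cases hs : 0 < s
  · rw [indicator_of_mem (show (s, η) ∈ Ioi 0 ×ˢ univ from ⟨hs, mem_univ _⟩)]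
  · rw [indicator_of_notMem (show (s, η) ∉ Ioi 0 ×ˢ univ from fun h => hs h.1)]
    simp [indicator, polarDensity, if_neg hs]

/-- The part `0 < t < T` of the cylinder. -/
abbrev slabProd (n : ℕ) (T : ℝ) : Measure (ℝ × Sph n) := (volume.restrict (Ioo 0 T)).prod (surf n)

theorem slabProd_eq_restrict (n : ℕ) (T : ℝ) :
    slabProd n T = (cylMeas n).restrict (Ioo 0 T ×ˢ univ) := by
  rw [cylMeas, ← Measure.prod_restrict, Measure.restrict_univ]

theorem ae_polarProd_of_slabProd {n : ℕ} {q : ℝ × Sph n → Prop}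
    (h : ∀ k : ℕ, ∀ᵐ x ∂(slabProd n (k + 1)), q x) : ∀ᵐ x ∂(polarProd n), q x := by
  have e : (Ioi (0 : ℝ)) ×ˢ (univ : Set (Sph n)) = ⋃ k : ℕ, Ioo (0 : ℝ) (k + 1) ×ˢ univ := by
    ext ⟨s, η⟩
    simp only [mem_prod, mem_Ioi, mem_univ, and_true, mem_iUnion, mem_Ioo]
    constructor
    · intro hs
      obtain ⟨k, hk⟩ := exists_nat_gt s
      exact ⟨k, hs, by linarith⟩
    · rintro ⟨k, hs, -⟩; exact hs
  rw [polarProd_eq_restrict, e, ae_restrict_iUnion_iff]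
  intro k
  rw [← slabProd_eq_restrict]
  exact h k

theorem lintegral_slabProd_fracKer_le {n : ℕ} (hn : n ≠ 0) {α T : ℝ} (hα0 : 0 < α)
    {p : ℝ × Sph n} (hp : 0 < p.1) :
    ∫⁻ x, ENNReal.ofReal (fracKer α x.1 x.1 x.2 p) ∂(slabProd n T) ≤
      ENNReal.ofReal (sphArea n) * ENNReal.ofReal (T ^ α / α) *
        (Iio T ×ˢ (univ : Set (Sph n))).indicator 1 p := by
  rw [lintegral_prod _ (measurable_fracKer α measurable_fst measurable_fst measurable_snd
    measurable_const).ennreal_ofReal.aemeasurable]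
  simp only [lintegral_fracKer_sphere hn le_rfl hp]
  have e : ∀ t : ℝ, (if p.1 < t then ENNReal.ofReal (sphArea n) *
      ENNReal.ofReal ((t - p.1) ^ (α - 1)) else 0) = (Ioi p.1).indicator
      (fun t => ENNReal.ofReal (sphArea n) * ENNReal.ofReal ((t - p.1) ^ (α - 1))) t := fun t => by
    simp [indicator_apply]
  rw [lintegral_congr e, setLIntegral_indicator measurableSet_Ioi, inter_comm, Ioo_inter_Ioi,
    max_eq_right hp.le, lintegral_const_mul' _ _ (by finiteness), mul_assoc]
  gcongr
  by_cases h : p.1 < T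
  · rw [lintegral_rpow_sub hα0 h.le, indicator_of_mem (show p ∈ Iio T ×ˢ univ from ⟨h, mem_univ _⟩),
      Pi.one_apply, mul_one]
    refine ENNReal.ofReal_le_ofReal ?_
    gcongr
    linarith
  · rw [Ioo_eq_empty h]; simp

/-- Tonelli's theorem with the integration over `x` first: the kernel then has mass at most a
constant times `T^α`, and only `p.1 < T` contributes. Both the almost everywhere convergence of
`S_+^α φ` and its local integrability follow. -/
theorem lintegral_fracKer_polarDensity_lt_top {n : ℕ} (hn : 2 ≤ n) {α : ℝ} (hα0 : 0 < α)
    (hα1 : α < 1) {φ : Sph (n + 1) → ℂ} (hφm : StronglyMeasurable φ) (hφ : LocInt φ) {T : ℝ}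
    (hT : 0 < T) :
    ∫⁻ x, ∫⁻ p, ENNReal.ofReal (fracKer α x.1 x.1 x.2 p) * ‖polarDensity n α φ p‖ₑ ∂(polarProd n)
      ∂(slabProd n T) < ∞ := by
  have hgm := (stronglyMeasurable_polarDensity (α := α) hφm).measurable
  have hm : Measurable fun b : (ℝ × Sph n) × (ℝ × Sph n) =>
      ENNReal.ofReal (fracKer α b.1.1 b.1.1 b.1.2 b.2) * ‖polarDensity n α φ b.2‖ₑ :=
    (measurable_fracKer α measurable_fst.fst measurable_fst.fst measurable_fst.snd
      measurable_snd).ennreal_ofReal.mul (hgm.comp measurable_snd).enorm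
  set Φ : ℝ × Sph n → ℝ × Sph n → ℝ≥0∞ := fun x p =>
    ENNReal.ofReal (fracKer α x.1 x.1 x.2 p) * ‖polarDensity n α φ p‖ₑ with hΦ
  have hm' : AEMeasurable (Function.uncurry Φ) ((slabProd n T).prod (polarProd n)) := hm.aemeasurable
  change ∫⁻ x, ∫⁻ p, Φ x p ∂(polarProd n) ∂(slabProd n T) < ∞
  rw [lintegral_lintegral_swap hm']
  set C := ENNReal.ofReal (sphArea n) * ENNReal.ofReal (T ^ α / α) with hC
  have hg := integrable_polarDensity hn hα0 hα1 hφm hφ hT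
  have hCt : C ≠ ∞ := by rw [hC]; finiteness
  have hstep : ∀ᵐ p ∂(polarProd n), ∫⁻ x, Φ x p ∂(slabProd n T) ≤
      C * ‖(Iio T ×ˢ univ).indicator (polarDensity n α φ) p‖ₑ := by
    filter_upwards [ae_pos_polarProd] with p hp
    simp only [hΦ]
    rw [lintegral_mul_const' _ _ enorm_ne_top]
    refine (mul_le_mul_left (lintegral_slabProd_fracKer_le (by omega) hα0 hp) _).trans ?_
    rw [← hC, mul_assoc]
    gcongr
    by_cases h : p ∈ Iio T ×ˢ (univ : Set (Sph n))
    · rw [indicator_of_mem h, indicator_of_mem h, Pi.one_apply, one_mul]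
    · rw [indicator_of_notMem h, zero_mul]; exact zero_le
  refine (lintegral_mono_ae hstep).trans_lt ?_
  rw [lintegral_const_mul' _ _ hCt, polarProd_eq_restrict]
  exact ENNReal.mul_lt_top hCt.lt_top ((setLIntegral_le_lintegral _ _).trans_lt hg.hasFiniteIntegral)

theorem ae_integrable_fracKer {n : ℕ} (hn : 2 ≤ n) {α : ℝ} (hα0 : 0 < α)
    (hα1 : α < 1) {φ : Sph (n + 1) → ℂ} (hφm : StronglyMeasurable φ) (hφ : LocInt φ) :
    ∀ᵐ x ∂(polarProd n), Integrable (fun p => fracKer α x.1 x.1 x.2 p • polarDensity n α φ p)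
      (polarProd n) := by
  refine ae_polarProd_of_slabProd fun k => ?_
  have hgm := stronglyMeasurable_polarDensity (α := α) hφm
  have hk := lintegral_fracKer_polarDensity_lt_top hn hα0 hα1 hφm hφ (T := k + 1) (by positivity)
  have hm : Measurable fun x : ℝ × Sph n => ∫⁻ p, ENNReal.ofReal (fracKer α x.1 x.1 x.2 p) *
      ‖polarDensity n α φ p‖ₑ ∂(polarProd n) := by
    refine Measurable.lintegral_prod_right' (f := fun b : (ℝ × Sph n) × (ℝ × Sph n) =>
      ENNReal.ofReal (fracKer α b.1.1 b.1.1 b.1.2 b.2) * ‖polarDensity n α φ b.2‖ₑ) ?_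
    exact (measurable_fracKer α measurable_fst.fst measurable_fst.fst measurable_fst.snd
      measurable_snd).ennreal_ofReal.mul (hgm.measurable.comp measurable_snd).enorm
  filter_upwards [ae_lt_top hm hk.ne] with x hx
  refine ⟨(measurable_fracKer α measurable_const measurable_const measurable_const
    measurable_id).stronglyMeasurable.aestronglyMeasurable.smul hgm.aestronglyMeasurable, ?_⟩
  refine lt_of_le_of_lt (le_of_eq (lintegral_congr_ae ?_)) hx
  filter_upwards [ae_pos_polarProd] with p hp
  rw [enorm_smul, Real.enorm_of_nonneg (fracKer_nonneg le_rfl x.2 hp)]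

/-- The constant of the fractional integral in polar coordinates. -/
def fracConst (n : ℕ) (α : ℝ) : ℝ := 2 / (Real.Gamma α * sphArea n) * 2 ^ (α - 1)

theorem measurable_leftFracIntegrand {n : ℕ} {α : ℝ} {φ : Sph (n + 1) → ℂ}
    (hφm : StronglyMeasurable φ) :
    StronglyMeasurable fun b : Sph (n + 1) × Sph (n + 1) => leftFracIntegrand n α φ b.1 b.2 := by
  have h := (continuous_height (n := n)).measurable
  have h1 : Measurable fun b : Sph (n + 1) × Sph (n + 1) => (b.1 : Euc (n + 1)) :=
    measurable_subtype_coe.comp measurable_fst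
  have h2 : Measurable fun b : Sph (n + 1) × Sph (n + 1) => (b.2 : Euc (n + 1)) :=
    measurable_subtype_coe.comp measurable_snd
  refine StronglyMeasurable.smul (f := fun b : Sph (n + 1) × Sph (n + 1) =>
    (height b.1 - height b.2) ^ α / ‖(b.1 : Euc (n + 1)) - b.2‖ ^ n) ?_
    (hφm.comp_measurable measurable_snd)
  exact Measurable.stronglyMeasurable (by fun_prop)

theorem measurableSet_segment (n : ℕ) (a b : ℝ) : MeasurableSet (SphFrac.segment n a b) :=
  (measurableSet_lt_height a).inter (measurableSet_height_lt b)

theorem leftFrac_polarMap {n : ℕ} (hn : n ≠ 0) {α t : ℝ} (ht : 0 < t) {φ : Sph (n + 1) → ℂ}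
    (hφm : StronglyMeasurable φ) (ξ : Sph n) :
    (IntegrableOn (leftFracIntegrand n α φ (polarMap (t, ξ)))
        (SphFrac.segment n (-1) (height (polarMap (t, ξ)))) (surf (n + 1)) ↔
      Integrable (fun p => fracKer α t t ξ p • polarDensity n α φ p) (polarProd n)) ∧
    leftFrac n α φ (polarMap (t, ξ)) =
      (fracConst n α * (1 + t) ^ ((n : ℝ) / 2 - α) * t ^ (1 - (n : ℝ) / 2)) •
        ∫ p, fracKer α t t ξ p • polarDensity n α φ p ∂(polarProd n) := by
  set x := polarMap (t, ξ) with hx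
  set C := 2 ^ (α - 1) * (1 + t) ^ ((n : ℝ) / 2 - α) * t ^ (1 - (n : ℝ) / 2) with hC
  have hC0 : C ≠ 0 := by rw [hC]; positivity
  have hR := measurableSet_segment n (-1) (height x)
  have hFm : AEStronglyMeasurable ((SphFrac.segment n (-1) (height x)).indicator
      (leftFracIntegrand n α φ x)) (surf (n + 1)) :=
    (((measurable_leftFracIntegrand hφm).comp_measurable
      measurable_prodMk_left).indicator hR).aestronglyMeasurable
  have hcongr : (fun p => polarDens n p.1 • ((SphFrac.segment n (-1) (height x)).indicator
      (leftFracIntegrand n α φ x) (polarMap p))) =ᵐ[polarProd n]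
      fun p => C • (fracKer α t t ξ p • polarDensity n α φ p) := by
    filter_upwards [ae_pos_polarProd] with p hp
    obtain ⟨s, η⟩ := p
    have hs : 0 < s := hp
    have hiff := height_lt_iff_left hs.le ht.le le_rfl ξ η
    rw [leftGap_zero, sub_zero, sub_zero] at hiff
    by_cases h : s < t
    · have hmem : polarMap (s, η) ∈ SphFrac.segment n (-1) (height x) := by
        refine ⟨?_, hiff.2 h⟩
        rw [height_polarMap hs.le, lt_div_iff₀ (by positivity)]; linarith
      rw [indicator_of_mem hmem, leftFracIntegrand, smul_smul, leftFrac_coeff hs h, fracKer,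
        if_pos h, polarDensity, if_pos hp, smul_smul, smul_smul]
      congr 1
      rw [hC]; ring
    · rw [indicator_of_notMem (fun hm => h (hiff.1 hm.2)), fracKer, if_neg h]
      simp
  constructor
  · rw [← integrable_indicator_iff hR, integrable_polarMap_iff hn hFm, integrable_congr hcongr]
    exact integrable_smul_iff hC0 _
  · rw [leftFrac, leftFracFrom, ← integral_indicator hR, integral_polarMap hn hFm,
      integral_congr_ae hcongr, integral_smul, smul_smul]
    congr 1
    rw [hC, fracConst]; ring

theorem stronglyMeasurable_leftFrac {n : ℕ} {α : ℝ} {φ : Sph (n + 1) → ℂ}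
    (hφm : StronglyMeasurable φ) : StronglyMeasurable (leftFrac n α φ) := by
  have hS : MeasurableSet {b : Sph (n + 1) × Sph (n + 1) | -1 < height b.2 ∧ height b.2 < height b.1} := by
    have h := (continuous_height (n := n)).measurable
    exact (measurableSet_lt measurable_const (h.comp measurable_snd)).inter
      (measurableSet_lt (h.comp measurable_snd) (h.comp measurable_fst))
  have h := ((measurable_leftFracIntegrand (α := α) hφm).indicator hS).integral_prod_right'
    (ν := surf (n + 1))
  have e : leftFrac n α φ = (2 / (Real.Gamma α * sphArea n) : ℝ) • fun x => ∫ y,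
      {b : Sph (n + 1) × Sph (n + 1) | -1 < height b.2 ∧ height b.2 < height b.1}.indicator
        (fun b => leftFracIntegrand n α φ b.1 b.2) (x, y) ∂(surf (n + 1)) := by
    ext x
    rw [leftFrac, leftFracFrom, ← integral_indicator (measurableSet_segment n (-1) (height x))]
    rfl
  rw [e]
  exact h.const_smul _

/-- Local integrability of `S_+^α φ` is what makes the truncated integrals in the closed form
converge absolutely. -/
theorem locInt_leftFrac {n : ℕ} (hn : 2 ≤ n) {α : ℝ} (hα0 : 0 < α) (hα1 : α < 1)
    {φ : Sph (n + 1) → ℂ} (hφm : StronglyMeasurable φ) (hφ : LocInt φ) :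
    LocInt (leftFrac n α φ) := by
  intro a ha
  have hn0 : n ≠ 0 := by omega
  have hσ := sphArea_pos hn0
  have hΓ := Real.Gamma_pos_of_pos hα0
  -- Height `a` corresponds to the level `(1 + a) / (1 - a)`, which is not positive when `a ≤ -1`;
  -- adding `1` gives this `T`.
  set T := 2 / (1 - a) with hTdef
  have h1a : 0 < 1 - a := sub_pos.2 ha
  have hT : 0 < T := by positivity
  have haT : a ≤ (T - 1) / (1 + T) := by
    have e : T * (1 - a) = 2 := by rw [hTdef]; field_simp
    rw [le_div_iff₀ (by positivity)]; nlinarith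
  refine IntegrableOn.mono_set (t := {y | height y < (T - 1) / (1 + T)}) ?_
    (fun y (hy : height y < a) => hy.trans_le haT)
  have hR := measurableSet_height_lt (n := n) ((T - 1) / (1 + T))
  have hfm := stronglyMeasurable_leftFrac (α := α) hφm
  have hFm := (hfm.indicator hR).aestronglyMeasurable (μ := surf (n + 1))
  rw [← integrable_indicator_iff hR, integrable_polarMap_iff hn0 hFm]
  refine ⟨((measurable_polarDens n).comp measurable_fst).aestronglyMeasurable.smul
    (aestronglyMeasurable_polarMap hn0 hFm), ?_⟩
  set K := fracConst n α * 2 ^ (n - 1 : ℝ) with hK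
  have hfc : 0 < fracConst n α := by rw [fracConst]; positivity
  have hfin := lintegral_fracKer_polarDensity_lt_top hn hα0 hα1 hφm hφ hT
  set I : ℝ × Sph n → ℝ≥0∞ := fun x => ∫⁻ p, ENNReal.ofReal (fracKer α x.1 x.1 x.2 p) *
    ‖polarDensity n α φ p‖ₑ ∂(polarProd n) with hI
  have hbd : ∀ᵐ x ∂(polarProd n), ‖polarDens n x.1 • ({y | height y < (T - 1) / (1 + T)}.indicator
      (leftFrac n α φ) (polarMap x))‖ₑ ≤
      (Ioo 0 T ×ˢ univ).indicator (fun x => ENNReal.ofReal K * I x) x := by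
    filter_upwards [ae_pos_polarProd] with x hx
    obtain ⟨t, ξ⟩ := x
    have ht : 0 < t := hx
    by_cases htT : t < T
    · rw [indicator_of_mem (show polarMap (t, ξ) ∈ {y | height y < (T - 1) / (1 + T)} from
        (height_polarMap_lt_iff ht.le hT.le ξ).2 htT),
        indicator_of_mem (show (t, ξ) ∈ Ioo 0 T ×ˢ univ from ⟨⟨ht, htT⟩, mem_univ _⟩),
        (leftFrac_polarMap hn0 ht hφm ξ).2, smul_smul, enorm_smul]
      have h0 := polarDens_nonneg n ht.le
      have e1 : t ^ ((n : ℝ) / 2 - 1) * t ^ (1 - (n : ℝ) / 2) = 1 := by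
        rw [← Real.rpow_add ht]; simp
      have e2 : ((1 + t) ^ n)⁻¹ * (1 + t) ^ ((n : ℝ) / 2 - α) ≤ 1 := by
        rw [← Real.rpow_natCast, ← Real.rpow_neg (by positivity), ← Real.rpow_add (by positivity)]
        exact Real.rpow_le_one_of_one_le_of_nonpos (by linarith) (by linarith [one_le_half hn])
      have hle : polarDens n t * (fracConst n α * (1 + t) ^ ((n : ℝ) / 2 - α) *
          t ^ (1 - (n : ℝ) / 2)) ≤ K := by
        rw [polarDens, hK]
        calc _ = fracConst n α * 2 ^ (n - 1 : ℝ) *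
              (t ^ ((n : ℝ) / 2 - 1) * t ^ (1 - (n : ℝ) / 2)) *
              (((1 + t) ^ n)⁻¹ * (1 + t) ^ ((n : ℝ) / 2 - α)) := by ring
          _ ≤ fracConst n α * 2 ^ (n - 1 : ℝ) * 1 * 1 := by rw [e1]; gcongr
          _ = _ := by ring
      rw [Real.enorm_of_nonneg (by positivity)]
      gcongr
      refine (enorm_integral_le_lintegral_enorm _).trans (le_of_eq (lintegral_congr_ae ?_))
      filter_upwards [ae_pos_polarProd] with p hp
      rw [enorm_smul, Real.enorm_of_nonneg (fracKer_nonneg le_rfl ξ hp)]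
    · rw [indicator_of_notMem (show polarMap (t, ξ) ∉ {y | height y < (T - 1) / (1 + T)} from
        fun h => htT ((height_polarMap_lt_iff ht.le hT.le ξ).1 h))]
      simp
  refine (lintegral_mono_ae hbd).trans_lt ?_
  rw [polarProd_eq_restrict, lintegral_indicator (measurableSet_Ioo.prod MeasurableSet.univ),
    Measure.restrict_restrict (measurableSet_Ioo.prod MeasurableSet.univ),
    inter_eq_left.2 (prod_mono (fun s hs => hs.1) le_rfl), ← slabProd_eq_restrict,
    lintegral_const_mul' _ _ ENNReal.ofReal_ne_top]
  exact ENNReal.mul_lt_top ENNReal.ofReal_lt_top hfin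

/-- Where the heights differ by more than `ε`, so do the points, and the kernel is at most `1 / (ε^α
ε^n)`. -/
theorem integrableOn_leftQuot {n : ℕ} {α : ℝ} (hα0 : 0 < α) {f : Sph (n + 1) → ℂ}
    (hf : LocInt f) (x : Sph (n + 1)) {ε : ℝ} (hε : 0 < ε) :
    IntegrableOn (leftQuot n α f x) {y | height y < height x - ε} (surf (n + 1)) := by
  have hR := measurableSet_height_lt (n := n) (height x - ε)
  have hx1 := (abs_le.1 (abs_height_le x)).2
  have h1 : IntegrableOn (fun y => f x - f y) {y | height y < height x - ε} (surf (n + 1)) :=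
    (integrable_const (f x)).integrableOn.sub (hf _ (by linarith))
  have h := (continuous_height (n := n)).measurable
  have h2 : Measurable fun y : Sph (n + 1) => ‖(x : Euc (n + 1)) - y‖ := by fun_prop
  have hcm : Measurable fun y : Sph (n + 1) =>
      ((height x - height y) ^ α * ‖(x : Euc (n + 1)) - y‖ ^ n)⁻¹ := by fun_prop
  refine Integrable.mono' (h1.norm.const_mul ((ε ^ α * ε ^ n)⁻¹))
    (hcm.aestronglyMeasurable.smul h1.aestronglyMeasurable) ?_
  filter_upwards [ae_restrict_mem hR] with y hy
  have hy' : ε ≤ height x - height y := by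
    have : height y < height x - ε := hy
    linarith
  have h3 : ε ≤ ‖(x : Euc (n + 1)) - y‖ := by
    have := PiLp.norm_apply_le ((x : Euc (n + 1)) - (y : Euc (n + 1))) (Fin.last n)
    refine hy'.trans ((le_abs_self _).trans ?_)
    simpa [height] using this
  have h4 : 0 < height x - height y := by linarith
  have h5 : 0 < ‖(x : Euc (n + 1)) - y‖ := by linarith
  rw [leftQuot, norm_smul, Real.norm_of_nonneg (by positivity)]
  gcongr

/-! ### Reduction of the left-sided inversion to the half-line. -/

/-- The Poisson average of the density at level `s`, as seen from the point `(t, ξ)`. -/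
def polarAvg (n : ℕ) (α : ℝ) (φ : Sph (n + 1) → ℂ) (t : ℝ) (ξ : Sph n) (s : ℝ) : ℂ :=
  ∫ η : Sph n, poissonKer (√(s / t) • (ξ : Euc n)) η • polarDensity n α φ (s, η) ∂(surf n)

theorem polarAvg_of_le {n : ℕ} {α : ℝ} {φ : Sph (n + 1) → ℂ} {t : ℝ} {ξ : Sph n} {s : ℝ}
    (hs : s ≤ 0) : polarAvg n α φ t ξ s = 0 := by
  simp [polarAvg, polarDensity_of_le hs]

theorem integral_fracKer_eq {n : ℕ} {α s t : ℝ} {φ : Sph (n + 1) → ℂ} {ξ : Sph n}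
    (h : Integrable (fun p => fracKer α s t ξ p • polarDensity n α φ p) (polarProd n)) :
    IntegrableOn (fun w => ((w - (t - s)) ^ (α - 1) : ℝ) • polarAvg n α φ t ξ (t - w))
      (Ioi (t - s)) ∧
    ∫ p, fracKer α s t ξ p • polarDensity n α φ p ∂(polarProd n) =
      ∫ w in Ioi (t - s), ((w - (t - s)) ^ (α - 1) : ℝ) • polarAvg n α φ t ξ (t - w) := by
  set Θ : ℝ → ℂ := (Iio s).indicator fun s' => ((s - s') ^ (α - 1) : ℝ) • polarAvg n α φ t ξ s'
    with hΘ
  have hin : ∀ s' : ℝ, ∫ η, fracKer α s t ξ (s', η) • polarDensity n α φ (s', η) ∂(surf n) = Θ s' :=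
    fun s' => by
      by_cases hs : s' < s
      · rw [hΘ, indicator_of_mem (show s' ∈ Iio s from hs), polarAvg, ← integral_smul]
        simp only [fracKer, if_pos hs, mul_smul]
      · rw [hΘ, indicator_of_notMem (show s' ∉ Iio s from hs)]
        simp [fracKer, if_neg hs]
  have h1 := h.integral_prod_left
  simp only [hin] at h1
  have h2 : Integrable Θ := by
    rw [← IntegrableOn, ← integrable_indicator_iff measurableSet_Ioi] at h1
    refine h1.congr (Eventually.of_forall fun s' => ?_)
    by_cases hs : 0 < s'
    · rw [indicator_of_mem (show s' ∈ Ioi 0 from hs)]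
    · rw [indicator_of_notMem (show s' ∉ Ioi 0 from hs), hΘ]
      simp [indicator_apply, polarAvg_of_le (not_lt.1 hs)]
  have h0 : ∀ s', s' ∉ Ioi (0 : ℝ) → Θ s' = 0 := fun s' hs => by
    simp [hΘ, indicator_apply, polarAvg_of_le (not_lt.1 hs)]
  have hrefl : ∀ w, Θ (t - w) = (Ioi (t - s)).indicator
      (fun w => ((w - (t - s)) ^ (α - 1) : ℝ) • polarAvg n α φ t ξ (t - w)) w := fun w => by
    by_cases hw : t - s < w
    · rw [hΘ, indicator_of_mem (show t - w ∈ Iio s by simp only [mem_Iio]; linarith),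
        indicator_of_mem (show w ∈ Ioi (t - s) from hw), show s - (t - w) = w - (t - s) by ring]
    · rw [hΘ, indicator_of_notMem (fun h => hw (by simp only [mem_Iio] at h; linarith)),
        indicator_of_notMem (show w ∉ Ioi (t - s) from hw)]
  have h3 := h2.comp_sub_left t
  simp only [hrefl] at h3
  refine ⟨(integrable_indicator_iff measurableSet_Ioi).1 h3, ?_⟩
  rw [integral_prod _ h]
  simp only [hin]
  rw [setIntegral_eq_integral_of_forall_compl_eq_zero h0, ← integral_sub_left_eq_self Θ volume t]
  simp only [hrefl]
  rw [integral_indicator measurableSet_Ioi]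

/-- Absolute convergence at the point `(t, ξ)` alone is passed on to almost every lower level `s`;
this suffices, because the half-line inversion needs `A (-τ)` only for almost every `τ`. -/
theorem ae_integrable_fracKer_order {n : ℕ} {α t : ℝ} (hα0 : 0 < α) (ht : 0 < t)
    {φ : Sph (n + 1) → ℂ} (hφm : StronglyMeasurable φ) {ξ : Sph n}
    (h : Integrable (fun p => fracKer α t t ξ p • polarDensity n α φ p) (polarProd n)) :
    ∀ᵐ s ∂(volume.restrict (Ioo 0 t)),
      Integrable (fun p => fracKer α s t ξ p • polarDensity n α φ p) (polarProd n) := by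
  have hgm := stronglyMeasurable_polarDensity (α := α) hφm
  set Φ : ℝ → ℝ × Sph n → ℝ≥0∞ := fun s p =>
    ENNReal.ofReal (fracKer α s t ξ p) * ‖polarDensity n α φ p‖ₑ with hΦ
  have hm : Measurable (Function.uncurry Φ) :=
    (measurable_fracKer α measurable_fst measurable_const measurable_const
      measurable_snd).ennreal_ofReal.mul (hgm.measurable.comp measurable_snd).enorm
  have hfin : ∫⁻ s, ∫⁻ p, Φ s p ∂(polarProd n) ∂(volume.restrict (Ioo 0 t)) < ∞ := by
    have hm' : AEMeasurable (Function.uncurry Φ) ((volume.restrict (Ioo 0 t)).prod (polarProd n)) :=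
      hm.aemeasurable
    rw [lintegral_lintegral_swap hm']
    have hstep : ∀ᵐ p ∂(polarProd n), ∫⁻ s in Ioo 0 t, Φ s p ≤
        ENNReal.ofReal (t / α) * ‖fracKer α t t ξ p • polarDensity n α φ p‖ₑ := by
      filter_upwards [ae_pos_polarProd] with p hp
      simp only [hΦ]
      rw [lintegral_mul_const' _ _ enorm_ne_top, enorm_smul,
        Real.enorm_of_nonneg (fracKer_nonneg le_rfl ξ hp), ← mul_assoc]
      gcongr
      exact lintegral_fracKer_order hα0 ht ξ hp
    refine (lintegral_mono_ae hstep).trans_lt ?_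
    rw [lintegral_const_mul' _ _ ENNReal.ofReal_ne_top]
    exact ENNReal.mul_lt_top ENNReal.ofReal_lt_top h.hasFiniteIntegral
  have hm2 : Measurable fun s => ∫⁻ p, Φ s p ∂(polarProd n) := hm.lintegral_prod_right'
  filter_upwards [ae_lt_top hm2 hfin.ne, ae_restrict_mem measurableSet_Ioo] with s hs hst
  refine ⟨(measurable_fracKer α measurable_const measurable_const measurable_const
    measurable_id).stronglyMeasurable.aestronglyMeasurable.smul hgm.aestronglyMeasurable, ?_⟩
  refine lt_of_le_of_lt (le_of_eq (lintegral_congr_ae ?_)) hs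
  filter_upwards [ae_pos_polarProd] with p hp
  rw [enorm_smul, Real.enorm_of_nonneg (fracKer_nonneg hst.2.le ξ hp)]

/-- By Fubini's theorem and the semigroup property, the Poisson mean at `√(s/t)` replaces the kernel
at `√(p.1/s)`, which depends on `s`, by the one at `√(p.1/t)`, which does not. The density at level
`p.1` then no longer depends on `s`. -/
theorem integral_poissonKer_leftFrac {n : ℕ} (hn : n ≠ 0) {α s t : ℝ} (hs : 0 < s) (hst : s < t)
    {φ : Sph (n + 1) → ℂ} (hφm : StronglyMeasurable φ) {ξ : Sph n}
    (h : Integrable (fun p => fracKer α s t ξ p • polarDensity n α φ p) (polarProd n)) :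
    ∫ ζ : Sph n, poissonKer (√(s / t) • (ξ : Euc n)) ζ • leftFrac n α φ (polarMap (s, ζ)) ∂(surf n) =
      (fracConst n α * (1 + s) ^ ((n : ℝ) / 2 - α) * s ^ (1 - (n : ℝ) / 2) * sphArea n) •
        ∫ p, fracKer α s t ξ p • polarDensity n α φ p ∂(polarProd n) := by
  have hσ := sphArea_pos hn
  have hgm := stronglyMeasurable_polarDensity (α := α) hφm
  set C := fracConst n α * (1 + s) ^ ((n : ℝ) / 2 - α) * s ^ (1 - (n : ℝ) / 2) with hC
  set X := √(s / t) • (ξ : Euc n) with hX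
  have hX1 : ‖X‖ < 1 := norm_smul_sqrt_lt_one hs.le hst ξ
  set F : Sph n × (ℝ × Sph n) → ℂ := fun b =>
    (poissonKer X b.1 * fracKer α s s b.1 b.2) • polarDensity n α φ b.2 with hF
  have hFm : AEStronglyMeasurable F ((surf n).prod (polarProd n)) := by
    refine AEStronglyMeasurable.smul (f := fun b : Sph n × (ℝ × Sph n) =>
      poissonKer X b.1 * fracKer α s s b.1 b.2) ?_
      (hgm.comp_measurable measurable_snd).aestronglyMeasurable
    exact (((continuous_poissonKer_right hX1).measurable.comp measurable_fst).mul
      (measurable_fracKer α measurable_const measurable_const measurable_fst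
        measurable_snd)).aestronglyMeasurable
  have hFi : Integrable F ((surf n).prod (polarProd n)) := by
    rw [integrable_prod_iff' hFm]
    refine ⟨?_, ?_⟩
    · filter_upwards [ae_pos_polarProd] with p hp
      exact (integral_poissonKer_mul_fracKer hn hs hst ξ hp).1.smul_const (polarDensity n α φ p)
    · refine (h.norm.const_mul (sphArea n)).congr ?_
      filter_upwards [ae_pos_polarProd] with p hp
      have e : ∀ ζ : Sph n, ‖F (ζ, p)‖ =
          poissonKer X ζ * fracKer α s s ζ p * ‖polarDensity n α φ p‖ := fun ζ => by
        rw [show F (ζ, p) = (poissonKer X ζ * fracKer α s s ζ p) • polarDensity n α φ p from rfl,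
          norm_smul, Real.norm_of_nonneg (mul_nonneg (poissonKer_nonneg hX1.le _) (fracKer_nonneg le_rfl ζ hp))]
      simp only [e]
      rw [integral_mul_const, (integral_poissonKer_mul_fracKer hn hs hst ξ hp).2, norm_smul,
        Real.norm_of_nonneg (fracKer_nonneg hst.le ξ hp), mul_assoc]
  have e1 : ∀ ζ : Sph n, poissonKer X ζ • leftFrac n α φ (polarMap (s, ζ)) =
      C • ∫ p, F (ζ, p) ∂(polarProd n) := fun ζ => by
    rw [(leftFrac_polarMap hn hs hφm ζ).2, smul_comm, ← hC, ← integral_smul]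
    simp only [hF, mul_smul]
  have e2 : ∀ᵐ p ∂(polarProd n), ∫ ζ, F (ζ, p) ∂(surf n) =
      sphArea n • (fracKer α s t ξ p • polarDensity n α φ p) := by
    filter_upwards [ae_pos_polarProd] with p hp
    simp only [hF]
    rw [integral_smul_const, (integral_poissonKer_mul_fracKer hn hs hst ξ hp).2, mul_smul]
  simp only [e1]
  rw [integral_smul, integral_integral_swap (f := fun ζ p => F (ζ, p)) hFi, integral_congr_ae e2,
    integral_smul, smul_smul]

/-- The prefactors of `A_x^+` are exactly those that cancel the powers of `s` and `1 + s` left by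
`S_+^α`. For `τ ≥ t` both sides vanish, because the density is zero at nonpositive levels. -/
theorem leftAux_leftFrac {n : ℕ} (hn : n ≠ 0) {α t : ℝ} (hα0 : 0 < α) (ht : 0 < t)
    {φ : Sph (n + 1) → ℂ} (hφm : StronglyMeasurable φ) {ξ : Sph n}
    (h : Integrable (fun p => fracKer α t t ξ p • polarDensity n α φ p) (polarProd n)) :
    ∀ᵐ τ ∂volume.restrict (Ioi (0 : ℝ)),
      leftAux n α (leftFrac n α φ) (polarMap (t, ξ)) (-τ) = ∫ w in Ioi τ, ((w - τ) ^ (α - 1) : ℝ) •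
        ((fracConst n α * t ^ (1 - (n : ℝ) / 2)) • polarAvg n α φ t ξ (t - w)) := by
  have hσ := sphArea_pos hn
  have h1 := (ae_restrict_iff' measurableSet_Ioo).1 (ae_integrable_fracKer_order hα0 ht hφm h)
  have h2 := (Measure.measurePreserving_sub_left (volume : Measure ℝ) t).quasiMeasurePreserving.ae h1
  rw [ae_restrict_iff' measurableSet_Ioi]
  filter_upwards [h2] with τ hτ hτ0
  have hτ0' : (0 : ℝ) < τ := hτ0
  simp only [smul_comm _ (fracConst n α * t ^ (1 - (n : ℝ) / 2))]
  rw [integral_smul]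
  by_cases hτt : τ < t
  · have hs : 0 < t - τ := sub_pos.2 hτt
    have hI := hτ ⟨hs, by linarith⟩
    have h3 := (integral_fracKer_eq hI).2
    rw [sub_sub_cancel] at h3
    rw [← h3, leftAux_neg ht hτ0', integral_poissonKer_leftFrac hn hs (by linarith) hφm hI,
      smul_smul, smul_smul, leftWeight, if_pos hτt]
    congr 1
    set s := t - τ with hsdef
    rw [show 1 - τ / t = s / t by rw [hsdef]; field_simp, show 1 + t - τ = 1 + s by rw [hsdef]; ring,
      Real.div_rpow hs.le ht.le]
    have e1 : (1 + s) ^ (α - (n : ℝ) / 2) * (1 + s) ^ ((n : ℝ) / 2 - α) = 1 := by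
      rw [← Real.rpow_add (by positivity)]; simp
    have e2 : s ^ ((n : ℝ) / 2 - 1) * s ^ (1 - (n : ℝ) / 2) = 1 := by
      rw [← Real.rpow_add hs]; simp
    have e3 : t ^ (1 - (n : ℝ) / 2) = (t ^ ((n : ℝ) / 2 - 1))⁻¹ := by
      rw [← Real.rpow_neg ht.le]; congr 1; ring
    rw [e3]
    calc _ = (s ^ ((n : ℝ) / 2 - 1) * s ^ (1 - (n : ℝ) / 2)) *
          ((1 + s) ^ (α - (n : ℝ) / 2) * (1 + s) ^ ((n : ℝ) / 2 - α)) *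
          ((sphArea n)⁻¹ * sphArea n) * (fracConst n α * (t ^ ((n : ℝ) / 2 - 1))⁻¹) := by ring
      _ = _ := by rw [e1, e2, inv_mul_cancel₀ hσ.ne']; ring
  · rw [leftAux_neg ht hτ0', leftWeight, if_neg hτt, zero_smul,
      setIntegral_eq_zero_of_forall_eq_zero, smul_zero]
    intro w hw
    have hw' : τ < w := hw
    rw [polarAvg_of_le (by linarith [not_lt.1 hτt]), smul_zero]

/-- For `h/2 < w < h` the point `√((t - w)/t) ξ` has distance at least `w / (2 t) ≥ h / (4 t)` from
the unit sphere, while the numerator of the kernel is `w / t ≤ h / t`. The lower bound on `w` is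
indispensable here; it is the reason for averaging over the shells `(h/2, h)` and not over `(0, h)`.
-/
theorem poissonKer_le_slabKer {n : ℕ} {t h w : ℝ} (ht : 0 < t) (hh : 0 < h) (hht : h < t)
    (hw : w ∈ Ioo (h / 2) h) (ξ η : Sph n) :
    ‖poissonKer (√((t - w) / t) • (ξ : Euc n)) η‖ₑ ≤
      ENNReal.ofReal ((min (4 * t)⁻¹ 2⁻¹ ^ n)⁻¹ / t * h) * slabKer h ξ η := by
  obtain ⟨hw1, hw2⟩ := hw
  have hξ : ‖(ξ : Euc n)‖ = 1 := norm_eq_of_mem_sphere ξ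
  have hη : ‖(η : Euc n)‖ = 1 := norm_eq_of_mem_sphere η
  set r := √((t - w) / t) with hr
  set κ := min (4 * t)⁻¹ 2⁻¹ with hκ
  have hq : 0 ≤ (t - w) / t := div_nonneg (by linarith) ht.le
  have hr0 : 0 ≤ r := Real.sqrt_nonneg _
  have hr2 : r ^ 2 = 1 - w / t := by rw [hr, Real.sq_sqrt hq]; field_simp
  have hwt : 0 < w / t := div_pos (by linarith) ht
  have hr1 : r ≤ 1 := by nlinarith
  have hX : ‖r • (ξ : Euc n)‖ = r := by
    rw [norm_smul, hξ, mul_one, Real.norm_of_nonneg hr0]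
  have hκ0 : 0 < κ := by rw [hκ]; positivity
  have hge : κ * max h ‖(ξ : Euc n) - η‖ ≤ ‖r • (ξ : Euc n) - η‖ := by
    rw [mul_max_of_nonneg _ _ hκ0.le]
    refine max_le ?_ ?_
    · have h1 := one_sub_norm_le (r • (ξ : Euc n)) hη
      rw [hX] at h1
      have h2 : w / t ≤ 2 * (1 - r) := by nlinarith
      have h3 : κ * h ≤ (4 * t)⁻¹ * h := by gcongr; exact min_le_left _ _
      have h4 : (4 * t)⁻¹ * h ≤ w / t / 2 := by
        rw [div_div, ← div_eq_inv_mul, div_le_div_iff₀ (by positivity) (by positivity)]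
        nlinarith
      linarith
    · have h1 := norm_sub_le_two_mul hξ hη hr0 hr1
      have h3 : κ * ‖(ξ : Euc n) - η‖ ≤ 2⁻¹ * ‖(ξ : Euc n) - η‖ := by
        gcongr; exact min_le_right _ _
      linarith
  have hm : 0 < max h ‖(ξ : Euc n) - η‖ := lt_max_of_lt_left hh
  rw [Real.enorm_of_nonneg (poissonKer_nonneg (by rw [hX]; exact hr1) _), slabKer,
    ← ENNReal.ofReal_mul (by positivity)]
  refine ENNReal.ofReal_le_ofReal ?_
  rw [poissonKer, hX, hr2, sub_sub_cancel]
  calc w / t / ‖r • (ξ : Euc n) - η‖ ^ n ≤ h / t / (κ * max h ‖(ξ : Euc n) - η‖) ^ n := by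
        gcongr
    _ = _ := by rw [mul_pow]; field_simp

theorem lintegral_slice_le_slabInt {n : ℕ} {t h : ℝ} (hh : 0 < h) (ξ : Sph n)
    {u : ℝ × Sph n → ℝ≥0∞} (hu : Measurable u) :
    ∫⁻ w in Ioo (h / 2) h, ∫⁻ η, slabKer h ξ η * u (t - w, η) ∂(surf n) ≤
      slabInt h u (t, ξ) := by
  set V : ℝ → ℝ≥0∞ := fun s => ∫⁻ η, slabKer h ξ η * u (s, η) ∂(surf n) with hV
  have hm : Measurable fun p : ℝ × Sph n => slabKer h ξ p.2 * u p :=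
    (measurable_slabKer_snd hh ξ).mul hu
  have hslab : slabInt h u (t, ξ) = ∫⁻ s, (Metric.closedBall t h).indicator V s := by
    rw [slabInt, ← Measure.prod_restrict, Measure.restrict_univ, lintegral_prod _ hm.aemeasurable,
      lintegral_indicator Metric.isClosed_closedBall.measurableSet]
  rw [hslab, ← lintegral_sub_left_eq_self ((Metric.closedBall t h).indicator V) t, ← lintegral_indicator measurableSet_Ioo]
  refine lintegral_mono fun w => ?_
  by_cases hw : w ∈ Ioo (h / 2) h
  · rw [indicator_of_mem hw, indicator_of_mem]
    rw [Metric.mem_closedBall, Real.dist_eq, abs_le]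
    exact ⟨by linarith [hw.2], by linarith [hw.1]⟩
  · rw [indicator_of_notMem hw]
    exact zero_le

/-- Since the kernel has mass `sphArea n`, the difference is a Poisson mean of the oscillation of
the density about its value at `(t, ξ)`. The kernel bound brings a factor `h` that cancels `1 / h`
and leaves `slabInt`. Truncation at `T > t` is harmless, as only levels below `t` are seen. -/
theorem tendsto_shell_polarAvg {n : ℕ} (hn : n ≠ 0) {α t T : ℝ} (ht : 0 < t) (htT : t < T)
    {φ : Sph (n + 1) → ℂ} (hφm : StronglyMeasurable φ) (ξ : Sph n)
    (hgi : Integrable ((Iio T ×ˢ univ).indicator (polarDensity n α φ)) (cylMeas n))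
    (hx : Tendsto (fun h => slabInt h (fun p =>
      ‖(Iio T ×ˢ univ).indicator (polarDensity n α φ) p -
        (Iio T ×ˢ univ).indicator (polarDensity n α φ) (t, ξ)‖ₑ) (t, ξ)) (𝓝[>] 0) (𝓝 0)) (c : ℝ) :
    Tendsto (fun h : ℝ => ENNReal.ofReal h⁻¹ * ∫⁻ w in Ioo (h / 2) h,
      ‖c • polarAvg n α φ t ξ (t - w) - (c * sphArea n) • polarDensity n α φ (t, ξ)‖ₑ)
      (𝓝[>] 0) (𝓝 0) := by
  set gT := (Iio T ×ˢ (univ : Set (Sph n))).indicator (polarDensity n α φ) with hgT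
  have hgTm : Measurable gT :=
    (stronglyMeasurable_polarDensity hφm).measurable.indicator
      (measurableSet_Iio.prod MeasurableSet.univ)
  have hval : ∀ s, s < T → ∀ η : Sph n, gT (s, η) = polarDensity n α φ (s, η) := fun s hs η => by
    rw [hgT, indicator_of_mem (show (s, η) ∈ Iio T ×ˢ univ from ⟨hs, mem_univ _⟩)]
  set u : ℝ × Sph n → ℝ≥0∞ := fun p => ‖gT p - gT (t, ξ)‖ₑ with hu
  have hum : Measurable u := (hgTm.sub measurable_const).enorm
  set K := (min (4 * t)⁻¹ 2⁻¹ ^ n)⁻¹ / t with hK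
  have hK0 : 0 < K := by rw [hK]; positivity
  have hae : ∀ᵐ w : ℝ, Integrable (fun η => gT (t - w, η)) (surf n) :=
    (Measure.measurePreserving_sub_left (volume : Measure ℝ) t).quasiMeasurePreserving.ae
      hgi.prod_right_ae
  have hbound : ∀ᶠ h in 𝓝[>] (0 : ℝ), ENNReal.ofReal h⁻¹ * ∫⁻ w in Ioo (h / 2) h,
      ‖c • polarAvg n α φ t ξ (t - w) - (c * sphArea n) • polarDensity n α φ (t, ξ)‖ₑ ≤
      ‖c‖ₑ * ENNReal.ofReal K * slabInt h u (t, ξ) := by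
    filter_upwards [Ioo_mem_nhdsGT ht] with h hh
    obtain ⟨hh0, hht⟩ := hh
    have hstep : ∫⁻ w in Ioo (h / 2) h,
        ‖c • polarAvg n α φ t ξ (t - w) - (c * sphArea n) • polarDensity n α φ (t, ξ)‖ₑ ≤
        ∫⁻ w in Ioo (h / 2) h, ‖c‖ₑ * ENNReal.ofReal (K * h) *
          ∫⁻ η, slabKer h ξ η * u (t - w, η) ∂(surf n) := by
      refine lintegral_mono_ae ?_
      filter_upwards [ae_restrict_of_ae hae, ae_restrict_mem measurableSet_Ioo] with w hwi hw
      have hX : ‖√((t - w) / t) • (ξ : Euc n)‖ < 1 :=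
        norm_smul_sqrt_lt_one (by linarith [hw.2]) (by linarith [hw.1]) ξ
      have hPc := continuous_poissonKer_right hX
      have hPb : ∃ B, ∀ η : Sph n, ‖poissonKer (√((t - w) / t) • (ξ : Euc n)) η‖ ≤ B :=
        ⟨_, fun η => ContinuousMap.norm_coe_le_norm ⟨_, hPc⟩ η⟩
      obtain ⟨B, hB⟩ := hPb
      have hi1 : Integrable (fun η : Sph n =>
          poissonKer (√((t - w) / t) • (ξ : Euc n)) η • gT (t - w, η)) (surf n) :=
        hwi.bdd_smul B hPc.aestronglyMeasurable (Eventually.of_forall hB)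
      have hi2 : Integrable (fun η : Sph n =>
          poissonKer (√((t - w) / t) • (ξ : Euc n)) η • gT (t, ξ)) (surf n) :=
        (integrable_const (gT (t, ξ))).bdd_smul B hPc.aestronglyMeasurable (Eventually.of_forall hB)
      have e : c • polarAvg n α φ t ξ (t - w) - (c * sphArea n) • polarDensity n α φ (t, ξ) =
          c • ∫ η : Sph n, poissonKer (√((t - w) / t) • (ξ : Euc n)) η •
            (gT (t - w, η) - gT (t, ξ)) ∂(surf n) := by
        simp only [smul_sub]
        rw [integral_sub hi1 hi2, integral_smul_const, integral_poissonKer hn hX,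
          hval t htT ξ, smul_sub, smul_smul, polarAvg]
        simp only [hval (t - w) (by linarith [hw.1])]
      rw [e, enorm_smul, mul_assoc]
      gcongr
      refine (enorm_integral_le_lintegral_enorm _).trans ?_
      rw [← lintegral_const_mul' _ _ ENNReal.ofReal_ne_top]
      refine lintegral_mono fun η => ?_
      simp only []
      rw [enorm_smul, ← mul_assoc]
      gcongr
      exact poissonKer_le_slabKer ht hh0 hht hw ξ η
    calc _ ≤ ENNReal.ofReal h⁻¹ * (‖c‖ₑ * ENNReal.ofReal (K * h) * slabInt h u (t, ξ)) := by
          gcongr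
          refine hstep.trans ?_
          rw [lintegral_const_mul' _ _ (ENNReal.mul_ne_top enorm_ne_top ENNReal.ofReal_ne_top)]
          gcongr
          exact lintegral_slice_le_slabInt hh0 ξ hum
      _ = _ := by
          rw [ENNReal.ofReal_mul hK0.le, ENNReal.ofReal_inv_of_pos hh0]
          have h1 : (ENNReal.ofReal h)⁻¹ * ENNReal.ofReal h = 1 :=
            ENNReal.inv_mul_cancel (by simpa using hh0) ENNReal.ofReal_ne_top
          calc _ = ((ENNReal.ofReal h)⁻¹ * ENNReal.ofReal h) *
                (‖c‖ₑ * ENNReal.ofReal K * slabInt h u (t, ξ)) := by ring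
            _ = _ := by rw [h1, one_mul]
  have hlim : Tendsto (fun h => ‖c‖ₑ * ENNReal.ofReal K * slabInt h u (t, ξ)) (𝓝[>] 0) (𝓝 0) := by
    have := ENNReal.Tendsto.const_mul (a := ‖c‖ₑ * ENNReal.ofReal K) hx
      (Or.inr (ENNReal.mul_ne_top enorm_ne_top ENNReal.ofReal_ne_top))
    rwa [mul_zero] at this
  exact tendsto_of_tendsto_of_tendsto_of_le_of_le' tendsto_const_nhds hlim
    (Eventually.of_forall fun _ => zero_le) hbound

/-- The limit of the first-difference integrals of `A_x^+ (S_+^α φ)`, up to the constant. -/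
theorem tendsto_firstDiff_leftFrac {n : ℕ} (hn : n ≠ 0) {α t : ℝ} (hα0 : 0 < α) (hα1 : α < 1)
    (ht : 0 < t) {φ : Sph (n + 1) → ℂ} (hφm : StronglyMeasurable φ) {ξ : Sph n}
    (h : Integrable (fun p => fracKer α t t ξ p • polarDensity n α φ p) (polarProd n))
    (hc : ∀ c : ℝ, Tendsto (fun h : ℝ => ENNReal.ofReal h⁻¹ * ∫⁻ w in Ioo (h / 2) h,
      ‖c • polarAvg n α φ t ξ (t - w) - (c * sphArea n) • polarDensity n α φ (t, ξ)‖ₑ)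
      (𝓝[>] 0) (𝓝 0)) :
    ∃ d : ℂ, (∀ ε : ℝ, 0 < ε →
        IntegrableOn (firstDiff α (leftAux n α (leftFrac n α φ) (polarMap (t, ξ)))) (Ioi ε)) ∧
      Tendsto (fun ε => ∫ τ in Ioi ε, firstDiff α (leftAux n α (leftFrac n α φ)
        (polarMap (t, ξ))) τ) (𝓝[>] 0) (𝓝 d) ∧ marchaudFactor n α t • d = φ (polarMap (t, ξ)) := by
  have hσ := sphArea_pos hn
  have hΓ := Real.Gamma_pos_of_pos hα0
  have hκ : 0 < kappa α 1 := kappa_pos hα0 hα1 le_rfl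
  set c := fracConst n α * t ^ (1 - (n : ℝ) / 2) with hcdef
  obtain ⟨h1, h2⟩ := integral_fracKer_eq h
  simp only [sub_self, sub_zero] at h1 h2
  have hG : IntegrableOn (fun w => (w ^ (α - 1) : ℝ) • (c • polarAvg n α φ t ξ (t - w)))
      (Ioi 0) := by
    simp only [smul_comm _ c]
    exact h1.smul c
  have hA0 : leftAux n α (leftFrac n α φ) (polarMap (t, ξ)) 0 =
      ∫ w in Ioi 0, (w ^ (α - 1) : ℝ) • (c • polarAvg n α φ t ξ (t - w)) := by
    simp only [smul_comm _ c]
    rw [integral_smul, ← h2, leftAux_zero ht, (leftFrac_polarMap hn ht hφm ξ).2, smul_smul]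
    congr 1
    have e1 : (1 + t) ^ (α - (n : ℝ) / 2) * (1 + t) ^ ((n : ℝ) / 2 - α) = 1 := by
      rw [← Real.rpow_add (by positivity)]; simp
    calc _ = ((1 + t) ^ (α - (n : ℝ) / 2) * (1 + t) ^ ((n : ℝ) / 2 - α)) *
          (fracConst n α * t ^ (1 - (n : ℝ) / 2)) := by ring
      _ = _ := by rw [e1, one_mul]
  obtain ⟨hI, hL⟩ := tendsto_firstDiff hα0 hα1 hG (hc c) hA0 (leftAux_leftFrac hn hα0 ht hφm h)
  refine ⟨_, hI, hL, ?_⟩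
  rw [polarDensity, if_pos ht, smul_smul, smul_smul, smul_smul]
  refine (congrArg (· • φ (polarMap (t, ξ))) ?_).trans (one_smul ℝ _)
  have e1 : (1 + t) ^ (α + (n : ℝ) / 2) * (1 + t) ^ (-((n : ℝ) / 2) - α) = 1 := by
    rw [← Real.rpow_add (by positivity)]; ring_nf; simp
  have e2 : t ^ (1 - (n : ℝ) / 2) * t ^ ((n : ℝ) / 2 - 1) = 1 := by
    rw [← Real.rpow_add ht]; simp
  have e3 : (2 : ℝ) ^ (-α) * (2 * 2 ^ (α - 1)) = 1 := by
    rw [Real.rpow_sub_one two_ne_zero, mul_div_cancel₀ _ two_ne_zero,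
      ← Real.rpow_add two_pos]; simp
  simp only [hcdef, marchaudFactor, fracConst]
  calc _ = (2 ^ (-α) * (2 * 2 ^ (α - 1))) *
        ((1 + t) ^ (α + (n : ℝ) / 2) * (1 + t) ^ (-((n : ℝ) / 2) - α)) *
        (t ^ (1 - (n : ℝ) / 2) * t ^ ((n : ℝ) / 2 - 1)) * ((kappa α 1)⁻¹ * kappa α 1) *
        (Real.Gamma α * sphArea n / (Real.Gamma α * sphArea n)) := by ring
    _ = 1 := by
      rw [e1, e2, e3, inv_mul_cancel₀ hκ.ne', div_self (by positivity)]; ring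

theorem tendsto_leftGap {t : ℝ} (ht : 0 < t) : Tendsto (leftGap t) (𝓝[>] 0) (𝓝[>] 0) := by
  refine tendsto_nhdsWithin_of_tendsto_nhds_of_eventually_within _ ?_ ?_
  · have : ContinuousAt (leftGap t) 0 := by
      unfold leftGap
      exact ContinuousAt.div (by fun_prop) (by fun_prop) (by simp)
    have h := this.tendsto
    rw [leftGap_zero] at h
    exact h.mono_left nhdsWithin_le_nhds
  · filter_upwards [self_mem_nhdsWithin] with ε hε
    have hε' : 0 < ε := hε
    rw [mem_Ioi, leftGap]
    positivity

/-- If the first-difference integrals converge, then so does the truncated closed form. -/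
theorem tendsto_closedForm_left {n : ℕ} (hn : 2 ≤ n) {α t : ℝ} (hα0 : 0 < α) (hα1 : α < 1)
    (ht : 0 < t) {f : Sph (n + 1) → ℂ} {ξ : Sph n} {d : ℂ}
    (hq : ∀ ε : ℝ, 0 < ε → IntegrableOn (leftQuot n α f (polarMap (t, ξ)))
      {y | height y < height (polarMap (t, ξ)) - ε} (surf (n + 1)))
    (hd : Tendsto (fun ε => ∫ τ in Ioi ε, firstDiff α (leftAux n α f (polarMap (t, ξ))) τ)
      (𝓝[>] 0) (𝓝 d)) :
    Tendsto (fun ε : ℝ =>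
      (Real.Gamma (n / 2) / (Real.Gamma (n / 2 - α) * (1 + height (polarMap (t, ξ))) ^ α) : ℝ) •
          f (polarMap (t, ξ)) +
        (2 * α / (sphArea n * Real.Gamma (1 - α)) : ℝ) •
          ∫ y in {y | height y < height (polarMap (t, ξ)) - ε},
            leftQuot n α f (polarMap (t, ξ)) y ∂(surf (n + 1)))
      (𝓝[>] 0) (𝓝 (marchaudFactor n α t • d)) := by
  have hn0 : n ≠ 0 := by omega
  obtain ⟨hLi, hLv⟩ := integrableOn_leftConst hn hα0 hα1 ht
  have hgap := tendsto_leftGap ht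
  set c := t ^ (-α) * (1 + t) ^ (-((n : ℝ) / 2)) * marchaudConst α (n / 2 - α) with hc
  set x := polarMap (t, ξ) with hx
  have hconst := (tendsto_setIntegral_Ioi_zero hLi).comp hgap
  rw [hLv] at hconst
  have hJ : Tendsto (fun ε => marchaudFactor n α t • (c • f x +
      ((∫ τ in Ioi (leftGap t ε), firstDiff α (leftAux n α f x) τ) -
        (∫ τ in Ioi (leftGap t ε), leftConst n α t τ) • f x))) (𝓝[>] 0)
      (𝓝 (marchaudFactor n α t • (c • f x + (d - c • f x)))) :=
    ((tendsto_const_nhds.add ((hd.comp hgap).sub (hconst.smul_const (f x)))).const_smul _)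
  rw [add_sub_cancel] at hJ
  refine hJ.congr' ?_
  filter_upwards [self_mem_nhdsWithin] with ε hε
  have hε' : 0 < ε := hε
  obtain ⟨hI, hv⟩ := integral_leftQuot hn0 (f := f) (ξ := ξ) (α := α) ht hε'.le (hq ε hε')
  have hg0 : 0 ≤ leftGap t ε := by rw [leftGap]; positivity
  rw [hv, closedForm_left hn0 hα0 hα1 ht, (integral_firstDiff_leftAux hn hα0 hα1 ht hg0 hI).2,
    add_sub_cancel_left]

/-- The inversion of `S_+^α` for locally integrable densities. -/
theorem ae_leftInverse {n : ℕ} (hn : 2 ≤ n) {α : ℝ} (hα0 : 0 < α) (hα1 : α < 1)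
    {φ : Sph (n + 1) → ℂ} (hφm : StronglyMeasurable φ) (hφ : LocInt φ) :
    ∀ᵐ x ∂(surf (n + 1)),
      IntegrableOn (leftFracIntegrand n α φ x) (SphFrac.segment n (-1) (height x))
        (surf (n + 1)) ∧
      HasLeftT n α (leftFrac n α φ) x (φ x) ∧
      (∀ ε : ℝ, 0 < ε → IntegrableOn (leftQuot n α (leftFrac n α φ) x)
        {y | height y < height x - ε} (surf (n + 1))) ∧
      Tendsto (fun ε : ℝ =>
        (Real.Gamma (n / 2) / (Real.Gamma (n / 2 - α) * (1 + height x) ^ α) : ℝ) •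
            leftFrac n α φ x +
          (2 * α / (sphArea n * Real.Gamma (1 - α)) : ℝ) •
            ∫ y in {y | height y < height x - ε},
              leftQuot n α (leftFrac n α φ) x y ∂(surf (n + 1)))
        (𝓝[>] 0) (𝓝 (φ x)) := by
  have hn0 : n ≠ 0 := by omega
  refine ae_surf_of_ae_polarProd hn0 ?_
  -- The differentiation theorem requires integrability, which holds only for the density cut off at
  -- a finite level. Countably many cut-offs share one null set, and at level `t` any cut-off `k + 1
  -- > t` can be used.
  have hleb : ∀ᵐ x ∂(polarProd n), ∀ k : ℕ, Tendsto (fun h => slabInt h (fun p =>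
      ‖(Iio (k + 1 : ℝ) ×ˢ univ).indicator (polarDensity n α φ) p -
        (Iio (k + 1 : ℝ) ×ˢ univ).indicator (polarDensity n α φ) x‖ₑ) x) (𝓝[>] 0) (𝓝 0) := by
    rw [polarProd_eq_restrict, ae_all_iff]
    exact fun k => ae_restrict_of_ae (ae_tendsto_slabInt hn0
      (integrable_polarDensity hn hα0 hα1 hφm hφ (by positivity)))
  filter_upwards [ae_integrable_fracKer hn hα0 hα1 hφm hφ, hleb, ae_pos_polarProd] with p h1 h2 hp
  obtain ⟨t, ξ⟩ := p
  have ht : 0 < t := hp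
  obtain ⟨k, hk⟩ := exists_nat_gt t
  obtain ⟨d, hI, hL, hd⟩ := tendsto_firstDiff_leftFrac hn0 hα0 hα1 ht hφm h1 fun c =>
    tendsto_shell_polarAvg hn0 ht (T := k + 1) (by linarith) hφm ξ
      (integrable_polarDensity hn hα0 hα1 hφm hφ (by positivity)) (h2 k) c
  have hq : ∀ ε : ℝ, 0 < ε → IntegrableOn (leftQuot n α (leftFrac n α φ) (polarMap (t, ξ)))
      {y | height y < height (polarMap (t, ξ)) - ε} (surf (n + 1)) := fun ε hε =>
    integrableOn_leftQuot hα0 (locInt_leftFrac hn hα0 hα1 hφm hφ) _ hε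
  refine ⟨(leftFrac_polarMap hn0 ht hφm ξ).1.2 h1, ?_, hq, ?_⟩
  · have hT := hasLeftT_of_tendsto hα0 hα1 (x := polarMap (t, ξ)) hI hL
    rw [tanSq_polarMap ht.le] at hT
    rwa [← hd]
  · rw [← hd]
    exact tendsto_closedForm_left hn hα0 hα1 ht hq hL

/-! ### Densities in weighted Lebesgue spaces. -/

theorem ae_abs_height_lt_one {n : ℕ} (hn : n ≠ 0) :
    ∀ᵐ x ∂(surf (n + 1)), -1 < height x ∧ height x < 1 := by
  refine ae_surf_of_ae_polarProd hn ?_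
  filter_upwards [ae_pos_polarProd] with p hp
  obtain ⟨t, ξ⟩ := p
  have ht : 0 < t := hp
  rw [height_polarMap ht.le, lt_div_iff₀ (by positivity), div_lt_one (by positivity)]
  constructor <;> linarith

theorem measurable_weight {n : ℕ} (μ ν : ℝ) : Measurable (weight (n := n) μ ν) := by
  have h := (continuous_height (n := n)).measurable
  unfold weight
  fun_prop

/-- In polar coordinates the integrand is `s^{n/2-1-b}` times a function continuous on `[0, T]`. The
exponent `e` is irrelevant, since the pole of height `1` is cut off. -/
theorem integrableOn_weight {n : ℕ} (hn : n ≠ 0) {b e a : ℝ} (hb : b < (n : ℝ) / 2) (ha : a < 1) :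
    IntegrableOn (weight (n := n) (-b) e) {y | height y < a} (surf (n + 1)) := by
  set T := 2 / (1 - a) with hTdef
  have h1a : 0 < 1 - a := sub_pos.2 ha
  have hT : 0 < T := by positivity
  have haT : a ≤ (T - 1) / (1 + T) := by
    have e : T * (1 - a) = 2 := by rw [hTdef]; field_simp
    rw [le_div_iff₀ (by positivity)]; nlinarith
  refine IntegrableOn.mono_set (t := {y | height y < (T - 1) / (1 + T)}) ?_
    (fun y (hy : height y < a) => hy.trans_le haT)
  have hR := measurableSet_height_lt (n := n) ((T - 1) / (1 + T))
  have hFm := ((measurable_weight (n := n) (-b) e).indicator hR).aestronglyMeasurable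
    (μ := surf (n + 1))
  rw [← integrable_indicator_iff hR, integrable_polarMap_iff hn hFm]
  set c : ℝ → ℝ := fun s => 2 ^ (n - 1 : ℝ) * ((1 + s) ^ n)⁻¹ * (2 / (1 + s)) ^ (-b) *
    (2 / (1 + s)) ^ e with hc
  have hcc : ContinuousOn c (Icc 0 T) := by
    have hne : ∀ s ∈ Icc (0 : ℝ) T, 1 + s ≠ 0 := fun s hs => by linarith [hs.1]
    have hne2 : ∀ s ∈ Icc (0 : ℝ) T, 2 / (1 + s) ≠ 0 := fun s hs =>
      div_ne_zero two_ne_zero (hne s hs)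
    have hd : ContinuousOn (fun s : ℝ => 2 / (1 + s)) (Icc 0 T) :=
      ContinuousOn.div (by fun_prop) (by fun_prop) hne
    refine ((continuousOn_const.mul (ContinuousOn.inv₀ (by fun_prop) fun s hs =>
      pow_ne_zero _ (hne s hs))).mul (hd.rpow_const fun s hs => Or.inl (hne2 s hs))).mul
      (hd.rpow_const fun s hs => Or.inl (hne2 s hs))
  have hr : IntegrableOn (fun s : ℝ => s ^ ((n : ℝ) / 2 - 1 - b)) (Icc 0 T) := by
    rw [← intervalIntegrable_iff_integrableOn_Icc_of_le hT.le]
    exact intervalIntegral.intervalIntegrable_rpow' (by linarith)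
  have hi : IntegrableOn (fun s => s ^ ((n : ℝ) / 2 - 1 - b) * c s) (Ioo 0 T) :=
    (hr.mul_continuousOn hcc isCompact_Icc).mono_set Ioo_subset_Icc_self
  have hi2 := ((integrable_indicator_iff measurableSet_Ioo).2 hi).mono_measure
    (Measure.restrict_le_self (s := Ioi 0))
  refine (hi2.comp_fst (surf n)).congr ?_
  filter_upwards [ae_pos_polarProd] with p hp
  obtain ⟨s, ξ⟩ := p
  have hs : 0 < s := hp
  by_cases hsT : s < T
  · rw [indicator_of_mem (show s ∈ Ioo 0 T from ⟨hs, hsT⟩),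
      indicator_of_mem (show polarMap (s, ξ) ∈ {y | height y < (T - 1) / (1 + T)} from
        (height_polarMap_lt_iff hs.le hT.le ξ).2 hsT), weight, height_polarMap hs.le,
      show 1 + (s - 1) / (1 + s) = s * (2 / (1 + s)) by field_simp; ring,
      show 1 - (s - 1) / (1 + s) = 2 / (1 + s) by field_simp; ring,
      Real.mul_rpow hs.le (by positivity), polarDens, smul_eq_mul, sub_eq_add_neg _ b,
      Real.rpow_add hs, hc]
    ring
  · have hnot : polarMap (s, ξ) ∉ {y | height y < (T - 1) / (1 + T)} := fun h =>
      hsT ((height_polarMap_lt_iff hs.le hT.le ξ).1 h)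
    rw [indicator_of_notMem (fun h : s ∈ Ioo 0 T => hsT h.2), indicator_of_notMem hnot, smul_zero]

theorem weight_smul_weight {n : ℕ} {x : Sph (n + 1)} (h1 : -1 < height x) (h2 : height x < 1)
    (μ ν : ℝ) (z : ℂ) : weight (-μ) (-ν) x • weight μ ν x • z = z := by
  rw [smul_smul]
  refine (congrArg (· • z) ?_).trans (one_smul ℝ z)
  have e1 : (1 + height x) ^ (-μ) * (1 + height x) ^ μ = 1 := by
    rw [← Real.rpow_add (by linarith)]; simp
  have e2 : (1 - height x) ^ (-ν) * (1 - height x) ^ ν = 1 := by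
    rw [← Real.rpow_add (by linarith)]; simp
  calc weight (-μ) (-ν) x * weight μ ν x = ((1 + height x) ^ (-μ) * (1 + height x) ^ μ) *
        ((1 - height x) ^ (-ν) * (1 - height x) ^ ν) := by simp only [weight]; ring
    _ = 1 := by rw [e1, e2, one_mul]

theorem aestronglyMeasurable_of_weight {n : ℕ} (hn : n ≠ 0) {μ ν : ℝ} {φ : Sph (n + 1) → ℂ}
    (h : AEStronglyMeasurable (fun x => weight μ ν x • φ x) (surf (n + 1))) :
    AEStronglyMeasurable φ (surf (n + 1)) := by
  refine ((measurable_weight (-μ) (-ν)).aestronglyMeasurable.smul h).congr ?_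
  filter_upwards [ae_abs_height_lt_one hn] with x hx
  exact weight_smul_weight hx.1 hx.2 μ ν (φ x)

theorem locInt_of_memLp {n : ℕ} (hn : n ≠ 0) {p : ℝ≥0∞} {μ ν : ℝ} {φ : Sph (n + 1) → ℂ}
    (hp : 1 < p) (hμ : μ < n / 2 * (1 - (p⁻¹).toReal))
    (h : MemLp (fun x => weight μ ν x • φ x) p (surf (n + 1))) : LocInt φ := by
  intro a ha
  have hp1 : p⁻¹ < 1 := ENNReal.inv_lt_one.2 hp
  -- The conjugate exponent of `p`, including `q = 1` for `p = ∞`. By Hölder's inequality it is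
  -- enough that the inverse weight is in `L^q` below level `a`, which follows from `μ q < n / 2`.
  set q : ℝ≥0∞ := (1 - p⁻¹)⁻¹ with hq
  have hr : 0 < 1 - (p⁻¹).toReal := by
    have := (ENNReal.toReal_lt_toReal (hp1.trans ENNReal.one_lt_top).ne ENNReal.one_ne_top).2 hp1
    simpa using this
  have hqr : q.toReal = (1 - (p⁻¹).toReal)⁻¹ := by
    rw [hq, ENNReal.toReal_inv, ENNReal.toReal_sub_of_le hp1.le ENNReal.one_ne_top,
      ENNReal.toReal_one]
  have hq0 : q ≠ 0 := ENNReal.inv_ne_zero.2 (ENNReal.sub_ne_top ENNReal.one_ne_top)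
  have hqt : q ≠ ∞ := ENNReal.inv_ne_top.2 (tsub_pos_of_lt hp1).ne'
  have hH : ENNReal.HolderTriple q p 1 :=
    ⟨by rw [hq, inv_inv, tsub_add_cancel_of_le hp1.le, inv_one]⟩
  have hR := measurableSet_height_lt (n := n) a
  have hb : μ * q.toReal < (n : ℝ) / 2 := by
    rw [hqr, ← div_eq_mul_inv, div_lt_iff₀ hr]; exact hμ
  have hae : ∀ᵐ x ∂((surf (n + 1)).restrict {y | height y < a}), -1 < height x ∧ height x < 1 :=
    ae_restrict_of_ae (ae_abs_height_lt_one hn)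
  have hw : MemLp (weight (n := n) (-μ) (-ν)) q ((surf (n + 1)).restrict {y | height y < a}) := by
    rw [← integrable_norm_rpow_iff (measurable_weight _ _).aestronglyMeasurable hq0 hqt]
    refine Integrable.congr (integrableOn_weight hn (e := -(ν * q.toReal)) hb ha) ?_
    filter_upwards [hae] with x hx
    have h1 : 0 < 1 + height x := by linarith [hx.1]
    have h2 : 0 < 1 - height x := by linarith [hx.2]
    rw [weight, weight, Real.norm_of_nonneg (by positivity),
      Real.mul_rpow (by positivity) (by positivity), ← Real.rpow_mul h1.le, ← Real.rpow_mul h2.le,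
      neg_mul, neg_mul]
  have hprod := (h.restrict {y | height y < a}).smul hw (r := 1)
  refine (memLp_one_iff_integrable.1 hprod).congr ?_
  filter_upwards [hae] with x hx
  exact weight_smul_weight hx.1 hx.2 μ ν (φ x)

theorem leftFracIntegrand_congr {n : ℕ} {α : ℝ} {φ ψ : Sph (n + 1) → ℂ}
    (h : φ =ᵐ[surf (n + 1)] ψ) (x : Sph (n + 1)) :
    leftFracIntegrand n α φ x =ᵐ[surf (n + 1)] leftFracIntegrand n α ψ x := by
  filter_upwards [h] with y hy
  rw [leftFracIntegrand, leftFracIntegrand, hy]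

theorem leftFrac_congr {n : ℕ} {α : ℝ} {φ ψ : Sph (n + 1) → ℂ} (h : φ =ᵐ[surf (n + 1)] ψ) :
    leftFrac n α φ = leftFrac n α ψ := by
  funext x
  rw [leftFrac, leftFrac, leftFracFrom, leftFracFrom,
    integral_congr_ae (ae_restrict_of_ae (leftFracIntegrand_congr h x))]

/-- The inversion of `S_+^α` in weighted spaces. -/
theorem ae_leftInverse_of_memLp {n : ℕ} (hn : 2 ≤ n) {α : ℝ} (hα0 : 0 < α) (hα1 : α < 1)
    {p : ℝ≥0∞} {μ ν : ℝ} {φ : Sph (n + 1) → ℂ} (hp : 1 < p) (hμ : μ < n / 2 * (1 - (p⁻¹).toReal))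
    (h : MemLp (fun x => weight μ ν x • φ x) p (surf (n + 1))) :
    ∀ᵐ x ∂(surf (n + 1)),
      IntegrableOn (leftFracIntegrand n α φ x) (SphFrac.segment n (-1) (height x))
        (surf (n + 1)) ∧
      HasLeftT n α (leftFrac n α φ) x (φ x) ∧
      (∀ ε : ℝ, 0 < ε → IntegrableOn (leftQuot n α (leftFrac n α φ) x)
        {y | height y < height x - ε} (surf (n + 1))) ∧
      Tendsto (fun ε : ℝ =>
        (Real.Gamma (n / 2) / (Real.Gamma (n / 2 - α) * (1 + height x) ^ α) : ℝ) •
            leftFrac n α φ x +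
          (2 * α / (sphArea n * Real.Gamma (1 - α)) : ℝ) •
            ∫ y in {y | height y < height x - ε},
              leftQuot n α (leftFrac n α φ) x y ∂(surf (n + 1)))
        (𝓝[>] 0) (𝓝 (φ x)) := by
  have hn0 : n ≠ 0 := by omega
  have hm := aestronglyMeasurable_of_weight hn0 h.1
  have hloc := locInt_of_memLp hn0 hp hμ h
  have he := hm.ae_eq_mk
  -- Passing to a strongly measurable representative is legitimate: `leftFrac` at every point
  -- depends only on the class of `φ`, and the value `φ x` is affected only on a null set.
  have hloc' : LocInt (hm.mk φ) := fun a ha => (hloc a ha).congr (ae_restrict_of_ae he)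
  filter_upwards [ae_leftInverse hn hα0 hα1 hm.stronglyMeasurable_mk hloc', he] with x hx hex
  rw [← leftFrac_congr he, ← hex] at hx
  exact ⟨hx.1.congr (ae_restrict_of_ae (leftFracIntegrand_congr he.symm x)), hx.2⟩

/-! ### From the truncated closed form back to the right-sided hypersingular integral. -/

theorem tendsto_rightGap {t : ℝ} (ht : 0 < t) : Tendsto (rightGap t) (𝓝[>] 0) (𝓝[>] 0) := by
  refine tendsto_nhdsWithin_of_tendsto_nhds_of_eventually_within _ ?_ ?_
  · have : ContinuousAt (rightGap t) 0 := by
      unfold rightGap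
      exact ContinuousAt.div (by fun_prop) (by fun_prop) (by positivity)
    have h := this.tendsto
    rw [rightGap_zero] at h
    exact h.mono_left nhdsWithin_le_nhds
  · filter_upwards [self_mem_nhdsWithin] with ε hε
    have hε' : 0 < ε := hε
    rw [mem_Ioi, rightGap]
    positivity

theorem marchaudFactor_pos {n : ℕ} {α t : ℝ} (hα0 : 0 < α) (hα1 : α < 1) (ht : 0 < t) :
    0 < marchaudFactor n α t := by
  have hκ : 0 < kappa α 1 := kappa_pos hα0 hα1 le_rfl
  rw [marchaudFactor]
  positivity

/-- If the truncated closed form converges, then `T_-^α f` exists and has the same value. -/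
theorem hasRightT_of_tendsto_closedForm {n : ℕ} (hn : 2 ≤ n) {α : ℝ} (hα0 : 0 < α) (hα1 : α < 1)
    {f : Sph (n + 1) → ℂ} {x : Sph (n + 1)} {c : ℂ} (hx : -1 < height x) (hx1 : height x < 1)
    (hq : ∀ ε : ℝ, 0 < ε → IntegrableOn (rightQuot n α f x) {y | height x + ε < height y}
      (surf (n + 1)))
    (hc : Tendsto (fun ε : ℝ =>
      (Real.Gamma (n / 2) / (Real.Gamma (n / 2 - α) * (1 - height x) ^ α) : ℝ) • f x +
        (2 * α / (sphArea n * Real.Gamma (1 - α)) : ℝ) •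
          ∫ y in {y | height x + ε < height y}, rightQuot n α f x y ∂(surf (n + 1)))
      (𝓝[>] 0) (𝓝 c)) :
    HasRightT n α f x c := by
  have hn0 : n ≠ 0 := by omega
  obtain ⟨ξ, ht, hxe⟩ := exists_polarMap_eq x hx hx1
  generalize tanSq x = t at ht hxe
  subst hxe
  have hM := marchaudFactor_pos (n := n) hα0 hα1 ht
  obtain ⟨hRi, hRv⟩ := integrableOn_rightConst hn hα0 hα1 ht.le
  have hconst := tendsto_setIntegral_Ioi_zero hRi
  rw [hRv] at hconst
  set C := (1 + t) ^ (-((n : ℝ) / 2)) * marchaudConst α (n / 2 - α) with hC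
  set x := polarMap (t, ξ) with hxdef
  have hall : ∀ δ : ℝ, 0 < δ → _ := fun δ hδ =>
    have hg : 0 < rightGap t δ := by rw [rightGap]; positivity
    integral_rightQuot hn0 (f := f) (ξ := ξ) (α := α) ht hδ.le (hq _ hg)
  have hlim : Tendsto (fun δ => ∫ τ in Ioi δ, firstDiff α (rightAux n α f x) τ) (𝓝[>] 0)
      (𝓝 ((marchaudFactor n α t)⁻¹ • c)) := by
    -- The closed form truncated at `rightGap t δ` is `marchaudFactor` times the sum of `C • f x`
    -- and the integral of `rightRest` beyond `δ`. The factor is nonzero, so the identity can be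
    -- solved for that integral, and the part of the constant is added back.
    have h1 := (hconst.smul_const (f x)).add
      (((hc.comp (tendsto_rightGap ht)).const_smul (marchaudFactor n α t)⁻¹).sub
        (tendsto_const_nhds (x := C • f x)))
    rw [add_sub_cancel] at h1
    refine h1.congr' ?_
    filter_upwards [self_mem_nhdsWithin] with δ hδ
    have hδ' : 0 < δ := hδ
    obtain ⟨hI, hv⟩ := hall δ hδ'
    simp only [Function.comp_apply]
    rw [(integral_firstDiff_rightAux hn hα0 hα1 ht hδ'.le hI).2, hv,
      closedForm_right hn0 hα0 hα1 ht.le, inv_smul_smul₀ hM.ne', add_sub_cancel_left]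
  have hT := hasRightT_of_tendsto hα0 hα1 (f := f) (x := x) (fun δ hδ =>
    (integral_firstDiff_rightAux hn hα0 hα1 ht hδ.le (hall δ hδ).1).1) hlim
  rw [tanSq_polarMap ht.le] at hT
  rwa [← marchaudFactor, smul_inv_smul₀ hM.ne'] at hT

/-! ### Reflection in the equator. -/

/-- The reflection of the last coordinate. -/
def flipEquiv (n : ℕ) : Euc (n + 1) ≃ₗᵢ[ℝ] Euc (n + 1) :=
  LinearIsometryEquiv.piLpCongrRight 2 fun i : Fin (n + 1) =>
    if i = Fin.last n then LinearIsometryEquiv.neg ℝ else LinearIsometryEquiv.refl ℝ ℝ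

/-- The reflection of the sphere in the equator. -/
def flip (n : ℕ) : Sph (n + 1) → Sph (n + 1) := sphMap (flipEquiv n)

theorem height_flip {n : ℕ} (x : Sph (n + 1)) : height (flip n x) = -height x := by
  simp [height, flip, sphMap, flipEquiv]

theorem flip_flip {n : ℕ} (x : Sph (n + 1)) : flip n (flip n x) = x := by
  ext i
  by_cases hi : i = Fin.last n <;> simp [flip, sphMap, flipEquiv, hi]

theorem norm_flip_sub_flip {n : ℕ} (x y : Sph (n + 1)) :
    ‖(flip n x : Euc (n + 1)) - flip n y‖ = ‖(x : Euc (n + 1)) - y‖ := by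
  change ‖flipEquiv n x - flipEquiv n y‖ = _
  rw [← map_sub, LinearIsometryEquiv.norm_map]

theorem measurePreserving_flip (n : ℕ) : MeasurePreserving (flip n) (surf (n + 1)) (surf (n + 1)) :=
  measurePreserving_sphMap _

theorem measurableEmbedding_flip (n : ℕ) : MeasurableEmbedding (flip n) :=
  (MeasurableEquiv.ofInvolutive (flip n) flip_flip
    (measurePreserving_flip n).measurable).measurableEmbedding

theorem weight_flip {n : ℕ} (μ ν : ℝ) (x : Sph (n + 1)) : weight μ ν (flip n x) = weight ν μ x := by
  rw [weight, weight, height_flip, sub_neg_eq_add, ← sub_eq_add_neg, mul_comm]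

theorem rightFracIntegrand_eq {n : ℕ} {α : ℝ} (φ : Sph (n + 1) → ℂ) (x : Sph (n + 1)) :
    rightFracIntegrand n α φ x = leftFracIntegrand n α (φ ∘ flip n) (flip n x) ∘ flip n := by
  funext y
  rw [Function.comp_apply, rightFracIntegrand, leftFracIntegrand, norm_flip_sub_flip, height_flip,
    height_flip, Function.comp_apply, flip_flip, neg_sub_neg]

theorem segment_eq_preimage_flip {n : ℕ} (x : Sph (n + 1)) : SphFrac.segment n (height x) 1 =
    flip n ⁻¹' SphFrac.segment n (-1) (height (flip n x)) := by
  ext y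
  change height x < height y ∧ height y < 1 ↔
    -1 < height (flip n y) ∧ height (flip n y) < height (flip n x)
  rw [height_flip, height_flip, neg_lt_neg_iff, neg_lt_neg_iff, and_comm]

theorem rightFrac_eq {n : ℕ} {α : ℝ} (φ : Sph (n + 1) → ℂ) (x : Sph (n + 1)) :
    rightFrac n α φ x = leftFrac n α (φ ∘ flip n) (flip n x) := by
  rw [rightFrac, rightFracFrom, leftFrac, leftFracFrom, rightFracIntegrand_eq,
    segment_eq_preimage_flip]
  congr 1
  exact (measurePreserving_flip n).setIntegral_preimage_emb (measurableEmbedding_flip n) _ _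

theorem rightQuot_eq {n : ℕ} {α : ℝ} (φ : Sph (n + 1) → ℂ) (x : Sph (n + 1)) :
    rightQuot n α (rightFrac n α φ) x =
      leftQuot n α (leftFrac n α (φ ∘ flip n)) (flip n x) ∘ flip n := by
  funext y
  rw [Function.comp_apply, rightQuot, leftQuot, norm_flip_sub_flip, height_flip, height_flip,
    neg_sub_neg, rightFrac_eq, rightFrac_eq]

theorem lt_height_eq_preimage_flip {n : ℕ} (x : Sph (n + 1)) (ε : ℝ) :
    {y | height x + ε < height y} = flip n ⁻¹' {y | height y < height (flip n x) - ε} := by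
  ext y
  change height x + ε < height y ↔ height (flip n y) < height (flip n x) - ε
  rw [height_flip, height_flip]
  constructor <;> intro h <;> linarith

/-- The inversion of `S_-^α` in weighted spaces. -/
theorem ae_rightInverse_of_memLp {n : ℕ} (hn : 2 ≤ n) {α : ℝ} (hα0 : 0 < α) (hα1 : α < 1)
    {p : ℝ≥0∞} {μ ν : ℝ} {φ : Sph (n + 1) → ℂ} (hp : 1 < p) (hν : ν < n / 2 * (1 - (p⁻¹).toReal))
    (h : MemLp (fun x => weight μ ν x • φ x) p (surf (n + 1))) :
    ∀ᵐ x ∂(surf (n + 1)),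
      IntegrableOn (rightFracIntegrand n α φ x) (SphFrac.segment n (height x) 1)
        (surf (n + 1)) ∧
      HasRightT n α (rightFrac n α φ) x (φ x) ∧
      (∀ ε : ℝ, 0 < ε → IntegrableOn (rightQuot n α (rightFrac n α φ) x)
        {y | height x + ε < height y} (surf (n + 1))) ∧
      Tendsto (fun ε : ℝ =>
        (Real.Gamma (n / 2) / (Real.Gamma (n / 2 - α) * (1 - height x) ^ α) : ℝ) •
            rightFrac n α φ x +
          (2 * α / (sphArea n * Real.Gamma (1 - α)) : ℝ) •
            ∫ y in {y | height x + ε < height y},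
              rightQuot n α (rightFrac n α φ) x y ∂(surf (n + 1)))
        (𝓝[>] 0) (𝓝 (φ x)) := by
  have hn0 : n ≠ 0 := by omega
  have hmp := measurePreserving_flip n
  have hemb := measurableEmbedding_flip n
  have h' : MemLp (fun x => weight ν μ x • (φ ∘ flip n) x) p (surf (n + 1)) := by
    have h2 := h.comp_measurePreserving hmp
    simpa only [Function.comp_def, weight_flip] using h2
  filter_upwards [hmp.quasiMeasurePreserving.ae (ae_leftInverse_of_memLp hn hα0 hα1 hp hν h'),
    ae_abs_height_lt_one hn0] with x hx hht
  -- The existence of `T_+^α` is discarded, because the reflection does not turn `A_x^+` into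
  -- `A_x^-`. What is reflected is the limit of the truncated closed form, from which the existence
  -- of `T_-^α` follows.
  obtain ⟨h1, -, h3, h4⟩ := hx
  have hq : ∀ ε : ℝ, 0 < ε → IntegrableOn (rightQuot n α (rightFrac n α φ) x)
      {y | height x + ε < height y} (surf (n + 1)) := fun ε hε => by
    rw [rightQuot_eq, lt_height_eq_preimage_flip]
    exact (hmp.integrableOn_comp_preimage hemb).2 (h3 ε hε)
  have hlim : Tendsto (fun ε : ℝ =>
        (Real.Gamma (n / 2) / (Real.Gamma (n / 2 - α) * (1 - height x) ^ α) : ℝ) •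
            rightFrac n α φ x +
          (2 * α / (sphArea n * Real.Gamma (1 - α)) : ℝ) •
            ∫ y in {y | height x + ε < height y},
              rightQuot n α (rightFrac n α φ) x y ∂(surf (n + 1)))
        (𝓝[>] 0) (𝓝 (φ x)) := by
    rw [Function.comp_apply, flip_flip] at h4
    refine h4.congr fun ε => ?_
    rw [height_flip, ← sub_eq_add_neg, rightFrac_eq, rightQuot_eq, lt_height_eq_preimage_flip,
      height_flip]
    congr 2
    exact (hmp.setIntegral_preimage_emb hemb _ _).symm
  refine ⟨?_, hasRightT_of_tendsto_closedForm hn hα0 hα1 hht.1 hht.2 hq hlim, hq, hlim⟩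
  rw [rightFracIntegrand_eq, segment_eq_preimage_flip]
  exact (hmp.integrableOn_comp_preimage hemb).2 h1

end SphFrac

end

open SphFrac in
theorem mainTheorem10 (n : ℕ) (hn : 2 ≤ n) (α : ℝ) (hα0 : 0 < α) (hα1 : α < 1) :
    -- the closed form of `T_+^α f`, where its integral converges absolutely
    (∀ (f : Sph (n + 1) → ℂ) (x : Sph (n + 1)), -1 < height x → height x < 1 →
      IntegrableOn (leftQuot n α f x) {y | height y < height x} (surf (n + 1)) →
      HasLeftT n α f x
        ((Real.Gamma (n / 2) / (Real.Gamma (n / 2 - α) * (1 + height x) ^ α) : ℝ) • f x +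
          (2 * α / (sphArea n * Real.Gamma (1 - α)) : ℝ) •
            ∫ y in {y | height y < height x}, leftQuot n α f x y ∂(surf (n + 1)))) ∧
    -- the closed form of `T_-^α f`, where its integral converges absolutely
    (∀ (f : Sph (n + 1) → ℂ) (x : Sph (n + 1)), -1 < height x → height x < 1 →
      IntegrableOn (rightQuot n α f x) {y | height x < height y} (surf (n + 1)) →
      HasRightT n α f x
        ((Real.Gamma (n / 2) / (Real.Gamma (n / 2 - α) * (1 - height x) ^ α) : ℝ) • f x +
          (2 * α / (sphArea n * Real.Gamma (1 - α)) : ℝ) •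
            ∫ y in {y | height x < height y}, rightQuot n α f x y ∂(surf (n + 1)))) ∧
    -- `T_+^α` and its closed form invert `S_+^α`
    (∀ (p : ℝ≥0∞) (μ ν : ℝ) (φ : Sph (n + 1) → ℂ), 1 < p →
      μ < n / 2 * (1 - (p⁻¹).toReal) →
      MemLp (fun x => weight μ ν x • φ x) p (surf (n + 1)) →
      ∀ᵐ x ∂(surf (n + 1)),
        IntegrableOn (leftFracIntegrand n α φ x) (SphFrac.segment n (-1) (height x))
          (surf (n + 1)) ∧
        HasLeftT n α (leftFrac n α φ) x (φ x) ∧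
        (∀ ε : ℝ, 0 < ε → IntegrableOn (leftQuot n α (leftFrac n α φ) x)
          {y | height y < height x - ε} (surf (n + 1))) ∧
        Tendsto (fun ε : ℝ =>
          (Real.Gamma (n / 2) / (Real.Gamma (n / 2 - α) * (1 + height x) ^ α) : ℝ) •
              leftFrac n α φ x +
            (2 * α / (sphArea n * Real.Gamma (1 - α)) : ℝ) •
              ∫ y in {y | height y < height x - ε},
                leftQuot n α (leftFrac n α φ) x y ∂(surf (n + 1)))
          (𝓝[>] 0) (𝓝 (φ x))) ∧
    -- `T_-^α` and its closed form invert `S_-^α`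
    (∀ (p : ℝ≥0∞) (μ ν : ℝ) (φ : Sph (n + 1) → ℂ), 1 < p →
      ν < n / 2 * (1 - (p⁻¹).toReal) →
      MemLp (fun x => weight μ ν x • φ x) p (surf (n + 1)) →
      ∀ᵐ x ∂(surf (n + 1)),
        IntegrableOn (rightFracIntegrand n α φ x) (SphFrac.segment n (height x) 1)
          (surf (n + 1)) ∧
        HasRightT n α (rightFrac n α φ) x (φ x) ∧
        (∀ ε : ℝ, 0 < ε → IntegrableOn (rightQuot n α (rightFrac n α φ) x)
          {y | height x + ε < height y} (surf (n + 1))) ∧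
        Tendsto (fun ε : ℝ =>
          (Real.Gamma (n / 2) / (Real.Gamma (n / 2 - α) * (1 - height x) ^ α) : ℝ) •
              rightFrac n α φ x +
            (2 * α / (sphArea n * Real.Gamma (1 - α)) : ℝ) •
              ∫ y in {y | height x + ε < height y},
                rightQuot n α (rightFrac n α φ) x y ∂(surf (n + 1)))
          (𝓝[>] 0) (𝓝 (φ x))) ∧
    -- the identity for the constant
    (∀ x : Sph (n + 1), height x < 1 →
      IntegrableOn (lambdaIntegrand n α x) {y | height x < height y} (surf (n + 1)) ∧
      2 * α / (sphArea n * Real.Gamma (1 - α)) *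
          ∫ y in {y | height x < height y}, lambdaIntegrand n α x y ∂(surf (n + 1)) =
        Real.Gamma (n / 2) / (Real.Gamma (n / 2 - α) * (1 - height x) ^ α)) := by
  exact ⟨fun _ _ h1 h2 h => hasLeftT_closedForm hn hα0 hα1 h1 h2 h,
    fun _ _ h1 h2 h => hasRightT_closedForm hn hα0 hα1 h1 h2 h,
    fun _ _ _ _ hp hμ h => ae_leftInverse_of_memLp hn hα0 hα1 hp hμ h,
    fun _ _ _ _ hp hν h => ae_rightInverse_of_memLp hn hα0 hα1 hp hν h,
    fun _ hx => integral_lambdaIntegrand hn hα0 hα1 hx⟩
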